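/- Let $\{V_j\}_{j\in\mathbb Z}$ be i.i.d. real random variables on a probability space with $|V_j|\le\overline V<\infty$ almost surely, $\mathbf E\{V_0\}=0$, $V_0$ not almost surely zero, and such that $0$ belongs to the support of the law of $V_0$. Let $H=H_0+V$ on $\ell^2(\mathbb Z)$, where $(H_0u)_j=-u_{j+1}-u_{j-1}$ and $(Vu)_j=V_ju_j$, and let $\sigma(H)$ be its (almost surely non-random) spectrum. Let $N_H$ be the Integrated Density of States, i.e. the probability measure with $\mathbf E\{f_{00}(H)\}=\int f\,dN_H$, where $f_{jk}(H)$ are the matrix entries of $f(H)$. Let $\alpha>0$, $\beta>0$, $E_F\in\sigma(H)$, and $$r_\alpha(\lambda)=(1-\alpha)^{-1}\log_2(\lambda^\alpha+(1-\lambda)^\alpha)\ (\alpha\ne1),\quad r_1(\lambda)=-\lambda\log_2\lambda-(1-\lambda)\log_2(1-\lambda),\quad \lambda\in[0,1],$$ $$n_F(\lambda)=(e^{\beta(\lambda-E_F)}+1)^{-1},\qquad \gamma=r_\alpha\circ n_F .$$ For $\Lambda=[-M,M]\subset\mathbb Z$, $|\Lambda|=2M+1$, let $(n_F(H))_\Lambda$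 be the restriction $\{(n_F(H))_{jk}\}_{j,k\in\Lambda}$ and $$\Sigma_\Lambda=|\Lambda|^{-1/2}\Big(\mathrm{Tr}\, r_\alpha\big((n_F(H))_\Lambda\big)-|\Lambda|\int\gamma\,dN_H\Big).$$ Let $\mathcal F_m^\infty$ be the $\sigma$-algebra generated by $\{V_j\}_{j\ge m}$ and $A_0=V_0\int_0^1\gamma'_{00}(H|_{V_0\to uV_0})\,du$. Then there is $\sigma>0$ such that: (i) $\lim_{M\to\infty}\mathbf E\{\Sigma_\Lambda^2\}=\sigma^2$, where $$\sigma^2=\sum_{l\in\mathbb Z}\mathbf{Cov}\{\gamma_{00}(H),\gamma_{ll}(H)\} =\mathbf E\big\{(\mathbf E\{A_0|\mathcal F_0^\infty\}-\mathbf E\{A_0|\mathcal F_1^\infty\})^2\big\} =\mathbf E\big\{\mathbf{Var}\{\mathbf E\{A_0|\mathcal F_0^\infty\}|\mathcal F_1^\infty\}\big\};$$ (ii) for every interval $\Delta\subset\mathbb R$, $\mathbf P\{\sigma^{-1}\Sigma_{[-M,M]}\in\Delta\}\to\Phi(\Delta)$ as $M\to\infty$, where $\Phi$ is the standard Gaussian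 law; equivalently, $\Sigma_{[-M,M]}$ converges in distribution to the Gaussian random variable of zero mean and variance $\sigma^2$. -/

import Mathlib

open MeasureTheory ProbabilityTheory Filter Topology
open scoped lp ENNReal CompactlySupported

namespace Anderson

noncomputable section

/-- The complex Hilbert space `ℓ²(ℤ)`, a copy of Mathlib's `ℓ²(ℤ, ℂ)` carrying exactly its norm,
inner product and completeness. -/
def Ell2 : Type := ℓ²(ℤ, ℂ)

instance : NormedAddCommGroup Ell2 := inferInstanceAs (NormedAddCommGroup ℓ²(ℤ, ℂ))

instance : InnerProductSpace ℂ Ell2 := inferInstanceAs (InnerProductSpace ℂ ℓ²(ℤ, ℂ))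

instance : CompleteSpace Ell2 := inferInstanceAs (CompleteSpace ℓ²(ℤ, ℂ))

instance : CoeFun Ell2 fun _ => ℤ → ℂ := ⟨fun u => (show ℓ²(ℤ, ℂ) from u : ℤ → ℂ)⟩

/-- The standard basis vector `e_k`. -/
def basisVec (k : ℤ) : Ell2 := (lp.single 2 k 1 : ℓ²(ℤ, ℂ))

/-- Translation on `ℓ²(ℤ)`: `(shiftLp n u) j = u (j + n)`. -/
def shiftLp (n : ℤ) : ℓ²(ℤ, ℂ) →L[ℂ] ℓ²(ℤ, ℂ) :=
  LinearMap.mkContinuous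
    { toFun := fun u => ⟨fun j => u (j + n), by
        have h := (memℓp_gen_iff (by norm_num : 0 < (2 : ℝ≥0∞).toReal)).1 (lp.memℓp u)
        exact (memℓp_gen_iff (by norm_num)).2 ((Equiv.addRight n).summable_iff.2 h)⟩
      map_add' := fun _ _ => rfl
      map_smul' := fun _ _ => rfl } 1 (by
    intro u
    rw [one_mul, lp.norm_eq_tsum_rpow (by norm_num), lp.norm_eq_tsum_rpow (by norm_num)]
    exact le_of_eq (congrArg (· ^ (1 / (2 : ℝ≥0∞).toReal))
      ((Equiv.addRight n).tsum_eq fun j => ‖u j‖ ^ (2 : ℝ≥0∞).toReal)))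

/-- Translation on `Ell2`. -/
def shift (n : ℤ) : Ell2 →L[ℂ] Ell2 := shiftLp n

theorem shift_apply (n : ℤ) (u : Ell2) (j : ℤ) : shift n u j = u (j + n) := rfl

/-- The operator of multiplication by a bounded real sequence `V`
(by convention `0` if `V` is unbounded). -/
def potentialLp (V : ℤ → ℝ) : ℓ²(ℤ, ℂ) →L[ℂ] ℓ²(ℤ, ℂ) :=
  open Classical in
  if h : ∃ C, ∀ j, |V j| ≤ C then
    lp.mapCLM 2 (fun j => (V j : ℂ) • ContinuousLinearMap.id ℂ ℂ) (K := h.choose)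
      ((abs_nonneg _).trans (h.choose_spec 0)) (fun j => by
        rw [norm_smul, ContinuousLinearMap.norm_id, mul_one, Complex.norm_real]
        exact h.choose_spec j)
  else 0

/-- Multiplication by `V` on `Ell2`. -/
def potential (V : ℤ → ℝ) : Ell2 →L[ℂ] Ell2 := potentialLp V

theorem potential_apply {V : ℤ → ℝ} (h : ∃ C, ∀ j, |V j| ≤ C) (u : Ell2) (j : ℤ) :
    potential V u j = V j * u j := by
  change potentialLp V u j = V j * u j
  rw [potentialLp, dif_pos h]
  rfl

/-- The discrete Schrödinger operator `H = H₀ + V`, with `(H₀ u) j = -u (j + 1) - u (j - 1)`. -/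
def schrodinger (V : ℤ → ℝ) : Ell2 →L[ℂ] Ell2 :=
  -shift 1 - shift (-1) + potential V

/-- The matrix entry `A_{jk} = ⟨e_j, A e_k⟩` of an operator in the standard basis of `ℓ²(ℤ)`. -/
def entry (A : Ell2 →L[ℂ] Ell2) (j k : ℤ) : ℂ := inner ℂ (basisVec j) (A (basisVec k))

/-- The diagonal entry `f_{jj}(H)` of `f(H)`, where `H` has potential `V` and `f(H)` is given by
the continuous functional calculus. -/
def diag (f : ℝ → ℝ) (V : ℤ → ℝ) (j : ℤ) : ℝ := (entry (cfc f (schrodinger V)) j j).re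

/-- The restriction `A_Λ = {A_{jk}}_{j,k ∈ Λ}` to `Λ = [-M, M]`. -/
def restrict (A : Ell2 →L[ℂ] Ell2) (M : ℕ) :
    Matrix (Finset.Icc (-M : ℤ) M) (Finset.Icc (-M : ℤ) M) ℂ :=
  Matrix.of fun j k => entry A j k

/-- `Tr_Λ φ(a_Λ(H))` with `Λ = [-M, M]`. -/
def traceBox (φ a : ℝ → ℝ) (V : ℤ → ℝ) (M : ℕ) : ℝ :=
  (cfc φ (restrict (cfc a (schrodinger V)) M)).trace.re

/-- The positive functional `f ↦ ⟨e₀, f(A) e₀⟩`. -/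
def spectralFunctional (A : Ell2 →L[ℂ] Ell2) : C_c(ℝ, ℝ) →ₚ[ℝ] ℝ :=
  PositiveLinearMap.mk₀
    { toFun := fun f => (entry (cfc f A) 0 0).re
      map_add' := fun f g => by
        have := cfc_add (R := ℝ) (a := A) (⇑f) (⇑g) f.continuous.continuousOn
          g.continuous.continuousOn
        simp only [CompactlySupportedContinuousMap.coe_add]
        rw [show (⇑f + ⇑g) = fun x => f x + g x from rfl, this]
        simp [entry]
      map_smul' := fun c f => by
        have := cfc_smul (R := ℝ) (a := A) c (⇑f) f.continuous.continuousOn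
        simp only [CompactlySupportedContinuousMap.coe_smul]
        rw [show (c • ⇑f) = fun x => c • f x from rfl, this]
        simp [entry] }
    (fun f hf => by
      have h : 0 ≤ cfc f A := cfc_nonneg fun x _ => hf x
      exact ((ContinuousLinearMap.nonneg_iff_isPositive _).1 h).re_inner_nonneg_right
        (basisVec 0))

/-- The spectral measure `μ_A(dλ) = (𝓔_A(dλ))₀₀` at site `0`, where `𝓔_A` is the resolution of
identity of `A`. -/
def spectralMeasure (A : Ell2 →L[ℂ] Ell2) : Measure ℝ :=
  RealRMK.rieszMeasure (spectralFunctional A)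

/-- The Fermi distribution. -/
def fermi (β EF lam : ℝ) : ℝ := (Real.exp (β * (lam - EF)) + 1)⁻¹

/-- The Rényi entropy function; for `α = 1` it is the von Neumann (binary Shannon) entropy
`-λ log₂ λ - (1 - λ) log₂ (1 - λ)`, the limit of the formula as `α → 1`. -/
def renyi (α lam : ℝ) : ℝ :=
  if α = 1 then -lam * Real.logb 2 lam - (1 - lam) * Real.logb 2 (1 - lam)
  else (1 - α)⁻¹ * Real.logb 2 (lam ^ α + (1 - lam) ^ α)

section Random

variable {Ω : Type*} [MeasurableSpace Ω]

/-- The Integrated Density of States measure `N_H(B) = E{μ_H(B)}`, so that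
`E{f₀₀(H)} = ∫ f dN_H`. -/
def ids (P : Measure Ω) (V : ℤ → Ω → ℝ) : Measure ℝ :=
  P.bind fun ω => spectralMeasure (schrodinger fun j => V j ω)

/-- `Σ_Λ = |Λ|^{-1/2} (Tr_Λ φ(a_Λ(H)) - |Λ| ∫ φ(a(λ)) N_H(dλ))`, `Λ = [-M, M]`. -/
def fluct (P : Measure Ω) (V : ℤ → Ω → ℝ) (φ a : ℝ → ℝ) (M : ℕ) (ω : Ω) : ℝ :=
  (√(2 * M + 1 : ℝ))⁻¹ *
    (traceBox φ a (fun j => V j ω) M - (2 * M + 1 : ℝ) * ∫ x, φ (a x) ∂(ids P V))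

/-- `A₀ = V₀ ∫₀¹ γ'₀₀(H|_{V₀ → u V₀}) du`. -/
def siteDeriv (V : ℤ → Ω → ℝ) (γ : ℝ → ℝ) (ω : Ω) : ℝ :=
  V 0 ω * ∫ u in (0 : ℝ)..1,
    diag (deriv γ) (Function.update (fun j => V j ω) 0 (u * V 0 ω)) 0

/-- The `σ`-algebra `𝓕_m^∞` generated by `V_j`, `j ≥ m`. -/
abbrev tailSigma (V : ℤ → Ω → ℝ) (m : ℤ) : MeasurableSpace Ω :=
  ⨆ j ∈ Set.Ici m, MeasurableSpace.comap (V j) inferInstance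

end Random

end

end Anderson

open Anderson

namespace Anderson

noncomputable section

/-! ### Coordinates and matrix entries -/

/-! The proof has four ingredients: locality of functions of `H`, a block central limit theorem, a
martingale formula for the variance, and a spectral argument showing that the variance is positive.
Let `R` bound the potential, so the spectrum lies in `[-(2 + R), 2 + R]`.

Locality. A smooth `f` has a rapidly convergent Chebyshev expansion on this interval, and a
polynomial of degree `d` in the nearest-neighbour operator `H` has range `d`. Hence the entries of
`f(H)` decay like the fourth inverse power of the distance, and so does the influence of remote
sites on `f_jj(H)` (`PolyExpansion`). If `u` is a unit eigenvector of the restriction `n_F(H)_Λ`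
with eigenvalue `μ`, Taylor's formula at `μ` bounds `r_α(μ) - ⟨u, γ(H) u⟩` by a constant times the
variance of `n_F(H)` in the state `u`. Summed over `u`, these variances give the squared
Hilbert–Schmidt norm of the block of `n_F(H)` coupling `Λ` to its complement, which is bounded in
`Λ`. So `Σ_Λ` is the normalized sum of the stationary sequence `γ_jj(H)`, up to `O(|Λ|^{-1/2})`
(`abs_traceBox_sub_sum_diag_le`).

Central limit theorem. Setting the potential to zero outside a long block changes the block sum only
by a bounded amount, and the modified block sums are i.i.d. The classical theorem applies to them,
and the error is controlled in `L¹` (`SiteLocal.tendsto_charFun_normSum`).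

Variance. Let `E_m` average over the sites left of `m`, and let `D_j = E_0 γ_jj - E_1 γ_jj`. By
stationarity and telescoping, the sum of the covariances is the second moment of `∑ D_j`
(`SiteLocal.hasSum_covariance`). Subtracting from `γ_jj` its value at `V_0 = 0` does not change
`D_j`, so `∑ D_j = E_0 A - E_1 A`, where `A` is the total effect of `V_0` on the diagonal. The trace
formula for a rank-one perturbation identifies `A` with the integral of `γ'_00` along the values of
the potential at the origin (`PolyExpansion.hasSum_diag_update_sub`).

Positivity. If the variance vanishes, then `E_0 A = E_1 A` on all configurations with values in the
support of the law. Since `0` is in the support, a symmetry of the second differences propagates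
this to the left and gives `A = 0` there (`SiteLocal.siteSum_eq_zero`). In particular, a single
impurity `w` at the origin has an effect independent of an impurity `u` at distance `n`, for every
`n`. But `γ'` is a sum of poles on a vertical line, and as `n → ∞` the interaction of the impurities
is dominated by the lowest pole, with an explicit leading coefficient whose phase depends on `u`. A
centred nonzero law has both a positive and a negative point in its support, and their phases cannot
both make the real part vanish (`PoleSeries.exists_twoSite_ne_zero`). -/

theorem coe_add (u v : Ell2) (j : ℤ) : (u + v) j = u j + v j := rfl

theorem coe_sub (u v : Ell2) (j : ℤ) : (u - v) j = u j - v j := rfl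

theorem coe_neg (u : Ell2) (j : ℤ) : (-u) j = -u j := rfl

theorem coe_smul (c : ℂ) (u : Ell2) (j : ℤ) : (c • u) j = c * u j := rfl

theorem ell2_ext {u v : Ell2} (h : ∀ j, u j = v j) : u = v := lp.ext (funext h)

theorem basisVec_apply (k j : ℤ) : basisVec k j = if j = k then 1 else 0 := by
  have h : basisVec k j = (Pi.single k (1 : ℂ) : ℤ → ℂ) j :=
    congrFun (lp.coeFn_single (E := fun _ : ℤ => ℂ) 2 k 1) j
  rw [h, Pi.single_apply]

theorem inner_basisVec_left (j : ℤ) (u : Ell2) : inner ℂ (basisVec j) u = u j := by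
  have h := lp.inner_single_left (𝕜 := ℂ) (G := fun _ : ℤ => ℂ) j (1 : ℂ) (show ℓ²(ℤ, ℂ) from u)
  refine h.trans ?_
  simp

theorem norm_basisVec (j : ℤ) : ‖basisVec j‖ = 1 := by
  have h := lp.norm_single (E := fun _ : ℤ => ℂ) (p := 2) (by norm_num) j (1 : ℂ)
  exact h.trans (by simp)

theorem hasSum_inner_ell2 (u v : Ell2) :
    HasSum (fun j : ℤ => inner ℂ (u j) (v j)) (inner ℂ u v) :=
  lp.hasSum_inner (𝕜 := ℂ) (G := fun _ : ℤ => ℂ) u v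

theorem entry_eq_apply (A : Ell2 →L[ℂ] Ell2) (j k : ℤ) : entry A j k = (A (basisVec k)) j :=
  inner_basisVec_left _ _

theorem norm_entry_le (A : Ell2 →L[ℂ] Ell2) (j k : ℤ) : ‖entry A j k‖ ≤ ‖A‖ := by
  refine (norm_inner_le_norm _ _).trans ?_
  rw [norm_basisVec, one_mul]
  exact (A.le_opNorm _).trans (by rw [norm_basisVec, mul_one])

/-- The matrix entry as a continuous linear functional of the operator. -/
def entryCLM (j k : ℤ) : (Ell2 →L[ℂ] Ell2) →L[ℂ] ℂ :=
  (innerSL ℂ (basisVec j)).comp (ContinuousLinearMap.apply ℂ Ell2 (basisVec k))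

theorem entryCLM_apply (j k : ℤ) (A : Ell2 →L[ℂ] Ell2) : entryCLM j k A = entry A j k := rfl

theorem entry_add (A B : Ell2 →L[ℂ] Ell2) (j k : ℤ) :
    entry (A + B) j k = entry A j k + entry B j k := (entryCLM j k).map_add A B

theorem entry_sub (A B : Ell2 →L[ℂ] Ell2) (j k : ℤ) :
    entry (A - B) j k = entry A j k - entry B j k := (entryCLM j k).map_sub A B

theorem entry_smul_real (c : ℝ) (A : Ell2 →L[ℂ] Ell2) (j k : ℤ) :
    entry (c • A) j k = c * entry A j k := by
  have h : c • A = (c : ℂ) • A := by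
    ext u
    simp
  rw [h]
  exact (entryCLM j k).map_smul (c : ℂ) A

theorem entry_one (j k : ℤ) : entry 1 j k = if j = k then 1 else 0 := by
  rw [entry_eq_apply, one_apply_eq_self, basisVec_apply]

theorem entry_sum {ι : Type*} (s : Finset ι) (A : ι → Ell2 →L[ℂ] Ell2) (j k : ℤ) :
    entry (∑ i ∈ s, A i) j k = ∑ i ∈ s, entry (A i) j k := map_sum (entryCLM j k) A s

theorem entry_adjoint (A : Ell2 →L[ℂ] Ell2) (j k : ℤ) :
    entry A.adjoint j k = (starRingEnd ℂ) (entry A k j) := by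
  rw [entry, entry, ContinuousLinearMap.adjoint_inner_right, inner_conj_symm]

theorem hasSum_entry_mul (A B : Ell2 →L[ℂ] Ell2) (j k : ℤ) :
    HasSum (fun m => entry A j m * entry B m k) (entry (A * B) j k) := by
  have h := hasSum_inner_ell2 (A.adjoint (basisVec j)) (B (basisVec k))
  rw [ContinuousLinearMap.adjoint_inner_left] at h
  refine HasSum.congr_fun h fun m => ?_
  rw [← entry_eq_apply, ← entry_eq_apply, entry_adjoint]
  simp [mul_comm]

theorem hasSum_norm_sq (u : Ell2) : HasSum (fun j : ℤ => ‖u j‖ ^ 2) (‖u‖ ^ 2) := by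
  have h := Complex.hasSum_re (hasSum_inner_ell2 u u)
  have h2 : (inner ℂ u u : ℂ).re = ‖u‖ ^ 2 := by
    rw [inner_self_eq_norm_sq_to_K]
    norm_cast
  rw [h2] at h
  refine h.congr_fun ?_ 
  intro j
  rw [inner_self_eq_norm_sq_to_K]
  norm_cast

/-! ### The Schrödinger operator -/

theorem inner_shift_left (n : ℤ) (u v : Ell2) :
    inner ℂ (shift n u) v = inner ℂ u (shift (-n) v) := by
  have h1 := hasSum_inner_ell2 (shift n u) v
  have h2 := hasSum_inner_ell2 u (shift (-n) v)
  rw [← (Equiv.addRight n).hasSum_iff] at h2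
  refine h1.unique ?_
  convert h2 using 1
  funext j
  simp [shift_apply]

theorem norm_shift_le (n : ℤ) : ‖shift n‖ ≤ 1 :=
  ContinuousLinearMap.opNorm_le_bound _ zero_le_one fun u => by
    have h := hasSum_norm_sq u
    rw [← (Equiv.addRight n).hasSum_iff] at h
    have h2 : ‖shift n u‖ ^ 2 = ‖u‖ ^ 2 := (hasSum_norm_sq (shift n u)).unique h
    rw [one_mul]
    exact le_of_sq_le_sq h2.le (norm_nonneg _)

theorem norm_potential_le {V : ℤ → ℝ} {R : ℝ} (hV : ∀ j, |V j| ≤ R) : ‖potential V‖ ≤ R := by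
  have hR : 0 ≤ R := (abs_nonneg _).trans (hV 0)
  refine ContinuousLinearMap.opNorm_le_bound _ hR fun u => ?_
  have h1 := hasSum_norm_sq (potential V u)
  have h2 := (hasSum_norm_sq u).mul_left (R ^ 2)
  have h3 : ‖potential V u‖ ^ 2 ≤ R ^ 2 * ‖u‖ ^ 2 := by
    refine hasSum_le (fun j => ?_) h1 h2
    rw [potential_apply ⟨R, hV⟩, norm_mul, mul_pow, Complex.norm_real, Real.norm_eq_abs]
    gcongr
    exact hV j
  rw [← mul_pow] at h3
  exact le_of_sq_le_sq h3 (by positivity)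

theorem isSelfAdjoint_potential (V : ℤ → ℝ) : IsSelfAdjoint (potential V) := by
  by_cases h : ∃ C, ∀ j, |V j| ≤ C
  · rw [ContinuousLinearMap.isSelfAdjoint_iff_isSymmetric]
    intro u v
    refine (hasSum_inner_ell2 (potential V u) v).unique ?_
    refine HasSum.congr_fun (hasSum_inner_ell2 u (potential V v)) fun j => ?_
    rw [potential_apply h, potential_apply h]
    simp
    ring
  · have h0 : potential V = 0 := by
      change potentialLp V = 0
      rw [potentialLp, dif_neg h]
    rw [h0]
    exact IsSelfAdjoint.zero _

theorem isSelfAdjoint_schrodinger (V : ℤ → ℝ) : IsSelfAdjoint (schrodinger V) := by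
  refine IsSelfAdjoint.add ?_ (isSelfAdjoint_potential V)
  rw [ContinuousLinearMap.isSelfAdjoint_iff_isSymmetric]
  intro u v
  change inner ℂ (-shift 1 u - shift (-1) u) v = inner ℂ u (-shift 1 v - shift (-1) v)
  rw [inner_sub_left, inner_neg_left, inner_sub_right, inner_neg_right, inner_shift_left,
    inner_shift_left, neg_neg]
  ring

theorem norm_schrodinger_le {V : ℤ → ℝ} {R : ℝ} (hV : ∀ j, |V j| ≤ R) :
    ‖schrodinger V‖ ≤ 2 + R := by
  calc ‖schrodinger V‖ ≤ ‖-shift 1 - shift (-1)‖ + ‖potential V‖ := norm_add_le _ _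
    _ ≤ (‖-shift 1‖ + ‖shift (-1)‖) + ‖potential V‖ := by gcongr; exact norm_sub_le _ _
    _ ≤ (1 + 1) + R := by
        rw [norm_neg]
        gcongr
        exacts [norm_shift_le _, norm_shift_le _, norm_potential_le hV]
    _ = 2 + R := by ring

instance : Nontrivial Ell2 :=
  ⟨⟨basisVec 0, 0, fun h => by simpa [h] using norm_basisVec 0⟩⟩

theorem abs_le_of_mem_spectrum {V : ℤ → ℝ} {R : ℝ} (hV : ∀ j, |V j| ≤ R) {x : ℝ}
    (hx : x ∈ spectrum ℝ (schrodinger V)) : |x| ≤ 2 + R :=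
  (spectrum.norm_le_norm_of_mem hx).trans (norm_schrodinger_le hV)

theorem schrodinger_apply {V : ℤ → ℝ} (hV : ∃ R, ∀ j, |V j| ≤ R) (u : Ell2) (j : ℤ) :
    schrodinger V u j = -u (j + 1) - u (j - 1) + V j * u j := by
  have h : schrodinger V u = -shift 1 u - shift (-1) u + potential V u := rfl
  rw [h, coe_add, coe_sub, coe_neg, shift_apply, shift_apply, potential_apply hV]
  rfl

theorem entry_schrodinger_mul {V : ℤ → ℝ} (hV : ∃ R, ∀ j, |V j| ≤ R) (A : Ell2 →L[ℂ] Ell2)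
    (j k : ℤ) :
    entry (schrodinger V * A) j k = -entry A (j + 1) k - entry A (j - 1) k + V j * entry A j k := by
  simp only [entry_eq_apply]
  exact schrodinger_apply hV _ _

/-- Each factor of `H` hops by at most one site. This finite range is the source of every locality
estimate. -/
theorem entry_pow_eq_zero {V : ℤ → ℝ} (hV : ∃ R, ∀ j, |V j| ≤ R) (n : ℕ) {j k : ℤ}
    (h : (n : ℤ) < |j - k|) : entry (schrodinger V ^ n) j k = 0 := by
  induction n generalizing j with
  | zero =>
    rw [pow_zero, entry_one, if_neg]
    rintro rfl
    simp at h
  | succ n ih =>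
    rw [pow_succ', entry_schrodinger_mul hV, ih, ih, ih]
    · simp
    all_goals (push_cast at h; grind)

/-- Paths of `n` hops from `j` stay within distance `n`, so no other potential value enters. -/
theorem entry_pow_congr {V W : ℤ → ℝ} (hV : ∃ R, ∀ j, |V j| ≤ R) (hW : ∃ R, ∀ j, |W j| ≤ R)
    (n : ℕ) {j k : ℤ} (h : ∀ i, |i - j| ≤ n → V i = W i) :
    entry (schrodinger V ^ n) j k = entry (schrodinger W ^ n) j k := by
  induction n generalizing j with
  | zero => rw [pow_zero, pow_zero]
  | succ n ih =>
    rw [pow_succ', pow_succ', entry_schrodinger_mul hV, entry_schrodinger_mul hW, ih, ih, ih,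
      h j (by simp; positivity)]
    all_goals (intro i hi; apply h; push_cast; grind)

theorem entry_pow_translate {V : ℤ → ℝ} (hV : ∃ R, ∀ j, |V j| ≤ R) (n : ℕ) (j k m : ℤ) :
    entry (schrodinger (fun i => V (i + m)) ^ n) j k = entry (schrodinger V ^ n) (j + m) (k + m) := by
  have hW : ∃ R, ∀ j, |V (j + m)| ≤ R := hV.imp fun R h j => h _
  induction n generalizing j with
  | zero => simp [entry_one]
  | succ n ih =>
    rw [pow_succ', pow_succ', entry_schrodinger_mul hV, entry_schrodinger_mul hW, ih, ih, ih]
    rw [show j + 1 + m = j + m + 1 by ring, show j - 1 + m = j + m - 1 by ring]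

theorem continuous_entry_pow {X : Type*} [TopologicalSpace X] {V : X → ℤ → ℝ}
    (hV : ∀ x, ∃ R, ∀ j, |V x j| ≤ R) (hc : ∀ j, Continuous fun x => V x j) (n : ℕ) (j k : ℤ) :
    Continuous fun x => entry (schrodinger (V x) ^ n) j k := by
  induction n generalizing j with
  | zero => simp only [pow_zero]; exact continuous_const
  | succ n ih =>
    simp only [pow_succ', entry_schrodinger_mul (hV _)]
    have := Complex.continuous_ofReal.comp (hc j)
    exact (((ih _).neg).sub (ih _)).add (this.mul (ih _))

end

end Anderson

namespace Anderson

noncomputable section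

/-! ### Polynomials of the Schrödinger operator -/

open Polynomial in
theorem entry_aeval (A : Ell2 →L[ℂ] Ell2) (p : ℝ[X]) {N : ℕ} (hN : p.natDegree ≤ N) (j k : ℤ) :
    entry (aeval A p) j k = ∑ i ∈ Finset.range (N + 1), (p.coeff i : ℂ) * entry (A ^ i) j k := by
  rw [aeval_eq_sum_range' (Nat.lt_succ_of_le hN), entry_sum]
  simp only [entry_smul_real]

open Polynomial in
theorem entry_aeval_eq_zero {V : ℤ → ℝ} (hV : ∃ R, ∀ j, |V j| ≤ R) (p : ℝ[X]) {j k : ℤ}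
    (h : (p.natDegree : ℤ) < |j - k|) : entry (aeval (schrodinger V) p) j k = 0 := by
  rw [entry_aeval _ p le_rfl]
  refine Finset.sum_eq_zero fun i hi => ?_
  rw [entry_pow_eq_zero hV, mul_zero]
  have := Finset.mem_range.1 hi
  omega

open Polynomial in
theorem entry_aeval_congr {V W : ℤ → ℝ} (hV : ∃ R, ∀ j, |V j| ≤ R) (hW : ∃ R, ∀ j, |W j| ≤ R)
    (p : ℝ[X]) {j k : ℤ} (h : ∀ i, |i - j| ≤ p.natDegree → V i = W i) :
    entry (aeval (schrodinger V) p) j k = entry (aeval (schrodinger W) p) j k := by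
  rw [entry_aeval _ p le_rfl, entry_aeval _ p le_rfl]
  refine Finset.sum_congr rfl fun i hi => ?_
  rw [entry_pow_congr hV hW]
  intro l hl
  have := Finset.mem_range.1 hi
  exact h l (by omega)

open Polynomial in
theorem entry_aeval_translate {V : ℤ → ℝ} (hV : ∃ R, ∀ j, |V j| ≤ R) (p : ℝ[X]) (j k m : ℤ) :
    entry (aeval (schrodinger (fun i => V (i + m))) p) j k
      = entry (aeval (schrodinger V) p) (j + m) (k + m) := by
  rw [entry_aeval _ p le_rfl, entry_aeval _ p le_rfl]
  simp only [entry_pow_translate hV]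

open Polynomial in
theorem continuous_entry_aeval {X : Type*} [TopologicalSpace X] {V : X → ℤ → ℝ}
    (hV : ∀ x, ∃ R, ∀ j, |V x j| ≤ R) (hc : ∀ j, Continuous fun x => V x j) (p : ℝ[X]) (j k : ℤ) :
    Continuous fun x => entry (aeval (schrodinger (V x)) p) j k := by
  simp only [entry_aeval _ p le_rfl]
  exact continuous_finsetSum _ fun i _ => continuous_const.mul (continuous_entry_pow hV hc i j k)

/-! ### The trace of a rank-one perturbation -/

/-- The rank-one projection onto the site `0`. -/
def siteProj : Ell2 →L[ℂ] Ell2 := (innerSL ℂ (basisVec 0)).smulRight (basisVec 0)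

theorem siteProj_apply (u : Ell2) : siteProj u = (u 0) • basisVec 0 := by
  change (inner ℂ (basisVec 0) u : ℂ) • basisVec 0 = _
  rw [inner_basisVec_left]

theorem entry_mul_siteProj_mul (A B : Ell2 →L[ℂ] Ell2) (j k : ℤ) :
    entry (A * siteProj * B) j k = entry A j 0 * entry B 0 k := by
  rw [entry_eq_apply]
  change A (siteProj (B (basisVec k))) j = _
  rw [siteProj_apply, map_smul, coe_smul, ← entry_eq_apply, ← entry_eq_apply, mul_comm]

theorem exists_abs_update_le {V : ℤ → ℝ} (hV : ∃ R, ∀ j, |V j| ≤ R) (k : ℤ) (t : ℝ) :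
    ∃ R, ∀ j, |Function.update V k t j| ≤ R := by
  obtain ⟨R, hR⟩ := hV
  refine ⟨max R |t|, fun j => ?_⟩
  by_cases h : j = k
  · subst h; simp
  · rw [Function.update_of_ne h]; exact (hR j).trans (le_max_left _ _)

theorem schrodinger_update {V : ℤ → ℝ} (hV : ∃ R, ∀ j, |V j| ≤ R) (t : ℝ) :
    schrodinger (Function.update V 0 t)
      = schrodinger (Function.update V 0 0) + (t : ℂ) • siteProj := by
  ext u
  refine ell2_ext fun j => ?_
  rw [add_apply, smul_apply, coe_add, coe_smul,
    schrodinger_apply (exists_abs_update_le hV 0 t), schrodinger_apply (exists_abs_update_le hV 0 0),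
    siteProj_apply, coe_smul, basisVec_apply]
  by_cases h : j = 0
  · subst h; simp
  · simp [h]

theorem hasDerivAt_pow_add_smul (A B : Ell2 →L[ℂ] Ell2) (n : ℕ) (t : ℝ) :
    HasDerivAt (fun t : ℝ => (A + (t : ℂ) • B) ^ n)
      (∑ a ∈ Finset.range n, (A + (t : ℂ) • B) ^ a * B * (A + (t : ℂ) • B) ^ (n - 1 - a)) t := by
  have h1 : HasDerivAt (fun t : ℝ => A + (t : ℂ) • B) B t := by
    simpa using ((Complex.ofRealCLM.hasDerivAt (x := t)).smul_const B).const_add A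
  induction n with
  | zero => simpa using hasDerivAt_const t (1 : Ell2 →L[ℂ] Ell2)
  | succ n ih =>
    have h2 := ih.mul h1
    refine (h2.congr_deriv ?_).congr_of_eventuallyEq (Eventually.of_forall fun s => pow_succ _ _)
    symm
    rw [Finset.sum_range_succ, Finset.sum_mul]
    congr 1
    · refine Finset.sum_congr rfl fun a ha => ?_
      have := Finset.mem_range.1 ha
      rw [mul_assoc _ _ (A + (t : ℂ) • B), ← pow_succ]
      congr 2
      omega
    · simp

/-- Cyclicity of the trace turns the trace of `H^a P H^b` into the entry of `H^(a+b)` at the origin.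
The box already contains the whole trace, because `H^a` does not reach beyond distance `a` from the
origin. -/
theorem sum_entry_pow_mul_siteProj {V : ℤ → ℝ} (hV : ∃ R, ∀ j, |V j| ≤ R) (a b : ℕ) {N : ℕ}
    (hN : a ≤ N) :
    ∑ j ∈ Finset.Icc (-(N : ℤ)) N, entry (schrodinger V ^ a * siteProj * schrodinger V ^ b) j j
      = entry (schrodinger V ^ (a + b)) 0 0 := by
  have h := hasSum_entry_mul (schrodinger V ^ b) (schrodinger V ^ a) 0 0
  rw [← pow_add, add_comm b a] at h
  refine HasSum.unique ?_ h
  simp only [entry_mul_siteProj_mul]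
  have h2 := hasSum_sum_of_ne_finset_zero (L := .unconditional ℤ)
    (f := fun m => entry (schrodinger V ^ b) 0 m * entry (schrodinger V ^ a) m 0)
    (s := Finset.Icc (-(N : ℤ)) N) (fun m hm => by
      rw [entry_pow_eq_zero hV a, mul_zero]
      rw [Finset.mem_Icc] at hm
      grind)
  simpa only [mul_comm] using h2

-- The derivative of the trace of `p(H + tP)` is the entry of `p'(H + tP)` at the origin, by the
-- Leibniz rule and cyclicity; integrate in `t`. The full trace need not exist, but only sites
-- within the degree of `p` feel the perturbation, so a finite box suffices.
open Polynomial in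
theorem sum_entry_aeval_update_sub {V : ℤ → ℝ} (hV : ∃ R, ∀ j, |V j| ≤ R) (p : ℝ[X]) {N : ℕ}
    (hN : p.natDegree ≤ N) (w : ℝ) :
    ∑ j ∈ Finset.Icc (-(N : ℤ)) N, (entry (aeval (schrodinger (Function.update V 0 w)) p) j j
        - entry (aeval (schrodinger (Function.update V 0 0)) p) j j)
      = ∫ t in (0 : ℝ)..w,
          entry (aeval (schrodinger (Function.update V 0 t)) (derivative p)) 0 0 := by
  have hpow : ∀ (n : ℕ), n ≤ N → ∀ t : ℝ, HasDerivAt (fun t : ℝ => ∑ j ∈ Finset.Icc (-(N : ℤ)) N,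
      entry (schrodinger (Function.update V 0 t) ^ n) j j)
      (n * entry (schrodinger (Function.update V 0 t) ^ (n - 1)) 0 0) t := by
    intro n hn t
    have h1 := hasDerivAt_pow_add_smul (schrodinger (Function.update V 0 0)) siteProj n t
    simp only [← schrodinger_update hV] at h1
    have h2 := HasDerivAt.fun_sum (u := Finset.Icc (-(N : ℤ)) N) fun j _ =>
      ((entryCLM j j).restrictScalars ℝ).hasFDerivAt.comp_hasDerivAt t h1
    refine h2.congr_deriv ?_
    simp only [ContinuousLinearMap.coe_restrictScalars', map_sum, entryCLM_apply]
    rw [Finset.sum_comm]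
    have h3 : ∀ a ∈ Finset.range n, ∑ j ∈ Finset.Icc (-(N : ℤ)) N,
        entry (schrodinger (Function.update V 0 t) ^ a * siteProj *
          schrodinger (Function.update V 0 t) ^ (n - 1 - a)) j j
        = entry (schrodinger (Function.update V 0 t) ^ (n - 1)) 0 0 := by
      intro a ha
      have := Finset.mem_range.1 ha
      rw [sum_entry_pow_mul_siteProj (exists_abs_update_le hV 0 t) _ _ (by omega)]
      congr 2
      omega
    rw [Finset.sum_congr rfl h3]
    simp
  have hder : ∀ t : ℝ, HasDerivAt (fun t : ℝ => ∑ j ∈ Finset.Icc (-(N : ℤ)) N,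
      entry (aeval (schrodinger (Function.update V 0 t)) p) j j)
      (entry (aeval (schrodinger (Function.update V 0 t)) (derivative p)) 0 0) t := by
    intro t
    have h1 := HasDerivAt.fun_sum (u := Finset.range (N + 1)) fun i hi =>
      (hpow i (by have := Finset.mem_range.1 hi; omega) t).const_mul (p.coeff i : ℂ)
    refine (h1.congr_deriv ?_).congr_of_eventuallyEq (Eventually.of_forall fun s => ?_)
    · rw [derivative_apply, Polynomial.sum_over_range' _ (by simp) (N + 1) (Nat.lt_succ_of_le hN),
        map_sum, entry_sum]
      refine Finset.sum_congr rfl fun i _ => ?_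
      rw [← smul_eq_C_mul, map_smul, map_pow, aeval_X, entry_smul_real]
      push_cast
      ring
    · simp only [entry_aeval _ p hN]
      rw [Finset.sum_comm]
      simp only [Finset.mul_sum]
  have hcont : Continuous fun t : ℝ =>
      entry (aeval (schrodinger (Function.update V 0 t)) (derivative p)) 0 0 := by
    refine continuous_entry_aeval (fun t => exists_abs_update_le hV 0 t) (fun j => ?_) _ _ _
    by_cases h : j = 0
    · subst h; simpa using continuous_id'
    · simpa [h] using continuous_const
  rw [intervalIntegral.integral_eq_sub_of_hasDerivAt (fun t _ => hder t)
    (hcont.intervalIntegrable _ _), Finset.sum_sub_distrib]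

end

end Anderson

namespace Anderson

noncomputable section

open scoped ContDiff

/-! ### Expansion of smooth functions in polynomials of increasing degree -/

theorem norm_fourierCoeffOn_le {F : ℝ → ℂ} {C : ℝ} (hC : ∀ x, ‖F x‖ ≤ C) (n : ℤ) :
    ‖fourierCoeffOn Real.two_pi_pos F n‖ ≤ C := by
  rw [fourierCoeffOn_eq_integral]
  have h : ‖∫ x in (0 : ℝ)..2 * Real.pi,
      (fourier (-n) (x : AddCircle (2 * Real.pi - 0)) : ℂ) • F x‖ ≤ C * |2 * Real.pi - 0| := by
    refine intervalIntegral.norm_integral_le_of_norm_le_const fun x _ => ?_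
    rw [norm_smul, fourier_apply, Circle.norm_coe, one_mul]
    exact hC x
  rw [norm_smul]
  have hpi := Real.pi_pos
  rw [sub_zero, abs_of_pos Real.two_pi_pos] at h
  rw [sub_zero] 
  rw [Real.norm_of_nonneg (by positivity)]
  calc 1 / (2 * Real.pi) * _ ≤ 1 / (2 * Real.pi) * (C * (2 * Real.pi)) := by gcongr
    _ = C := by field_simp

/-- One integration by parts per derivative; periodicity cancels the boundary terms. -/
theorem norm_pow_mul_fourierCoeffOn {F : ℝ → ℂ} (hF : ContDiff ℝ ∞ F)
    (hper : Function.Periodic F (2 * Real.pi)) (k : ℕ) (n : ℤ) (hn : n ≠ 0) :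
    |(n : ℝ)| ^ k * ‖fourierCoeffOn Real.two_pi_pos F n‖
      = ‖fourierCoeffOn Real.two_pi_pos (iteratedDeriv k F) n‖ := by
  induction k with
  | zero => simp
  | succ k ih =>
    have hp : Function.Periodic (iteratedDeriv k F) (2 * Real.pi) := by
      intro x
      have h := congrFun (iteratedDeriv_comp_add_const k F (2 * Real.pi)) x
      rw [funext hper] at h
      exact h.symm
    have hdiff : ∀ x ∈ Set.uIcc 0 (2 * Real.pi),
        HasDerivAt (iteratedDeriv k F) (iteratedDeriv (k + 1) F x) x := by
      intro x _
      rw [iteratedDeriv_succ]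
      exact ((hF.differentiable_iteratedDeriv k (by exact_mod_cast ENat.natCast_lt_top k)) x).hasDerivAt
    have hc : Continuous (iteratedDeriv (k + 1) F) :=
      hF.continuous_iteratedDeriv (k + 1) (by exact_mod_cast le_top)
    have h := fourierCoeffOn_of_hasDerivAt Real.two_pi_pos hn hdiff (hc.intervalIntegrable _ _)
    have h0 : iteratedDeriv k F (2 * Real.pi) - iteratedDeriv k F 0 = 0 := by
      have := hp 0
      rw [zero_add] at this
      rw [this, sub_self]
    rw [h0, mul_zero, zero_sub] at h
    rw [pow_succ', mul_assoc, ih, h]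
    have hn' : |(n : ℝ)| ≠ 0 := by simpa using hn
    simp only [norm_mul, norm_neg, norm_div, Complex.norm_I, Complex.norm_intCast,
      Complex.norm_real, norm_one, Complex.norm_ofNat, Complex.ofReal_zero, sub_zero,
      Complex.ofReal_mul, Complex.ofReal_ofNat]
    rw [Real.norm_of_nonneg Real.pi_pos.le]
    have := Real.pi_pos
    field_simp

theorem hasSum_fourierCoeffOn {F : ℝ → ℂ} (hF : Continuous F)
    (hper : Function.Periodic F (2 * Real.pi))
    (hs : Summable fun n => fourierCoeffOn Real.two_pi_pos F n) (x : ℝ) :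
    HasSum (fun n : ℤ => fourierCoeffOn Real.two_pi_pos F n * Complex.exp (Complex.I * n * x))
      (F x) := by
  have : Fact (0 < 2 * Real.pi) := ⟨Real.two_pi_pos⟩
  let G : C(AddCircle (2 * Real.pi), ℂ) :=
    ⟨hper.lift, by
      refine continuous_coinduced_dom.2 ?_
      exact hF⟩
  have hG : ∀ n, fourierCoeff G n = fourierCoeffOn Real.two_pi_pos F n := by
    intro n
    rw [fourierCoeffOn_eq_integral, fourierCoeff_eq_intervalIntegral _ _ 0, zero_add, sub_zero]
    rfl
  have h := has_pointwise_sum_fourier_series_of_summable (f := G) (by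
    convert hs using 1; exact funext hG) (x : AddCircle (2 * Real.pi))
  have hGx : G (x : AddCircle (2 * Real.pi)) = F x := rfl
  rw [hGx] at h
  refine h.congr_fun fun n => ?_
  rw [hG, smul_eq_mul, fourier_coe_apply]
  congr 2
  have := Real.pi_pos
  push_cast
  field_simp

/-- With `x = L cos θ`, the function `f(L cos θ)` is smooth, even and periodic. Its Fourier
coefficients decay faster than any power, and `cos (n θ)` is the Chebyshev polynomial in `cos θ`.
The two-sided index of the Fourier series is kept. -/
theorem exists_chebyshev_expansion {f : ℝ → ℝ} (hf : ContDiff ℝ ∞ f) {L : ℝ} (hL : 0 < L) :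
    ∃ d : ℤ → ℝ, Summable (fun n : ℤ => ((n.natAbs : ℝ) + 1) ^ 4 * |d n|) ∧
      ∀ x, |x| ≤ L →
        HasSum (fun n : ℤ => d n * (Polynomial.Chebyshev.T ℝ n).eval (L⁻¹ * x)) (f x) := by
  set F : ℝ → ℂ := fun θ => (f (L * Real.cos θ) : ℂ) with hFdef
  have hF : ContDiff ℝ ∞ F :=
    Complex.ofRealCLM.contDiff.comp (hf.comp (contDiff_const.mul Real.contDiff_cos))
  have hper : Function.Periodic F (2 * Real.pi) := by
    intro x
    simp [hFdef]
  -- Six derivatives: the weight costs four powers of `n`, and two more make the series summable.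
  have h5 : (((6 : ℕ) : ℕ∞) : WithTop ℕ∞) ≤ ((⊤ : ℕ∞) : WithTop ℕ∞) := by exact_mod_cast le_top
  have hc6 : Continuous (iteratedDeriv 6 F) := hF.continuous_iteratedDeriv 6 h5
  have hp6 : Function.Periodic (iteratedDeriv 6 F) (2 * Real.pi) := by
    intro x
    have h := congrFun (iteratedDeriv_comp_add_const 6 F (2 * Real.pi)) x
    rw [funext hper] at h
    exact h.symm
  obtain ⟨C, hC⟩ : ∃ C, ∀ x, ‖iteratedDeriv 6 F x‖ ≤ C := by
    obtain ⟨C, hC⟩ := (isCompact_Icc (a := (0 : ℝ)) (b := 2 * Real.pi)).exists_bound_of_continuousOn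
      hc6.continuousOn
    refine ⟨C, fun x => ?_⟩
    obtain ⟨y, hy, hxy⟩ := hp6.exists_mem_Ico₀ Real.two_pi_pos x
    rw [hxy]
    exact hC y ⟨hy.1, hy.2.le⟩
  set c : ℤ → ℂ := fun n => fourierCoeffOn Real.two_pi_pos F n with hcdef
  have hdecay : ∀ n : ℤ, n ≠ 0 → |(n : ℝ)| ^ 6 * ‖c n‖ ≤ C := by
    intro n hn
    rw [hcdef]
    dsimp only
    rw [norm_pow_mul_fourierCoeffOn hF hper 6 n hn]
    exact norm_fourierCoeffOn_le hC n
  have hsum : Summable fun n : ℤ => ((n.natAbs : ℝ) + 1) ^ 4 * ‖c n‖ := by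
    have h1 : Summable fun n : ℤ => 16 * C * (1 / (n : ℝ) ^ 2) :=
      (Real.summable_one_div_int_pow.2 one_lt_two).mul_left _
    refine Summable.of_norm_bounded_eventually h1 ?_
    rw [eventually_cofinite]
    refine (Set.finite_singleton (0 : ℤ)).subset fun n hn => ?_
    by_contra h0
    apply hn
    have h0' : n ≠ 0 := h0
    rw [Real.norm_of_nonneg (by positivity)]
    have h2 : (1 : ℝ) ≤ |(n : ℝ)| := by
      rw [← Int.cast_abs]; exact_mod_cast Int.one_le_abs h0'
    have h3 : ((n.natAbs : ℝ) + 1) ≤ 2 * |(n : ℝ)| := by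
      rw [Nat.cast_natAbs, Int.cast_abs]; linarith
    have h4 := hdecay n h0'
    have h5 : (n : ℝ) ^ 2 = |(n : ℝ)| ^ 2 := (sq_abs _).symm
    rw [h5]
    calc ((n.natAbs : ℝ) + 1) ^ 4 * ‖c n‖ ≤ (2 * |(n : ℝ)|) ^ 4 * ‖c n‖ := by gcongr
      _ = 16 * (|(n : ℝ)| ^ 6 * ‖c n‖) * (1 / |(n : ℝ)| ^ 2) := by
          have : |(n : ℝ)| ≠ 0 := by positivity
          field_simp
          ring
      _ ≤ 16 * C * (1 / |(n : ℝ)| ^ 2) := by gcongr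
  have hsum0 : Summable c := by
    refine Summable.of_norm_bounded hsum fun n => ?_
    have : (1 : ℝ) ≤ ((n.natAbs : ℝ) + 1) ^ 4 := one_le_pow₀ (by linarith [Nat.cast_nonneg (α := ℝ) n.natAbs])
    exact le_mul_of_one_le_left (norm_nonneg _) this
  refine ⟨fun n => (c n).re, ?_, ?_⟩
  · refine hsum.of_nonneg_of_le (fun n => by positivity) fun n => ?_
    gcongr
    exact Complex.abs_re_le_norm _
  · intro x hx
    have hx' : |L⁻¹ * x| ≤ 1 := by
      rw [abs_mul, abs_of_pos (inv_pos.2 hL), inv_mul_le_iff₀ hL, mul_one]; exact hx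
    set θ := Real.arccos (L⁻¹ * x) with hθ
    have hcos : Real.cos θ = L⁻¹ * x := Real.cos_arccos (abs_le.1 hx').1 (abs_le.1 hx').2
    have h1 := hasSum_fourierCoeffOn hF.continuous hper hsum0 θ
    -- Averaging the series at `θ` and `-θ` replaces the exponentials by cosines.
    have h2 := hasSum_fourierCoeffOn hF.continuous hper hsum0 (-θ)
    have h3 := Complex.hasSum_re ((h1.add h2).div_const 2)
    have hval : ((F θ + F (-θ)) / 2).re = f x := by
      have : L * (L⁻¹ * x) = x := by field_simp
      simp [hFdef, hcos, this]
    rw [hval] at h3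
    refine h3.congr_fun fun n => ?_
    rw [← hcos, Polynomial.Chebyshev.T_real_cos]
    have h4 : (c n * Complex.exp (Complex.I * n * θ)
        + c n * Complex.exp (Complex.I * n * ((-θ : ℝ) : ℂ))) / 2
        = c n * ((Real.cos (n * θ) : ℝ) : ℂ) := by
      rw [Complex.ofReal_cos, Complex.cos]
      push_cast
      rw [show Complex.I * n * θ = n * θ * Complex.I by ring,
        show Complex.I * n * (-θ : ℂ) = -(n * θ) * Complex.I by ring]
      ring
    rw [h4, Complex.re_mul_ofReal]

/-- A polynomial expansion `f = ∑ p i` on `[-L, L]`, where `p i` has degree at most `|i| + 1` and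
sup-norm at most `b i`, with `b` decaying fast. -/
structure PolyExpansion (L : ℝ) (f : ℝ → ℝ) (p : ℤ → Polynomial ℝ) (b : ℤ → ℝ) : Prop where
  natDegree_le : ∀ i, (p i).natDegree ≤ i.natAbs + 1
  abs_eval_le : ∀ i x, |x| ≤ L → |(p i).eval x| ≤ b i
  summable : Summable fun i : ℤ => ((i.natAbs : ℝ) + 1) ^ 4 * b i
  hasSum : ∀ x, |x| ≤ L → HasSum (fun i => (p i).eval x) (f x)

open Polynomial in
theorem exists_antiderivative (p : ℝ[X]) :
    ∃ q : ℝ[X], derivative q = p ∧ q.eval 0 = 0 ∧ q.natDegree ≤ p.natDegree + 1 := by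
  refine ⟨∑ i ∈ Finset.range (p.natDegree + 1), C (p.coeff i / (i + 1)) * X ^ (i + 1), ?_, ?_, ?_⟩
  · conv_rhs => rw [p.as_sum_range_C_mul_X_pow]
    rw [derivative_sum]
    refine Finset.sum_congr rfl fun i _ => ?_
    rw [derivative_C_mul_X_pow]
    have : ((i : ℝ) + 1) ≠ 0 := by positivity
    simp only [Nat.add_sub_cancel]
    congr 2
    push_cast
    field_simp
  · simp [eval_finsetSum]
  · refine natDegree_sum_le_of_forall_le _ _ fun i hi => ?_
    have := Finset.mem_range.1 hi
    exact (natDegree_C_mul_X_pow_le _ _).trans (by omega)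

-- The derivative is expanded and the series is then integrated term by term, so that one family of
-- polynomials expands `f` while its derivatives expand `f'`. The trace formula needs both at once;
-- integration is what raises the degree to `|i| + 1`.
open Polynomial in
theorem exists_polyExpansion {f : ℝ → ℝ} (hf : ContDiff ℝ ∞ f) {L : ℝ} (hL : 0 < L) :
    ∃ (p : ℤ → ℝ[X]) (b b' : ℤ → ℝ), PolyExpansion L f p b ∧
      PolyExpansion L (deriv f) (fun i => derivative (p i)) b' := by
  have hf' : ContDiff ℝ ∞ (deriv f) := by
    have := (contDiff_succ_iff_deriv (n := ∞) (f := f)).1 (by simpa using hf)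
    exact this.2.2
  obtain ⟨d, hd, hsum⟩ := exists_chebyshev_expansion hf' hL
  choose q hq1 hq2 hq3 using fun i : ℤ =>
    exists_antiderivative (C (d i) * (Chebyshev.T ℝ i).comp (C L⁻¹ * X))
  have hev : ∀ i x, (derivative (q i)).eval x = d i * (Chebyshev.T ℝ i).eval (L⁻¹ * x) := by
    intro i x
    rw [hq1]; simp
  have hevb : ∀ i x, |x| ≤ L → |(derivative (q i)).eval x| ≤ |d i| := by
    intro i x hx
    rw [hev, abs_mul]
    refine mul_le_of_le_one_right (abs_nonneg _) (Chebyshev.abs_eval_T_real_le_one i ?_)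
    rw [abs_mul, abs_of_pos (inv_pos.2 hL), inv_mul_le_iff₀ hL, mul_one]; exact hx
  have hdeg : ∀ i, (C (d i) * (Chebyshev.T ℝ i).comp (C L⁻¹ * X)).natDegree ≤ i.natAbs := by
    intro i
    refine (natDegree_C_mul_le _ _).trans (natDegree_comp_le.trans ?_)
    rw [Chebyshev.natDegree_T]
    have : (C L⁻¹ * X : ℝ[X]).natDegree ≤ 1 := by
      simpa using natDegree_C_mul_X_pow_le L⁻¹ 1
    exact (Nat.mul_le_mul_left _ this).trans (mul_one _).le
  have hftc : ∀ i x, (q i).eval x = ∫ t in (0 : ℝ)..x, (derivative (q i)).eval t := by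
    intro i x
    rw [intervalIntegral.integral_eq_sub_of_hasDerivAt (fun t _ => (q i).hasDerivAt t)
      ((derivative (q i)).continuous.intervalIntegrable _ _), hq2, sub_zero]
  have hqb : ∀ i x, |x| ≤ L → |(q i).eval x| ≤ |d i| * L := by
    intro i x hx
    rw [hftc]
    have := intervalIntegral.norm_integral_le_of_norm_le_const (a := 0) (b := x)
      (f := fun t => (derivative (q i)).eval t) (C := |d i|) (fun t ht => by
        apply hevb
        rcases Set.mem_uIoc.1 ht with h | h
        · rw [abs_le] at hx ⊢; constructor <;> linarith [hx.1, hx.2, h.1, h.2]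
        · rw [abs_le] at hx ⊢; constructor <;> linarith [hx.1, hx.2, h.1, h.2])
    rw [sub_zero] at this
    exact this.trans (by gcongr)
  have hds : Summable fun i => |d i| := by
    refine hd.of_nonneg_of_le (fun i => abs_nonneg _) fun n => ?_
    have : (1 : ℝ) ≤ ((n.natAbs : ℝ) + 1) ^ 4 := one_le_pow₀ (by linarith [Nat.cast_nonneg (α := ℝ) n.natAbs])
    exact le_mul_of_one_le_left (abs_nonneg _) this
  have hqs : ∀ x, |x| ≤ L → HasSum (fun i => (q i).eval x) (f x - f 0) := by
    intro x hx
    have hmem : ∀ t ∈ Set.uIoc 0 x, |t| ≤ L := fun t ht => by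
      rcases Set.mem_uIoc.1 ht with h | h
      · rw [abs_le] at hx ⊢; constructor <;> linarith [hx.1, hx.2, h.1, h.2]
      · rw [abs_le] at hx ⊢; constructor <;> linarith [hx.1, hx.2, h.1, h.2]
    have h := intervalIntegral.hasSum_integral_of_dominated_convergence (μ := volume) (a := 0)
      (b := x) (F := fun i t => (derivative (q i)).eval t) (f := deriv f) (fun i _ => |d i|)
      (fun i => (derivative (q i)).continuous.aestronglyMeasurable)
      (fun i => Eventually.of_forall fun t ht => hevb i t (hmem t ht))
      (Eventually.of_forall fun t _ => hds) (by simp)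
      (Eventually.of_forall fun t ht => by
        simp only [hev]; exact hsum t (hmem t ht))
    rw [intervalIntegral.integral_deriv_eq_sub
      (fun t _ => (hf.differentiable (by simp)) t) (hf'.continuous.intervalIntegrable _ _)] at h
    simpa only [← hftc] using h
  -- The antiderivatives vanish at `0`, so the constant `f 0` is restored in the term `i = 0`.
  refine ⟨fun i => q i + (if i = 0 then C (f 0) else 0),
    fun i => |d i| * L + (if i = 0 then |f 0| else 0), fun i => |d i|, ⟨?_, ?_, ?_, ?_⟩,
    ⟨?_, ?_, ?_, ?_⟩⟩
  · intro i
    refine (natDegree_add_le _ _).trans (max_le ((hq3 i).trans (by linarith [hdeg i])) ?_)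
    split_ifs <;> simp
  · intro i x hx
    split_ifs
    · rw [eval_add, eval_C]; exact (abs_add_le _ _).trans (by linarith [hqb i x hx])
    · simpa using hqb i x hx
  · simp only [mul_add, ← mul_assoc]
    refine (hd.mul_right L).add (summable_of_ne_finset_zero (s := {0}) fun i hi => ?_)
    rw [if_neg (by simpa using hi), mul_zero]
  · intro x hx
    have h1 := (hqs x hx).add (hasSum_ite_eq (0 : ℤ) (f 0))
    rw [sub_add_cancel] at h1
    refine h1.congr_fun fun i => ?_
    split_ifs <;> simp
  · intro i
    refine (natDegree_derivative_le _).trans ?_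
    have h1 : (q i + (if i = 0 then C (f 0) else 0)).natDegree ≤ i.natAbs + 1 := by
      refine (natDegree_add_le _ _).trans (max_le ((hq3 i).trans (by linarith [hdeg i])) ?_)
      split_ifs <;> simp
    exact (Nat.sub_le _ _).trans h1
  · intro i x hx
    have : derivative (q i + (if i = 0 then C (f 0) else 0)) = derivative (q i) := by
      split_ifs <;> simp
    rw [this]
    exact hevb i x hx
  · exact hd
  · intro x hx
    refine (hsum x hx).congr_fun fun i => ?_
    have : derivative (q i + (if i = 0 then C (f 0) else 0)) = derivative (q i) := by
      split_ifs <;> simp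
    rw [this, hev]

end

end Anderson

namespace Anderson

noncomputable section

/-! ### Locality of functions of the Schrödinger operator -/

namespace PolyExpansion

variable {R : ℝ} {f : ℝ → ℝ} {p : ℤ → Polynomial ℝ} {b : ℤ → ℝ}

/-- The weighted sum of the bounds, which controls all locality estimates. -/
def weight (b : ℤ → ℝ) : ℝ := ∑' i : ℤ, ((i.natAbs : ℝ) + 1) ^ 4 * b i

theorem bound_nonneg (hR : 0 ≤ R) (h : PolyExpansion (2 + R) f p b) (i : ℤ) : 0 ≤ b i :=
  (abs_nonneg _).trans (h.abs_eval_le i 0 (by rw [abs_zero]; linarith))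

theorem bound_le (hR : 0 ≤ R) (h : PolyExpansion (2 + R) f p b) (i : ℤ) :
    b i ≤ ((i.natAbs : ℝ) + 1) ^ 4 * b i :=
  le_mul_of_one_le_left (h.bound_nonneg hR i)
    (one_le_pow₀ (by linarith [Nat.cast_nonneg (α := ℝ) i.natAbs]))

theorem summable_bound (hR : 0 ≤ R) (h : PolyExpansion (2 + R) f p b) : Summable b :=
  h.summable.of_nonneg_of_le (h.bound_nonneg hR) (h.bound_le hR)

variable {V W : ℤ → ℝ}

theorem norm_aeval_le (h : PolyExpansion (2 + R) f p b) (hV : ∀ j, |V j| ≤ R) (i : ℤ) :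
    ‖Polynomial.aeval (schrodinger V) (p i)‖ ≤ b i := by
  have hR : 0 ≤ R := (abs_nonneg _).trans (hV 0)
  rw [← cfc_polynomial (p i) (schrodinger V) (isSelfAdjoint_schrodinger V)]
  exact norm_cfc_le (h.bound_nonneg hR i) fun x hx =>
    h.abs_eval_le i x (abs_le_of_mem_spectrum hV hx)

/-- The expansion converges uniformly on the spectrum, which the functional calculus turns into norm
convergence. -/
theorem hasSum_aeval (h : PolyExpansion (2 + R) f p b) (hV : ∀ j, |V j| ≤ R) :
    HasSum (fun i => Polynomial.aeval (schrodinger V) (p i)) (cfc f (schrodinger V)) := by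
  have hR : 0 ≤ R := (abs_nonneg _).trans (hV 0)
  have h1 := tendstoUniformlyOn_tsum (h.summable_bound hR) (s := spectrum ℝ (schrodinger V))
    (f := fun i x => (p i).eval x)
    (fun i x hx => h.abs_eval_le i x (abs_le_of_mem_spectrum hV hx))
  have h2 : TendstoUniformlyOn (fun (t : Finset ℤ) x => ∑ i ∈ t, (p i).eval x) f atTop
      (spectrum ℝ (schrodinger V)) := by
    refine h1.congr_right fun x hx => ?_
    exact (h.hasSum x (abs_le_of_mem_spectrum hV hx)).tsum_eq
  have h3 := tendsto_cfc_fun h2 (Eventually.of_forall fun t =>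
    (continuous_finsetSum t fun i _ => (p i).continuous).continuousOn)
  refine Tendsto.congr (fun t => ?_) h3
  have h4 : (fun x => ∑ i ∈ t, (p i).eval x) = fun x => (∑ i ∈ t, p i).eval x := by
    funext x
    rw [Polynomial.eval_finsetSum]
  rw [h4, cfc_polynomial _ _ (isSelfAdjoint_schrodinger V), map_sum]

theorem hasSum_entry (h : PolyExpansion (2 + R) f p b) (hV : ∀ j, |V j| ≤ R) (j k : ℤ) :
    HasSum (fun i => entry (Polynomial.aeval (schrodinger V) (p i)) j k)
      (entry (cfc f (schrodinger V)) j k) :=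
  (entryCLM j k).hasSum (h.hasSum_aeval hV)

theorem norm_entry_aeval_le (h : PolyExpansion (2 + R) f p b) (hV : ∀ j, |V j| ≤ R) (i j k : ℤ) :
    ‖entry (Polynomial.aeval (schrodinger V) (p i)) j k‖ ≤ b i :=
  (norm_entry_le _ _ _).trans (h.norm_aeval_le hV i)

/-- Terms of degree below `|j - k|` vanish by finite range. For the others `|j - k| + 1 ≤ 2 (|i| +
1)`, so the distance is absorbed in the weight, at the price `2 ^ 4 = 16`. -/
theorem norm_entry_le_weight (h : PolyExpansion (2 + R) f p b) (hV : ∀ j, |V j| ≤ R) (j k : ℤ) :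
    ‖entry (cfc f (schrodinger V)) j k‖ ≤ 16 * weight b / (((j - k).natAbs : ℝ) + 1) ^ 4 := by
  have hR : 0 ≤ R := (abs_nonneg _).trans (hV 0)
  have h1 := (h.summable.hasSum.mul_left 16).div_const ((((j - k).natAbs : ℝ) + 1) ^ 4)
  refine (h.hasSum_entry hV j k).norm_le_of_bounded h1 fun i => ?_
  have hb := h.bound_nonneg hR i
  by_cases hi : i.natAbs + 1 < (j - k).natAbs
  · rw [entry_aeval_eq_zero ⟨R, hV⟩]
    · rw [norm_zero]
      positivity
    · have := h.natDegree_le i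
      rw [Int.abs_eq_natAbs]
      omega
  · refine (h.norm_entry_aeval_le hV i j k).trans ?_
    rw [le_div_iff₀ (by positivity)]
    have h2 : ((j - k).natAbs : ℝ) + 1 ≤ 2 * ((i.natAbs : ℝ) + 1) := by
      have : (j - k).natAbs + 1 ≤ 2 * (i.natAbs + 1) := by omega
      exact_mod_cast this
    calc b i * (((j - k).natAbs : ℝ) + 1) ^ 4 ≤ b i * (2 * ((i.natAbs : ℝ) + 1)) ^ 4 := by gcongr
      _ = 16 * (((i.natAbs : ℝ) + 1) ^ 4 * b i) := by ring

/-- Terms of degree at most `N` cannot tell the two potentials apart; each of the others is bounded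
by `2 b i`. -/
theorem norm_entry_sub_le (h : PolyExpansion (2 + R) f p b) (hV : ∀ j, |V j| ≤ R)
    (hW : ∀ j, |W j| ≤ R) {N : ℕ} {j k : ℤ} (hVW : ∀ i, |i - j| ≤ N → V i = W i) :
    ‖entry (cfc f (schrodinger V)) j k - entry (cfc f (schrodinger W)) j k‖
      ≤ 2 * weight b / ((N : ℝ) + 1) ^ 4 := by
  have hR : 0 ≤ R := (abs_nonneg _).trans (hV 0)
  have h1 := (h.summable.hasSum.mul_left 2).div_const (((N : ℝ) + 1) ^ 4)
  refine ((h.hasSum_entry hV j k).sub (h.hasSum_entry hW j k)).norm_le_of_bounded h1 fun i => ?_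
  have hb := h.bound_nonneg hR i
  by_cases hi : i.natAbs + 1 ≤ N
  · rw [entry_aeval_congr ⟨R, hV⟩ ⟨R, hW⟩, sub_self]
    · rw [norm_zero]
      positivity
    · intro l hl
      have := h.natDegree_le i
      exact hVW l (by omega)
  · refine (norm_sub_le _ _).trans ((add_le_add (h.norm_entry_aeval_le hV i j k)
      (h.norm_entry_aeval_le hW i j k)).trans ?_)
    rw [le_div_iff₀ (by positivity)]
    have h2 : ((N : ℝ) + 1) ≤ ((i.natAbs : ℝ) + 1) := by
      have : N + 1 ≤ i.natAbs + 1 := by omega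
      exact_mod_cast this
    calc (b i + b i) * ((N : ℝ) + 1) ^ 4 ≤ (b i + b i) * ((i.natAbs : ℝ) + 1) ^ 4 := by gcongr
      _ = 2 * (((i.natAbs : ℝ) + 1) ^ 4 * b i) := by ring

theorem abs_diag_sub_le (h : PolyExpansion (2 + R) f p b) (hV : ∀ j, |V j| ≤ R)
    (hW : ∀ j, |W j| ≤ R) {N : ℕ} {j : ℤ} (hVW : ∀ i, |i - j| ≤ N → V i = W i) :
    |diag f V j - diag f W j| ≤ 2 * weight b / ((N : ℝ) + 1) ^ 4 := by
  rw [diag, diag, ← Complex.sub_re]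
  exact (Complex.abs_re_le_norm _).trans (h.norm_entry_sub_le hV hW hVW)

theorem abs_diag_le (h : PolyExpansion (2 + R) f p b) (hV : ∀ j, |V j| ≤ R) (j : ℤ) :
    |diag f V j| ≤ 16 * weight b := by
  refine (Complex.abs_re_le_norm _).trans ((h.norm_entry_le_weight hV j j).trans ?_)
  simp

theorem entry_translate (h : PolyExpansion (2 + R) f p b) (hV : ∀ j, |V j| ≤ R) (j k m : ℤ) :
    entry (cfc f (schrodinger fun i => V (i + m))) j k
      = entry (cfc f (schrodinger V)) (j + m) (k + m) := by
  refine (h.hasSum_entry (fun i => hV (i + m)) j k).unique ?_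
  simpa only [entry_aeval_translate ⟨R, hV⟩] using h.hasSum_entry hV (j + m) (k + m)

theorem diag_translate (h : PolyExpansion (2 + R) f p b) (hV : ∀ j, |V j| ≤ R) (j m : ℤ) :
    diag f (fun i => V (i + m)) j = diag f V (j + m) := by
  rw [diag, diag, h.entry_translate hV]

theorem continuous_entry {X : Type*} [TopologicalSpace X] {V : X → ℤ → ℝ}
    (h : PolyExpansion (2 + R) f p b) (hV : ∀ x j, |V x j| ≤ R)
    (hc : ∀ j, Continuous fun x => V x j) (j k : ℤ) :
    Continuous fun x => entry (cfc f (schrodinger (V x))) j k := by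
  rcases isEmpty_or_nonempty X with hX | ⟨⟨x₀⟩⟩
  · exact continuous_of_const fun x => (hX.false x).elim
  have hR : 0 ≤ R := (abs_nonneg _).trans (hV x₀ 0)
  have h1 : (fun x => entry (cfc f (schrodinger (V x))) j k)
      = fun x => ∑' i, entry (Polynomial.aeval (schrodinger (V x)) (p i)) j k :=
    funext fun x => (h.hasSum_entry (hV x) j k).tsum_eq.symm
  rw [h1]
  exact continuous_tsum (fun i => continuous_entry_aeval (fun x => ⟨R, hV x⟩) hc (p i) j k)
    (h.summable_bound hR) fun i x => h.norm_entry_aeval_le (hV x) i j k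

theorem continuous_diag {X : Type*} [TopologicalSpace X] {V : X → ℤ → ℝ}
    (h : PolyExpansion (2 + R) f p b) (hV : ∀ x j, |V x j| ≤ R)
    (hc : ∀ j, Continuous fun x => V x j) (j : ℤ) :
    Continuous fun x => diag f (V x) j :=
  Complex.continuous_re.comp (h.continuous_entry hV hc j j)

theorem abs_update_le (hV : ∀ j, |V j| ≤ R) {t : ℝ} (ht : |t| ≤ R) (k j : ℤ) :
    |Function.update V k t j| ≤ R := by
  by_cases hj : j = k
  · subst hj; simpa using ht
  · rw [Function.update_of_ne hj]; exact hV j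

/-- Krein's trace formula for a rank-one perturbation, in which the spectral shift is written as an
integral over the coupling constant. It holds for each polynomial and is summed over the expansion.
-/
theorem hasSum_diag_update_sub {b' : ℤ → ℝ} (h : PolyExpansion (2 + R) f p b)
    (h' : PolyExpansion (2 + R) (deriv f) (fun i => Polynomial.derivative (p i)) b')
    (hV : ∀ j, |V j| ≤ R) {w : ℝ} (hw : |w| ≤ R) :
    HasSum (fun j => diag f (Function.update V 0 w) j - diag f (Function.update V 0 0) j)
      (∫ t in (0 : ℝ)..w, diag (deriv f) (Function.update V 0 t) 0) := by
  have hR : 0 ≤ R := (abs_nonneg _).trans (hV 0)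
  have hVw := abs_update_le hV hw 0
  have hV0 := abs_update_le hV (t := 0) (by simpa using hR) 0
  -- The contributions indexed by polynomial and site form an absolutely summable double family: at
  -- most `3 (|i| + 1)` sites contribute to the polynomial `i`, each at most `2 b i`. Summing over
  -- sites first gives the integral, summing over polynomials first gives the diagonal entries.
  set F : ℤ × ℤ → ℂ := fun q =>
    entry (Polynomial.aeval (schrodinger (Function.update V 0 w)) (p q.1)) q.2 q.2
      - entry (Polynomial.aeval (schrodinger (Function.update V 0 0)) (p q.1)) q.2 q.2 with hF
  have hzero : ∀ i j : ℤ, j ∉ Finset.Icc (-((i.natAbs + 1 : ℕ) : ℤ)) ((i.natAbs + 1 : ℕ) : ℤ) →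
      F (i, j) = 0 := by
    intro i j hj
    simp only [hF]
    rw [entry_aeval_congr ⟨R, hVw⟩ ⟨R, hV0⟩, sub_self]
    intro l hl
    have := h.natDegree_le i
    have hl0 : l ≠ 0 := by
      rintro rfl
      rw [Finset.mem_Icc] at hj
      grind
    rw [Function.update_of_ne hl0, Function.update_of_ne hl0]
  have hFb : ∀ i j : ℤ, ‖F (i, j)‖ ≤ 2 * b i := by
    intro i j
    refine (norm_sub_le _ _).trans ?_
    linarith [h.norm_entry_aeval_le hVw i j j, h.norm_entry_aeval_le hV0 i j j]
  have hcard : ∀ i : ℤ, ((Finset.Icc (-((i.natAbs + 1 : ℕ) : ℤ)) ((i.natAbs + 1 : ℕ) : ℤ)).card : ℝ)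
      ≤ 3 * ((i.natAbs : ℝ) + 1) ^ 4 := by
    intro i
    rw [Int.card_Icc]
    have h1 : (((i.natAbs + 1 : ℕ) : ℤ) + 1 - -((i.natAbs + 1 : ℕ) : ℤ)).toNat
        ≤ 3 * (i.natAbs + 1) := by omega
    have h2 : (3 : ℝ) * ((i.natAbs : ℝ) + 1) ≤ 3 * ((i.natAbs : ℝ) + 1) ^ 4 := by
      have : (1 : ℝ) ≤ (i.natAbs : ℝ) + 1 := by linarith [Nat.cast_nonneg (α := ℝ) i.natAbs]
      nlinarith [one_le_pow₀ this (n := 3)]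
    refine le_trans ?_ h2
    exact_mod_cast h1
  have hFs : Summable F := by
    rw [← summable_norm_iff]
    rw [summable_prod_of_nonneg fun q => norm_nonneg _]
    refine ⟨fun i => summable_of_ne_finset_zero fun j hj => by rw [hzero i j hj, norm_zero], ?_⟩
    refine (h.summable.mul_left 6).of_nonneg_of_le (fun i => tsum_nonneg fun j => norm_nonneg _)
      fun i => ?_
    rw [tsum_eq_sum (s := Finset.Icc (-((i.natAbs + 1 : ℕ) : ℤ)) ((i.natAbs + 1 : ℕ) : ℤ))
      fun j hj => by rw [hzero i j hj, norm_zero]]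
    refine (Finset.sum_le_card_nsmul _ _ _ fun j _ => hFb i j).trans ?_
    rw [nsmul_eq_mul]
    have := mul_le_mul_of_nonneg_right (hcard i)
      (mul_nonneg zero_le_two (h.bound_nonneg hR i) : 0 ≤ 2 * b i)
    linarith
  have hfib1 : ∀ i, HasSum (fun j => F (i, j)) (∫ t in (0 : ℝ)..w,
      entry (Polynomial.aeval (schrodinger (Function.update V 0 t))
        (Polynomial.derivative (p i))) 0 0) := by
    intro i
    rw [← sum_entry_aeval_update_sub ⟨R, hV⟩ (p i) (h.natDegree_le i) w]
    exact hasSum_sum_of_ne_finset_zero fun j hj => hzero i j hj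
  have hmem : ∀ t ∈ Set.uIoc 0 w, |t| ≤ R := fun t ht => by
    rcases Set.mem_uIoc.1 ht with h | h
    · rw [abs_le] at hw ⊢; constructor <;> linarith [hw.1, hw.2, h.1, h.2]
    · rw [abs_le] at hw ⊢; constructor <;> linarith [hw.1, hw.2, h.1, h.2]
  have hsum1 := HasSum.prod_fiberwise hFs.hasSum hfib1
  have hcont : ∀ i, Continuous fun t : ℝ => entry (Polynomial.aeval
      (schrodinger (Function.update V 0 t)) (Polynomial.derivative (p i))) 0 0 := by
    intro i
    refine continuous_entry_aeval (fun t => exists_abs_update_le ⟨R, hV⟩ 0 t) (fun j => ?_) _ _ _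
    by_cases hj : j = 0
    · subst hj; simpa using continuous_id'
    · simpa [hj] using continuous_const
  have hsum2 := intervalIntegral.hasSum_integral_of_dominated_convergence (μ := volume) (a := 0)
    (b := w) (F := fun i t => entry (Polynomial.aeval (schrodinger (Function.update V 0 t))
      (Polynomial.derivative (p i))) 0 0)
    (f := fun t => entry (cfc (deriv f) (schrodinger (Function.update V 0 t))) 0 0)
    (fun i _ => b' i) (fun i => (hcont i).aestronglyMeasurable)
    (fun i => Eventually.of_forall fun t ht =>
      h'.norm_entry_aeval_le (abs_update_le hV (hmem t ht) 0) i 0 0)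
    (Eventually.of_forall fun t _ => h'.summable_bound hR) (by simp)
    (Eventually.of_forall fun t ht => h'.hasSum_entry (abs_update_le hV (hmem t ht) 0) 0 0)
  have hfib2 : ∀ j, HasSum (fun i => F (i, j)) (entry (cfc f (schrodinger (Function.update V 0 w))) j j
      - entry (cfc f (schrodinger (Function.update V 0 0))) j j) := fun j =>
    (h.hasSum_entry hVw j j).sub (h.hasSum_entry hV0 j j)
  have hsum3 := HasSum.prod_fiberwise ((Equiv.prodComm ℤ ℤ).hasSum_iff.2 hFs.hasSum) hfib2
  rw [hsum1.unique hsum2] at hsum3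
  have hre := Complex.hasSum_re hsum3
  have hint : IntervalIntegrable (fun t => entry (cfc (deriv f)
      (schrodinger (Function.update V 0 t))) 0 0) volume 0 w := by
    -- The expansion is only available for `|t| ≤ R`, so `t` is clamped to obtain continuity on the
    -- whole line.
    have hcl : Continuous fun t : ℝ => entry (cfc (deriv f) (schrodinger
        (Function.update V 0 (max (-R) (min t R))))) 0 0 := by
      refine h'.continuous_entry (fun t => abs_update_le hV ?_ 0) (fun j => ?_) 0 0
      · rw [abs_le]
        exact ⟨le_max_left _ _, max_le (by linarith) (min_le_right _ _)⟩
      · by_cases hj : j = 0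
        · subst hj
          simp only [Function.update_self]
          fun_prop
        · simpa [hj] using continuous_const
    refine (hcl.intervalIntegrable 0 w).congr fun t ht => ?_
    have h3 := abs_le.1 (hmem t ht)
    rw [min_eq_left h3.2, max_eq_right h3.1]
  have h4 := Complex.reCLM.intervalIntegral_comp_comm hint
  simp only [Complex.reCLM_apply] at h4
  rw [← h4] at hre
  simp only [Complex.sub_re] at hre
  exact hre

end PolyExpansion

end

end Anderson

namespace Anderson

noncomputable section

/-! ### Restriction to a box -/

open Matrix in
/-- The inclusion of vectors supported on the box `[-M, M]`. -/
def embed {M : ℕ} (x : Finset.Icc (-M : ℤ) M → ℂ) : Ell2 := ∑ j, x j • basisVec j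

open Matrix in
theorem inner_embed {M : ℕ} (A : Ell2 →L[ℂ] Ell2) (x y : Finset.Icc (-M : ℤ) M → ℂ) :
    inner ℂ (embed x) (A (embed y)) = star x ⬝ᵥ (restrict A M *ᵥ y) := by
  simp only [embed, map_sum, map_smul, sum_inner, inner_sum, inner_smul_left, inner_smul_right,
    dotProduct, mulVec, restrict, Matrix.of_apply, Finset.mul_sum, entry, Pi.star_apply]
  rw [Finset.sum_comm]
  refine Finset.sum_congr rfl fun j _ => Finset.sum_congr rfl fun k _ => ?_
  simp only [starRingEnd_apply]
  ring

theorem restrict_one (M : ℕ) : restrict 1 M = 1 := by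
  ext j k
  rw [restrict, Matrix.of_apply, entry_one, Matrix.one_apply]
  simp only [Subtype.ext_iff]

theorem isHermitian_restrict {A : Ell2 →L[ℂ] Ell2} (hA : IsSelfAdjoint A) (M : ℕ) :
    (restrict A M).IsHermitian := by
  refine Matrix.IsHermitian.ext fun j k => ?_
  have h := entry_adjoint A j k
  rw [ContinuousLinearMap.isSelfAdjoint_iff'.1 hA] at h
  exact h.symm

theorem trace_cfc_eq_sum {n : Type*} [Fintype n] [DecidableEq n] {B : Matrix n n ℂ}
    (hB : B.IsHermitian) (φ : ℝ → ℝ) :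
    (cfc φ B).trace = ∑ i, (φ (hB.eigenvalues i) : ℂ) := by
  rw [hB.cfc_eq, Matrix.IsHermitian.cfc, Unitary.conjStarAlgAut_apply, Matrix.trace_mul_comm,
    ← mul_assoc, Unitary.coe_star_mul_self, one_mul, Matrix.trace_diagonal]
  rfl

open Matrix in
theorem sum_star_dotProduct_mulVec_eigenvectorBasis {n : Type*} [Fintype n] [DecidableEq n]
    {B : Matrix n n ℂ} (hB : B.IsHermitian) (T : Matrix n n ℂ) :
    ∑ i, star (hB.eigenvectorBasis i : n → ℂ) ⬝ᵥ (T *ᵥ (hB.eigenvectorBasis i : n → ℂ))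
      = T.trace := by
  obtain ⟨U, hU⟩ : ∃ U : Matrix n n ℂ, U = (hB.eigenvectorUnitary : Matrix n n ℂ) := ⟨_, rfl⟩
  have h1 : (star U * T * U).trace = T.trace := by
    rw [Matrix.trace_mul_comm, ← mul_assoc, hU, Unitary.mul_star_self_of_mem hB.eigenvectorUnitary.2, one_mul]
  rw [← h1, Matrix.trace]
  refine Finset.sum_congr rfl fun i _ => ?_
  rw [Matrix.diag_apply, mul_assoc, Matrix.mul_apply', hU]
  rfl

/-- The decay profile `(|d| + 1)⁻⁴`. -/
def decay (d : ℤ) : ℝ := 1 / ((d.natAbs : ℝ) + 1) ^ 4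

theorem decay_pos (d : ℤ) : 0 < decay d := by
  unfold decay
  positivity

theorem decay_neg (d : ℤ) : decay (-d) = decay d := by
  rw [decay, decay, Int.natAbs_neg]

theorem decay_anti {d e : ℤ} (h : d.natAbs ≤ e.natAbs) : decay e ≤ decay d := by
  unfold decay
  gcongr

theorem summable_decay_nat : Summable fun n : ℕ => decay n := by
  have h := (summable_nat_add_iff 1).2 (Real.summable_one_div_nat_pow.2 (by norm_num : 1 < 4))
  simpa [decay] using h

theorem summable_decay : Summable decay := by
  refine Summable.of_nat_of_neg summable_decay_nat ?_
  simpa only [decay_neg] using summable_decay_nat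

/-- The tail of the Hilbert–Schmidt norm coupling the box to its complement. -/
theorem sum_sub_sum_norm_entry_sq_le {A : Ell2 →L[ℂ] Ell2} (hA : IsSelfAdjoint A) {κ : ℝ}
    (hκ : ∀ j k, ‖entry A j k‖ ≤ κ * decay (j - k)) (M : ℕ) :
    ∑ j ∈ Finset.Icc (-M : ℤ) M, ((entry (A * A) j j).re
      - ∑ k ∈ Finset.Icc (-M : ℤ) M, ‖entry A j k‖ ^ 2)
      ≤ 2 * (κ * ∑' d : ℤ, decay d) ^ 2 := by
  set S := ∑' d : ℤ, decay d with hS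
  have hrow : ∀ j, HasSum (fun k => ‖entry A j k‖ ^ 2) (entry (A * A) j j).re := by
    intro j
    refine (Complex.hasSum_re (hasSum_entry_mul A A j j)).congr_fun fun k => ?_
    have h := entry_adjoint A k j
    rw [ContinuousLinearMap.isSelfAdjoint_iff'.1 hA] at h
    rw [h, Complex.mul_conj, Complex.normSq_eq_norm_sq, Complex.ofReal_re]
  have hterm : ∀ j ∈ Finset.Icc (-M : ℤ) M, (entry (A * A) j j).re
      - ∑ k ∈ Finset.Icc (-M : ℤ) M, ‖entry A j k‖ ^ 2
      ≤ κ ^ 2 * S * (decay (M - j) + decay (M + j)) := by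
    intro j hj
    have h1 : HasSum (fun k => if k ∈ Finset.Icc (-M : ℤ) M then ‖entry A j k‖ ^ 2 else 0)
        (∑ k ∈ Finset.Icc (-M : ℤ) M, ‖entry A j k‖ ^ 2) := by
      have := hasSum_sum_of_ne_finset_zero (L := .unconditional ℤ) (s := Finset.Icc (-M : ℤ) M)
        (f := fun k => if k ∈ Finset.Icc (-M : ℤ) M then ‖entry A j k‖ ^ 2 else 0)
        (fun k hk => if_neg hk)
      rwa [Finset.sum_congr rfl fun k hk => if_pos hk] at this
    have h2 : HasSum (fun k => decay (j - k)) S :=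
      (Equiv.hasSum_iff (f := decay) (Equiv.subLeft j)).2 summable_decay.hasSum
    have h3 := h2.mul_left (κ ^ 2 * (decay (M - j) + decay (M + j)))
    rw [show κ ^ 2 * S * (decay (M - j) + decay (M + j))
      = κ ^ 2 * (decay (M - j) + decay (M + j)) * S by ring]
    refine hasSum_le (fun k => ?_) ((hrow j).sub h1) h3
    have hp := decay_pos (j - k)
    have hp1 := decay_pos (M - j)
    have hp2 := decay_pos (M + j)
    split_ifs with hk
    · rw [sub_self]
      positivity
    · rw [sub_zero]
      -- A site outside the box is farther from `j` than the nearer end. One factor of decay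
      -- measures the distance to the boundary, the other remains to be summed over `k`.
      have h4 : decay (j - k) ≤ decay (M - j) + decay (M + j) := by
        rw [Finset.mem_Icc] at hj hk
        rcases lt_or_ge k (-M : ℤ) with h | h
        · have := decay_anti (d := M + j) (e := j - k) (by omega)
          linarith
        · have := decay_anti (d := M - j) (e := j - k) (by omega)
          linarith
      calc ‖entry A j k‖ ^ 2 ≤ (κ * decay (j - k)) ^ 2 := by
            gcongr
            exact hκ j k
        _ = κ ^ 2 * decay (j - k) * decay (j - k) := by ring
        _ ≤ κ ^ 2 * (decay (M - j) + decay (M + j)) * decay (j - k) := by gcongr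
  have hsum1 : ∑ j ∈ Finset.Icc (-M : ℤ) M, decay (M - j) ≤ S := by
    have h2 : HasSum (fun j : ℤ => decay (M - j)) S :=
      (Equiv.hasSum_iff (f := decay) (Equiv.subLeft (M : ℤ))).2 summable_decay.hasSum
    exact sum_le_hasSum _ (fun j _ => (decay_pos _).le) h2
  have hsum2 : ∑ j ∈ Finset.Icc (-M : ℤ) M, decay (M + j) ≤ S := by
    have h2 : HasSum (fun j : ℤ => decay (M + j)) S :=
      (Equiv.hasSum_iff (f := decay) (Equiv.addLeft (M : ℤ))).2 summable_decay.hasSum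
    exact sum_le_hasSum _ (fun j _ => (decay_pos _).le) h2
  have hS0 : 0 ≤ S := tsum_nonneg fun d => (decay_pos d).le
  refine (Finset.sum_le_sum hterm).trans ?_
  rw [← Finset.mul_sum, Finset.sum_add_distrib]
  calc κ ^ 2 * S * (∑ j ∈ Finset.Icc (-M : ℤ) M, decay (M - j)
        + ∑ j ∈ Finset.Icc (-M : ℤ) M, decay (M + j)) ≤ κ ^ 2 * S * (S + S) := by gcongr
    _ = 2 * (κ * S) ^ 2 := by ring

/-- Quadratic Taylor bound for `φ` on the set `I`. -/
def HasQuadraticBound (φ φ' : ℝ → ℝ) (I : Set ℝ) (C : ℝ) : Prop :=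
  ∀ x ∈ I, ∀ y ∈ I, |φ x - φ y - φ' y * (x - y)| ≤ C * (x - y) ^ 2

/-- The numerical range lies in the hull of the spectrum. This keeps the eigenvalues of the
restriction inside the interval where the entropy function is smooth. -/
theorem re_inner_cfc_mem_Icc {H : Ell2 →L[ℂ] Ell2} (hH : IsSelfAdjoint H) {a : ℝ → ℝ}
    (ha : ContinuousOn a (spectrum ℝ H)) {m₁ m₂ : ℝ} (hI : ∀ x ∈ spectrum ℝ H, a x ∈ Set.Icc m₁ m₂)
    {u : Ell2} (hu : ‖u‖ = 1) : (inner ℂ u (cfc a H u)).re ∈ Set.Icc m₁ m₂ := by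
  have hone : (inner ℂ u u : ℂ).re = 1 := by
    rw [inner_self_eq_norm_sq_to_K, hu]; simp
  have hc : ∀ c : ℝ, (inner ℂ u (cfc (fun _ : ℝ => c) H u)).re = c := by
    intro c
    rw [cfc_const c H hH, Algebra.algebraMap_eq_smul_one]
    change (inner ℂ u ((c : ℂ) • u)).re = c
    rw [inner_smul_right, Complex.re_ofReal_mul, hone, mul_one]
  have hle : ∀ f g : ℝ → ℝ, ContinuousOn f (spectrum ℝ H) → ContinuousOn g (spectrum ℝ H) →
      (∀ x ∈ spectrum ℝ H, f x ≤ g x) →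
      (inner ℂ u (cfc f H u)).re ≤ (inner ℂ u (cfc g H u)).re := by
    intro f g hf hg hfg
    have h := cfc_mono hfg hf hg
    have h2 := (ContinuousLinearMap.le_def _ _).1 h
    have h3 := h2.re_inner_nonneg_right u
    rw [sub_apply, inner_sub_right, map_sub] at h3
    exact sub_nonneg.1 h3
  constructor
  · rw [← hc m₁]
    exact hle _ _ continuousOn_const ha fun x hx => (hI x hx).1
  · rw [← hc m₂]
    exact hle _ _ ha continuousOn_const fun x hx => (hI x hx).2

/-- Expand `φ` at the mean `μ` of `a` in the spectral measure of `u`: the linear term integrates to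
zero, and the remainder is bounded by the variance of `a`. -/
theorem abs_re_inner_cfc_comp_sub_le {H : Ell2 →L[ℂ] Ell2} (hH : IsSelfAdjoint H) {φ φ' a : ℝ → ℝ}
    (ha : ContinuousOn a (spectrum ℝ H)) (hφ : ContinuousOn (φ ∘ a) (spectrum ℝ H)) {m₁ m₂ C : ℝ}
    (hI : ∀ x ∈ spectrum ℝ H, a x ∈ Set.Icc m₁ m₂)
    (hC : HasQuadraticBound φ φ' (Set.Icc m₁ m₂) C) {u : Ell2} (hu : ‖u‖ = 1) {μ : ℝ}
    (hμ : (inner ℂ u (cfc a H u)).re = μ) :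
    |(inner ℂ u (cfc (φ ∘ a) H u)).re - φ μ|
      ≤ C * ((inner ℂ u ((cfc a H * cfc a H) u)).re - μ ^ 2) := by
  have hμI : μ ∈ Set.Icc m₁ m₂ := hμ ▸ re_inner_cfc_mem_Icc hH ha hI hu
  have hone : (inner ℂ u u : ℂ).re = 1 := by
    rw [inner_self_eq_norm_sq_to_K, hu]; simp
  set r : ℝ → ℝ := fun x => φ (a x) - φ μ - φ' μ * (a x - μ) with hr
  have hrc : ContinuousOn r (spectrum ℝ H) := by
    exact (hφ.sub continuousOn_const).sub (continuousOn_const.mul (ha.sub continuousOn_const))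
  set q : ℝ → ℝ := fun x => (a x - μ) * (a x - μ) with hq
  have hqc : ContinuousOn q (spectrum ℝ H) := by fun_prop
  have hcr : cfc r H = cfc (φ ∘ a) H - algebraMap ℝ _ (φ μ)
      - φ' μ • (cfc a H - algebraMap ℝ _ μ) := by
    have h1 : ContinuousOn (fun x => φ (a x)) (spectrum ℝ H) := hφ
    rw [hr, cfc_sub (fun x => φ (a x) - φ μ) (fun x => φ' μ * (a x - μ)) H
      (h1.sub continuousOn_const) (by fun_prop),
      cfc_sub (fun x => φ (a x)) (fun _ => φ μ) H h1 (by fun_prop),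
      cfc_const_mul (φ' μ) (fun x => a x - μ) H (by fun_prop),
      cfc_sub a (fun _ => μ) H ha (by fun_prop), cfc_const _ _ hH, cfc_const _ _ hH]
    rfl
  have hcq : cfc q H = (cfc a H - algebraMap ℝ _ μ) * (cfc a H - algebraMap ℝ _ μ) := by
    rw [hq, cfc_mul (fun x => a x - μ) (fun x => a x - μ) H (by fun_prop) (by fun_prop),
      cfc_sub a (fun _ => μ) H ha (by fun_prop), cfc_const _ _ hH]
  have halg : ∀ (c : ℝ) (v : Ell2), (algebraMap ℝ (Ell2 →L[ℂ] Ell2) c) v = (c : ℂ) • v := by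
    intro c v
    rw [Algebra.algebraMap_eq_smul_one]
    rfl
  have hvr : (inner ℂ u (cfc r H u)).re = (inner ℂ u (cfc (φ ∘ a) H u)).re - φ μ := by
    rw [hcr, sub_apply, sub_apply, smul_apply, sub_apply, halg, halg, inner_sub_right,
      inner_sub_right, show φ' μ • (cfc a H u - (μ : ℂ) • u) = (φ' μ : ℂ) • (cfc a H u - (μ : ℂ) • u)
        from rfl, inner_smul_right, inner_smul_right, inner_sub_right, inner_smul_right]
    simp only [Complex.sub_re, Complex.re_ofReal_mul, hone, hμ]
    ring
  have hvq : (inner ℂ u (cfc q H u)).re = (inner ℂ u ((cfc a H * cfc a H) u)).re - μ ^ 2 := by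
    have h2 : (cfc a H - algebraMap ℝ _ μ) * (cfc a H - algebraMap ℝ _ μ)
        = cfc a H * cfc a H - (2 * μ) • cfc a H + algebraMap ℝ _ (μ ^ 2) := by
      rw [Algebra.algebraMap_eq_smul_one, Algebra.algebraMap_eq_smul_one]
      simp only [sub_mul, mul_sub, smul_mul_assoc, mul_smul_comm, one_mul, mul_one]
      module
    rw [hcq, h2, add_apply, sub_apply, smul_apply, halg, inner_add_right, inner_sub_right,
      show (2 * μ) • cfc a H u = ((2 * μ : ℝ) : ℂ) • cfc a H u from rfl, inner_smul_right,
      inner_smul_right]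
    simp only [Complex.sub_re, Complex.add_re, Complex.re_ofReal_mul, hone, hμ]
    ring
  have hle : ∀ f g : ℝ → ℝ, ContinuousOn f (spectrum ℝ H) → ContinuousOn g (spectrum ℝ H) →
      (∀ x ∈ spectrum ℝ H, f x ≤ g x) →
      (inner ℂ u (cfc f H u)).re ≤ (inner ℂ u (cfc g H u)).re := by
    intro f g hf hg hfg
    have h := cfc_mono hfg hf hg
    have h2 := (ContinuousLinearMap.le_def _ _).1 h
    have h3 := h2.re_inner_nonneg_right u
    rw [sub_apply, inner_sub_right, map_sub] at h3
    exact sub_nonneg.1 h3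
  have hsmul : ∀ (c : ℝ), (inner ℂ u (cfc (fun x => c * q x) H u)).re
      = c * (inner ℂ u (cfc q H u)).re := by
    intro c
    rw [cfc_const_mul c q H hqc, smul_apply,
      show c • cfc q H u = (c : ℂ) • cfc q H u from rfl, inner_smul_right, Complex.re_ofReal_mul]
  rw [← hvr, ← hvq, abs_le, ← neg_mul, ← hsmul, ← hsmul]
  constructor
  · refine hle _ _ (by fun_prop) hrc fun x hx => ?_
    have := (abs_le.1 (hC (a x) (hI x hx) μ hμI)).1
    simp only [hr, hq]
    nlinarith
  · refine hle _ _ hrc (by fun_prop) fun x hx => ?_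
    have := (abs_le.1 (hC (a x) (hI x hx) μ hμI)).2
    simp only [hr, hq]
    nlinarith

open Matrix in
theorem norm_embed_eigenvectorBasis {M : ℕ} {B : Matrix (Finset.Icc (-M : ℤ) M) (Finset.Icc (-M : ℤ) M) ℂ}
    (hB : B.IsHermitian) (i : Finset.Icc (-M : ℤ) M) :
    ‖embed (hB.eigenvectorBasis i : Finset.Icc (-M : ℤ) M → ℂ)‖ = 1 := by
  have h1 := inner_embed (1 : Ell2 →L[ℂ] Ell2) (hB.eigenvectorBasis i : Finset.Icc (-M : ℤ) M → ℂ)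
    (hB.eigenvectorBasis i : Finset.Icc (-M : ℤ) M → ℂ)
  rw [restrict_one, one_mulVec, dotProduct_comm, ← EuclideanSpace.inner_eq_star_dotProduct,
    one_apply_eq_self, inner_self_eq_norm_sq_to_K, inner_self_eq_norm_sq_to_K,
    hB.eigenvectorBasis.norm_eq_one] at h1
  have h2 : ‖embed (hB.eigenvectorBasis i : Finset.Icc (-M : ℤ) M → ℂ)‖ ^ 2 = 1 := by
    have h3 : ((‖embed (hB.eigenvectorBasis i : Finset.Icc (-M : ℤ) M → ℂ)‖ : ℂ)) ^ 2 = 1 := by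
      simpa using h1
    exact_mod_cast h3
  exact (pow_eq_one_iff_of_nonneg (norm_nonneg _) two_ne_zero).1 h2

open Matrix in
theorem re_inner_embed_eigenvectorBasis {M : ℕ} {A : Ell2 →L[ℂ] Ell2}
    (hB : (restrict A M).IsHermitian) (i : Finset.Icc (-M : ℤ) M) :
    (inner ℂ (embed (hB.eigenvectorBasis i : Finset.Icc (-M : ℤ) M → ℂ))
      (A (embed (hB.eigenvectorBasis i : Finset.Icc (-M : ℤ) M → ℂ)))).re = hB.eigenvalues i := by
  rw [inner_embed, hB.eigenvalues_eq]
  rfl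

theorem eigenvalues_restrict_mem_Icc {H : Ell2 →L[ℂ] Ell2} (hH : IsSelfAdjoint H) {a : ℝ → ℝ}
    (ha : ContinuousOn a (spectrum ℝ H)) {m₁ m₂ : ℝ} (hI : ∀ x ∈ spectrum ℝ H, a x ∈ Set.Icc m₁ m₂)
    {M : ℕ} (hB : (restrict (cfc a H) M).IsHermitian) (i : Finset.Icc (-M : ℤ) M) :
    hB.eigenvalues i ∈ Set.Icc m₁ m₂ := by
  rw [← re_inner_embed_eigenvectorBasis hB i]
  exact re_inner_cfc_mem_Icc hH ha hI (norm_embed_eigenvectorBasis hB i)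

theorem sum_re_inner_embed {M : ℕ} {B : Matrix (Finset.Icc (-M : ℤ) M) (Finset.Icc (-M : ℤ) M) ℂ}
    (hB : B.IsHermitian) (T : Ell2 →L[ℂ] Ell2) :
    ∑ i, (inner ℂ (embed (hB.eigenvectorBasis i : Finset.Icc (-M : ℤ) M → ℂ))
      (T (embed (hB.eigenvectorBasis i : Finset.Icc (-M : ℤ) M → ℂ)))).re
      = ∑ j ∈ Finset.Icc (-M : ℤ) M, (entry T j j).re := by
  simp only [inner_embed]
  rw [← Complex.re_sum, sum_star_dotProduct_mulVec_eigenvectorBasis, Matrix.trace, Complex.re_sum,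
    ← Finset.sum_coe_sort (Finset.Icc (-M : ℤ) M)]
  rfl

/-- Up to a bounded error, the trace of a function of the restriction is the sum of the diagonal
entries of the function. -/
theorem abs_traceBox_sub_sum_diag_le {R : ℝ} {a φ φ' : ℝ → ℝ} {p : ℤ → Polynomial ℝ} {b : ℤ → ℝ}
    (h : PolyExpansion (2 + R) a p b) (ha : Continuous a) {m₁ m₂ C : ℝ}
    (hI : ∀ x, |x| ≤ 2 + R → a x ∈ Set.Icc m₁ m₂) (hφ : ContinuousOn φ (Set.Icc m₁ m₂))
    (hC0 : 0 ≤ C) (hC : HasQuadraticBound φ φ' (Set.Icc m₁ m₂) C) {V : ℤ → ℝ}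
    (hV : ∀ j, |V j| ≤ R) (M : ℕ) :
    |traceBox φ a V M - ∑ j ∈ Finset.Icc (-M : ℤ) M, diag (φ ∘ a) V j|
      ≤ C * (2 * (16 * PolyExpansion.weight b * ∑' d : ℤ, decay d) ^ 2) := by
  set H := schrodinger V with hHdef
  have hH : IsSelfAdjoint H := isSelfAdjoint_schrodinger V
  have hsp : ∀ x ∈ spectrum ℝ H, a x ∈ Set.Icc m₁ m₂ := fun x hx =>
    hI x (abs_le_of_mem_spectrum hV hx)
  have hA : IsSelfAdjoint (cfc a H) := cfc_predicate a H
  have hB := isHermitian_restrict hA M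
  have hφa : ContinuousOn (φ ∘ a) (spectrum ℝ H) :=
    hφ.comp ha.continuousOn fun x hx => hsp x hx
  have htr : traceBox φ a V M = ∑ i, φ (hB.eigenvalues i) := by
    rw [traceBox, trace_cfc_eq_sum hB, Complex.re_sum]
    simp
  have hdiag : ∑ j ∈ Finset.Icc (-M : ℤ) M, diag (φ ∘ a) V j
      = ∑ i, (inner ℂ (embed (hB.eigenvectorBasis i : Finset.Icc (-M : ℤ) M → ℂ))
      (cfc (φ ∘ a) H (embed (hB.eigenvectorBasis i : Finset.Icc (-M : ℤ) M → ℂ)))).re :=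
    (sum_re_inner_embed hB _).symm
  -- The eigenvalue squares add up to the squared Hilbert–Schmidt norm of the restriction.
  have hsq : ∑ i, hB.eigenvalues i ^ 2 = ∑ j ∈ Finset.Icc (-M : ℤ) M,
      ∑ k ∈ Finset.Icc (-M : ℤ) M, ‖entry (cfc a H) j k‖ ^ 2 := by
    have h1 := trace_cfc_eq_sum hB fun x => x ^ 2
    rw [cfc_pow_id (restrict (cfc a H) M) 2 hB.isSelfAdjoint, pow_two] at h1
    have h2 := congrArg Complex.re h1
    rw [Complex.re_sum] at h2
    simp only [Complex.ofReal_re] at h2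
    rw [← h2, Matrix.trace, Complex.re_sum, ← Finset.sum_coe_sort (Finset.Icc (-M : ℤ) M)]
    refine Finset.sum_congr rfl fun j _ => ?_
    rw [Matrix.diag_apply, Matrix.mul_apply, Complex.re_sum,
      ← Finset.sum_coe_sort (Finset.Icc (-M : ℤ) M)]
    refine Finset.sum_congr rfl fun k _ => ?_
    have h3 := hB.apply j k
    rw [← h3, Complex.star_def, mul_comm, Complex.mul_conj, Complex.normSq_eq_norm_sq,
      Complex.ofReal_re, restrict, Matrix.of_apply]
    have h4 := entry_adjoint (cfc a H) j k
    rw [ContinuousLinearMap.isSelfAdjoint_iff'.1 hA] at h4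
    rw [h4, RCLike.norm_conj]
  rw [htr, hdiag, ← Finset.sum_sub_distrib]
  refine (Finset.abs_sum_le_sum_abs _ _).trans ?_
  -- Each eigenvector of the restriction, extended by zero, is a state in which `a(H)` has the
  -- eigenvalue as its mean. The sum of the variances is the squared Hilbert–Schmidt norm of the
  -- part of `a(H)` linking the box to its complement.
  calc ∑ i, |φ (hB.eigenvalues i)
        - (inner ℂ (embed (hB.eigenvectorBasis i : Finset.Icc (-M : ℤ) M → ℂ))
          (cfc (φ ∘ a) H (embed (hB.eigenvectorBasis i : Finset.Icc (-M : ℤ) M → ℂ)))).re|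
      ≤ ∑ i, C * ((inner ℂ (embed (hB.eigenvectorBasis i : Finset.Icc (-M : ℤ) M → ℂ))
          ((cfc a H * cfc a H) (embed (hB.eigenvectorBasis i : Finset.Icc (-M : ℤ) M → ℂ)))).re
          - hB.eigenvalues i ^ 2) := by
        refine Finset.sum_le_sum fun i _ => ?_
        rw [abs_sub_comm]
        exact abs_re_inner_cfc_comp_sub_le hH ha.continuousOn hφa hsp hC
          (norm_embed_eigenvectorBasis hB i) (re_inner_embed_eigenvectorBasis hB i)
    _ = C * ∑ j ∈ Finset.Icc (-M : ℤ) M, ((entry (cfc a H * cfc a H) j j).re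
          - ∑ k ∈ Finset.Icc (-M : ℤ) M, ‖entry (cfc a H) j k‖ ^ 2) := by
        rw [← Finset.mul_sum, Finset.sum_sub_distrib, sum_re_inner_embed, hsq,
          ← Finset.sum_sub_distrib]
    _ ≤ _ := by
        gcongr
        refine sum_sub_sum_norm_entry_sq_le hA (fun j k => ?_) M
        refine (h.norm_entry_le_weight hV j k).trans_eq ?_
        rw [decay]
        ring

/-- For polynomial `φ` the trace is a polynomial in finitely many continuous entries; Weierstrass
approximation on an interval containing all eigenvalues gives the rest. This supplies the
measurability of the fluctuations. -/
theorem continuous_traceBox {X : Type*} [TopologicalSpace X] {V : X → ℤ → ℝ} {R : ℝ} {a φ : ℝ → ℝ}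
    {p : ℤ → Polynomial ℝ} {b : ℤ → ℝ}
    (h : PolyExpansion (2 + R) a p b) (ha : Continuous a) {m₁ m₂ : ℝ}
    (hI : ∀ x, |x| ≤ 2 + R → a x ∈ Set.Icc m₁ m₂) (hφ : ContinuousOn φ (Set.Icc m₁ m₂))
    (hV : ∀ x j, |V x j| ≤ R) (hc : ∀ j, Continuous fun x => V x j) (M : ℕ) :
    Continuous fun x => traceBox φ a (V x) M := by
  have hB : ∀ x, (restrict (cfc a (schrodinger (V x))) M).IsHermitian := fun x =>
    isHermitian_restrict (cfc_predicate a _) M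
  have hmem : ∀ x i, (hB x).eigenvalues i ∈ Set.Icc m₁ m₂ := fun x i =>
    eigenvalues_restrict_mem_Icc (isSelfAdjoint_schrodinger _) ha.continuousOn
      (fun y hy => hI y (abs_le_of_mem_spectrum (hV x) hy)) (hB x) i
  have hpoly : ∀ q : Polynomial ℝ, Continuous fun x => traceBox (fun y => q.eval y) a (V x) M := by
    intro q
    have hmat : Continuous fun x => restrict (cfc a (schrodinger (V x))) M :=
      continuous_matrix fun j k => h.continuous_entry hV hc j k
    have h1 : (fun x => traceBox (fun y => q.eval y) a (V x) M)
        = fun x => (Polynomial.aeval (restrict (cfc a (schrodinger (V x))) M) q).trace.re := by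
      funext x
      rw [traceBox, cfc_polynomial q _ (hB x).isSelfAdjoint]
    rw [h1]
    refine Complex.continuous_re.comp (Continuous.matrix_trace ?_)
    simp only [Polynomial.aeval_eq_sum_range]
    refine continuous_finsetSum _ fun i _ => ?_
    have h2 : Continuous fun x => restrict (cfc a (schrodinger (V x))) M ^ i := hmat.pow i
    exact h2.const_smul (q.coeff i)
  refine continuous_of_uniform_approx_of_continuous fun u hu => ?_
  obtain ⟨ε, hε, hεu⟩ := Metric.mem_uniformity_dist.1 hu
  have hcard : (0 : ℝ) < (Fintype.card (Finset.Icc (-M : ℤ) M) : ℝ) + 1 := by positivity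
  obtain ⟨q, hq⟩ := exists_polynomial_near_of_continuousOn m₁ m₂ φ hφ
    (ε / ((Fintype.card (Finset.Icc (-M : ℤ) M) : ℝ) + 1)) (by positivity)
  refine ⟨_, hpoly q, fun x => hεu ?_⟩
  rw [Real.dist_eq, traceBox, traceBox, trace_cfc_eq_sum (hB x), trace_cfc_eq_sum (hB x),
    Complex.re_sum, Complex.re_sum, ← Finset.sum_sub_distrib]
  simp only [Complex.ofReal_re]
  refine (Finset.abs_sum_le_sum_abs _ _).trans_lt ?_
  calc ∑ i, |φ ((hB x).eigenvalues i) - q.eval ((hB x).eigenvalues i)|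
      ≤ ∑ _i : Finset.Icc (-M : ℤ) M,
        ε / ((Fintype.card (Finset.Icc (-M : ℤ) M) : ℝ) + 1) := by
        refine Finset.sum_le_sum fun i _ => ?_
        rw [abs_sub_comm]
        exact (hq _ (hmem x i)).le
    _ = (Fintype.card (Finset.Icc (-M : ℤ) M) : ℝ)
          * (ε / ((Fintype.card (Finset.Icc (-M : ℤ) M) : ℝ) + 1)) := by
        rw [Finset.sum_const, nsmul_eq_mul, Finset.card_univ]
    _ < ε := by
        rw [mul_div_assoc', div_lt_iff₀ hcard]
        nlinarith

end

end Anderson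

namespace Anderson

noncomputable section

/-! ### Local functionals of an i.i.d. sequence -/

/-- Translation of a configuration. -/
def translate (m : ℤ) (v : ℤ → ℝ) : ℤ → ℝ := fun i => v (i + m)

theorem translate_translate (m n : ℤ) (v : ℤ → ℝ) :
    translate m (translate n v) = translate (m + n) v := by
  funext i
  rw [translate, translate, translate, add_assoc]

theorem translate_zero (v : ℤ → ℝ) : translate 0 v = v := by
  funext i
  rw [translate, add_zero]

theorem measurable_translate (m : ℤ) : Measurable (translate m) :=
  measurable_pi_lambda _ fun i => measurable_pi_apply (i + m)

theorem continuous_translate (m : ℤ) : Continuous (translate m) :=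
  continuous_pi fun i => continuous_apply (i + m)

/-- The law of an i.i.d. sequence indexed by `ℤ`. -/
def iidLaw (μ : Measure ℝ) : Measure (ℤ → ℝ) := Measure.infinitePi fun _ => μ

variable {μ : Measure ℝ} [IsProbabilityMeasure μ]

instance : IsProbabilityMeasure (iidLaw μ) :=
  inferInstanceAs (IsProbabilityMeasure (Measure.infinitePi fun _ : ℤ => μ))

theorem measurePreserving_translate (m : ℤ) :
    MeasurePreserving (translate m) (iidLaw μ) (iidLaw μ) :=
  ⟨measurable_translate m,
    Measure.map_infinitePi_infinitePi_of_inj (P := fun _ : ℤ => μ) (add_left_injective m)⟩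

theorem iIndepFun_coord : iIndepFun (fun (i : ℤ) (v : ℤ → ℝ) => v i) (iidLaw μ) :=
  iIndepFun_infinitePi (P := fun _ : ℤ => μ) (X := fun _ x => x) fun _ => measurable_id

/-- Setting a configuration to `0` outside a finite set. -/
def trunc (s : Finset ℤ) (v : ℤ → ℝ) : ℤ → ℝ := fun i => if i ∈ s then v i else 0

theorem trunc_of_mem {s : Finset ℤ} {i : ℤ} (h : i ∈ s) (v : ℤ → ℝ) : trunc s v i = v i := if_pos h

theorem measurable_trunc (s : Finset ℤ) : Measurable (trunc s) := by
  refine measurable_pi_lambda _ fun i => ?_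
  by_cases h : i ∈ s
  · simpa [trunc, h] using measurable_pi_apply i
  · simp [trunc, h]

theorem indepFun_trunc {s t : Finset ℤ} (hst : Disjoint s t) :
    IndepFun (trunc s) (trunc t) (iidLaw μ) := by
  have h := iIndepFun_coord (μ := μ).indepFun_finset s t hst fun i => measurable_pi_apply i
  have hm : ∀ s : Finset ℤ, Measurable fun (w : s → ℝ) (i : ℤ) => if h : i ∈ s then w ⟨i, h⟩ else 0 := by
    intro s
    refine measurable_pi_lambda _ fun i => ?_
    by_cases h : i ∈ s
    · simpa [h] using measurable_pi_apply _
    · simp [h]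
  have h2 := h.comp (hm s) (hm t)
  have he : ∀ s : Finset ℤ, trunc s = (fun (w : s → ℝ) (i : ℤ) => if h : i ∈ s then w ⟨i, h⟩ else 0)
      ∘ fun v i => v i := by
    intro s
    funext v i
    by_cases h : i ∈ s <;> simp [trunc, h]
  rw [he s, he t]
  exact h2

/-! ### Decay of covariances -/

theorem abs_covariance_le_of_abs_le {Ω : Type*} [MeasurableSpace Ω] {P : Measure Ω}
    [IsProbabilityMeasure P] {U W : Ω → ℝ} {a b : ℝ} (hU : ∀ ω, |U ω| ≤ a) (hW : ∀ ω, |W ω| ≤ b) :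
    |cov[U, W; P]| ≤ 4 * a * b := by
  have hm : ∀ {U : Ω → ℝ} {a : ℝ}, (∀ ω, |U ω| ≤ a) → ∀ ω, |U ω - P[U]| ≤ 2 * a := by
    intro U a hU ω
    have h1 : |P[U]| ≤ a := by
      have := norm_integral_le_of_norm_le_const (μ := P) (f := U) (C := a)
        (Eventually.of_forall fun ω => hU ω)
      simpa using this
    calc |U ω - P[U]| ≤ |U ω| + |P[U]| := abs_sub _ _
      _ ≤ 2 * a := by linarith [hU ω]
  have h := norm_integral_le_of_norm_le_const (μ := P)
    (f := fun ω => (U ω - P[U]) * (W ω - P[W])) (C := 4 * a * b) (Eventually.of_forall fun ω => by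
      rw [Real.norm_eq_abs, abs_mul]
      have h1 := hm hU ω
      have h2 := hm hW ω
      calc |U ω - P[U]| * |W ω - P[W]| ≤ (2 * a) * (2 * b) :=
            mul_le_mul h1 h2 (abs_nonneg _) ((abs_nonneg _).trans h1)
        _ = 4 * a * b := by ring)
  simpa [covariance] using h

/-- The decay profile `(n + 1)⁻²`. -/
def sqDecay (n : ℕ) : ℝ := 1 / ((n : ℝ) + 1) ^ 2

theorem sqDecay_pos (n : ℕ) : 0 < sqDecay n := by
  unfold sqDecay
  positivity

theorem summable_sqDecay : Summable sqDecay := by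
  have h := (summable_nat_add_iff 1).2 (Real.summable_one_div_nat_pow.2 (by norm_num : 1 < 2))
  change Summable fun n => sqDecay n
  simpa [sqDecay] using h

theorem summable_sqDecay_int : Summable fun d : ℤ => sqDecay d.natAbs := by
  refine Summable.of_nat_of_neg ?_ ?_ <;> simpa using summable_sqDecay

/-- A bounded functional which depends on the sites at distance more than `N` from `[0, p)` by at
most `A (N + 1)⁻²`. -/
structure BlockLocal (p : ℕ) (A : ℝ) (Y : (ℤ → ℝ) → ℝ) : Prop where
  measurable : Measurable Y
  abs_le : ∀ v, |Y v| ≤ A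
  abs_sub_le : ∀ (N : ℕ) (v w : ℤ → ℝ), (∀ i : ℤ, -(N : ℤ) ≤ i → i < p + N → v i = w i) →
    |Y v - Y w| ≤ A * sqDecay N

theorem memLp_of_abs_le {Ω : Type*} [MeasurableSpace Ω] {P : Measure Ω} [IsFiniteMeasure P]
    {Y : Ω → ℝ} (hm : Measurable Y) {A : ℝ} (hA : ∀ ω, |Y ω| ≤ A) : MemLp Y 2 P :=
  MemLp.of_bound hm.aestronglyMeasurable A (Eventually.of_forall hA)

namespace BlockLocal

variable {p : ℕ} {A : ℝ} {Y : (ℤ → ℝ) → ℝ}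

theorem nonneg (hY : BlockLocal p A Y) : 0 ≤ A := (abs_nonneg _).trans (hY.abs_le 0)

theorem measurable_translate (hY : BlockLocal p A Y) (m : ℤ) :
    Measurable fun v => Y (translate m v) := hY.measurable.comp (Anderson.measurable_translate m)

theorem memLp_translate (hY : BlockLocal p A Y) (m : ℤ) :
    MemLp (fun v => Y (translate m v)) 2 (iidLaw μ) :=
  memLp_of_abs_le (hY.measurable_translate m) fun _ => hY.abs_le _

/-- Cutting the configuration off outside disjoint windows around the two blocks makes the
functionals independent. The covariance is therefore only the cost of the two cuts. -/
theorem abs_covariance_le (hY : BlockLocal p A Y) (hp : 1 ≤ p) (i k : ℤ) :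
    |cov[fun v => Y (translate (i * p) v), fun v => Y (translate (k * p) v); iidLaw μ]|
      ≤ 72 * A ^ 2 * sqDecay (k - i).natAbs := by
  wlog hik : i ≤ k generalizing i k
  · rw [covariance_comm, ← Int.natAbs_neg, neg_sub]
    exact this k i (by omega)
  have hA := hY.nonneg
  -- Equal or adjacent blocks leave no room for a gap; the trivial bound is enough, as `sqDecay` is
  -- at least `1 / 4`.
  rcases lt_or_ge (k - i) 2 with hd | hd
  · refine (abs_covariance_le_of_abs_le (fun v => hY.abs_le _) fun v => hY.abs_le _).trans ?_
    have h1 : (1 : ℝ) / 4 ≤ sqDecay (k - i).natAbs := by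
      have h2 : ((k - i).natAbs : ℝ) ≤ 1 := by
        have : (k - i).natAbs ≤ 1 := by omega
        exact_mod_cast this
      rw [sqDecay]
      have : (((k - i).natAbs : ℝ) + 1) ^ 2 ≤ 2 ^ 2 := by gcongr; linarith
      exact one_div_le_one_div_of_le (by positivity) (by linarith)
    nlinarith [sq_nonneg A, mul_le_mul_of_nonneg_left h1 (sq_nonneg A)]
  obtain ⟨d, hd'⟩ : ∃ d : ℕ, k - i = d := ⟨(k - i).toNat, by omega⟩
  -- The gap between the blocks has length `(d - 1) p ≥ d - 1`, and half of it goes to each window.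
  obtain ⟨N, hN⟩ : ∃ N : ℕ, N = (d - 1) / 2 := ⟨_, rfl⟩
  have hprod : ((d : ℤ) - 1) ≤ (k - i - 1) * p := by
    rw [hd']
    have : (1 : ℤ) ≤ p := by exact_mod_cast hp
    nlinarith
  set s := Finset.Ico (i * p - N : ℤ) (i * p + p + N) with hs
  set t := Finset.Ico (k * p - N : ℤ) (k * p + p + N) with ht
  have hst : Disjoint s t := by
    rw [Finset.disjoint_left]
    intro x hx hx'
    rw [hs, Finset.mem_Ico] at hx
    rw [ht, Finset.mem_Ico] at hx'
    have : (k - i - 1) * p = k * p - i * p - p := by ring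
    omega
  have hclose : ∀ (l : ℤ) (v : ℤ → ℝ), |Y (translate (l * p) v) - Y (translate (l * p)
      (trunc (Finset.Ico (l * p - N : ℤ) (l * p + p + N)) v))| ≤ A * sqDecay N := by
    intro l v
    refine hY.abs_sub_le N _ _ fun j hj1 hj2 => ?_
    rw [translate, translate, trunc_of_mem]
    rw [Finset.mem_Ico]
    constructor <;> linarith
  set Yi := fun v => Y (translate (i * p) v) with hYi
  set Yk := fun v => Y (translate (k * p) v) with hYk
  set Yi' := fun v => Y (translate (i * p) (trunc s v)) with hYi'
  set Yk' := fun v => Y (translate (k * p) (trunc t v)) with hYk'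
  have mi : MemLp Yi 2 (iidLaw μ) := hY.memLp_translate _
  have mk : MemLp Yk 2 (iidLaw μ) := hY.memLp_translate _
  have mi' : MemLp Yi' 2 (iidLaw μ) :=
    memLp_of_abs_le ((hY.measurable_translate _).comp (measurable_trunc s)) fun _ => hY.abs_le _
  have mk' : MemLp Yk' 2 (iidLaw μ) :=
    memLp_of_abs_le ((hY.measurable_translate _).comp (measurable_trunc t)) fun _ => hY.abs_le _
  have hind : cov[Yi', Yk'; iidLaw μ] = 0 :=
    ((indepFun_trunc hst).comp (hY.measurable_translate (i * p))
      (hY.measurable_translate (k * p))).covariance_eq_zero mi' mk'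
  have h1 : cov[Yi, Yk; iidLaw μ] = cov[Yi - Yi', Yk; iidLaw μ] + cov[Yi', Yk - Yk'; iidLaw μ] := by
    rw [covariance_sub_left mi mi' mk, covariance_sub_right mi' mk mk', hind]
    ring
  rw [h1]
  have h2 : |cov[Yi - Yi', Yk; iidLaw μ]| ≤ 4 * (A * sqDecay N) * A :=
    abs_covariance_le_of_abs_le (fun v => hclose i v) fun v => hY.abs_le _
  have h3 : |cov[Yi', Yk - Yk'; iidLaw μ]| ≤ 4 * A * (A * sqDecay N) :=
    abs_covariance_le_of_abs_le (fun v => hY.abs_le _) fun v => hclose k v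
  -- From `d + 1 ≤ 3 (N + 1)`; together with the two cuts, of cost `4 A ^ 2` each, this makes the
  -- constant `72`.
  have h4 : sqDecay N ≤ 9 * sqDecay (k - i).natAbs := by
    have h5 : ((k - i).natAbs : ℝ) + 1 ≤ 3 * ((N : ℝ) + 1) := by
      have : (k - i).natAbs + 1 ≤ 3 * (N + 1) := by omega
      exact_mod_cast this
    rw [sqDecay, sqDecay, mul_one_div, div_le_div_iff₀ (by positivity) (by positivity)]
    nlinarith [Nat.cast_nonneg (α := ℝ) (k - i).natAbs]
  calc _ ≤ |cov[Yi - Yi', Yk; iidLaw μ]| + |cov[Yi', Yk - Yk'; iidLaw μ]| := abs_add_le _ _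
    _ ≤ 8 * A ^ 2 * sqDecay N := by linarith
    _ ≤ 8 * A ^ 2 * (9 * sqDecay (k - i).natAbs) := by gcongr
    _ = _ := by ring

/-- The rows of the covariance matrix are summable uniformly. The bound is linear in the number of
blocks and has no factor from their length, which is what makes long blocks efficient. -/
theorem variance_sum_le (hY : BlockLocal p A Y) (hp : 1 ≤ p) (n : ℕ) :
    Var[fun v => ∑ k ∈ Finset.range n, Y (translate (k * p) v); iidLaw μ]
      ≤ n * (72 * A ^ 2 * ∑' d : ℤ, sqDecay d.natAbs) := by
  rw [variance_fun_sum' (X := fun (k : ℕ) v => Y (translate (k * p) v))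
    fun k _ => hY.memLp_translate (μ := μ) (k * p)]
  have h1 : ∀ i ∈ Finset.range n, ∑ k ∈ Finset.range n,
      cov[fun v => Y (translate (i * p) v), fun v => Y (translate (k * p) v); iidLaw μ]
      ≤ 72 * A ^ 2 * ∑' d : ℤ, sqDecay d.natAbs := by
    intro i _
    have h2 : HasSum (fun k : ℤ => sqDecay (k - i).natAbs) (∑' d : ℤ, sqDecay d.natAbs) :=
      (Equiv.hasSum_iff (f := fun d : ℤ => sqDecay d.natAbs) (Equiv.subRight (i : ℤ))).2
        summable_sqDecay_int.hasSum
    calc ∑ k ∈ Finset.range n,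
        cov[fun v => Y (translate (i * p) v), fun v => Y (translate (k * p) v); iidLaw μ]
        ≤ ∑ k ∈ Finset.range n, 72 * A ^ 2 * sqDecay ((k : ℤ) - i).natAbs :=
          Finset.sum_le_sum fun k _ => (le_abs_self _).trans (hY.abs_covariance_le hp i k)
      _ = 72 * A ^ 2 * ∑ k ∈ Finset.range n, sqDecay ((k : ℤ) - i).natAbs := by
          rw [Finset.mul_sum]
      _ ≤ _ := by
          gcongr
          have h3 := sum_le_hasSum ((Finset.range n).map Nat.castEmbedding)
            (fun k _ => (sqDecay_pos _).le) h2
          simpa using h3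
  refine (Finset.sum_le_card_nsmul _ _ _ h1).trans ?_
  rw [Finset.card_range, nsmul_eq_mul]

theorem covariance_translate (hY : BlockLocal p A Y) (i k : ℤ) :
    cov[fun v => Y (translate i v), fun v => Y (translate k v); iidLaw μ]
      = cov[Y, fun v => Y (translate (k - i) v); iidLaw μ] := by
  have h := measurePreserving_translate (μ := μ) i
  conv_rhs => rw [← h.map_eq]
  rw [covariance_map hY.measurable.aestronglyMeasurable
    (hY.measurable_translate _).aestronglyMeasurable h.measurable.aemeasurable]
  congr 1
  funext v
  simp [Function.comp, translate_translate]

end BlockLocal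

end

end Anderson

namespace Anderson

noncomputable section

variable {μ : Measure ℝ} [IsProbabilityMeasure μ]

/-! ### Asymptotic variance -/

theorem covariance_sq_le {Ω : Type*} [MeasurableSpace Ω] {P : Measure Ω} [IsProbabilityMeasure P]
    {X Y : Ω → ℝ} (hX : MemLp X 2 P) (hY : MemLp Y 2 P) :
    cov[X, Y; P] ^ 2 ≤ Var[X; P] * Var[Y; P] := by
  have h : ∀ x : ℝ, 0 ≤ Var[X; P] * (x * x) + (2 * cov[X, Y; P]) * x + Var[Y; P] := by
    intro x
    have h1 : Var[(x • X) + Y; P] = _ := variance_add (hX.const_smul x) hY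
    rw [covariance_smul_left, variance_smul] at h1
    have h2 := variance_nonneg ((x • X) + Y) P
    nlinarith
  have := discrim_le_zero h
  rw [discrim] at this
  nlinarith

/-! ### Variance of partial sums of a stationary sequence -/

/-- The number of `i < n` with `i + l ∈ [0, n)`. -/
def overlap (n : ℕ) (l : ℤ) : ℕ := ((Finset.range n).filter fun i : ℕ => 0 ≤ l + i ∧ l + i < n).card

theorem overlap_le (n : ℕ) (l : ℤ) : overlap n l ≤ n := by
  refine (Finset.card_filter_le _ _).trans ?_
  rw [Finset.card_range]

theorem le_overlap_add (n : ℕ) (l : ℤ) : n ≤ overlap n l + l.natAbs := by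
  -- The indices pushed out lie at the upper end for `l ≥ 0` and at the lower end for `l < 0`.
  have h1 : (Finset.range n).filter (fun i : ℕ => ¬(0 ≤ l + i ∧ l + i < n))
      ⊆ (Finset.range l.natAbs).image fun i => if 0 ≤ l then n - 1 - i else i := by
    intro i hi
    rw [Finset.mem_filter, Finset.mem_range] at hi
    rw [Finset.mem_image]
    by_cases hl : 0 ≤ l
    · refine ⟨n - 1 - i, ?_, ?_⟩
      · rw [Finset.mem_range]; omega
      · rw [if_pos hl]; omega
    · refine ⟨i, ?_, ?_⟩
      · rw [Finset.mem_range]; omega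
      · rw [if_neg hl]
  have h2 := Finset.card_filter_add_card_filter_not (s := Finset.range n)
    (fun i : ℕ => 0 ≤ l + i ∧ l + i < n)
  rw [Finset.card_range] at h2
  have h3 := (Finset.card_le_card h1).trans Finset.card_image_le
  rw [Finset.card_range] at h3
  rw [overlap]
  omega

theorem sum_sum_sub_eq_tsum (c : ℤ → ℝ) (n : ℕ) :
    ∑ i ∈ Finset.range n, ∑ k ∈ Finset.range n, c ((k : ℤ) - i)
      = ∑' l : ℤ, (overlap n l : ℝ) * c l := by
  have h1 : ∀ i : ℕ, HasSum (fun l : ℤ => if 0 ≤ l + i ∧ l + i < n then c l else 0)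
      (∑ k ∈ Finset.range n, c ((k : ℤ) - i)) := by
    intro i
    rw [← (Equiv.subRight (i : ℤ)).hasSum_iff]
    have h2 : ((fun l : ℤ => if 0 ≤ l + i ∧ l + i < n then c l else 0) ∘ (Equiv.subRight (i : ℤ)))
        = fun k : ℤ => if 0 ≤ k ∧ k < n then c (k - i) else 0 := by
      funext k
      simp
    rw [h2]
    have h3 := hasSum_sum_of_ne_finset_zero (L := .unconditional ℤ)
      (f := fun k : ℤ => if 0 ≤ k ∧ k < n then c (k - i) else 0)
      (s := (Finset.range n).map Nat.castEmbedding) (fun k hk => by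
        rw [if_neg]
        rintro ⟨hk1, hk2⟩
        apply hk
        rw [Finset.mem_map]
        exact ⟨k.toNat, by rw [Finset.mem_range]; omega, by simp; omega⟩)
    rw [Finset.sum_map] at h3
    convert h3 using 1
    refine Finset.sum_congr rfl fun k hk => ?_
    have := Finset.mem_range.1 hk
    simp [this]
  have h4 := hasSum_sum (s := Finset.range n) fun i _ => h1 i
  rw [← h4.tsum_eq]
  refine tsum_congr fun l => ?_
  rw [Finset.sum_ite, Finset.sum_const_zero, add_zero, Finset.sum_const, nsmul_eq_mul, overlap]

theorem tendsto_overlap_div (l : ℤ) :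
    Tendsto (fun n : ℕ => (overlap n l : ℝ) / n) atTop (𝓝 1) := by
  have h1 : Tendsto (fun n : ℕ => 1 - (l.natAbs : ℝ) / n) atTop (𝓝 1) := by
    simpa using tendsto_const_nhds.sub (tendsto_const_div_atTop_nhds_zero_nat (l.natAbs : ℝ))
  refine tendsto_of_tendsto_of_tendsto_of_le_of_le' h1 tendsto_const_nhds ?_ ?_
  · filter_upwards [eventually_gt_atTop 0] with n hn
    have hn' : (0 : ℝ) < n := by exact_mod_cast hn
    have h2 : (n : ℝ) ≤ overlap n l + l.natAbs := by exact_mod_cast le_overlap_add n l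
    rw [le_div_iff₀ hn', sub_mul, div_mul_cancel₀ _ hn'.ne']
    linarith
  · filter_upwards with n
    exact div_le_one_of_le₀ (by exact_mod_cast overlap_le n l) (by positivity)

namespace BlockLocal

variable {A : ℝ} {g : (ℤ → ℝ) → ℝ}

theorem summable_covariance (hg : BlockLocal 1 A g) :
    Summable fun l : ℤ => cov[g, fun v => g (translate l v); iidLaw μ] := by
  refine Summable.of_norm_bounded (summable_sqDecay_int.mul_left (72 * A ^ 2)) fun l => ?_
  have h := hg.abs_covariance_le (μ := μ) le_rfl 0 l
  simpa [translate_zero] using h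

theorem variance_sum_eq (hg : BlockLocal 1 A g) (n : ℕ) :
    Var[fun v => ∑ j ∈ Finset.range n, g (translate j v); iidLaw μ]
      = ∑' l : ℤ, (overlap n l : ℝ) * cov[g, fun v => g (translate l v); iidLaw μ] := by
  rw [variance_fun_sum' (X := fun (k : ℕ) v => g (translate k v))
    fun k _ => hg.memLp_translate (μ := μ) k, ← sum_sum_sub_eq_tsum]
  simp only [hg.covariance_translate]

/-- Grouping pairs of sites by their difference `l` leaves the covariance at lag `l` with a weight
that tends to `1` and is at most `1`; the covariances themselves are the dominating series. -/
theorem tendsto_variance_div (hg : BlockLocal 1 A g) :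
    Tendsto (fun n : ℕ => Var[fun v => ∑ j ∈ Finset.range n, g (translate j v); iidLaw μ] / n)
      atTop (𝓝 (∑' l : ℤ, cov[g, fun v => g (translate l v); iidLaw μ])) := by
  simp only [hg.variance_sum_eq, ← tsum_div_const]
  refine tendsto_tsum_of_dominated_convergence (bound := fun l : ℤ =>
    |cov[g, fun v => g (translate l v); iidLaw μ]|) hg.summable_covariance.abs (fun l => ?_) ?_
  · have h := (tendsto_overlap_div l).mul_const (cov[g, fun v => g (translate l v); iidLaw μ])
    rw [one_mul] at h
    refine h.congr fun n => ?_
    ring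
  · filter_upwards with n l
    rw [mul_div_right_comm, norm_mul]
    refine mul_le_of_le_one_left (norm_nonneg _) ?_
    rw [Real.norm_of_nonneg (by positivity)]
    exact div_le_one_of_le₀ (by exact_mod_cast overlap_le n l) (by positivity)

theorem tsum_covariance_nonneg (hg : BlockLocal 1 A g) :
    0 ≤ ∑' l : ℤ, cov[g, fun v => g (translate l v); iidLaw μ] :=
  ge_of_tendsto' hg.tendsto_variance_div fun n => div_nonneg (variance_nonneg _ _) (by positivity)

end BlockLocal

/-! ### Block sums -/

/-- A bounded functional which depends on the sites at distance more than `N` from `0` by at most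
`K (N + 1)⁻⁴`. -/
structure SiteLocal (K : ℝ) (g : (ℤ → ℝ) → ℝ) : Prop where
  measurable : Measurable g
  abs_le : ∀ v, |g v| ≤ K
  abs_sub_le : ∀ (N : ℕ) (v w : ℤ → ℝ), (∀ i : ℤ, |i| ≤ N → v i = w i) →
    |g v - g w| ≤ K * decay N

/-- The sum of the translates of `g` over the block `[0, p)`. -/
def blockSum (g : (ℤ → ℝ) → ℝ) (p : ℕ) (v : ℤ → ℝ) : ℝ := ∑ j ∈ Finset.range p, g (translate j v)

/-- The block sum of the configuration cut off outside the block. -/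
def cutBlockSum (g : (ℤ → ℝ) → ℝ) (p : ℕ) (v : ℤ → ℝ) : ℝ :=
  blockSum g p (trunc (Finset.Ico 0 (p : ℤ)) v)

/-- The reason for the fourth power in `SiteLocal`: it splits into a square for the distance from a
block and a summable square for the depth inside it. -/
theorem decay_add_le (N m : ℕ) : decay ((N + m : ℕ) : ℤ) ≤ sqDecay N * sqDecay m := by
  rw [decay, sqDecay, sqDecay, one_div_mul_one_div, Int.natAbs_natCast]
  refine one_div_le_one_div_of_le (by positivity) ?_
  have hN : (0 : ℝ) ≤ N := Nat.cast_nonneg N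
  have hm : (0 : ℝ) ≤ m := Nat.cast_nonneg m
  push_cast
  calc ((N : ℝ) + 1) ^ 2 * ((m : ℝ) + 1) ^ 2
      ≤ ((N : ℝ) + m + 1) ^ 2 * ((N : ℝ) + m + 1) ^ 2 := by gcongr <;> linarith
    _ = ((N : ℝ) + m + 1) ^ 4 := by ring

namespace SiteLocal

variable {K : ℝ} {g : (ℤ → ℝ) → ℝ}

theorem nonneg (hg : SiteLocal K g) : 0 ≤ K := (abs_nonneg _).trans (hg.abs_le 0)

theorem blockLocal (hg : SiteLocal K g) : BlockLocal 1 K g where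
  measurable := hg.measurable
  abs_le := hg.abs_le
  abs_sub_le N v w h := by
    refine (hg.abs_sub_le N v w fun i hi => ?_).trans ?_
    · rw [_root_.abs_le] at hi
      exact h i hi.1 (by push_cast; omega)
    · have h1 := decay_add_le N 0
      have h2 : sqDecay 0 = 1 := by norm_num [sqDecay]
      rw [h2, mul_one, add_zero] at h1
      exact mul_le_mul_of_nonneg_left h1 hg.nonneg

theorem measurable_blockSum (hg : SiteLocal K g) (p : ℕ) : Measurable (blockSum g p) :=
  Finset.measurable_fun_sum _ fun j _ => hg.measurable.comp (measurable_translate j)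

theorem measurable_cutBlockSum (hg : SiteLocal K g) (p : ℕ) : Measurable (cutBlockSum g p) :=
  (hg.measurable_blockSum p).comp (measurable_trunc _)

theorem abs_blockSum_le (hg : SiteLocal K g) (p : ℕ) (v : ℤ → ℝ) : |blockSum g p v| ≤ p * K := by
  refine (Finset.abs_sum_le_sum_abs _ _).trans ?_
  refine (Finset.sum_le_card_nsmul _ _ K fun j _ => hg.abs_le _).trans ?_
  rw [Finset.card_range, nsmul_eq_mul]

/-- A site deep inside the block hardly feels the outside, so only sites near the two ends
contribute. The sum over depths converges, with a bound that does not depend on `p`. -/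
theorem abs_blockSum_sub_le (hg : SiteLocal K g) (p N : ℕ) {v w : ℤ → ℝ}
    (h : ∀ i : ℤ, -(N : ℤ) ≤ i → i < p + N → v i = w i) :
    |blockSum g p v - blockSum g p w| ≤ 2 * K * (∑' n, sqDecay n) * sqDecay N := by
  have hK := hg.nonneg
  rw [blockSum, blockSum, ← Finset.sum_sub_distrib]
  refine (Finset.abs_sum_le_sum_abs _ _).trans ?_
  have h1 : ∀ j ∈ Finset.range p, |g (translate j v) - g (translate j w)|
      ≤ K * sqDecay N * (sqDecay j + sqDecay (p - 1 - j)) := by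
    intro j hj
    have hj' := Finset.mem_range.1 hj
    -- The position `j` lies at depth `min j (p - 1 - j)`, to which the distance `N` outside the
    -- block is added.
    refine (hg.abs_sub_le (N + min j (p - 1 - j)) _ _ fun i hi => ?_).trans ?_
    · rw [_root_.abs_le] at hi
      exact h _ (by omega) (by omega)
    · have h2 := decay_add_le N (min j (p - 1 - j))
      have h3 : sqDecay (min j (p - 1 - j)) ≤ sqDecay j + sqDecay (p - 1 - j) := by
        rcases min_choice j (p - 1 - j) with h | h <;> rw [h]
        · linarith [sqDecay_pos (p - 1 - j)]
        · linarith [sqDecay_pos j]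
      have h4 := sqDecay_pos N
      calc K * decay ((N + min j (p - 1 - j) : ℕ) : ℤ)
          ≤ K * (sqDecay N * sqDecay (min j (p - 1 - j))) := by gcongr
        _ ≤ K * (sqDecay N * (sqDecay j + sqDecay (p - 1 - j))) := by gcongr
        _ = _ := by ring
  refine (Finset.sum_le_sum h1).trans ?_
  rw [← Finset.mul_sum, Finset.sum_add_distrib, Finset.sum_range_reflect sqDecay p]
  have h5 : ∑ j ∈ Finset.range p, sqDecay j ≤ ∑' n, sqDecay n :=
    summable_sqDecay.sum_le_tsum _ fun n _ => (sqDecay_pos n).le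
  have h4 := sqDecay_pos N
  calc K * sqDecay N * (∑ j ∈ Finset.range p, sqDecay j + ∑ j ∈ Finset.range p, sqDecay j)
      ≤ K * sqDecay N * (∑' n, sqDecay n + ∑' n, sqDecay n) := by gcongr
    _ = _ := by ring

/-- Cutting off the configuration is a boundary effect: the constant is uniform in the block length.
-/
theorem blockLocal_sub_cut (hg : SiteLocal K g) (p : ℕ) :
    BlockLocal p (4 * K * ∑' n, sqDecay n) (fun v => blockSum g p v - cutBlockSum g p v) where
  measurable := (hg.measurable_blockSum p).sub (hg.measurable_cutBlockSum p)
  abs_le v := by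
    have h2 : sqDecay 0 = 1 := by norm_num [sqDecay]
    have hQ : 0 ≤ ∑' n, sqDecay n := tsum_nonneg fun n => (sqDecay_pos n).le
    have hK := hg.nonneg
    refine (hg.abs_blockSum_sub_le p 0 fun i h1 h2 => ?_).trans ?_
    · rw [trunc_of_mem]
      rw [Finset.mem_Ico]
      constructor <;> simp_all
    · rw [h2]
      nlinarith [mul_nonneg hK hQ]
  abs_sub_le N v w h := by
    have h1 := hg.abs_blockSum_sub_le p N h
    have h2 := hg.abs_blockSum_sub_le p N (v := trunc (Finset.Ico 0 (p : ℤ)) v)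
      (w := trunc (Finset.Ico 0 (p : ℤ)) w) fun i hi1 hi2 => by
        rw [trunc, trunc, h i hi1 hi2]
    rw [cutBlockSum, cutBlockSum]
    rw [_root_.abs_le] at h1 h2 ⊢
    constructor <;> linarith [h1.1, h1.2, h2.1, h2.2]

theorem sum_blockSum (p n : ℕ) (v : ℤ → ℝ) :
    ∑ k ∈ Finset.range n, blockSum g p (translate (k * p) v)
      = ∑ j ∈ Finset.range (n * p), g (translate j v) := by
  induction n with
  | zero => simp
  | succ n ih =>
    rw [Finset.sum_range_succ, ih, Nat.succ_mul, Finset.sum_range_add]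
    congr 1
    refine Finset.sum_congr rfl fun j _ => ?_
    rw [translate_translate]
    congr 2
    push_cast
    ring

/-- The cut changes the block sum by a bounded amount. By Cauchy–Schwarz the covariance with that
change is of order `√p`, which disappears after division by `p`. -/
theorem tendsto_variance_cutBlockSum_div (hg : SiteLocal K g) :
    Tendsto (fun p : ℕ => Var[cutBlockSum g p; iidLaw μ] / p) atTop
      (𝓝 (∑' l : ℤ, cov[g, fun v => g (translate l v); iidLaw μ])) := by
  set A := 4 * K * ∑' n, sqDecay n with hA
  have mG : ∀ p, MemLp (blockSum g p) 2 (iidLaw μ) := fun p =>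
    memLp_of_abs_le (hg.measurable_blockSum p) (hg.abs_blockSum_le p)
  have mY : ∀ p, MemLp (fun v => blockSum g p v - cutBlockSum g p v) 2 (iidLaw μ) := fun p =>
    memLp_of_abs_le (hg.blockLocal_sub_cut p).measurable (hg.blockLocal_sub_cut p).abs_le
  have h1 := hg.blockLocal.tendsto_variance_div (μ := μ)
  have hvY : ∀ p, Var[fun v => blockSum g p v - cutBlockSum g p v; iidLaw μ] ≤ 4 * A * A := by
    intro p
    rw [← covariance_self (hg.blockLocal_sub_cut p).measurable.aemeasurable]
    exact (le_abs_self _).trans (abs_covariance_le_of_abs_le (hg.blockLocal_sub_cut p).abs_le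
      (hg.blockLocal_sub_cut p).abs_le)
  have hYp : Tendsto (fun p : ℕ => Var[fun v => blockSum g p v - cutBlockSum g p v; iidLaw μ] / p)
      atTop (𝓝 0) := by
    refine squeeze_zero (fun p => div_nonneg (variance_nonneg _ _) (by positivity)) (fun p => ?_)
      (tendsto_const_div_atTop_nhds_zero_nat (4 * A * A))
    gcongr
    exact hvY p
  have hcov : Tendsto (fun p : ℕ => cov[blockSum g p, fun v => blockSum g p v - cutBlockSum g p v;
      iidLaw μ] / p) atTop (𝓝 0) := by
    have h2 := (h1.mul hYp).sqrt
    rw [mul_zero, Real.sqrt_zero] at h2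
    refine squeeze_zero_norm (fun p => ?_) h2
    refine Real.le_sqrt_of_sq_le ?_
    rw [Real.norm_eq_abs, sq_abs, div_pow, div_mul_div_comm, ← sq]
    gcongr
    exact covariance_sq_le (mG p) (mY p)
  have h3 := (h1.sub (hcov.const_mul 2)).add hYp
  rw [mul_zero, sub_zero, add_zero] at h3
  refine h3.congr fun p => ?_
  have h4 : cutBlockSum g p = fun v => blockSum g p v - (blockSum g p v - cutBlockSum g p v) := by
    funext v
    ring
  conv_rhs => rw [h4]
  rw [variance_fun_sub (mG p) (mY p)]
  have h5 : Var[fun v => ∑ j ∈ Finset.range p, g (translate j v); iidLaw μ]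
      = Var[blockSum g p; iidLaw μ] := rfl
  rw [h5]
  ring

end SiteLocal

end

end Anderson

namespace Anderson

noncomputable section

/-! ### The central limit theorem for local functionals -/

variable {μ : Measure ℝ} [IsProbabilityMeasure μ]

/-- The values of a configuration in the `k`-th block of length `p`. -/
def block (p k : ℕ) (v : ℤ → ℝ) : Fin p → ℝ := fun j => v (k * p + j : ℤ)

theorem measurable_block (p k : ℕ) : Measurable (block p k) :=
  measurable_pi_lambda _ fun _ => measurable_pi_apply _

theorem block_index_injective (p : ℕ) :
    Function.Injective fun q : ℕ × Fin p => ((q.1 * p + q.2 : ℕ) : ℤ) := by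
  rintro ⟨k, j⟩ ⟨k', j'⟩ h
  have h1 : k * p + (j : ℕ) = k' * p + (j' : ℕ) := Int.ofNat_inj.1 h
  have hp : 0 < p := j.pos
  have h2 : k = k' := by
    have h3 := congrArg (· / p) h1
    simp only [add_comm _ (_ : ℕ), Nat.add_mul_div_right _ _ hp, Nat.div_eq_of_lt j.isLt,
      Nat.div_eq_of_lt j'.isLt] at h3
    exact h3
  subst h2
  have h3 : (j : ℕ) = j' := by omega
  rw [Fin.ext h3]

/-- The map `(k, j) ↦ k p + j` is injective, so it pulls the product law back to a product law on
pairs; currying groups the pairs into independent blocks. -/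
theorem iIndepFun_block (p : ℕ) : iIndepFun (block p) (iidLaw μ) := by
  rw [iIndepFun_iff_map_fun_eq_infinitePi_map (measurable_block p)]
  have h1 : (fun (v : ℤ → ℝ) k => block p k v) = (MeasurableEquiv.curry ℕ (Fin p) ℝ) ∘
      fun v (q : ℕ × Fin p) => v ((q.1 * p + q.2 : ℕ) : ℤ) := by
    funext v k j
    simp [block, MeasurableEquiv.curry]
  have h2 : ∀ k, (iidLaw μ).map (block p k) = Measure.infinitePi fun _ : Fin p => μ := by
    intro k
    refine Measure.map_infinitePi_infinitePi_of_inj (P := fun _ : ℤ => μ)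
      (f := fun j : Fin p => (k * p + j : ℤ)) ?_
    intro j j' h
    exact Fin.ext (by simpa using h)
  have h3 : Measurable fun (v : ℤ → ℝ) (q : ℕ × Fin p) => v ((q.1 * p + q.2 : ℕ) : ℤ) :=
    measurable_pi_lambda _ fun _ => measurable_pi_apply _
  rw [h1, ← Measure.map_map (MeasurableEquiv.measurable _) h3, iidLaw,
    Measure.map_infinitePi_infinitePi_of_inj (P := fun _ : ℤ => μ) (block_index_injective p),
    Measure.infinitePi_map_curry (fun _ _ => μ)]
  congr 1
  funext k
  exact (h2 k).symm

theorem exists_cutBlockSum_eq_comp_block {K : ℝ} {g : (ℤ → ℝ) → ℝ} (hg : SiteLocal K g) (p : ℕ) :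
    ∃ F : (Fin p → ℝ) → ℝ, Measurable F ∧
      ∀ (k : ℕ) (v : ℤ → ℝ), cutBlockSum g p (translate (k * p) v) = F (block p k v) := by
  refine ⟨fun b => blockSum g p fun i => if h : 0 ≤ i ∧ i < p then b ⟨i.toNat, by omega⟩ else 0,
    (hg.measurable_blockSum p).comp ?_, fun k v => ?_⟩
  · refine measurable_pi_lambda _ fun i => ?_
    by_cases h : 0 ≤ i ∧ i < p
    · simpa only [h, dif_pos, and_self] using measurable_pi_apply _
    · simp [h]
  · rw [cutBlockSum]
    congr 1
    funext i
    by_cases h : 0 ≤ i ∧ i < p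
    · simp only [trunc, Finset.mem_Ico, h, and_self, if_true, dif_pos, block, translate]
      congr 1
      have := Int.toNat_of_nonneg h.1
      omega
    · simp [trunc, h]

theorem iIndepFun_cutBlockSum {K : ℝ} {g : (ℤ → ℝ) → ℝ} (hg : SiteLocal K g) (p : ℕ) :
    iIndepFun (fun (k : ℕ) v => cutBlockSum g p (translate (k * p) v)) (iidLaw μ) := by
  obtain ⟨F, hF, h⟩ := exists_cutBlockSum_eq_comp_block hg p
  have h1 := (iIndepFun_block (μ := μ) p).comp (fun _ => F) fun _ => hF
  convert h1 using 2 with k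
  funext v
  exact h k v

/-! ### Bernstein blocks and characteristic functions -/

theorem norm_integral_cexp_sub_le {Ω : Type*} [MeasurableSpace Ω] {P : Measure Ω}
    [IsProbabilityMeasure P] {X Y : Ω → ℝ} (hX : AEMeasurable X P) (hY : AEMeasurable Y P)
    (hXY : Integrable (fun ω => X ω - Y ω) P) (t : ℝ) :
    ‖∫ ω, Complex.exp (t * X ω * Complex.I) ∂P - ∫ ω, Complex.exp (t * Y ω * Complex.I) ∂P‖
      ≤ |t| * ∫ ω, |X ω - Y ω| ∂P := by
  have hi : ∀ {X : Ω → ℝ}, AEMeasurable X P →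
      Integrable (fun ω => Complex.exp (t * X ω * Complex.I)) P := by
    intro X hX
    refine Integrable.of_bound (C := 1) ?_ (Eventually.of_forall fun ω => ?_)
    · exact (Complex.measurable_exp.comp_aemeasurable
        (((Complex.measurable_ofReal.comp_aemeasurable hX).const_mul _).mul_const _)).aestronglyMeasurable
    · rw [← Complex.ofReal_mul, Complex.norm_exp_ofReal_mul_I]
  rw [← integral_sub (hi hX) (hi hY), ← integral_const_mul]
  refine norm_integral_le_of_norm_le (hXY.abs.const_mul _) (Eventually.of_forall fun ω => ?_)
  have h1 : Complex.exp (t * X ω * Complex.I) - Complex.exp (t * Y ω * Complex.I)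
      = Complex.exp ((t * Y ω : ℝ) * Complex.I)
        * (Complex.exp (Complex.I * (t * (X ω - Y ω) : ℝ)) - 1) := by
    rw [mul_sub, ← Complex.exp_add, mul_one]
    push_cast
    ring_nf
  rw [h1, norm_mul, Complex.norm_exp_ofReal_mul_I, one_mul, ← abs_mul]
  exact Real.norm_exp_I_mul_ofReal_sub_one_le

theorem integral_abs_sub_mean_le {Ω : Type*} [MeasurableSpace Ω] {P : Measure Ω}
    [IsProbabilityMeasure P] {X : Ω → ℝ} (hX : MemLp X 2 P) :
    ∫ ω, |X ω - P[X]| ∂P ≤ √(Var[X; P]) := by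
  refine Real.le_sqrt_of_sq_le ?_
  have h1 : MemLp (fun ω => |X ω - P[X]|) 2 P := (hX.sub (memLp_const _)).abs
  have h2 := variance_nonneg (fun ω => |X ω - P[X]|) P
  rw [variance_eq_sub h1] at h2
  rw [variance_eq_integral hX.aestronglyMeasurable.aemeasurable]
  simpa using h2

namespace SiteLocal

variable {K : ℝ} {g : (ℤ → ℝ) → ℝ}

/-- The normalized centered sum `n^{-1/2} ∑_{j < n} (g ∘ translate j - ∫ g)`. -/
def _root_.Anderson.normSum (μ : Measure ℝ) (g : (ℤ → ℝ) → ℝ) (n : ℕ) (v : ℤ → ℝ) : ℝ :=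
  (√n)⁻¹ * (∑ j ∈ Finset.range n, g (translate j v) - n * ∫ w, g w ∂(iidLaw μ))

/-- The normalized centered sum of the independent block sums. -/
def _root_.Anderson.normCutSum (μ : Measure ℝ) (g : (ℤ → ℝ) → ℝ) (p n : ℕ) (v : ℤ → ℝ) : ℝ :=
  (√n)⁻¹ * (∑ k ∈ Finset.range (n / p), cutBlockSum g p (translate (k * p) v)
    - (n / p : ℕ) * ∫ w, cutBlockSum g p w ∂(iidLaw μ))

theorem measurable_normSum {μ : Measure ℝ} (hg : SiteLocal K g) (n : ℕ) : Measurable (normSum μ g n) :=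
  ((Finset.measurable_fun_sum (Finset.range n) fun (j : ℕ) _ =>
    hg.measurable.comp (measurable_translate (j : ℤ))).sub_const _).const_mul _

theorem measurable_normCutSum {μ : Measure ℝ} (hg : SiteLocal K g) (p n : ℕ) : Measurable (normCutSum μ g p n) :=
  ((Finset.measurable_fun_sum _ fun _ _ =>
    (hg.measurable_cutBlockSum p).comp (measurable_translate _)).sub_const _).const_mul _

theorem integral_translate (f : (ℤ → ℝ) → ℝ) (hf : Measurable f) (m : ℤ) :
    ∫ v, f (translate m v) ∂(iidLaw μ) = ∫ v, f v ∂(iidLaw μ) := by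
  conv_rhs => rw [← (measurePreserving_translate (μ := μ) m).map_eq]
  rw [integral_map (measurable_translate m).aemeasurable hf.aestronglyMeasurable]

theorem abs_cutBlockSum_le (hg : SiteLocal K g) (p : ℕ) (v : ℤ → ℝ) :
    |cutBlockSum g p v| ≤ p * K := hg.abs_blockSum_le p _

/-- The classical theorem for i.i.d. variables, applied to the cut block sums along the number of
blocks, followed by Slutsky's lemma for the change of normalization. -/
theorem tendstoInDistribution_normCutSum (hg : SiteLocal K g) {p : ℕ} (hp : 1 ≤ p) :
    TendstoInDistribution (normCutSum μ g p) atTop (fun x : ℝ => x * (√p)⁻¹) (fun _ => iidLaw μ)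
      (gaussianReal 0 Var[cutBlockSum g p; iidLaw μ].toNNReal) := by
  set X : ℕ → (ℤ → ℝ) → ℝ := fun k v => cutBlockSum g p (translate (k * p) v) with hX
  have hX0 : X 0 = cutBlockSum g p := by
    funext v
    simp [hX, translate_zero]
  have hm : ∀ k, Measurable (X k) := fun k =>
    (hg.measurable_cutBlockSum p).comp (measurable_translate _)
  have hid : ∀ i, IdentDistrib (X i) (X 0) (iidLaw μ) (iidLaw μ) := by
    intro i
    refine ⟨(hm i).aemeasurable, (hm 0).aemeasurable, ?_⟩
    rw [hX0]
    conv_rhs => rw [← (measurePreserving_translate (μ := μ) (i * p)).map_eq]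
    rw [Measure.map_map (hg.measurable_cutBlockSum p) (measurable_translate _)]
    rfl
  have hclt := tendstoInDistribution_inv_sqrt_mul_sum_sub (P := iidLaw μ) (X := X)
    (P' := gaussianReal 0 Var[X 0; iidLaw μ].toNNReal) (Y := id)
    ⟨aemeasurable_id, Measure.map_id⟩
    (memLp_of_abs_le (hm 0) fun v => hg.abs_cutBlockSum_le p _) (iIndepFun_cutBlockSum hg p) hid
  have hdiv : Tendsto (fun n : ℕ => n / p) atTop atTop := Nat.tendsto_div_const_atTop (by omega)
  have h1 : TendstoInDistribution
      (fun (n : ℕ) v => (√((n / p : ℕ) : ℝ))⁻¹ *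
        (∑ k ∈ Finset.range (n / p), X k v - (n / p : ℕ) * ∫ w, X 0 w ∂(iidLaw μ))) atTop
      id (fun _ => iidLaw μ) (gaussianReal 0 Var[X 0; iidLaw μ].toNNReal) :=
    ⟨fun n => hclt.forall_aemeasurable (n / p), hclt.aemeasurable_limit, hclt.tendsto.comp hdiv⟩
  -- The classical normalization uses the number of blocks, here it is the number of sites; the
  -- ratio of the two tends to `(√p)⁻¹`.
  have hc : Tendsto (fun n : ℕ => √((n / p : ℕ) : ℝ) * (√(n : ℝ))⁻¹) atTop (𝓝 (√p)⁻¹) := by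
    have h2 : Tendsto (fun n : ℕ => ((n / p : ℕ) : ℝ) / n) atTop (𝓝 ((p : ℝ)⁻¹)) := by
      have h3 := (tendsto_nat_floor_mul_div_atTop (R := ℝ) (a := (p : ℝ)⁻¹) (by positivity)).comp
        tendsto_natCast_atTop_atTop
      refine h3.congr fun n => ?_
      simp only [Function.comp]
      congr 2
      rw [mul_comm, ← div_eq_mul_inv, Nat.floor_div_eq_div]
    have h4 := h2.sqrt
    rw [Real.sqrt_inv] at h4
    refine h4.congr fun n => ?_
    rw [Real.sqrt_div (by positivity), div_eq_mul_inv]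
  have hcm : TendstoInMeasure (iidLaw μ)
      (fun (n : ℕ) (_ : ℤ → ℝ) => √((n / p : ℕ) : ℝ) * (√(n : ℝ))⁻¹) atTop
      (fun _ => (√p)⁻¹) :=
    tendstoInMeasure_of_tendsto_ae (fun n => aestronglyMeasurable_const)
      (Eventually.of_forall fun _ => hc)
  have h5 := h1.continuous_comp_prodMk_of_tendstoInMeasure_const
    (g := fun q : ℝ × ℝ => q.1 * q.2) (by fun_prop) hcm (fun n => aemeasurable_const)
  rw [hX0] at h5
  refine (h5.congr (fun n => Eventually.of_forall fun v => ?_) (Eventually.of_forall fun x => rfl))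
  simp only [normCutSum, hX]
  rcases Nat.eq_zero_or_pos (n / p) with h0 | h0
  · simp [h0]
  · have : √((n / p : ℕ) : ℝ) ≠ 0 := by
      rw [Real.sqrt_ne_zero']
      exact_mod_cast h0
    field_simp

/-- The first error comes from the incomplete last block and vanishes as `n → ∞` for fixed `p`. The
second is the standard deviation of the boundary effects of about `n / p` blocks; it is of order
`(√p)⁻¹`, uniformly in `n`. -/
theorem integral_abs_normSum_sub_le (hg : SiteLocal K g) {p : ℕ} (hp : 1 ≤ p) {n : ℕ}
    (hn : 1 ≤ n) :
    ∫ v, |normSum μ g n v - normCutSum μ g p n v| ∂(iidLaw μ)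
      ≤ 2 * p * K * (√n)⁻¹
        + √(72 * (4 * K * ∑' m, sqDecay m) ^ 2 * ∑' d : ℤ, sqDecay d.natAbs) * (√p)⁻¹ := by
  set C := 72 * (4 * K * ∑' m, sqDecay m) ^ 2 * ∑' d : ℤ, sqDecay d.natAbs with hC
  have hK := hg.nonneg
  have hC0 : 0 ≤ C := mul_nonneg (by positivity) (tsum_nonneg fun d => (sqDecay_pos _).le)
  set Y : (ℤ → ℝ) → ℝ := fun v => ∑ k ∈ Finset.range (n / p),
    (fun v => blockSum g p v - cutBlockSum g p v) (translate (k * p) v) with hY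
  have hYm : MemLp Y 2 (iidLaw μ) := memLp_finsetSum _ fun k _ =>
    (hg.blockLocal_sub_cut p).memLp_translate _
  have hvar : Var[Y; iidLaw μ] ≤ (n / p : ℕ) * C := (hg.blockLocal_sub_cut p).variance_sum_le hp _
  have hig : Integrable g (iidLaw μ) := by
    have := memLp_of_abs_le (P := iidLaw μ) hg.measurable hg.abs_le
    exact this.integrable (by norm_num)
  have hic : Integrable (cutBlockSum g p) (iidLaw μ) := by
    have := memLp_of_abs_le (P := iidLaw μ) (hg.measurable_cutBlockSum p) (hg.abs_cutBlockSum_le p)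
    exact this.integrable (by norm_num)
  have hib : Integrable (blockSum g p) (iidLaw μ) := by
    have := memLp_of_abs_le (P := iidLaw μ) (hg.measurable_blockSum p) (hg.abs_blockSum_le p)
    exact this.integrable (by norm_num)
  set m := ∫ w, g w ∂(iidLaw μ) with hm
  have hm_le : |m| ≤ K := by
    have := norm_integral_le_of_norm_le_const (μ := iidLaw μ) (f := g) (C := K)
      (Eventually.of_forall fun ω => hg.abs_le ω)
    simpa using this
  have hmb : ∫ w, blockSum g p w ∂(iidLaw μ) = p * m := by
    simp only [blockSum]
    rw [integral_finsetSum (Finset.range p) (f := fun (j : ℕ) v => g (translate j v)) fun j _ =>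
      (measurePreserving_translate (μ := μ) j).integrable_comp_of_integrable hig]
    simp [integral_translate g hg.measurable, hm]
  have hEY : ∫ v, Y v ∂(iidLaw μ)
      = (n / p : ℕ) * (p * m) - (n / p : ℕ) * ∫ w, cutBlockSum g p w ∂(iidLaw μ) := by
    rw [hY, integral_finsetSum (Finset.range (n / p)) (f := fun (k : ℕ) v =>
      (fun v => blockSum g p v - cutBlockSum g p v) (translate (k * p) v)) fun k _ =>
      (measurePreserving_translate (μ := μ) (k * p)).integrable_comp_of_integrable (hib.sub hic)]
    have : ∀ k : ℕ, ∫ v, (fun v => blockSum g p v - cutBlockSum g p v) (translate (k * p) v)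
        ∂(iidLaw μ) = p * m - ∫ w, cutBlockSum g p w ∂(iidLaw μ) := by
      intro k
      rw [integral_translate _ (hg.blockLocal_sub_cut p).measurable, integral_sub hib hic, hmb]
    rw [Finset.sum_congr rfl fun k _ => this k]
    simp [mul_sub]
  -- The `r` sites left over after the complete blocks.
  obtain ⟨r, hr⟩ : ∃ r, r = n % p := ⟨_, rfl⟩
  have hnr : n = (n / p) * p + r := by rw [hr, Nat.div_add_mod']
  have hrp : r ≤ p := by rw [hr]; exact (Nat.mod_lt _ (by omega)).le
  have hnr' : (n : ℝ) = (n / p : ℕ) * p + r := by exact_mod_cast hnr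
  have hpt : ∀ v, |normSum μ g n v - normCutSum μ g p n v|
      ≤ 2 * p * K * (√n)⁻¹ + (√n)⁻¹ * |Y v - ∫ w, Y w ∂(iidLaw μ)| := by
    intro v
    have hsplit : ∑ j ∈ Finset.range n, g (translate j v)
        = ∑ k ∈ Finset.range (n / p), blockSum g p (translate (k * p) v)
          + ∑ j ∈ Finset.range r, g (translate ((n / p) * p + j : ℕ) v) := by
      rw [sum_blockSum, ← Finset.sum_range_add]
      rw [← hnr]
    have hrest : |∑ j ∈ Finset.range r, g (translate ((n / p) * p + j : ℕ) v)| ≤ p * K := by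
      refine (Finset.abs_sum_le_sum_abs _ _).trans ?_
      refine (Finset.sum_le_card_nsmul _ _ K fun j _ => hg.abs_le _).trans ?_
      rw [Finset.card_range, nsmul_eq_mul]
      gcongr
    have hrm : |r * m| ≤ p * K := by
      rw [abs_mul, Nat.abs_cast]
      gcongr
    have heq : normSum μ g n v - normCutSum μ g p n v
        = (√n)⁻¹ * ((∑ j ∈ Finset.range r, g (translate ((n / p) * p + j : ℕ) v) - r * m)
          + (Y v - ∫ w, Y w ∂(iidLaw μ))) := by
      have hYv : Y v = ∑ k ∈ Finset.range (n / p), blockSum g p (translate (k * p) v)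
          - ∑ k ∈ Finset.range (n / p), cutBlockSum g p (translate (k * p) v) := by
        rw [hY, ← Finset.sum_sub_distrib]
      have hnm : (n : ℝ) * m = (n / p : ℕ) * p * m + r * m := by
        conv_lhs => rw [hnr']
        ring
      rw [normSum, normCutSum, ← hm, hsplit, hnm, hEY, hYv]
      ring
    rw [heq, abs_mul, abs_of_nonneg (by positivity : 0 ≤ (√(n : ℝ))⁻¹)]
    calc (√n)⁻¹ * |(∑ j ∈ Finset.range r, g (translate ((n / p) * p + j : ℕ) v) - r * m)
          + (Y v - ∫ w, Y w ∂(iidLaw μ))|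
        ≤ (√n)⁻¹ * ((p * K + p * K) + |Y v - ∫ w, Y w ∂(iidLaw μ)|) := by
          gcongr
          refine (abs_add_le _ _).trans ?_
          gcongr
          exact (abs_sub _ _).trans (add_le_add hrest hrm)
      _ = _ := by ring
  have hYi : Integrable Y (iidLaw μ) := hYm.integrable (by norm_num)
  have hsub : Integrable (fun v => |Y v - ∫ w, Y w ∂(iidLaw μ)|) (iidLaw μ) :=
    (hYi.sub (integrable_const _)).abs
  calc ∫ v, |normSum μ g n v - normCutSum μ g p n v| ∂(iidLaw μ)
      ≤ ∫ v, (2 * p * K * (√n)⁻¹ + (√n)⁻¹ * |Y v - ∫ w, Y w ∂(iidLaw μ)|) ∂(iidLaw μ) := by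
        refine integral_mono_of_nonneg (Eventually.of_forall fun v => abs_nonneg _) ?_
          (Eventually.of_forall hpt)
        exact (integrable_const _).add (hsub.const_mul _)
    _ = 2 * p * K * (√n)⁻¹ + (√n)⁻¹ * ∫ v, |Y v - ∫ w, Y w ∂(iidLaw μ)| ∂(iidLaw μ) := by
        rw [integral_add (integrable_const _) (hsub.const_mul _), integral_const, probReal_univ,
          one_smul]
        congr 1
        exact integral_const_mul _ _
    _ ≤ 2 * p * K * (√n)⁻¹ + (√n)⁻¹ * √(n / p * C) := by
        gcongr
        refine (integral_abs_sub_mean_le hYm).trans (Real.sqrt_le_sqrt (hvar.trans ?_))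
        gcongr
        exact Nat.cast_div_le
    _ = _ := by
        have : √(n : ℝ) ≠ 0 := by
          rw [Real.sqrt_ne_zero']
          exact_mod_cast hn
        rw [Real.sqrt_mul (by positivity), Real.sqrt_div (by positivity)]
        field_simp

/-- For cut blocks the limit is Gaussian with variance per site `Var / p`, which tends to the sum of
covariances as `p → ∞`. The error of the cut is small uniformly in `n`, so the two limits can be
combined. -/
theorem tendsto_charFun_normSum (hg : SiteLocal K g) (t : ℝ) :
    Tendsto (fun n => ∫ v, Complex.exp (t * normSum μ g n v * Complex.I) ∂(iidLaw μ)) atTop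
      (𝓝 (Complex.exp (-((∑' l : ℤ, cov[g, fun v => g (translate l v); iidLaw μ] : ℝ)
        * t ^ 2 / 2)))) := by
  set s := ∑' l : ℤ, cov[g, fun v => g (translate l v); iidLaw μ] with hs
  set C := 72 * (4 * K * ∑' m, sqDecay m) ^ 2 * ∑' d : ℤ, sqDecay d.natAbs with hC
  have hcut : ∀ p : ℕ, 1 ≤ p →
      Tendsto (fun n => ∫ v, Complex.exp (t * normCutSum μ g p n v * Complex.I) ∂(iidLaw μ)) atTop
      (𝓝 (Complex.exp (-((Var[cutBlockSum g p; iidLaw μ] / p : ℝ) * t ^ 2 / 2)))) := by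
    intro p hp
    have h1 := ProbabilityMeasure.tendsto_iff_tendsto_charFun.1
      (hg.tendstoInDistribution_normCutSum (μ := μ) hp).tendsto t
    simp only [ProbabilityMeasure.coe_mk] at h1
    have h2 : ∀ n, charFun ((iidLaw μ).map (normCutSum μ g p n)) t
        = ∫ v, Complex.exp (t * normCutSum μ g p n v * Complex.I) ∂(iidLaw μ) := by
      intro n
      rw [charFun_apply_real, integral_map (hg.measurable_normCutSum p n).aemeasurable]
      exact (by fun_prop : Continuous fun x : ℝ => Complex.exp (t * x * Complex.I)).aestronglyMeasurable
    simp only [h2] at h1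
    rw [gaussianReal_map_mul_const, charFun_gaussianReal] at h1
    convert h1 using 2
    have hp0 : (p : ℝ) ≠ 0 := by positivity
    simp only [mul_zero, Complex.ofReal_zero, zero_mul, zero_sub]
    congr 3
    have h3 : (√(p : ℝ))⁻¹ ^ 2 = (p : ℝ)⁻¹ := by rw [inv_pow, Real.sq_sqrt (by positivity)]
    rw [NNReal.coe_mul, Real.coe_toNNReal _ (variance_nonneg _ _), NNReal.coe_mk, h3]
    push_cast
    ring
  have hlim : Tendsto (fun p : ℕ =>
      Complex.exp (-((Var[cutBlockSum g p; iidLaw μ] / p : ℝ) * t ^ 2 / 2))) atTop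
      (𝓝 (Complex.exp (-((s : ℝ) * t ^ 2 / 2)))) := by
    have h1 := hg.tendsto_variance_cutBlockSum_div (μ := μ)
    have h2 : Continuous fun x : ℝ => Complex.exp (-((x : ℝ) * t ^ 2 / 2)) := by fun_prop
    exact (h2.tendsto s).comp h1
  have hsp : Tendsto (fun p : ℕ => |t| * (√C * (√(p : ℝ))⁻¹)) atTop (𝓝 0) := by
    have h1 : Tendsto (fun p : ℕ => (√(p : ℝ))⁻¹) atTop (𝓝 0) :=
      (Real.tendsto_sqrt_atTop.comp tendsto_natCast_atTop_atTop).inv_tendsto_atTop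
    simpa using (h1.const_mul (√C)).const_mul |t|
  rw [Metric.tendsto_atTop']
  intro ε hε
  -- The block length is fixed first, making the cut error and the error in the variance small; only
  -- then is `n` taken large. Four errors of size `ε / 4` arise in all.
  obtain ⟨p, hp1, hp2, hp3⟩ := ((eventually_ge_atTop 1).and
    ((hsp.eventually (gt_mem_nhds (by positivity : 0 < ε / 4))).and
      (hlim.eventually (Metric.ball_mem_nhds _ (by positivity : 0 < ε / 4))))).exists
  have hsn : Tendsto (fun n : ℕ => |t| * (2 * p * K * (√(n : ℝ))⁻¹)) atTop (𝓝 0) := by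
    have h1 : Tendsto (fun p : ℕ => (√(p : ℝ))⁻¹) atTop (𝓝 0) :=
      (Real.tendsto_sqrt_atTop.comp tendsto_natCast_atTop_atTop).inv_tendsto_atTop
    simpa using (h1.const_mul (2 * p * K)).const_mul |t|
  obtain ⟨n₀, hn₀⟩ := eventually_atTop.1 ((eventually_ge_atTop 1).and
    ((hsn.eventually (gt_mem_nhds (by positivity : 0 < ε / 4))).and
      ((hcut p hp1).eventually (Metric.ball_mem_nhds _ (by positivity : 0 < ε / 4)))))
  refine ⟨n₀, fun n hn => ?_⟩
  obtain ⟨h1, h2, h3⟩ := hn₀ n hn.le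
  have hint : ∀ n, Integrable (normSum μ g n) (iidLaw μ) := fun n => by
    refine Integrable.const_mul (Integrable.sub (integrable_finsetSum _ fun j _ => ?_)
      (integrable_const _)) _
    exact ((hg.blockLocal.memLp_translate (j : ℤ)).integrable (by norm_num))
  have hint' : Integrable (normCutSum μ g p n) (iidLaw μ) := by
    refine Integrable.const_mul (Integrable.sub (integrable_finsetSum _ fun k _ => ?_)
      (integrable_const _)) _
    have := memLp_of_abs_le (P := iidLaw μ) ((hg.measurable_cutBlockSum p).comp
      (measurable_translate (k * p))) (fun v => hg.abs_cutBlockSum_le p _)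
    exact this.integrable (by norm_num)
  have h4 := norm_integral_cexp_sub_le (P := iidLaw μ) (hg.measurable_normSum (μ := μ) n).aemeasurable
    (hg.measurable_normCutSum (μ := μ) p n).aemeasurable ((hint n).sub hint') t
  have h5 := mul_le_mul_of_nonneg_left (hg.integral_abs_normSum_sub_le (μ := μ) hp1 h1)
    (abs_nonneg t)
  rw [← hC, mul_add] at h5
  have h6 := dist_triangle4 (∫ v, Complex.exp (t * normSum μ g n v * Complex.I) ∂(iidLaw μ))
    (∫ v, Complex.exp (t * normCutSum μ g p n v * Complex.I) ∂(iidLaw μ))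
    (Complex.exp (-((Var[cutBlockSum g p; iidLaw μ] / p : ℝ) * t ^ 2 / 2)))
    (Complex.exp (-((s : ℝ) * t ^ 2 / 2)))
  rw [← dist_eq_norm] at h4
  linarith

theorem tendstoInDistribution_normSum (hg : SiteLocal K g) :
    TendstoInDistribution (normSum μ g) atTop (id : ℝ → ℝ) (fun _ => iidLaw μ)
      (gaussianReal 0 (∑' l : ℤ, cov[g, fun v => g (translate l v); iidLaw μ]).toNNReal) where
  forall_aemeasurable n := (hg.measurable_normSum n).aemeasurable
  tendsto := by
    refine ProbabilityMeasure.tendsto_iff_tendsto_charFun.2 fun t => ?_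
    simp only [ProbabilityMeasure.coe_mk]
    have h2 : ∀ n, charFun ((iidLaw μ).map (normSum μ g n)) t
        = ∫ v, Complex.exp (t * normSum μ g n v * Complex.I) ∂(iidLaw μ) := by
      intro n
      rw [charFun_apply_real, integral_map (hg.measurable_normSum n).aemeasurable]
      exact (by fun_prop : Continuous fun x : ℝ => Complex.exp (t * x * Complex.I)).aestronglyMeasurable
    simp only [h2]
    rw [Measure.map_id, charFun_gaussianReal]
    convert hg.tendsto_charFun_normSum (μ := μ) t using 2
    simp only [Complex.ofReal_zero, mul_zero, zero_mul, zero_sub]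
    rw [Real.coe_toNNReal _ hg.blockLocal.tsum_covariance_nonneg]

end SiteLocal

end

end Anderson

namespace Anderson

noncomputable section

/-! ### Averaging over the sites to the left of a given site -/

/-- The configuration equal to `v` at the sites `i ≥ m` and to `w` at the sites `i < m`. -/
def mix (m : ℤ) (v w : ℤ → ℝ) : ℤ → ℝ := fun i => if m ≤ i then v i else w i

theorem mix_of_le {m i : ℤ} (h : m ≤ i) (v w : ℤ → ℝ) : mix m v w i = v i := if_pos h

theorem mix_of_lt {m i : ℤ} (h : i < m) (v w : ℤ → ℝ) : mix m v w i = w i := if_neg (by omega)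

theorem mix_mix {m n : ℤ} (h : m ≤ n) (v w w' : ℤ → ℝ) : mix n (mix m v w) w' = mix n v w' := by
  funext i
  by_cases hi : n ≤ i
  · rw [mix_of_le hi, mix_of_le (by omega), mix_of_le hi]
  · rw [mix_of_lt (by omega), mix_of_lt (by omega)]

theorem translate_mix (m j : ℤ) (v w : ℤ → ℝ) :
    translate j (mix m v w) = mix (m - j) (translate j v) (translate j w) := by
  funext i
  by_cases hi : m ≤ i + j
  · rw [translate, mix_of_le hi, mix_of_le (by omega), translate]
  · rw [translate, mix_of_lt (by omega), mix_of_lt (by omega), translate]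

theorem mix_zero_eq_mix_one_of_ne (v w : ℤ → ℝ) {i : ℤ} (hi : i ≠ 0) :
    mix 0 v w i = mix 1 v w i := by
  by_cases h : 1 ≤ i
  · rw [mix_of_le (by omega), mix_of_le h]
  · rw [mix_of_lt (by omega), mix_of_lt (by omega)]

theorem measurable_mix (m : ℤ) : Measurable fun z : (ℤ → ℝ) × (ℤ → ℝ) => mix m z.1 z.2 := by
  refine measurable_pi_lambda _ fun i => ?_
  by_cases h : m ≤ i
  · simp only [mix_of_le h]
    fun_prop
  · simp only [mix_of_lt (not_le.1 h)]
    fun_prop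

variable {μ : Measure ℝ} [IsProbabilityMeasure μ]

/-- Splicing two independent copies at `m` reproduces the i.i.d. law. Through Fubini this makes
averaging over the left copy a conditional expectation. -/
theorem map_mix (m : ℤ) :
    ((iidLaw μ).prod (iidLaw μ)).map (fun z => mix m z.1 z.2) = iidLaw μ := by
  refine Measure.eq_infinitePi (μ := fun _ : ℤ => μ) fun s t ht => ?_
  rw [Measure.map_apply (measurable_mix m) (MeasurableSet.pi s.countable_toSet fun i _ => ht i)]
  have h : (fun z : (ℤ → ℝ) × (ℤ → ℝ) => mix m z.1 z.2) ⁻¹' (Set.pi s t)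
      = (Set.pi (s.filter fun i => m ≤ i) t) ×ˢ (Set.pi (s.filter fun i => ¬ m ≤ i) t) := by
    ext z
    simp only [Set.mem_preimage, Set.mem_pi, Set.mem_prod, Finset.coe_filter, Set.mem_ofPred_eq,
      Finset.mem_coe]
    constructor
    · intro hz
      refine ⟨fun i hi => ?_, fun i hi => ?_⟩
      · simpa [mix, hi.2] using hz i hi.1
      · simpa [mix, hi.2] using hz i hi.1
    · rintro ⟨h1, h2⟩ i hi
      by_cases hm : m ≤ i
      · simpa [mix, hm] using h1 i ⟨hi, hm⟩
      · simpa [mix, hm] using h2 i ⟨hi, hm⟩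
  rw [h, Measure.prod_prod, iidLaw, Measure.infinitePi_pi _ fun i _ => ht i,
    Measure.infinitePi_pi _ fun i _ => ht i, Finset.prod_filter_mul_prod_filter_not]

/-- A bounded measurable functional. -/
structure BddMeas (f : (ℤ → ℝ) → ℝ) : Prop where
  measurable : Measurable f
  bdd : ∃ C, ∀ v, |f v| ≤ C

namespace BddMeas

variable {f h u : (ℤ → ℝ) → ℝ}

theorem integrable (hf : BddMeas f) (Q : Measure (ℤ → ℝ)) [IsFiniteMeasure Q] :
    Integrable f Q := by
  obtain ⟨C, hC⟩ := hf.bdd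
  exact Integrable.of_bound hf.measurable.aestronglyMeasurable C (Eventually.of_forall hC)

theorem comp (hf : BddMeas f) {φ : (ℤ → ℝ) → (ℤ → ℝ)} (hφ : Measurable φ) :
    BddMeas fun v => f (φ v) :=
  ⟨hf.measurable.comp hφ, hf.bdd.imp fun _ hC v => hC (φ v)⟩

theorem mul (hf : BddMeas f) (hu : BddMeas u) : BddMeas fun v => f v * u v := by
  obtain ⟨C, hC⟩ := hf.bdd
  obtain ⟨D, hD⟩ := hu.bdd
  refine ⟨hf.measurable.mul hu.measurable, C * D, fun v => ?_⟩
  rw [abs_mul]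
  exact mul_le_mul (hC v) (hD v) (abs_nonneg _) ((abs_nonneg _).trans (hC v))

theorem sub (hf : BddMeas f) (hu : BddMeas u) : BddMeas fun v => f v - u v := by
  obtain ⟨C, hC⟩ := hf.bdd
  obtain ⟨D, hD⟩ := hu.bdd
  exact ⟨hf.measurable.sub hu.measurable, C + D,
    fun v => (abs_sub _ _).trans (add_le_add (hC v) (hD v))⟩

end BddMeas

theorem SiteLocal.bddMeas {K : ℝ} {g : (ℤ → ℝ) → ℝ} (hg : SiteLocal K g) : BddMeas g :=
  ⟨hg.measurable, K, hg.abs_le⟩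

theorem BddMeas.comp_mix {f : (ℤ → ℝ) → ℝ} (hf : BddMeas f) (m : ℤ) (v : ℤ → ℝ) :
    BddMeas fun w => f (mix m v w) :=
  hf.comp ((measurable_mix m).comp measurable_prodMk_left)

/-- The average of `f` over the sites `i < m`. -/
def tailMean (μ : Measure ℝ) (m : ℤ) (f : (ℤ → ℝ) → ℝ) (v : ℤ → ℝ) : ℝ :=
  ∫ w, f (mix m v w) ∂(iidLaw μ)

theorem tailMean_mix {μ : Measure ℝ} {m n : ℤ} (hmn : m ≤ n) (f : (ℤ → ℝ) → ℝ) (v w : ℤ → ℝ) :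
    tailMean μ n f (mix m v w) = tailMean μ n f v := by
  simp only [tailMean, mix_mix hmn]

theorem tailMean_congr {μ : Measure ℝ} {m : ℤ} (f : (ℤ → ℝ) → ℝ) {v v' : ℤ → ℝ} (h : ∀ i, m ≤ i → v i = v' i) :
    tailMean μ m f v = tailMean μ m f v' := by
  have : ∀ w, mix m v w = mix m v' w := fun w => by
    funext i
    by_cases hi : m ≤ i
    · rw [mix_of_le hi, mix_of_le hi, h i hi]
    · rw [mix_of_lt (by omega), mix_of_lt (by omega)]
  simp only [tailMean, this]

theorem abs_integral_le_of_abs_le {Ω : Type*} [MeasurableSpace Ω] {P : Measure Ω}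
    [IsProbabilityMeasure P] {f : Ω → ℝ} {C : ℝ} (hC : ∀ v, |f v| ≤ C) : |∫ v, f v ∂P| ≤ C := by
  have := norm_integral_le_of_norm_le_const (μ := P) (f := f) (C := C)
    (Eventually.of_forall fun ω => hC ω)
  simpa using this

theorem abs_tailMean_le {f : (ℤ → ℝ) → ℝ} {C : ℝ} (hC : ∀ v, |f v| ≤ C) (m : ℤ) (v : ℤ → ℝ) :
    |tailMean μ m f v| ≤ C := abs_integral_le_of_abs_le fun _ => hC _

theorem BddMeas.tailMean {f : (ℤ → ℝ) → ℝ} (hf : BddMeas f) (m : ℤ) :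
    BddMeas (tailMean μ m f) := by
  refine ⟨?_, hf.bdd.imp fun _ hC => abs_tailMean_le hC m⟩
  exact ((hf.measurable.comp (measurable_mix m)).stronglyMeasurable.integral_prod_right'
    (ν := iidLaw μ)).measurable

theorem tailMean_sub {f h : (ℤ → ℝ) → ℝ} (hf : BddMeas f) (hh : BddMeas h) (m : ℤ) (v : ℤ → ℝ) :
    tailMean μ m (fun v => f v - h v) v = tailMean μ m f v - tailMean μ m h v :=
  integral_sub ((hf.comp_mix m v).integrable _) ((hh.comp_mix m v).integrable _)

theorem tailMean_translate {f : (ℤ → ℝ) → ℝ} (hf : BddMeas f) (m j : ℤ) (v : ℤ → ℝ) :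
    tailMean μ m (fun v => f (translate j v)) v = tailMean μ (m - j) f (translate j v) := by
  simp only [tailMean, translate_mix]
  exact SiteLocal.integral_translate (fun w => f (mix (m - j) (translate j v) w))
    (hf.comp_mix _ _).measurable j

/-- The characteristic identity of a conditional expectation: realize the law by splicing two
copies, observe that `u` ignores the second one, and apply Fubini. -/
theorem integral_tailMean_mul {f u : (ℤ → ℝ) → ℝ} (hf : BddMeas f) (hu : BddMeas u) {m : ℤ}
    (hum : ∀ v w, u (mix m v w) = u v) :
    ∫ v, tailMean μ m f v * u v ∂(iidLaw μ) = ∫ v, f v * u v ∂(iidLaw μ) := by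
  conv_rhs => rw [← map_mix (μ := μ) m]
  have hfu := hf.mul hu
  have hi : Integrable (fun z : (ℤ → ℝ) × (ℤ → ℝ) => f (mix m z.1 z.2) * u (mix m z.1 z.2))
      ((iidLaw μ).prod (iidLaw μ)) := by
    obtain ⟨C, hC⟩ := hfu.bdd
    exact Integrable.of_bound (hfu.measurable.comp (measurable_mix m)).aestronglyMeasurable C
      (Eventually.of_forall fun z => hC _)
  rw [integral_map (measurable_mix m).aemeasurable hfu.measurable.aestronglyMeasurable,
    integral_prod _ hi]
  refine integral_congr_ae (Eventually.of_forall fun v => ?_)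
  simp only [hum, tailMean]
  exact (integral_mul_const _ _).symm

theorem integral_tailMean_mul_tailMean {f h : (ℤ → ℝ) → ℝ} (hf : BddMeas f) (hh : BddMeas h)
    {m n : ℤ} (hmn : m ≤ n) :
    ∫ v, tailMean μ m f v * tailMean μ n h v ∂(iidLaw μ)
      = ∫ v, tailMean μ n f v * tailMean μ n h v ∂(iidLaw μ) := by
  rw [integral_tailMean_mul hf (hh.tailMean n) fun v w => tailMean_mix hmn h v w,
    integral_tailMean_mul hf (hh.tailMean n) fun v w => tailMean_mix le_rfl h v w]

/-- The conditional expectation given the sites `j ≥ m` is the average over the sites `j < m`. -/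
theorem condExp_tailSigma {Ω : Type*} [MeasurableSpace Ω] {P : Measure Ω} [IsProbabilityMeasure P]
    {V : ℤ → Ω → ℝ} (hV : ∀ j, Measurable (V j)) (hlaw : P.map (fun ω j => V j ω) = iidLaw μ)
    {f : (ℤ → ℝ) → ℝ} (hf : BddMeas f) (m : ℤ) :
    P[fun ω => f fun j => V j ω | tailSigma V m] =ᵐ[P] fun ω => tailMean μ m f fun j => V j ω := by
  have hVm : Measurable fun ω j => V j ω := measurable_pi_lambda _ hV
  have hle : tailSigma V m ≤ ‹MeasurableSpace Ω› :=
    iSup₂_le fun j _ => (hV j).comap_le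
  have hmix0 : Measurable fun v : ℤ → ℝ => mix m v 0 := 
    (measurable_mix m).comp (measurable_id.prodMk measurable_const)
  -- The tail `σ`-algebra is generated by one map, the configuration with its left part erased. Its
  -- events are then preimages, and the identity moves to configuration space.
  have hsig : tailSigma V m
      = MeasurableSpace.comap (fun ω => mix m (fun j => V j ω) 0) MeasurableSpace.pi := by
    refine le_antisymm (iSup₂_le fun j hj => ?_) ?_
    · have : V j = (fun v : ℤ → ℝ => v j) ∘ fun ω => mix m (fun j => V j ω) 0 := by
        funext ω
        exact (mix_of_le hj (fun j => V j ω) 0).symm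
      rw [this, ← MeasurableSpace.comap_comp]
      exact MeasurableSpace.comap_mono (measurable_pi_apply j).comap_le
    · rw [← measurable_iff_comap_le]
      refine @measurable_pi_lambda _ _ _ (tailSigma V m) _ _ fun j => ?_
      by_cases hj : m ≤ j
      · simp only [mix_of_le hj]
        exact Measurable.mono (comap_measurable (V j))
          (le_iSup₂_of_le (f := fun j (_ : j ∈ Set.Ici m) => MeasurableSpace.comap (V j) inferInstance)
            j hj le_rfl) le_rfl
      · simp only [mix_of_lt (not_le.1 hj)]
        exact measurable_const
  have hmeasm : Measurable[tailSigma V m] fun ω => mix m (fun j => V j ω) 0 := by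
    rw [hsig]
    exact comap_measurable _
  have hT := hf.tailMean (μ := μ) m
  have hTi : Integrable (fun ω => tailMean μ m f fun j => V j ω) P := by
    obtain ⟨C, hC⟩ := hT.bdd
    exact Integrable.of_bound (hT.measurable.comp hVm).aestronglyMeasurable C
      (Eventually.of_forall fun ω => hC _)
  have hfi : Integrable (fun ω => f fun j => V j ω) P := by
    obtain ⟨C, hC⟩ := hf.bdd
    exact Integrable.of_bound (hf.measurable.comp hVm).aestronglyMeasurable C
      (Eventually.of_forall fun ω => hC _)
  refine (ae_eq_condExp_of_forall_setIntegral_eq hle hfi (fun s _ _ => hTi.integrableOn)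
    (fun s hs _ => ?_) ?_).symm
  · have hs' := hle s hs
    rw [hsig] at hs
    obtain ⟨B, hB, rfl⟩ := hs
    set u : (ℤ → ℝ) → ℝ := fun v => B.indicator 1 (mix m v 0) with hu
    have hub : BddMeas u := by
      refine ⟨(measurable_one.indicator hB).comp hmix0, 1, fun v => ?_⟩
      by_cases hv : mix m v 0 ∈ B <;> simp [hu, hv]
    have hum : ∀ v w, u (mix m v w) = u v := fun v w => by simp only [hu, mix_mix le_rfl]
    have hset : ∀ {h : (ℤ → ℝ) → ℝ}, BddMeas h →
        ∫ ω in (fun ω => mix m (fun j => V j ω) 0) ⁻¹' B, h (fun j => V j ω) ∂P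
          = ∫ v, h v * u v ∂(iidLaw μ) := by
      intro h hh
      rw [← integral_indicator hs', ← hlaw,
        integral_map hVm.aemeasurable (hh.mul hub).measurable.aestronglyMeasurable]
      refine integral_congr_ae (Eventually.of_forall fun ω => ?_)
      by_cases hv : mix m (fun j => V j ω) 0 ∈ B <;> simp [hu, hv, Set.indicator]
    rw [hset hT, hset hf, integral_tailMean_mul hf hub hum]
  · refine Measurable.aestronglyMeasurable ?_
    have : (fun ω => tailMean μ m f fun j => V j ω)
        = fun ω => tailMean μ m f (mix m (fun j => V j ω) 0) := by
      funext ω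
      rw [tailMean_mix le_rfl]
    rw [this]
    exact hT.measurable.comp hmeasm

/-! ### The martingale representation of the limiting variance -/

namespace SiteLocal

variable {K : ℝ} {g : (ℤ → ℝ) → ℝ}

/-- Seen from the translate by `j`, the only altered site lies at distance `|j|`, so the
configurations agree up to distance `|j| - 1`; passing back to `|j|` costs a constant. -/
theorem abs_sub_translate_le (hg : SiteLocal K g) {v w : ℤ → ℝ} (h : ∀ i, i ≠ 0 → v i = w i)
    (j : ℤ) : |g (translate j v) - g (translate j w)| ≤ 32 * K * decay j := by
  have hK := hg.nonneg
  rcases eq_or_ne j 0 with rfl | hj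
  · have h1 := hg.abs_le (translate 0 v)
    have h2 := hg.abs_le (translate 0 w)
    have h3 : decay 0 = 1 := by norm_num [decay]
    rw [h3]
    exact (abs_sub _ _).trans (by linarith)
  · obtain ⟨n, hn⟩ : ∃ n : ℕ, j.natAbs = n + 1 := ⟨j.natAbs - 1, by omega⟩
    refine (hg.abs_sub_le n _ _ fun i hi => ?_).trans ?_
    · rw [_root_.abs_le] at hi
      exact h _ (by omega)
    · have h1 : decay n ≤ 32 * decay j := by
        rw [decay, decay, hn, Int.natAbs_natCast, mul_one_div,
          div_le_div_iff₀ (by positivity) (by positivity)]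
        have h2 : (((n + 1 : ℕ) : ℝ) + 1) ^ 4 ≤ (2 * ((n : ℝ) + 1)) ^ 4 := by
          gcongr
          push_cast
          linarith [Nat.cast_nonneg (α := ℝ) n]
        have h3 : (2 * ((n : ℝ) + 1)) ^ 4 = 16 * ((n : ℝ) + 1) ^ 4 := by ring
        have h4 : 0 ≤ ((n : ℝ) + 1) ^ 4 := by positivity
        linarith
      calc K * decay n ≤ K * (32 * decay j) := by gcongr
        _ = _ := by ring

theorem abs_sub_of_agree (hg : SiteLocal K g) (l : ℤ) (N : ℕ) {v w : ℤ → ℝ}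
    (h : ∀ i : ℤ, |i| ≤ N + l.natAbs → v i = w i) :
    |g (translate l v) - g (translate l w)| ≤ K * decay N := by
  refine hg.abs_sub_le N _ _ fun i hi => h _ ?_
  rw [_root_.abs_le] at hi ⊢
  omega

theorem tendsto_decay_nat : Tendsto (fun N : ℕ => decay N) atTop (𝓝 0) :=
  summable_decay_nat.tendsto_atTop_zero

theorem tendsto_tailMean_neg (hg : SiteLocal K g) (l : ℤ) (v : ℤ → ℝ) :
    Tendsto (fun N : ℕ => tailMean μ (1 - N) (fun v => g (translate l v)) v) atTop
      (𝓝 (g (translate l v))) := by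
  rw [tendsto_iff_norm_sub_tendsto_zero]
  rw [← tendsto_add_atTop_iff_nat (1 + l.natAbs)]
  have h0 := tendsto_decay_nat.const_mul K
  rw [mul_zero] at h0
  refine squeeze_zero (fun N => norm_nonneg _) (fun N => ?_) h0
  have hb := hg.bddMeas.comp (measurable_translate l)
  have h1 : tailMean μ (1 - (N + (1 + l.natAbs) : ℕ)) (fun v => g (translate l v)) v
      - g (translate l v) = ∫ w, (g (translate l (mix (1 - (N + (1 + l.natAbs) : ℕ)) v w))
        - g (translate l v)) ∂(iidLaw μ) := by
    rw [integral_sub ((hb.comp_mix _ _).integrable _) (integrable_const _)]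
    simp [tailMean]
  rw [h1, Real.norm_eq_abs]
  refine abs_integral_le_of_abs_le fun w => hg.abs_sub_of_agree l N fun i hi => ?_
  rw [_root_.abs_le] at hi
  exact mix_of_le (by omega) _ _

theorem tendsto_tailMean_pos (hg : SiteLocal K g) (l : ℤ) (v : ℤ → ℝ) :
    Tendsto (fun N : ℕ => tailMean μ (N + 1) (fun v => g (translate l v)) v) atTop
      (𝓝 (∫ w, g w ∂(iidLaw μ))) := by
  rw [tendsto_iff_norm_sub_tendsto_zero]
  rw [← tendsto_add_atTop_iff_nat l.natAbs]
  have h0 := tendsto_decay_nat.const_mul K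
  rw [mul_zero] at h0
  refine squeeze_zero (fun N => norm_nonneg _) (fun N => ?_) h0
  have hb := hg.bddMeas.comp (measurable_translate l)
  have h1 : tailMean μ ((N + l.natAbs : ℕ) + 1) (fun v => g (translate l v)) v
      - ∫ w, g w ∂(iidLaw μ) = ∫ w, (g (translate l (mix ((N + l.natAbs : ℕ) + 1) v w))
        - g (translate l w)) ∂(iidLaw μ) := by
    rw [integral_sub ((hb.comp_mix _ _).integrable _) (hb.integrable _),
      integral_translate g hg.measurable]
    rfl
  rw [h1, Real.norm_eq_abs]
  refine abs_integral_le_of_abs_le fun w => hg.abs_sub_of_agree l N fun i hi => ?_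
  rw [_root_.abs_le] at hi
  exact mix_of_lt (by omega) _ _

/-- The correlation `∫ (E_m g) (E_m (g ∘ translate l))` of the averages. -/
def _root_.Anderson.tailCorr (μ : Measure ℝ) (g : (ℤ → ℝ) → ℝ) (l m : ℤ) : ℝ :=
  ∫ v, tailMean μ m g v * tailMean μ m (fun v => g (translate l v)) v ∂(iidLaw μ)

/-- Far to the left nothing is averaged and the correlation is `E[g · g ∘ translate l]`; far to the
right everything is averaged and it is the product of the means. These are the two ends of the
telescoping sum below. -/
theorem tendsto_tailCorr_sub (hg : SiteLocal K g) (l : ℤ) :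
    Tendsto (fun N : ℕ => tailCorr μ g l (1 - N) - tailCorr μ g l (N + 1)) atTop
      (𝓝 (cov[g, fun v => g (translate l v); iidLaw μ])) := by
  have hb := hg.bddMeas.comp (measurable_translate l)
  have h0 : ∀ v, g (translate 0 v) = g v := fun v => by rw [translate_zero]
  have hbd : ∀ (m : ℤ) (v : ℤ → ℝ),
      ‖tailMean μ m g v * tailMean μ m (fun v => g (translate l v)) v‖ ≤ K * K := by
    intro m v
    rw [Real.norm_eq_abs, abs_mul]
    exact mul_le_mul (abs_tailMean_le hg.abs_le m v) (abs_tailMean_le (fun v => hg.abs_le _) m v)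
      (abs_nonneg _) hg.nonneg
  have hm : ∀ m : ℤ, AEStronglyMeasurable
      (fun v => tailMean μ m g v * tailMean μ m (fun v => g (translate l v)) v) (iidLaw μ) :=
    fun m => ((hg.bddMeas.tailMean m).mul (hb.tailMean m)).measurable.aestronglyMeasurable
  have h1 : Tendsto (fun N : ℕ => tailCorr μ g l (1 - N)) atTop
      (𝓝 (∫ v, g v * g (translate l v) ∂(iidLaw μ))) := by
    refine tendsto_integral_of_dominated_convergence (fun _ => K * K) (fun N => hm _)
      (integrable_const _) (fun N => Eventually.of_forall (hbd _)) (Eventually.of_forall fun v => ?_)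
    have := hg.tendsto_tailMean_neg (μ := μ) 0 v
    simp only [h0] at this
    exact this.mul (hg.tendsto_tailMean_neg l v)
  have h2 : Tendsto (fun N : ℕ => tailCorr μ g l (N + 1)) atTop
      (𝓝 (∫ _, (∫ w, g w ∂(iidLaw μ)) * (∫ w, g w ∂(iidLaw μ)) ∂(iidLaw μ))) := by
    refine tendsto_integral_of_dominated_convergence (fun _ => K * K) (fun N => hm _)
      (integrable_const _) (fun N => Eventually.of_forall (hbd _)) (Eventually.of_forall fun v => ?_)
    have := hg.tendsto_tailMean_pos (μ := μ) 0 v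
    simp only [h0] at this
    exact this.mul (hg.tendsto_tailMean_pos l v)
  have h3 : cov[g, fun v => g (translate l v); iidLaw μ]
      = ∫ v, g v * g (translate l v) ∂(iidLaw μ)
        - ∫ _, (∫ w, g w ∂(iidLaw μ)) * (∫ w, g w ∂(iidLaw μ)) ∂(iidLaw μ) := by
    rw [covariance_eq_sub (memLp_of_abs_le hg.measurable hg.abs_le)
      (hg.blockLocal.memLp_translate l), integral_translate g hg.measurable]
    simp
  rw [h3]
  exact h1.sub h2

/-- The increment of the averages of `g ∘ translate j` at the site `0`. -/
def _root_.Anderson.increment (μ : Measure ℝ) (g : (ℤ → ℝ) → ℝ) (j : ℤ) (v : ℤ → ℝ) : ℝ :=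
  tailMean μ 0 (fun v => g (translate j v)) v - tailMean μ 1 (fun v => g (translate j v)) v

theorem abs_increment_le (hg : SiteLocal K g) (j : ℤ) (v : ℤ → ℝ) :
    |increment μ g j v| ≤ 32 * K * decay j := by
  have hb := hg.bddMeas.comp (measurable_translate j)
  rw [increment, tailMean, tailMean,
    ← integral_sub ((hb.comp_mix _ _).integrable _) ((hb.comp_mix _ _).integrable _)]
  exact abs_integral_le_of_abs_le fun w => hg.abs_sub_translate_le
    (fun i hi => mix_zero_eq_mix_one_of_ne v w hi) j

theorem bddMeas_increment (hg : SiteLocal K g) (j : ℤ) : BddMeas (increment μ g j) :=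
  ((hg.bddMeas.comp (measurable_translate j)).tailMean 0).sub
    ((hg.bddMeas.comp (measurable_translate j)).tailMean 1)

theorem integral_tailMean_translate_mul (hg : SiteLocal K g) (m j k : ℤ) :
    ∫ v, tailMean μ m (fun v => g (translate j v)) v
      * tailMean μ m (fun v => g (translate k v)) v ∂(iidLaw μ)
      = tailCorr μ g (k - j) (m - j) := by
  have hb := hg.bddMeas.comp (measurable_translate (k - j))
  have h1 : ∀ v, tailMean μ m (fun v => g (translate k v)) v
      = tailMean μ (m - j) (fun v => g (translate (k - j) v)) (translate j v) := by
    intro v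
    rw [← tailMean_translate (μ := μ) hb]
    simp only [translate_translate, sub_add_cancel]
  have h0 := tailMean_translate (μ := μ) hg.bddMeas m j
  simp only [h1, h0]
  exact integral_translate (μ := μ) _ ((hg.bddMeas.tailMean (μ := μ) (m - j)).mul
    (hb.tailMean (μ := μ) (m - j))).measurable j

/-- By the tower property the mixed terms in the product of two martingale differences collapse.
Stationarity then expresses what is left through `tailCorr` at consecutive sites, which telescopes
in `j` when `k - j` is fixed. -/
theorem integral_increment_mul (hg : SiteLocal K g) (j k : ℤ) :
    ∫ v, increment μ g j v * increment μ g k v ∂(iidLaw μ)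
      = tailCorr μ g (k - j) (-j) - tailCorr μ g (k - j) (1 - j) := by
  have hj := hg.bddMeas.comp (measurable_translate j)
  have hk := hg.bddMeas.comp (measurable_translate k)
  set f := fun v => g (translate j v)
  set h := fun v => g (translate k v)
  have e00 := hg.integral_tailMean_translate_mul (μ := μ) 0 j k
  have e11 := hg.integral_tailMean_translate_mul (μ := μ) 1 j k
  have e01 := integral_tailMean_mul_tailMean (μ := μ) hj hk (zero_le_one (α := ℤ))
  have e10 : ∫ v, tailMean μ 1 f v * tailMean μ 0 h v ∂(iidLaw μ)
      = ∫ v, tailMean μ 1 f v * tailMean μ 1 h v ∂(iidLaw μ) := by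
    have := integral_tailMean_mul_tailMean (μ := μ) hk hj (zero_le_one (α := ℤ))
    simpa only [mul_comm] using this
  have hi : ∀ a b : ℤ, Integrable (fun v => tailMean μ a f v * tailMean μ b h v) (iidLaw μ) :=
    fun a b => ((hj.tailMean a).mul (hk.tailMean b)).integrable _
  have h1 : ∀ v, increment μ g j v * increment μ g k v
      = (tailMean μ 0 f v * tailMean μ 0 h v - tailMean μ 0 f v * tailMean μ 1 h v)
        - (tailMean μ 1 f v * tailMean μ 0 h v - tailMean μ 1 f v * tailMean μ 1 h v) := by
    intro v
    simp only [increment]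
    ring
  simp only [h1]
  have i0 : Integrable (fun v => tailMean μ 0 f v * tailMean μ 0 h v
      - tailMean μ 0 f v * tailMean μ 1 h v) (iidLaw μ) := (hi 0 0).sub (hi 0 1)
  have i1 : Integrable (fun v => tailMean μ 1 f v * tailMean μ 0 h v
      - tailMean μ 1 f v * tailMean μ 1 h v) (iidLaw μ) := (hi 1 0).sub (hi 1 1)
  rw [integral_sub i0 i1, integral_sub (hi 0 0) (hi 0 1), integral_sub (hi 1 0) (hi 1 1), e00, e01, e10, e11]
  ring_nf

/-- The terms `n` and `-(n + 1)` are paired, so that the telescoping sum over `ℤ` opens at both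
ends. -/
theorem sum_range_tailCorr {μ : Measure ℝ} (l : ℤ) (N : ℕ) :
    ∑ n ∈ Finset.range N, ((tailCorr μ g l (-(n : ℤ)) - tailCorr μ g l (1 - n))
      + (tailCorr μ g l (-(-((n : ℤ) + 1))) - tailCorr μ g l (1 - -((n : ℤ) + 1))))
      = tailCorr μ g l (1 - N) - tailCorr μ g l (N + 1) := by
  induction N with
  | zero => simp
  | succ N ih =>
    rw [Finset.sum_range_succ, ih]
    have e1 : (1 : ℤ) - (N + 1 : ℕ) = -N := by push_cast; ring
    have e2 : ((N + 1 : ℕ) : ℤ) + 1 = 1 - -((N : ℤ) + 1) := by push_cast; ring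
    have e3 : -(-((N : ℤ) + 1)) = N + 1 := by ring
    rw [e1, e2, e3]
    ring

theorem summable_bound_mul (hK : 0 ≤ K) :
    Summable fun q : ℤ × ℤ => (32 * K * decay q.1) * (32 * K * decay q.2) :=
  (summable_decay.mul_left (32 * K)).mul_of_nonneg (summable_decay.mul_left (32 * K))
    (fun j => mul_nonneg (by positivity) (decay_pos j).le)
    fun j => mul_nonneg (by positivity) (decay_pos j).le

theorem abs_integral_increment_mul_le (hg : SiteLocal K g) (j k : ℤ) :
    |∫ v, increment μ g j v * increment μ g k v ∂(iidLaw μ)|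
      ≤ (32 * K * decay j) * (32 * K * decay k) := by
  refine abs_integral_le_of_abs_le fun v => ?_
  rw [abs_mul]
  exact mul_le_mul (hg.abs_increment_le j v) (hg.abs_increment_le k v) (abs_nonneg _)
    ((abs_nonneg _).trans (hg.abs_increment_le (μ := μ) j v))

/-- The double series of products of increments converges absolutely. Summed along the diagonal `k -
j = l`, it telescopes to the covariance at lag `l`. -/
theorem hasSum_covariance (hg : SiteLocal K g) :
    HasSum (fun l : ℤ => cov[g, fun v => g (translate l v); iidLaw μ])
      (∑' q : ℤ × ℤ, ∫ v, increment μ g q.1 v * increment μ g q.2 v ∂(iidLaw μ)) := by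
  have hs : Summable fun q : ℤ × ℤ =>
      ∫ v, increment μ g q.1 v * increment μ g q.2 v ∂(iidLaw μ) :=
    Summable.of_norm_bounded (summable_bound_mul hg.nonneg)
      fun q => hg.abs_integral_increment_mul_le q.1 q.2
  -- The lag and the first site become the coordinates: `(l, j)` corresponds to the pair of sites
  -- `(j, j + l)`.
  let e : ℤ × ℤ ≃ ℤ × ℤ :=
    { toFun := fun q => (q.2, q.1 + q.2)
      invFun := fun q => (q.2 - q.1, q.1)
      left_inv := fun q => by simp
      right_inv := fun q => by simp }
  have h1 := (e.hasSum_iff.2 hs.hasSum)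
  refine h1.prod_fiberwise fun l => ?_
  have h2 : Summable fun j : ℤ => ((fun q : ℤ × ℤ =>
      ∫ v, increment μ g q.1 v * increment μ g q.2 v ∂(iidLaw μ)) ∘ e) (l, j) :=
    h1.summable.prod_factor l
  have h3 : ∀ j : ℤ, ((fun q : ℤ × ℤ =>
      ∫ v, increment μ g q.1 v * increment μ g q.2 v ∂(iidLaw μ)) ∘ e) (l, j)
      = tailCorr μ g l (-j) - tailCorr μ g l (1 - j) := by
    intro j
    change ∫ v, increment μ g j v * increment μ g (l + j) v ∂(iidLaw μ) = _
    rw [hg.integral_increment_mul, add_sub_cancel_right]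
  simp only [h3] at h2 ⊢
  have h4 := h2.hasSum.nat_add_neg_add_one.tendsto_sum_nat
  simp only [sum_range_tailCorr] at h4
  rw [← tendsto_nhds_unique h4 (hg.tendsto_tailCorr_sub l)]
  exact h2.hasSum

/-- Each series of averages can be summed under the integral. The subtracted configurations do not
see site `0`, so they drop out of the difference of the averages at `0` and `1`. -/
theorem hasSum_increment (hg : SiteLocal K g) {A : (ℤ → ℝ) → ℝ}
    (hA : ∀ v, HasSum (fun j => g (translate j v) - g (translate j (Function.update v 0 0))) (A v))
    (v : ℤ → ℝ) :
    HasSum (fun j => increment μ g j v) (tailMean μ 0 A v - tailMean μ 1 A v) := by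
  have hupd : Measurable fun v : ℤ → ℝ => Function.update v 0 0 := by
    refine measurable_pi_lambda _ fun i => ?_
    by_cases h : i = 0
    · subst h
      simp
    · simpa [Function.update_of_ne h] using measurable_pi_apply i
  have hb : ∀ j : ℤ, BddMeas fun v => g (translate j v) :=
    fun j => hg.bddMeas.comp (measurable_translate j)
  have hb0 : ∀ j : ℤ, BddMeas fun v => g (translate j (Function.update v 0 0)) :=
    fun j => (hb j).comp hupd
  have h1 : ∀ m : ℤ, HasSum (fun j => tailMean μ m
      (fun v => g (translate j v) - g (translate j (Function.update v 0 0))) v)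
      (tailMean μ m A v) := by
    intro m
    refine hasSum_integral_of_dominated_convergence (fun j _ => 32 * K * decay j)
      (fun j => (((hb j).sub (hb0 j)).comp_mix m v).measurable.aestronglyMeasurable)
      (fun j => Eventually.of_forall fun w => ?_)
      (Eventually.of_forall fun w => summable_decay.mul_left _) (integrable_const _)
      (Eventually.of_forall fun w => hA _)
    exact hg.abs_sub_translate_le (fun i hi => (Function.update_of_ne hi _ _).symm) j
  have h2 := (h1 0).sub (h1 1)
  refine h2.congr_fun fun j => ?_
  rw [tailMean_sub (hb j) (hb0 j), tailMean_sub (hb j) (hb0 j), increment]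
  have h3 : tailMean μ 0 (fun v => g (translate j (Function.update v 0 0))) v
      = tailMean μ 1 (fun v => g (translate j (Function.update v 0 0))) v := by
    simp only [tailMean]
    refine integral_congr_ae (Eventually.of_forall fun w => ?_)
    have : Function.update (mix 0 v w) 0 0 = Function.update (mix 1 v w) 0 0 := by
      funext i
      by_cases hi : i = 0
      · subst hi
        simp
      · rw [Function.update_of_ne hi, Function.update_of_ne hi, mix_zero_eq_mix_one_of_ne v w hi]
    simp only [this]
  rw [h3]
  ring

/-- Squaring the sum of the increments gives their double series, whose integral is already known to
be the sum of the covariances. -/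
theorem integral_sq_tailMean_sub (hg : SiteLocal K g) {A : (ℤ → ℝ) → ℝ}
    (hA : ∀ v, HasSum (fun j => g (translate j v) - g (translate j (Function.update v 0 0))) (A v)) :
    HasSum (fun l : ℤ => cov[g, fun v => g (translate l v); iidLaw μ])
      (∫ v, (tailMean μ 0 A v - tailMean μ 1 A v) ^ 2 ∂(iidLaw μ)) := by
  have hsq : ∀ v, HasSum (fun q : ℤ × ℤ => increment μ g q.1 v * increment μ g q.2 v)
      ((tailMean μ 0 A v - tailMean μ 1 A v) ^ 2) := by
    intro v
    have h := hg.hasSum_increment (μ := μ) hA v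
    rw [sq]
    refine h.mul h (Summable.of_norm_bounded (summable_bound_mul hg.nonneg) fun q => ?_)
    rw [norm_mul]
    exact mul_le_mul (hg.abs_increment_le q.1 v) (hg.abs_increment_le q.2 v) (abs_nonneg _)
      ((abs_nonneg _).trans (hg.abs_increment_le (μ := μ) q.1 v))
  have hint := hasSum_integral_of_dominated_convergence (μ := iidLaw μ)
    (F := fun (q : ℤ × ℤ) v => increment μ g q.1 v * increment μ g q.2 v)
    (fun q _ => (32 * K * decay q.1) * (32 * K * decay q.2))
    (fun q => ((hg.bddMeas_increment q.1).mul
      (hg.bddMeas_increment q.2)).measurable.aestronglyMeasurable)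
    (fun q => Eventually.of_forall fun v => by
      rw [norm_mul]
      exact mul_le_mul (hg.abs_increment_le q.1 v) (hg.abs_increment_le q.2 v) (abs_nonneg _)
        ((abs_nonneg _).trans (hg.abs_increment_le (μ := μ) q.1 v)))
    (Eventually.of_forall fun v => summable_bound_mul hg.nonneg) (integrable_const _)
    (Eventually.of_forall hsq)
  rw [← hint.tsum_eq]
  exact hg.hasSum_covariance

end SiteLocal

end

end Anderson

namespace Anderson

noncomputable section

/-! ### Vanishing of the limiting variance -/

variable {μ : Measure ℝ} [IsProbabilityMeasure μ]

/-- A product neighbourhood of a configuration with all coordinates in the support restricts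
finitely many coordinates and so has positive measure; a continuous function vanishing almost
everywhere must vanish there. -/
theorem eq_zero_of_ae_eq_zero_of_mem_support {F : (ℤ → ℝ) → ℝ} (hF : Continuous F)
    (h0 : ∀ᵐ v ∂(iidLaw μ), F v = 0) {v : ℤ → ℝ} (hv : ∀ i, v i ∈ μ.support) : F v = 0 := by
  by_contra hne
  have hopen : IsOpen {x | F x ≠ 0} := isOpen_ne_fun hF continuous_const
  obtain ⟨I, u, hu, hsub⟩ := isOpen_pi_iff.1 hopen v hne
  have hm : ∀ i, MeasurableSet (if i ∈ I then u i else Set.univ) := by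
    intro i
    by_cases h : i ∈ I
    · simpa [h] using (hu i h).1.measurableSet
    · simp [h]
  have h1 : iidLaw μ (Set.pi I u) = ∏ i ∈ I, μ (u i) :=
    Measure.infinitePi_pi _ fun i hi => (hu i hi).1.measurableSet
  have h2 : ∏ i ∈ I, μ (u i) ≠ 0 := by
    refine Finset.prod_ne_zero_iff.2 fun i hi => ?_
    exact ((Measure.mem_support_iff_forall _).1 (hv i) _ ((hu i hi).1.mem_nhds (hu i hi).2)).ne'
  have h3 : iidLaw μ (Set.pi I u) = 0 := by
    refine measure_mono_null hsub ?_
    simpa [ae_iff] using h0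
  exact h2 (h1 ▸ h3)

theorem ae_mem_support (i : ℤ) : ∀ᵐ w ∂(iidLaw μ), w i ∈ μ.support := by
  have h := (measurePreserving_eval_infinitePi (fun _ : ℤ => μ) i).quasiMeasurePreserving
  exact h.ae (p := fun x => x ∈ μ.support) Measure.support_mem_ae

theorem continuous_mix_left (m : ℤ) (w : ℤ → ℝ) : Continuous fun v => mix m v w := by
  refine continuous_pi fun i => ?_
  by_cases h : m ≤ i
  · simpa only [mix_of_le h] using continuous_apply i
  · simpa only [mix_of_lt (not_le.1 h)] using continuous_const

theorem continuous_tailMean {f : (ℤ → ℝ) → ℝ} (hf : BddMeas f) (hc : Continuous f) (m : ℤ) :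
    Continuous (tailMean μ m f) := by
  obtain ⟨C, hC⟩ := hf.bdd
  exact continuous_of_dominated (bound := fun _ => C)
    (fun v => (hf.comp_mix m v).measurable.aestronglyMeasurable)
    (fun v => Eventually.of_forall fun w => hC _) (integrable_const _)
    (Eventually.of_forall fun w => hc.comp (continuous_mix_left m w))

theorem tailMean_tailMean {f : (ℤ → ℝ) → ℝ} (hf : BddMeas f) {m n : ℤ} (hmn : m ≤ n)
    (v : ℤ → ℝ) : tailMean μ n (tailMean μ m f) v = tailMean μ n f v := by
  have hfn := hf.comp_mix n v
  have hmm : ∀ w w', mix m (mix n v w) w' = mix n v (mix m w w') := by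
    intro w w'
    funext i
    by_cases h1 : n ≤ i
    · rw [mix_of_le (by omega), mix_of_le h1, mix_of_le h1]
    · rw [mix_of_lt (not_le.1 h1) v]
      by_cases h2 : m ≤ i
      · rw [mix_of_le h2, mix_of_le h2, mix_of_lt (not_le.1 h1)]
      · rw [mix_of_lt (not_le.1 h2), mix_of_lt (not_le.1 h2)]
  have hi : Integrable (fun z : (ℤ → ℝ) × (ℤ → ℝ) => f (mix n v (mix m z.1 z.2)))
      ((iidLaw μ).prod (iidLaw μ)) := by
    obtain ⟨C, hC⟩ := hfn.bdd
    exact Integrable.of_bound (hfn.measurable.comp (measurable_mix m)).aestronglyMeasurable C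
      (Eventually.of_forall fun z => hC _)
  have h1 : tailMean μ n f v
      = ∫ x, f (mix n v x) ∂(((iidLaw μ).prod (iidLaw μ)).map fun z => mix m z.1 z.2) := by
    rw [map_mix, tailMean]
  rw [h1, integral_map (measurable_mix m).aemeasurable hfn.measurable.aestronglyMeasurable,
    integral_prod _ hi]
  simp only [tailMean, hmm]

theorem mix_update {m k : ℤ} (h : m ≤ k) (v w : ℤ → ℝ) (s : ℝ) :
    mix m (Function.update v k s) w = Function.update (mix m v w) k s := by
  funext i
  by_cases hi : i = k
  · subst hi
    rw [mix_of_le h, Function.update_self, Function.update_self]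
  · rw [Function.update_of_ne hi]
    by_cases hm : m ≤ i
    · rw [mix_of_le hm, mix_of_le hm, Function.update_of_ne hi]
    · rw [mix_of_lt (not_le.1 hm), mix_of_lt (not_le.1 hm)]

theorem translate_update (m : ℤ) (v : ℤ → ℝ) (s : ℝ) :
    translate m (Function.update v m s) = Function.update (translate m v) 0 s := by
  funext i
  by_cases hi : i = 0
  · subst hi
    rw [translate, zero_add, Function.update_self, Function.update_self]
  · rw [translate, Function.update_of_ne (by omega), Function.update_of_ne hi, translate]

namespace SiteLocal

variable {K : ℝ} {g : (ℤ → ℝ) → ℝ} {A : (ℤ → ℝ) → ℝ}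

theorem continuous_siteSum (hg : SiteLocal K g) (hgc : Continuous g)
    (hA : ∀ v, HasSum (fun j => g (translate j v) - g (translate j (Function.update v 0 0))) (A v)) :
    Continuous A := by
  have hupd : Continuous fun v : ℤ → ℝ => Function.update v 0 0 :=
    continuous_id.update 0 continuous_const
  have h1 : A = fun v => ∑' j, (g (translate j v) - g (translate j (Function.update v 0 0))) :=
    funext fun v => (hA v).tsum_eq.symm
  rw [h1]
  refine continuous_tsum (fun j => ?_) (summable_decay.mul_left (32 * K)) fun j v => ?_
  · exact (hgc.comp (continuous_translate j)).sub (hgc.comp ((continuous_translate j).comp hupd))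
  · exact hg.abs_sub_translate_le (fun i hi => (Function.update_of_ne hi _ _).symm) j

theorem bddMeas_siteSum (hg : SiteLocal K g) (hgc : Continuous g)
    (hA : ∀ v, HasSum (fun j => g (translate j v) - g (translate j (Function.update v 0 0))) (A v)) :
    BddMeas A := by
  refine ⟨(hg.continuous_siteSum hgc hA).measurable, ∑' j, 32 * K * decay j, fun v => ?_⟩
  rw [← (hA v).tsum_eq, ← Real.norm_eq_abs]
  exact tsum_of_norm_bounded (summable_decay.mul_left (32 * K)).hasSum fun j =>
    hg.abs_sub_translate_le (fun i hi => (Function.update_of_ne hi _ _).symm) j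

theorem hasSum_translate
    (hA : ∀ v, HasSum (fun j => g (translate j v) - g (translate j (Function.update v 0 0))) (A v))
    (m : ℤ) (v : ℤ → ℝ) :
    HasSum (fun j => g (translate j v) - g (translate j (Function.update v m 0)))
      (A (translate m v)) := by
  have h := hA (translate m v)
  rw [← translate_update] at h
  simp only [translate_translate] at h
  exact (Equiv.addRight m).hasSum_iff.1 h

/-- Formally `A x = Φ x - Φ (x with x 0 = 0)`, with `Φ` the divergent sum of all translates of `g`.
Both sides are the same second difference of `Φ` in the sites `0` and `m`, and the identity holds
term by term. -/
theorem siteSum_cocycle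
    (hA : ∀ v, HasSum (fun j => g (translate j v) - g (translate j (Function.update v 0 0))) (A v))
    {m : ℤ} (hm : m ≠ 0) (x : ℤ → ℝ) (s : ℝ) :
    A x - A (Function.update x m s)
      = (A (translate m x) - A (translate m (Function.update x m s)))
        - (A (translate m (Function.update x 0 0))
          - A (translate m (Function.update (Function.update x 0 0) m s))) := by
  have h1 := (hA x).sub (hA (Function.update x m s))
  have h2 := ((hasSum_translate hA m x).sub (hasSum_translate hA m (Function.update x m s))).sub
    ((hasSum_translate hA m (Function.update x 0 0)).sub
      (hasSum_translate hA m (Function.update (Function.update x 0 0) m s)))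
  refine h1.unique (h2.congr_fun fun j => ?_)
  rw [Function.update_idem, Function.update_idem, Function.update_comm hm]
  ring

/-- Vanishing variance makes the averages of `A` at `0` and `1` coincide, and since `0` may be
inserted at the origin both vanish. The cocycle identity shows that averaging over one site fewer
changes nothing, so every average of `A` vanishes; these averages converge to `A`. -/
theorem siteSum_eq_zero (hg : SiteLocal K g) (hgc : Continuous g)
    (hA : ∀ v, HasSum (fun j => g (translate j v) - g (translate j (Function.update v 0 0))) (A v))
    (h0 : (0 : ℝ) ∈ μ.support)
    (hvar : ∫ v, (tailMean μ 0 A v - tailMean μ 1 A v) ^ 2 ∂(iidLaw μ) = 0)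
    {v : ℤ → ℝ} (hv : ∀ i, v i ∈ μ.support) : A v = 0 := by
  have hAb := hg.bddMeas_siteSum hgc hA
  have hAc := hg.continuous_siteSum hgc hA
  have hupd : ∀ {v : ℤ → ℝ}, (∀ i, v i ∈ μ.support) → ∀ (k : ℤ) {s : ℝ}, s ∈ μ.support →
      ∀ i, Function.update v k s i ∈ μ.support := by
    intro v hv k s hs i
    by_cases hi : i = k
    · subst hi
      simpa using hs
    · simpa [Function.update_of_ne hi] using hv i
  have hA0 : ∀ v : ℤ → ℝ, v 0 = 0 → A v = 0 := by
    intro v hv0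
    have h1 : Function.update v 0 0 = v := by
      conv_lhs => rw [← hv0]
      exact Function.update_eq_self 0 v
    have h2 := hA v
    rw [h1] at h2
    exact h2.unique (by simp)
  -- The equality holds almost everywhere, and continuity extends it to every configuration with
  -- values in the support.
  have hdiff : ∀ {v : ℤ → ℝ}, (∀ i, v i ∈ μ.support) → tailMean μ 0 A v = tailMean μ 1 A v := by
    intro v hv
    have hc : Continuous fun v => tailMean μ 0 A v - tailMean μ 1 A v :=
      (continuous_tailMean hAb hAc 0).sub (continuous_tailMean hAb hAc 1)
    have hb := (hAb.tailMean (μ := μ) 0).sub (hAb.tailMean (μ := μ) 1)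
    have hae : ∀ᵐ v ∂(iidLaw μ), tailMean μ 0 A v - tailMean μ 1 A v = 0 := by
      have hi : Integrable (fun v => (tailMean μ 0 A v - tailMean μ 1 A v) ^ 2) (iidLaw μ) := by
        simpa only [sq] using (hb.mul hb).integrable (iidLaw μ)
      have := (integral_eq_zero_iff_of_nonneg (fun v => sq_nonneg _) hi).1 hvar
      filter_upwards [this] with v hv
      exact pow_eq_zero_iff (two_ne_zero) |>.1 hv
    exact sub_eq_zero.1 (eq_zero_of_ae_eq_zero_of_mem_support hc hae hv)
  -- The average at `1` ignores the value at the origin, which may therefore be replaced by `0`. It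
  -- then equals the average at `0`, where `A` vanishes identically.
  have hE1 : ∀ {v : ℤ → ℝ}, (∀ i, v i ∈ μ.support) → tailMean μ 1 A v = 0 := by
    intro v hv
    have h1 : tailMean μ 1 A v = tailMean μ 1 A (Function.update v 0 0) :=
      tailMean_congr A fun i hi => (Function.update_of_ne (by omega) _ _).symm
    rw [h1, ← hdiff (hupd hv 0 h0), tailMean]
    have : ∀ w, A (mix 0 (Function.update v 0 0) w) = 0 := fun w =>
      hA0 _ (by rw [mix_of_le le_rfl, Function.update_self])
    simp [this]
  have hE0 : ∀ {v : ℤ → ℝ}, (∀ i, v i ∈ μ.support) → tailMean μ 0 A v = 0 :=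
    fun hv => (hdiff hv).trans (hE1 hv)
  -- The vanishing of the average at `0`, translated to `m`.
  have hEm : ∀ (m : ℤ) {v : ℤ → ℝ}, (∀ i, v i ∈ μ.support) →
      ∫ w, A (translate m (mix m v w)) ∂(iidLaw μ) = 0 := by
    intro m v hv
    have h1 := tailMean_translate (μ := μ) hAb m m v
    rw [sub_self, hE0 (v := translate m v) fun i => hv _] at h1
    exact h1
  -- The cocycle identity writes the dependence on the value at `m` through four averages of `A ∘
  -- translate m`, all of which vanish.
  have hindep : ∀ {m : ℤ}, m < 0 → ∀ {v : ℤ → ℝ}, (∀ i, v i ∈ μ.support) → ∀ {s : ℝ},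
      s ∈ μ.support → tailMean μ m A (Function.update v m s) = tailMean μ m A v := by
    intro m hm v hv s hs
    have hAm := hAb.comp (measurable_translate m)
    have hi : ∀ v, Integrable (fun w => A (translate m (mix m v w))) (iidLaw μ) :=
      fun v => (hAm.comp_mix m v).integrable _
    have hi' : ∀ v v', Integrable (fun w => A (translate m (mix m v w))
        - A (translate m (mix m v' w))) (iidLaw μ) := fun v v' => (hi v).sub (hi v')
    have h1 : tailMean μ m A v - tailMean μ m A (Function.update v m s) = 0 := by
      rw [tailMean, tailMean, ← integral_sub ((hAb.comp_mix _ _).integrable _)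
        ((hAb.comp_mix _ _).integrable _)]
      have h2 : ∀ w, A (mix m v w) - A (mix m (Function.update v m s) w)
          = (A (translate m (mix m v w)) - A (translate m (mix m (Function.update v m s) w)))
            - (A (translate m (mix m (Function.update v 0 0) w))
              - A (translate m (mix m (Function.update (Function.update v 0 0) m s) w))) := by
        intro w
        rw [mix_update le_rfl, siteSum_cocycle hA hm.ne, mix_update le_rfl, mix_update hm.le]
      simp only [h2]
      rw [integral_sub (hi' _ _) (hi' _ _), integral_sub (hi _) (hi _), integral_sub (hi _) (hi _),
        hEm m hv, hEm m (hupd hv m hs), hEm m (hupd hv 0 h0), hEm m (hupd (hupd hv 0 h0) m hs)]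
      simp
    linarith
  have hall : ∀ (d : ℕ) {v : ℤ → ℝ}, (∀ i, v i ∈ μ.support) → tailMean μ (1 - d) A v = 0 := by
    intro d
    induction d with
    | zero =>
      intro v hv
      simpa using hE1 hv
    | succ d ih =>
      intro v hv
      -- Independence of the value at `m` requires `m < 0`; the step to `m = 0` has already been
      -- made.
      rcases Nat.eq_zero_or_pos d with rfl | hd
      · simpa using hE0 hv
      have hm : (1 : ℤ) - (d + 1 : ℕ) = (1 - d) - 1 := by push_cast; ring
      rw [hm, ← ih hv, ← tailMean_tailMean hAb (by omega : (1 - (d : ℤ)) - 1 ≤ 1 - d)]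
      -- The newly exposed site almost surely carries a value in the support, where it has no
      -- influence. The tower property then identifies consecutive averages.
      have h1 : ∀ᵐ w ∂(iidLaw μ), tailMean μ (1 - (d : ℤ) - 1) A (mix (1 - (d : ℤ)) v w)
          = tailMean μ (1 - (d : ℤ) - 1) A v := by
        filter_upwards [ae_mem_support (μ := μ) (1 - (d : ℤ) - 1)] with w hw
        rw [← hindep (by omega) hv hw]
        refine tailMean_congr A fun i hi => ?_
        by_cases hi' : i = 1 - (d : ℤ) - 1
        · subst hi'
          rw [mix_of_lt (by omega), Function.update_self]
        · rw [mix_of_le (by omega), Function.update_of_ne hi']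
      change _ = ∫ w, tailMean μ (1 - (d : ℤ) - 1) A (mix (1 - (d : ℤ)) v w) ∂(iidLaw μ)
      rw [integral_congr_ae h1]
      simp
  obtain ⟨C, hC⟩ := hAb.bdd
  -- As the averaged half-line recedes, the mixed configurations converge to `v` in every
  -- coordinate.
  have hlim : Tendsto (fun d : ℕ => tailMean μ (1 - (d : ℤ)) A v) atTop
      (𝓝 (∫ _, A v ∂(iidLaw μ))) := by
    refine tendsto_integral_of_dominated_convergence (fun _ => C)
      (fun d => (hAb.comp_mix _ v).measurable.aestronglyMeasurable) (integrable_const _)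
      (fun d => Eventually.of_forall fun w => hC _) (Eventually.of_forall fun w => ?_)
    refine (hAc.tendsto v).comp (tendsto_pi_nhds.2 fun i => ?_)
    refine tendsto_const_nhds.congr' ?_
    filter_upwards [eventually_ge_atTop (1 + i.natAbs)] with d hd
    rw [mix_of_le (by omega)]
  simp only [fun d : ℕ => hall d hv] at hlim
  have := tendsto_nhds_unique tendsto_const_nhds hlim
  simpa using this.symm

end SiteLocal

end

end Anderson

namespace Anderson

noncomputable section

/-! ### The resolvent -/

/-- The resolvent `(H - z)⁻¹`. -/
def green (V : ℤ → ℝ) (z : ℂ) : Ell2 →L[ℂ] Ell2 := cfc (fun x : ℂ => (x - z)⁻¹) (schrodinger V)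

section Resolvent

variable {V : ℤ → ℝ} {z : ℂ}

theorem isStarNormal_schrodinger (V : ℤ → ℝ) : IsStarNormal (schrodinger V) :=
  (isSelfAdjoint_schrodinger V).isStarNormal

theorem le_norm_sub_of_mem_spectrum {x : ℂ} (hx : x ∈ spectrum ℂ (schrodinger V)) :
    z.im ≤ ‖x - z‖ := by
  have h := (isSelfAdjoint_schrodinger V).im_eq_zero_of_mem_spectrum hx
  have h1 := Complex.abs_im_le_norm (x - z)
  rw [Complex.sub_im, h, zero_sub, abs_neg] at h1
  exact (le_abs_self _).trans h1

theorem sub_ne_zero_of_mem_spectrum (hz : 0 < z.im) {x : ℂ}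
    (hx : x ∈ spectrum ℂ (schrodinger V)) : x - z ≠ 0 :=
  norm_pos_iff.1 (hz.trans_le (le_norm_sub_of_mem_spectrum hx))

theorem continuousOn_inv_sub (hz : 0 < z.im) :
    ContinuousOn (fun x : ℂ => (x - z)⁻¹) (spectrum ℂ (schrodinger V)) :=
  (continuous_id.sub continuous_const).continuousOn.inv₀ fun _ hx => sub_ne_zero_of_mem_spectrum hz hx

theorem cfc_sub_const (V : ℤ → ℝ) (z : ℂ) :
    cfc (fun x : ℂ => x - z) (schrodinger V) = schrodinger V - z • 1 := by
  have := isStarNormal_schrodinger V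
  rw [cfc_sub (fun x => x) (fun _ => z) (schrodinger V), cfc_id' ℂ (schrodinger V),
    cfc_const z (schrodinger V), Algebra.algebraMap_eq_smul_one]

theorem green_mul_sub (V : ℤ → ℝ) (hz : 0 < z.im) : green V z * (schrodinger V - z • 1) = 1 := by
  have := isStarNormal_schrodinger V
  rw [← cfc_sub_const, green, ← cfc_mul _ _ (schrodinger V) (continuousOn_inv_sub hz)]
  rw [cfc_congr (g := fun _ => (1 : ℂ)) fun x hx => ?_, cfc_const_one ℂ (schrodinger V)]
  exact inv_mul_cancel₀ (sub_ne_zero_of_mem_spectrum hz hx)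

theorem sub_mul_green (V : ℤ → ℝ) (hz : 0 < z.im) : (schrodinger V - z • 1) * green V z = 1 := by
  have := isStarNormal_schrodinger V
  rw [← cfc_sub_const, green, ← cfc_mul (fun x => x - z) _ (schrodinger V)
    (continuous_id.sub continuous_const).continuousOn (continuousOn_inv_sub hz)]
  rw [cfc_congr (g := fun _ => (1 : ℂ)) fun x hx => ?_, cfc_const_one ℂ (schrodinger V)]
  exact mul_inv_cancel₀ (sub_ne_zero_of_mem_spectrum hz hx)

theorem norm_green_le (V : ℤ → ℝ) (hz : 0 < z.im) : ‖green V z‖ ≤ z.im⁻¹ := by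
  refine norm_cfc_le (by positivity) fun x hx => ?_
  rw [norm_inv]
  exact inv_anti₀ hz (le_norm_sub_of_mem_spectrum hx)

theorem norm_entry_green_le (V : ℤ → ℝ) (hz : 0 < z.im) (j k : ℤ) :
    ‖entry (green V z) j k‖ ≤ z.im⁻¹ := (norm_entry_le _ _ _).trans (norm_green_le V hz)

theorem norm_entry_green_sq_le (V : ℤ → ℝ) (hz : 0 < z.im) (j k : ℤ) :
    ‖entry (green V z * green V z) j k‖ ≤ z.im⁻¹ * z.im⁻¹ :=
  (norm_entry_le _ _ _).trans ((norm_mul_le _ _).trans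
    (mul_le_mul (norm_green_le V hz) (norm_green_le V hz) (norm_nonneg _) (by positivity)))

/-- The real part of a function with a pole of order at most two at `z`. -/
def poleFun (a b z : ℂ) (x : ℝ) : ℝ := (a * (x - z)⁻¹ + b * ((x - z)⁻¹ * (x - z)⁻¹)).re

theorem diag_poleFun (V : ℤ → ℝ) (hz : 0 < z.im) (a b : ℂ) (j : ℤ) :
    diag (poleFun a b z) V j
      = (a * entry (green V z) j j + b * entry (green V z * green V z) j j).re := by
  have hn := isStarNormal_schrodinger V
  set H := schrodinger V with hH
  set h : ℂ → ℂ := fun x => a * (x - z)⁻¹ + b * ((x - z)⁻¹ * (x - z)⁻¹) with hh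
  have hc := continuousOn_inv_sub (V := V) hz
  have hhc : ContinuousOn h (spectrum ℂ H) :=
    (continuousOn_const.mul hc).add (continuousOn_const.mul (hc.mul hc))
  have h1 : cfc h H = a • green V z + b • (green V z * green V z) := by
    rw [hh, cfc_add (a := H) (fun x => a * (x - z)⁻¹) (fun x => b * ((x - z)⁻¹ * (x - z)⁻¹)) (continuousOn_const.mul hc) (continuousOn_const.mul (hc.mul hc)),
      cfc_const_mul a _ H hc, cfc_const_mul b (fun x => (x - z)⁻¹ * (x - z)⁻¹) H (hc.mul hc), cfc_mul _ _ H hc hc, green]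
  -- On the real spectrum `poleFun` is the real part of `h`, so the operator is half the sum of
  -- `h(H)` and its adjoint.
  have h2 : cfc (poleFun a b z) H = (1 / 2 : ℂ) • (cfc h H + star (cfc h H)) := by
    rw [cfc_real_eq_complex (poleFun a b z) (isSelfAdjoint_schrodinger V), ← cfc_star,
      ← cfc_add (a := H) h (fun x => star (h x)) hhc (hhc.star),
      ← cfc_smul (1 / 2 : ℂ) (fun x => h x + star (h x)) H (hhc.add hhc.star)]
    refine cfc_congr fun x hx => ?_
    have hx' : ((x.re : ℝ) : ℂ) = x :=
      ((isSelfAdjoint_schrodinger V).mem_spectrum_eq_re hx).symm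
    have h3 : poleFun a b z x.re = (h x).re := by
      rw [poleFun, hx']
    simp only [h3]
    have h4 := Complex.add_conj (h x)
    rw [smul_eq_mul, Complex.star_def, h4]
    push_cast
    ring
  have h3 : entry (star (cfc h H)) j j = (starRingEnd ℂ) (entry (cfc h H) j j) :=
    entry_adjoint (cfc h H) j j
  have h4 : entry (cfc (poleFun a b z) H) j j
      = (1 / 2) * (entry (cfc h H) j j + (starRingEnd ℂ) (entry (cfc h H) j j)) := by
    rw [h2, ← h3, ← entry_add]
    exact (entryCLM j j).map_smul _ _
  have h5 : entry (cfc h H) j j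
      = a * entry (green V z) j j + b * entry (green V z * green V z) j j := by
    rw [h1, entry_add]
    congr 1
    · exact (entryCLM j j).map_smul _ _
    · exact (entryCLM j j).map_smul _ _
  rw [diag, h4, Complex.add_conj, h5]
  simp

end Resolvent

/-! ### Rank one perturbations -/

/-- The projection onto the `k`-th basis vector. -/
def proj (k : ℤ) : Ell2 →L[ℂ] Ell2 := (innerSL ℂ (basisVec k)).smulRight (basisVec k)

theorem proj_apply (k : ℤ) (u : Ell2) : proj k u = (u k) • basisVec k := by
  change (inner ℂ (basisVec k) u : ℂ) • basisVec k = _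
  rw [inner_basisVec_left]

theorem entry_mul_proj_mul (A B : Ell2 →L[ℂ] Ell2) (i j k : ℤ) :
    entry (A * proj k * B) i j = entry A i k * entry B k j := by
  rw [entry_eq_apply]
  change A (proj k (B (basisVec j))) i = _
  rw [proj_apply, map_smul, coe_smul, ← entry_eq_apply, ← entry_eq_apply, mul_comm]

theorem schrodinger_update_site {V : ℤ → ℝ} (hV : ∃ R, ∀ j, |V j| ≤ R) {k : ℤ} (hk : V k = 0)
    (t : ℝ) : schrodinger (Function.update V k t) = schrodinger V + (t : ℂ) • proj k := by
  ext u
  refine ell2_ext fun j => ?_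
  rw [add_apply, coe_add, schrodinger_apply hV,
    schrodinger_apply (exists_abs_update_le hV k t), smul_apply, proj_apply,
    coe_smul, coe_smul, basisVec_apply]
  by_cases h : j = k
  · subst h
    simp [hk]
  · simp [h]

section RankOne

variable {V : ℤ → ℝ} {z : ℂ} {k : ℤ}

/-- The second resolvent identity. -/
theorem green_update_right (hV : ∃ R, ∀ j, |V j| ≤ R) (hk : V k = 0) (hz : 0 < z.im) (t : ℝ) :
    green (Function.update V k t) z
      = green V z - (t : ℂ) • (green V z * proj k * green (Function.update V k t) z) := by
  have h1 := green_mul_sub V hz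
  have h2 := sub_mul_green (Function.update V k t) hz
  have h3 : schrodinger (Function.update V k t) - z • 1
      = (schrodinger V - z • 1) + (t : ℂ) • proj k := by
    rw [schrodinger_update_site hV hk]
    abel
  rw [h3] at h2
  have h4 : green V z * (((schrodinger V - z • 1) + (t : ℂ) • proj k)
      * green (Function.update V k t) z) = green V z := by rw [h2, mul_one]
  rw [add_mul, mul_add, ← mul_assoc, h1, one_mul, smul_mul_assoc, mul_smul_comm, ← mul_assoc] at h4
  exact eq_sub_of_add_eq h4

theorem entry_green_update (hV : ∃ R, ∀ j, |V j| ≤ R) (hk : V k = 0) (hz : 0 < z.im) (t : ℝ)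
    (i j : ℤ) : entry (green (Function.update V k t) z) i j
      = entry (green V z) i j
        - t * (entry (green V z) i k * entry (green (Function.update V k t) z) k j) := by
  conv_lhs => rw [green_update_right hV hk hz t]
  rw [entry_sub, ← entry_mul_proj_mul]
  congr 1
  exact (entryCLM i j).map_smul _ _

/-- The perturbed resolvent provides an explicit inverse of the Krein denominator. Nonvanishing and
the bound `1 + |t| / Im z` follow at once. -/
theorem one_add_mul_one_sub (hV : ∃ R, ∀ j, |V j| ≤ R) (hk : V k = 0) (hz : 0 < z.im) (t : ℝ) :
    (1 + t * entry (green V z) k k) * (1 - t * entry (green (Function.update V k t) z) k k) = 1 := by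
  have h := entry_green_update hV hk hz t k k
  linear_combination (t : ℂ) * (-h)

theorem one_add_ne_zero (hV : ∃ R, ∀ j, |V j| ≤ R) (hk : V k = 0) (hz : 0 < z.im) (t : ℝ) :
    1 + t * entry (green V z) k k ≠ 0 :=
  left_ne_zero_of_mul_eq_one (one_add_mul_one_sub hV hk hz t)

theorem norm_inv_one_add_le (hV : ∃ R, ∀ j, |V j| ≤ R) (hk : V k = 0) (hz : 0 < z.im) (t : ℝ) :
    ‖(1 + t * entry (green V z) k k)⁻¹‖ ≤ 1 + |t| * z.im⁻¹ := by
  rw [inv_eq_of_mul_eq_one_right (one_add_mul_one_sub hV hk hz t)]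
  refine (norm_sub_le _ _).trans ?_
  rw [norm_one, norm_mul, Complex.norm_real, Real.norm_eq_abs]
  gcongr
  exact norm_entry_green_le _ hz k k

theorem entry_green_update_right (hV : ∃ R, ∀ j, |V j| ≤ R) (hk : V k = 0) (hz : 0 < z.im) (t : ℝ)
    (j : ℤ) : entry (green (Function.update V k t) z) k j
      = entry (green V z) k j / (1 + t * entry (green V z) k k) := by
  rw [eq_div_iff (one_add_ne_zero hV hk hz t)]
  linear_combination entry_green_update hV hk hz t k j

theorem entry_green_update_eq (hV : ∃ R, ∀ j, |V j| ≤ R) (hk : V k = 0) (hz : 0 < z.im) (t : ℝ)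
    (i j : ℤ) : entry (green (Function.update V k t) z) i j
      = entry (green V z) i j - t / (1 + t * entry (green V z) k k)
        * (entry (green V z) i k * entry (green V z) k j) := by
  rw [entry_green_update hV hk hz, entry_green_update_right hV hk hz]
  ring

theorem entry_green_sq_update (hV : ∃ R, ∀ j, |V j| ≤ R) (hk : V k = 0) (hz : 0 < z.im) (t : ℝ)
    (i j : ℤ) :
    entry (green (Function.update V k t) z * green (Function.update V k t) z) i j
      = entry (green V z * green V z) i j
        - t * (entry (green V z * green V z) i k * entry (green (Function.update V k t) z) k j)
        - t * (entry (green V z) i k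
          * entry (green (Function.update V k t) z * green (Function.update V k t) z) k j) := by
  set G := green V z
  set G' := green (Function.update V k t) z with hG'
  have h0 : G' = G - (t : ℂ) • (G * proj k * G') := green_update_right hV hk hz t
  have h1 : G' * G' = G * G - (t : ℂ) • (G * G * proj k * G') - (t : ℂ) • (G * proj k * (G' * G')) := by
    have h1 : G' * G' = G * G' - (t : ℂ) • (G * proj k * G') * G' := by
      rw [← sub_mul, ← h0]
    have h2 : G * G' = G * G - G * ((t : ℂ) • (G * proj k * G')) := by
      rw [← mul_sub, ← h0]
    refine h1.trans ?_
    rw [h2, mul_smul_comm, smul_mul_assoc]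
    simp only [mul_assoc]
  have h2 : ∀ B : Ell2 →L[ℂ] Ell2, entry ((t : ℂ) • B) i j = t * entry B i j :=
    fun B => (entryCLM i j).map_smul _ _
  conv_lhs => rw [h1]
  rw [entry_sub, entry_sub, h2, h2, entry_mul_proj_mul, entry_mul_proj_mul]

theorem entry_green_sq_update_self (hV : ∃ R, ∀ j, |V j| ≤ R) (hk : V k = 0) (hz : 0 < z.im)
    (t : ℝ) (j : ℤ) :
    entry (green (Function.update V k t) z * green (Function.update V k t) z) k j
      = (entry (green V z * green V z) k j - t * (entry (green V z * green V z) k k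
        * entry (green (Function.update V k t) z) k j)) / (1 + t * entry (green V z) k k) := by
  rw [eq_div_iff (one_add_ne_zero hV hk hz t)]
  linear_combination entry_green_sq_update hV hk hz t k j

theorem entry_green_sq_update_diag (hV : ∃ R, ∀ j, |V j| ≤ R) (hk : V k = 0) (hz : 0 < z.im)
    (t : ℝ) :
    entry (green (Function.update V k t) z * green (Function.update V k t) z) k k
      = entry (green V z * green V z) k k / (1 + t * entry (green V z) k k) ^ 2 := by
  have h := one_add_ne_zero hV hk hz t
  rw [entry_green_sq_update_self hV hk hz, entry_green_update_right hV hk hz]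
  field_simp
  ring

end RankOne

/-! ### The free resolvent -/

/-- The sequence `j ↦ c |j - k|`. -/
def radial (c : ℕ → ℂ) (hc : Summable fun n => ‖c n‖ ^ 2) (k : ℤ) : Ell2 :=
  (⟨fun j => c (j - k).natAbs, by
    refine (memℓp_gen_iff (by norm_num)).2 ?_
    have h : Summable fun d : ℤ => ‖c d.natAbs‖ ^ 2 := by
      refine Summable.of_nat_of_neg ?_ ?_ <;> simpa using hc
    have h2 := (Equiv.subRight k).summable_iff.2 h
    simpa [Function.comp_def] using h2⟩ : ℓ²(ℤ, ℂ))

theorem radial_apply (c : ℕ → ℂ) (hc : Summable fun n => ‖c n‖ ^ 2) (k j : ℤ) :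
    radial c hc k j = c (j - k).natAbs := rfl

/-- The hypotheses are the difference equation `(H₀ - z) c = b` at the centre and away from it;
symmetry reduces both sides of the centre to the same recursion. -/
theorem sub_radial {c b : ℕ → ℂ} (hc : Summable fun n => ‖c n‖ ^ 2)
    (hb : Summable fun n => ‖b n‖ ^ 2) {z : ℂ} (h0 : -2 * c 1 - z * c 0 = b 0)
    (h1 : ∀ m, -c (m + 2) - c m - z * c (m + 1) = b (m + 1)) (k : ℤ) :
    (schrodinger 0 - z • 1) (radial c hc k) = radial b hb k := by
  refine ell2_ext fun j => ?_
  have h2 : (schrodinger 0 - z • 1) (radial c hc k)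
      = schrodinger 0 (radial c hc k) - z • radial c hc k := rfl
  rw [h2, coe_sub, coe_smul, schrodinger_apply ⟨0, by simp⟩]
  simp only [radial_apply, Pi.zero_apply, Complex.ofReal_zero, zero_mul, add_zero]
  rcases lt_trichotomy (j - k) 0 with h | h | h
  · obtain ⟨m, hm⟩ : ∃ m : ℕ, (j - k).natAbs = m + 1 := ⟨(j - k).natAbs - 1, by omega⟩
    have e1 : (j + 1 - k).natAbs = m := by omega
    have e2 : (j - 1 - k).natAbs = m + 2 := by omega
    rw [hm, e1, e2, ← h1 m]
    ring
  · have e0 : (j - k).natAbs = 0 := by omega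
    have e1 : (j + 1 - k).natAbs = 1 := by omega
    have e2 : (j - 1 - k).natAbs = 1 := by omega
    rw [e0, e1, e2, ← h0]
    ring
  · obtain ⟨m, hm⟩ : ∃ m : ℕ, (j - k).natAbs = m + 1 := ⟨(j - k).natAbs - 1, by omega⟩
    have e1 : (j + 1 - k).natAbs = m + 2 := by omega
    have e2 : (j - 1 - k).natAbs = m := by omega
    rw [hm, e1, e2, ← h1 m]

/-- The diagonal entry of the free resolvent at `z = -(ζ + ζ⁻¹)`. -/
def freeDiag (ζ : ℂ) : ℂ := ζ / (1 - ζ ^ 2)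

/-- Data of a point of the upper half plane and its uniformizing parameter. -/
structure Uniformized (z ζ : ℂ) : Prop where
  im_pos : 0 < z.im
  ne_zero : ζ ≠ 0
  norm_lt : ‖ζ‖ < 1
  eq : z = -(ζ + ζ⁻¹)

namespace Uniformized

variable {z ζ : ℂ}

theorem sq_ne (h : Uniformized z ζ) : 1 - ζ ^ 2 ≠ 0 := by
  intro h0
  have h1 : ‖ζ ^ 2‖ = 1 := by rw [← sub_eq_zero.1 h0, norm_one]
  rw [norm_pow] at h1
  have := pow_lt_one₀ (norm_nonneg ζ) h.norm_lt two_ne_zero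
  linarith

theorem freeDiag_ne_zero (h : Uniformized z ζ) : freeDiag ζ ≠ 0 := div_ne_zero h.ne_zero h.sq_ne

theorem summable_geom (h : Uniformized z ζ) (c : ℂ) :
    Summable fun n : ℕ => ‖c * ζ ^ n‖ ^ 2 := by
  have h1 : ‖ζ‖ ^ 2 < 1 := pow_lt_one₀ (norm_nonneg ζ) h.norm_lt two_ne_zero
  have h2 := (summable_geometric_of_lt_one (by positivity) h1).mul_left (‖c‖ ^ 2)
  refine h2.congr fun n => ?_
  rw [norm_mul, norm_pow, mul_pow, ← pow_mul, ← pow_mul, mul_comm 2 n]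

theorem summable_linear_geom (h : Uniformized z ζ) (c e : ℂ) :
    Summable fun n : ℕ => ‖c * (n + e) * ζ ^ n‖ ^ 2 := by
  have h1 : ‖ζ ^ 2‖ < 1 := by
    rw [norm_pow]
    exact pow_lt_one₀ (norm_nonneg ζ) h.norm_lt two_ne_zero
  have s0 := (summable_pow_mul_geometric_of_norm_lt_one 0 h1).norm
  have s2 := (summable_pow_mul_geometric_of_norm_lt_one 2 h1).norm
  refine Summable.of_nonneg_of_le (fun n => by positivity) (fun n => ?_)
    ((s2.mul_left (2 * ‖c‖ ^ 2)).add (s0.mul_left (2 * ‖c‖ ^ 2 * ‖e‖ ^ 2)))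
  simp only [norm_mul, norm_pow, pow_zero, one_mul, Complex.norm_natCast, mul_pow, ← pow_mul]
  have h3 : ‖(n : ℂ) + e‖ ≤ n + ‖e‖ := (norm_add_le _ _).trans (by simp)
  have h4 : ‖(n : ℂ) + e‖ ^ 2 ≤ 2 * (n : ℝ) ^ 2 + 2 * ‖e‖ ^ 2 := by
    have := pow_le_pow_left₀ (norm_nonneg _) h3 2
    nlinarith [sq_nonneg ((n : ℝ) - ‖e‖)]
  have h5 : (0 : ℝ) ≤ ‖c‖ ^ 2 * ‖ζ‖ ^ (2 * n) := by positivity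
  rw [mul_comm n 2]
  nlinarith [mul_le_mul_of_nonneg_left h4 h5]

/-- The decaying geometric sequence solves the difference equation with a point source, and the
resolvent is a left inverse of `H₀ - z`. -/
theorem green_basisVec (h : Uniformized z ζ) (k : ℤ) :
    green 0 z (basisVec k) = radial (fun n => freeDiag ζ * ζ ^ n) (h.summable_geom _) k := by
  have hb : Summable fun n : ℕ => ‖(if n = 0 then 1 else 0 : ℂ)‖ ^ 2 :=
    summable_of_ne_finset_zero (s := {0}) fun n hn => by
      rw [Finset.mem_singleton] at hn
      simp [hn]
  have h1 : basisVec k = radial (fun n => if n = 0 then 1 else 0) hb k := by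
    refine ell2_ext fun j => ?_
    rw [basisVec_apply, radial_apply]
    simp [sub_eq_zero]
  have hs := h.sq_ne
  have hne := h.ne_zero
  have h2 := sub_radial (h.summable_geom (freeDiag ζ)) hb (z := z) (by
    rw [h.eq, freeDiag]
    field_simp
    simp
    ring) (fun m => by
    rw [h.eq, freeDiag]
    field_simp
    simp
    ring) k
  rw [h1, ← h2]
  have h3 := green_mul_sub 0 h.im_pos
  exact congrArg (fun A : Ell2 →L[ℂ] Ell2 => A _) h3

/-- A second application of the resolvent has a geometric source in resonance with the homogeneous
solution; hence the factor linear in the distance. -/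
theorem green_sq_basisVec (h : Uniformized z ζ) (k : ℤ) :
    (green 0 z * green 0 z) (basisVec k)
      = radial (fun n => freeDiag ζ ^ 2 * (n + (1 + 2 * ζ * freeDiag ζ)) * ζ ^ n)
        (h.summable_linear_geom _ _) k := by
  have hs := h.sq_ne
  have hne := h.ne_zero
  have h2 := sub_radial (h.summable_linear_geom (freeDiag ζ ^ 2) (1 + 2 * ζ * freeDiag ζ))
    (h.summable_geom (freeDiag ζ)) (z := z) (by
    rw [h.eq, freeDiag]
    field_simp
    simp
    ring) (fun m => by
    rw [h.eq, freeDiag]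
    field_simp
    push_cast
    ring) k
  have h3 := green_mul_sub 0 h.im_pos
  change green 0 z (green 0 z (basisVec k)) = _
  rw [h.green_basisVec, ← h2]
  exact congrArg (fun A : Ell2 →L[ℂ] Ell2 => A _) h3

theorem entry_green (h : Uniformized z ζ) (j k : ℤ) :
    entry (green 0 z) j k = freeDiag ζ * ζ ^ (j - k).natAbs := by
  rw [entry_eq_apply, h.green_basisVec, radial_apply]

theorem entry_green_sq (h : Uniformized z ζ) (j k : ℤ) :
    entry (green 0 z * green 0 z) j k
      = freeDiag ζ ^ 2 * ((j - k).natAbs + (1 + 2 * ζ * freeDiag ζ)) * ζ ^ (j - k).natAbs := by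
  rw [entry_eq_apply, h.green_sq_basisVec, radial_apply]

theorem im_ne_zero (h : Uniformized z ζ) : ζ.im ≠ 0 := by
  intro h0
  have h1 := h.im_pos
  rw [h.eq] at h1
  simp [h0] at h1

/-- The inverse of the diagonal entry is `ζ⁻¹ - ζ`, whose two terms have imaginary parts of the same
sign. The final phase argument rests on this. -/
theorem im_freeDiag_ne_zero (h : Uniformized z ζ) : (freeDiag ζ).im ≠ 0 := by
  have hs := h.sq_ne
  have hne := h.ne_zero
  have h1 : (freeDiag ζ)⁻¹ = ζ⁻¹ - ζ := by
    rw [freeDiag]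
    field_simp
  intro h0
  have h2 : ((freeDiag ζ)⁻¹).im = 0 := by simp [h0]
  rw [h1, Complex.sub_im, Complex.inv_im] at h2
  have h3 : 0 < Complex.normSq ζ := Complex.normSq_pos.2 hne
  have h4 : -ζ.im / Complex.normSq ζ - ζ.im = -ζ.im * (1 / Complex.normSq ζ + 1) := by ring
  rw [h4] at h2
  rcases mul_eq_zero.1 h2 with h5 | h5
  · exact h.im_ne_zero (neg_eq_zero.1 h5)
  · have : 0 < 1 / Complex.normSq ζ := by positivity
    linarith

/-- Circles `|ζ| = const` correspond to ellipses with foci `±2` in the `z`-plane; the identity is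
the parallelogram law. -/
theorem norm_add_inv (h : Uniformized z ζ) :
    2 * (‖ζ‖ + ‖ζ‖⁻¹) = ‖z + 2‖ + ‖z - 2‖ := by
  have hne := h.ne_zero
  have hn : 0 < ‖ζ‖ := norm_pos_iff.2 hne
  have h1 : z + 2 = -((1 - ζ) ^ 2 / ζ) := by
    rw [h.eq]
    field_simp
    ring
  have h2 : z - 2 = -((1 + ζ) ^ 2 / ζ) := by
    rw [h.eq]
    field_simp
    ring
  have h3 : ‖1 - ζ‖ ^ 2 + ‖1 + ζ‖ ^ 2 = 2 * (1 + ‖ζ‖ ^ 2) := by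
    have := parallelogram_law_with_norm ℝ (1 : ℂ) ζ
    rw [norm_one] at this
    nlinarith
  rw [h1, h2, norm_neg, norm_neg, norm_div, norm_div, norm_pow, norm_pow, ← add_div, h3]
  field_simp
  ring

theorem norm_le_two_div (h : Uniformized z ζ) : ‖ζ‖ ≤ 2 * z.im⁻¹ := by
  have hn : 0 < ‖ζ‖ := norm_pos_iff.2 h.ne_zero
  have h1 := h.norm_add_inv
  have h2 : z.im ≤ ‖z + 2‖ := by
    have := (le_abs_self _).trans (Complex.abs_im_le_norm (z + 2))
    simpa using this
  have h3 : z.im ≤ ‖z - 2‖ := by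
    have := (le_abs_self _).trans (Complex.abs_im_le_norm (z - 2))
    simpa using this
  have h4 : ‖ζ‖ ≤ ‖ζ‖⁻¹ := h.norm_lt.le.trans (one_le_inv₀ hn |>.2 h.norm_lt.le)
  have h5 : z.im / 2 ≤ ‖ζ‖⁻¹ := by linarith
  have h6 := inv_anti₀ (by linarith [h.im_pos]) h5
  rw [inv_inv, inv_div] at h6
  rwa [← div_eq_mul_inv]

/-- Moving up a vertical line increases the distances to both foci and so shrinks `|ζ|`. Among poles
on one vertical line, the lowest gives the slowest decay. -/
theorem norm_lt_of_im_lt (h : Uniformized z ζ) {z' ζ' : ℂ} (h' : Uniformized z' ζ')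
    (hre : z.re = z'.re) (him : z.im < z'.im) : ‖ζ'‖ < ‖ζ‖ := by
  have hn : 0 < ‖ζ‖ := norm_pos_iff.2 h.ne_zero
  have hn' : 0 < ‖ζ'‖ := norm_pos_iff.2 h'.ne_zero
  have key : ∀ c : ℝ, ‖z + c‖ < ‖z' + c‖ := by
    intro c
    rw [Complex.norm_def, Complex.norm_def]
    refine Real.sqrt_lt_sqrt (Complex.normSq_nonneg _) ?_
    rw [Complex.normSq_apply, Complex.normSq_apply]
    simp only [Complex.add_re, Complex.add_im, Complex.ofReal_re, Complex.ofReal_im, add_zero, hre]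
    nlinarith [h.im_pos]
  have k1 := key 2
  have k2 := key (-2)
  push_cast at k1 k2
  rw [← sub_eq_add_neg, ← sub_eq_add_neg] at k2
  have h1 := h.norm_add_inv
  have h2 := h'.norm_add_inv
  by_contra hcon
  push Not at hcon
  have h3 : ‖ζ‖ + ‖ζ‖⁻¹ - (‖ζ'‖ + ‖ζ'‖⁻¹)
      = (‖ζ'‖ - ‖ζ‖) * (1 / (‖ζ‖ * ‖ζ'‖) - 1) := by
    field_simp
    ring
  have h4 : 1 ≤ 1 / (‖ζ‖ * ‖ζ'‖) :=
    one_le_one_div (by positivity) (mul_le_one₀ h.norm_lt.le hn'.le h'.norm_lt.le)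
  have h5 := mul_nonneg (sub_nonneg.2 hcon) (sub_nonneg.2 h4)
  linarith

end Uniformized

/-- The roots of `ζ² + z ζ + 1` have product `1`. If they lay on the unit circle, `z` would be real;
so exactly one is inside. -/
theorem exists_uniformized {z : ℂ} (hz : 0 < z.im) : ∃ ζ, Uniformized z ζ := by
  obtain ⟨s, hs⟩ := IsAlgClosed.exists_pow_nat_eq (z ^ 2 - 4) two_pos
  set ζ := (-z + s) / 2 with hζ
  have hquad : ζ ^ 2 + z * ζ + 1 = 0 := by
    rw [hζ]
    linear_combination (1 / 4 : ℂ) * hs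
  have hne : ζ ≠ 0 := by
    intro h0
    rw [h0] at hquad
    simp at hquad
  have heq : z = -(ζ + ζ⁻¹) := by
    field_simp
    linear_combination hquad
  have hnorm : ‖ζ‖ ≠ 1 := by
    intro h1
    have h2 : ζ⁻¹ = (starRingEnd ℂ) ζ := Complex.inv_eq_conj h1
    rw [h2] at heq
    rw [heq] at hz
    simp at hz
  rcases lt_or_gt_of_ne hnorm with h | h
  · exact ⟨ζ, hz, hne, h, heq⟩
  · refine ⟨ζ⁻¹, hz, inv_ne_zero hne, ?_, ?_⟩
    · rw [norm_inv]
      exact inv_lt_one_of_one_lt₀ h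
    · rw [inv_inv, add_comm]
      exact heq

end

end Anderson

namespace Anderson

noncomputable section

/-! ### Two impurities -/

/-- The diagonal entry at `0` of the resolvent with an impurity of strength `u` at distance `n`. -/
def siteDiag (ζ : ℂ) (n : ℕ) (u : ℝ) : ℂ :=
  freeDiag ζ - u / (1 + u * freeDiag ζ) * (freeDiag ζ ^ 2 * ζ ^ (2 * n))

/-- The diagonal entry of the square of the free resolvent. -/
def freeSq (ζ : ℂ) : ℂ := freeDiag ζ ^ 2 * (1 + 2 * ζ * freeDiag ζ)

/-- The diagonal entry at `0` of the square of the resolvent with an impurity of strength `u` at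
distance `n`. -/
def siteSq (ζ : ℂ) (n : ℕ) (u : ℝ) : ℂ :=
  freeSq ζ - ζ ^ (2 * n) * (2 * (u / (1 + u * freeDiag ζ)) * freeDiag ζ
    * (n * freeDiag ζ ^ 2 + freeSq ζ) - (u / (1 + u * freeDiag ζ)) ^ 2 * freeDiag ζ ^ 2 * freeSq ζ)

theorem bdd_zero : ∃ R, ∀ j : ℤ, |(0 : ℤ → ℝ) j| ≤ R := ⟨0, by simp⟩

namespace Uniformized

variable {z ζ : ℂ}

theorem entry_green_diag (h : Uniformized z ζ) (k : ℤ) : entry (green 0 z) k k = freeDiag ζ := by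
  rw [h.entry_green]
  simp

theorem entry_green_sq_diag (h : Uniformized z ζ) (k : ℤ) :
    entry (green 0 z * green 0 z) k k = freeSq ζ := by
  rw [h.entry_green_sq, freeSq]
  simp

theorem one_add_freeDiag_ne_zero (h : Uniformized z ζ) (t : ℝ) : 1 + t * freeDiag ζ ≠ 0 := by
  rw [← h.entry_green_diag 0]
  exact one_add_ne_zero bdd_zero rfl h.im_pos t

theorem norm_inv_one_add_freeDiag_le (h : Uniformized z ζ) (t : ℝ) :
    ‖(1 + t * freeDiag ζ)⁻¹‖ ≤ 1 + |t| * z.im⁻¹ := by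
  rw [← h.entry_green_diag 0]
  exact norm_inv_one_add_le bdd_zero rfl h.im_pos t

theorem norm_freeDiag_le (h : Uniformized z ζ) : ‖freeDiag ζ‖ ≤ z.im⁻¹ := by
  rw [← h.entry_green_diag 0]
  exact norm_entry_green_le 0 h.im_pos 0 0

theorem norm_freeSq_le (h : Uniformized z ζ) : ‖freeSq ζ‖ ≤ z.im⁻¹ * z.im⁻¹ := by
  rw [← h.entry_green_sq_diag 0]
  exact norm_entry_green_sq_le 0 h.im_pos 0 0

theorem entry_green_site (h : Uniformized z ζ) (n : ℕ) (u : ℝ) :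
    entry (green (Function.update 0 (n : ℤ) u) z) 0 0 = siteDiag ζ n u := by
  rw [entry_green_update_eq bdd_zero rfl h.im_pos, h.entry_green_diag, h.entry_green_diag,
    h.entry_green, h.entry_green, siteDiag]
  simp only [zero_sub, sub_zero, Int.natAbs_neg, Int.natAbs_natCast]
  ring

theorem entry_green_sq_site (h : Uniformized z ζ) (n : ℕ) (u : ℝ) :
    entry (green (Function.update 0 (n : ℤ) u) z * green (Function.update 0 (n : ℤ) u) z) 0 0
      = siteSq ζ n u := by
  rw [entry_green_sq_update bdd_zero rfl h.im_pos, entry_green_sq_update_self bdd_zero rfl h.im_pos,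
    entry_green_update_right bdd_zero rfl h.im_pos, h.entry_green_sq_diag, h.entry_green_sq_diag,
    h.entry_green_diag, h.entry_green, h.entry_green, h.entry_green_sq, h.entry_green_sq, siteSq,
    freeSq]
  simp only [zero_sub, sub_zero, Int.natAbs_neg, Int.natAbs_natCast]
  generalize 1 + u * freeDiag ζ = D
  ring

theorem bdd_site (n : ℤ) (u : ℝ) : ∃ R, ∀ j, |Function.update (0 : ℤ → ℝ) n u j| ≤ R :=
  exists_abs_update_le bdd_zero n u

theorem site_zero {n : ℕ} (hn : 1 ≤ n) (u : ℝ) : Function.update (0 : ℤ → ℝ) (n : ℤ) u 0 = 0 := by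
  rw [Function.update_of_ne (by omega)]
  rfl

theorem one_add_siteDiag_ne_zero (h : Uniformized z ζ) {n : ℕ} (hn : 1 ≤ n) (u t : ℝ) :
    1 + t * siteDiag ζ n u ≠ 0 := by
  rw [← h.entry_green_site]
  exact one_add_ne_zero (bdd_site n u) (site_zero hn u) h.im_pos t

theorem norm_inv_one_add_siteDiag_le (h : Uniformized z ζ) {n : ℕ} (hn : 1 ≤ n) (u t : ℝ) :
    ‖(1 + t * siteDiag ζ n u)⁻¹‖ ≤ 1 + |t| * z.im⁻¹ := by
  rw [← h.entry_green_site]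
  exact norm_inv_one_add_le (bdd_site n u) (site_zero hn u) h.im_pos t

end Uniformized

/-- The first order pairing of the two impurities. -/
def pairing (ζ : ℂ) (n : ℕ) (u w : ℝ) : ℂ :=
  ∫ t in (0 : ℝ)..w, (siteDiag ζ n u / (1 + t * siteDiag ζ n u)
    - freeDiag ζ / (1 + t * freeDiag ζ))

/-- The second order pairing of the two impurities. -/
def pairingSq (ζ : ℂ) (n : ℕ) (u w : ℝ) : ℂ :=
  w * (siteSq ζ n u / (1 + w * siteDiag ζ n u) - freeSq ζ / (1 + w * freeDiag ζ))

/-- The change of `∫₀ʷ f₀₀(H_0 + t δ_0) dt` caused by an impurity of strength `u` at distance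
`n`. -/
def twoSite (f : ℝ → ℝ) (n : ℕ) (u w : ℝ) : ℝ :=
  ∫ t in (0 : ℝ)..w, (diag f (Function.update (Function.update 0 (n : ℤ) u) 0 t) 0
    - diag f (Function.update 0 0 t) 0)

theorem continuous_div_one_add {g : ℂ} (hg : ∀ t : ℝ, 1 + t * g ≠ 0) (d : ℂ) :
    Continuous fun t : ℝ => d / (1 + t * g) :=
  continuous_const.div (by fun_prop) hg

theorem continuous_div_one_add_sq {g : ℂ} (hg : ∀ t : ℝ, 1 + t * g ≠ 0) (d : ℂ) :
    Continuous fun t : ℝ => d / (1 + t * g) ^ 2 :=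
  continuous_const.div (by fun_prop) fun t => pow_ne_zero 2 (hg t)

theorem integral_div_one_add_sq {g : ℂ} (hg : ∀ t : ℝ, 1 + t * g ≠ 0) (d : ℂ) (w : ℝ) :
    ∫ t in (0 : ℝ)..w, d / (1 + t * g) ^ 2 = w * (d / (1 + w * g)) := by
  -- The antiderivative that vanishes at `0`, which makes the second order pairing explicit.
  have h : ∀ t : ℝ, HasDerivAt (fun t : ℝ => (t : ℂ) * (d / (1 + t * g))) (d / (1 + t * g) ^ 2) t := by
    intro t
    have h1 : HasDerivAt (fun t : ℝ => (t : ℂ)) 1 t := Complex.ofRealCLM.hasDerivAt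
    have h2 : HasDerivAt (fun t : ℝ => 1 + (t : ℂ) * g) g t := by
      simpa using (h1.mul_const g).const_add 1
    have h3 := h1.fun_mul ((hasDerivAt_const t d).fun_div h2 (hg t))
    refine h3.congr_deriv ?_
    have h4 := hg t
    have h5 : (t : ℂ) * g = 1 + t * g - 1 := by ring
    generalize 1 + (t : ℂ) * g = D at h4 h5 ⊢
    field_simp
    linear_combination -d * h5
  rw [intervalIntegral.integral_eq_sub_of_hasDerivAt (fun t _ => h t)
    ((continuous_div_one_add_sq hg d).intervalIntegrable _ _)]
  simp

namespace Uniformized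

variable {z ζ : ℂ}

theorem diag_poleFun_site (h : Uniformized z ζ) {n : ℕ} (hn : 1 ≤ n) (u t : ℝ) (a b : ℂ) :
    diag (poleFun a b z) (Function.update (Function.update 0 (n : ℤ) u) 0 t) 0
      = (a * (siteDiag ζ n u / (1 + t * siteDiag ζ n u))
        + b * (siteSq ζ n u / (1 + t * siteDiag ζ n u) ^ 2)).re := by
  rw [diag_poleFun _ h.im_pos, entry_green_update_right (bdd_site n u) (site_zero hn u) h.im_pos,
    entry_green_sq_update_diag (bdd_site n u) (site_zero hn u) h.im_pos, h.entry_green_site,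
    h.entry_green_sq_site]

theorem diag_poleFun_free (h : Uniformized z ζ) (t : ℝ) (a b : ℂ) :
    diag (poleFun a b z) (Function.update 0 0 t) 0
      = (a * (freeDiag ζ / (1 + t * freeDiag ζ)) + b * (freeSq ζ / (1 + t * freeDiag ζ) ^ 2)).re := by
  rw [diag_poleFun _ h.im_pos, entry_green_update_right bdd_zero rfl h.im_pos,
    entry_green_sq_update_diag bdd_zero rfl h.im_pos, h.entry_green_diag, h.entry_green_sq_diag]

theorem continuous_diag_poleFun_sub (h : Uniformized z ζ) {n : ℕ} (hn : 1 ≤ n) (u : ℝ) (a b : ℂ) :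
    Continuous fun t : ℝ => diag (poleFun a b z) (Function.update (Function.update 0 (n : ℤ) u) 0 t) 0
      - diag (poleFun a b z) (Function.update 0 0 t) 0 := by
  simp only [h.diag_poleFun_site hn, h.diag_poleFun_free]
  have h1 := h.one_add_siteDiag_ne_zero hn u
  have h2 := h.one_add_freeDiag_ne_zero
  have c1 := continuous_div_one_add h1 (siteDiag ζ n u)
  have c2 := continuous_div_one_add_sq h1 (siteSq ζ n u)
  have c3 := continuous_div_one_add h2 (freeDiag ζ)
  have c4 := continuous_div_one_add_sq h2 (freeSq ζ)
  exact (Complex.continuous_re.comp ((continuous_const.mul c1).add (continuous_const.mul c2))).sub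
    (Complex.continuous_re.comp ((continuous_const.mul c3).add (continuous_const.mul c4)))

/-- The integrals over the coupling of the simple and of the double pole are the two pairings;
`pairingSq` is the second one in closed form. -/
theorem twoSite_poleFun (h : Uniformized z ζ) {n : ℕ} (hn : 1 ≤ n) (u w : ℝ) (a b : ℂ) :
    twoSite (poleFun a b z) n u w = (a * pairing ζ n u w + b * pairingSq ζ n u w).re := by
  have h1 := h.one_add_siteDiag_ne_zero hn u
  have h2 := h.one_add_freeDiag_ne_zero
  have c1 := (continuous_div_one_add h1 (siteDiag ζ n u)).sub (continuous_div_one_add h2 (freeDiag ζ))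
  have c2 := (continuous_div_one_add_sq h1 (siteSq ζ n u)).sub
    (continuous_div_one_add_sq h2 (freeSq ζ))
  have h3 : pairingSq ζ n u w = ∫ t in (0 : ℝ)..w, (siteSq ζ n u / (1 + t * siteDiag ζ n u) ^ 2
      - freeSq ζ / (1 + t * freeDiag ζ) ^ 2) := by
    rw [intervalIntegral.integral_sub
      ((continuous_div_one_add_sq h1 (siteSq ζ n u)).intervalIntegrable _ _)
      ((continuous_div_one_add_sq h2 (freeSq ζ)).intervalIntegrable _ _),
      integral_div_one_add_sq h1, integral_div_one_add_sq h2, pairingSq, mul_sub]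
  have i1 : IntervalIntegrable (fun t : ℝ => a * (siteDiag ζ n u / (1 + t * siteDiag ζ n u)
      - freeDiag ζ / (1 + t * freeDiag ζ))) volume 0 w :=
    (continuous_const.mul c1).intervalIntegrable _ _
  have i2 : IntervalIntegrable (fun t : ℝ => b * (siteSq ζ n u / (1 + t * siteDiag ζ n u) ^ 2
      - freeSq ζ / (1 + t * freeDiag ζ) ^ 2)) volume 0 w :=
    (continuous_const.mul c2).intervalIntegrable _ _
  rw [h3, pairing, ← intervalIntegral.integral_const_mul, ← intervalIntegral.integral_const_mul,
    ← intervalIntegral.integral_add i1 i2]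
  have h4 := Complex.reCLM.intervalIntegral_comp_comm (i1.add i2)
  simp only [Complex.reCLM_apply] at h4
  refine Eq.trans ?_ h4
  rw [twoSite]
  refine intervalIntegral.integral_congr fun t _ => ?_
  simp only [h.diag_poleFun_site hn, h.diag_poleFun_free]
  rw [← Complex.sub_re]
  congr 1
  ring

theorem siteDiag_sub (ζ : ℂ) (n : ℕ) (u : ℝ) :
    siteDiag ζ n u - freeDiag ζ = -(u / (1 + u * freeDiag ζ) * freeDiag ζ ^ 2) * ζ ^ (2 * n) := by
  rw [siteDiag]
  ring

/-- Puts the difference of the two diagonal entries, and with it the factor `ζ ^ (2 n)`, in front.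
-/
theorem pairing_integrand (h : Uniformized z ζ) {n : ℕ} (hn : 1 ≤ n) (u t : ℝ) :
    siteDiag ζ n u / (1 + t * siteDiag ζ n u) - freeDiag ζ / (1 + t * freeDiag ζ)
      = (siteDiag ζ n u - freeDiag ζ) * ((1 + t * siteDiag ζ n u)⁻¹ * (1 + t * freeDiag ζ)⁻¹) := by
  have h1 := h.one_add_siteDiag_ne_zero hn u t
  have h2 := h.one_add_freeDiag_ne_zero t
  rw [← mul_inv, ← div_eq_mul_inv, div_sub_div _ _ h1 h2]
  ring

theorem pairingSq_eq (h : Uniformized z ζ) {n : ℕ} (hn : 1 ≤ n) (u w : ℝ) :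
    pairingSq ζ n u w = w * ((siteSq ζ n u - freeSq ζ) * (1 + w * siteDiag ζ n u)⁻¹
      - freeSq ζ * w * (siteDiag ζ n u - freeDiag ζ)
        * ((1 + w * siteDiag ζ n u)⁻¹ * (1 + w * freeDiag ζ)⁻¹)) := by
  have h1 := h.one_add_siteDiag_ne_zero hn u w
  have h2 := h.one_add_freeDiag_ne_zero w
  rw [pairingSq]
  field_simp
  ring

theorem norm_coupling_le (h : Uniformized z ζ) {R u : ℝ} (hu : |u| ≤ R) :
    ‖(u : ℂ) / (1 + u * freeDiag ζ)‖ ≤ R * (1 + R * z.im⁻¹) := by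
  have h0 := h.im_pos
  have hR : 0 ≤ R := (abs_nonneg _).trans hu
  rw [div_eq_mul_inv, norm_mul, Complex.norm_real, Real.norm_eq_abs]
  gcongr
  exact (h.norm_inv_one_add_freeDiag_le u).trans (by gcongr)

theorem norm_siteDiag_sub_le (h : Uniformized z ζ) {R u : ℝ} (hu : |u| ≤ R) (n : ℕ) :
    ‖siteDiag ζ n u - freeDiag ζ‖
      ≤ R * (1 + R * z.im⁻¹) * z.im⁻¹ ^ 2 * ‖ζ‖ ^ (2 * n) := by
  have h0 := h.im_pos
  have hR : 0 ≤ R := (abs_nonneg _).trans hu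
  rw [siteDiag_sub, norm_mul, norm_neg, norm_mul, norm_pow, norm_pow]
  gcongr
  · exact h.norm_coupling_le hu
  · exact h.norm_freeDiag_le

theorem norm_siteSq_sub_le (h : Uniformized z ζ) {R u : ℝ} (hu : |u| ≤ R) (n : ℕ) :
    ‖siteSq ζ n u - freeSq ζ‖
      ≤ ‖ζ‖ ^ (2 * n) * (2 * (R * (1 + R * z.im⁻¹)) * z.im⁻¹
        * (n * z.im⁻¹ ^ 2 + z.im⁻¹ * z.im⁻¹)
        + (R * (1 + R * z.im⁻¹)) ^ 2 * z.im⁻¹ ^ 2 * (z.im⁻¹ * z.im⁻¹)) := by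
  have h0 := h.im_pos
  have hR : 0 ≤ R := (abs_nonneg _).trans hu
  have h1 := h.norm_coupling_le hu
  have h2 := h.norm_freeDiag_le
  have h3 := h.norm_freeSq_le
  have e : siteSq ζ n u - freeSq ζ = -(ζ ^ (2 * n) * (2 * (u / (1 + u * freeDiag ζ)) * freeDiag ζ
      * (n * freeDiag ζ ^ 2 + freeSq ζ)
        - (u / (1 + u * freeDiag ζ)) ^ 2 * freeDiag ζ ^ 2 * freeSq ζ)) := by
    rw [siteSq]
    ring
  rw [e, norm_neg, norm_mul, norm_pow]
  gcongr
  refine (norm_sub_le _ _).trans ?_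
  rw [norm_mul, norm_mul, norm_mul, norm_mul, norm_mul, norm_pow, norm_pow, Complex.norm_two]
  gcongr
  refine (norm_add_le _ _).trans ?_
  rw [norm_mul, norm_pow, Complex.norm_natCast]
  gcongr

/-- The constant in the bounds for the pairings. -/
def _root_.Anderson.pairingConst (R x : ℝ) : ℝ :=
  R ^ 2 * (1 + R * x) ^ 3 + 2 * R ^ 2 * (1 + R * x) ^ 2 * x + 2 * R ^ 3 * (1 + R * x) ^ 3 * x ^ 2

theorem norm_pairing_le (h : Uniformized z ζ) {R u w : ℝ} (hu : |u| ≤ R) (hw : |w| ≤ R) {n : ℕ}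
    (hn : 1 ≤ n) :
    ‖pairing ζ n u w‖ ≤ pairingConst R z.im⁻¹ * (n + 1) * z.im⁻¹ ^ 2 * ‖ζ‖ ^ (2 * n) := by
  have h0 := h.im_pos
  have hR : 0 ≤ R := (abs_nonneg _).trans hu
  set x := z.im⁻¹ with hx
  have hx0 : 0 ≤ x := by positivity
  have h1 : ‖pairing ζ n u w‖ ≤ (R * (1 + R * x) * x ^ 2 * ‖ζ‖ ^ (2 * n))
      * ((1 + R * x) * (1 + R * x)) * |w - 0| := by
    refine intervalIntegral.norm_integral_le_of_norm_le_const fun t ht => ?_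
    have ht' : |t| ≤ R := by
      rcases Set.mem_uIoc.1 ht with h | h
      · rw [abs_le] at hw ⊢; constructor <;> linarith [hw.1, hw.2, h.1, h.2]
      · rw [abs_le] at hw ⊢; constructor <;> linarith [hw.1, hw.2, h.1, h.2]
    rw [h.pairing_integrand hn, norm_mul, norm_mul]
    gcongr
    · exact h.norm_siteDiag_sub_le hu n
    · exact (h.norm_inv_one_add_siteDiag_le hn u t).trans (by gcongr)
    · exact (h.norm_inv_one_add_freeDiag_le t).trans (by gcongr)
  have h2 : R ^ 2 * (1 + R * x) ^ 3 ≤ pairingConst R x := by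
    rw [pairingConst]
    have : 0 ≤ 2 * R ^ 2 * (1 + R * x) ^ 2 * x + 2 * R ^ 3 * (1 + R * x) ^ 3 * x ^ 2 := by positivity
    linarith
  have h3 : 0 ≤ pairingConst R x := le_trans (by positivity) h2
  calc ‖pairing ζ n u w‖ ≤ (R * (1 + R * x) * x ^ 2 * ‖ζ‖ ^ (2 * n))
      * ((1 + R * x) * (1 + R * x)) * |w - 0| := h1
    _ ≤ (R * (1 + R * x) * x ^ 2 * ‖ζ‖ ^ (2 * n)) * ((1 + R * x) * (1 + R * x)) * R := by
        rw [sub_zero]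
        gcongr
    _ = R ^ 2 * (1 + R * x) ^ 3 * 1 * x ^ 2 * ‖ζ‖ ^ (2 * n) := by ring
    _ ≤ pairingConst R x * (n + 1) * x ^ 2 * ‖ζ‖ ^ (2 * n) := by
        gcongr
        linarith [Nat.cast_nonneg (α := ℝ) n]

theorem norm_pairingSq_le (h : Uniformized z ζ) {R u w : ℝ} (hu : |u| ≤ R) (hw : |w| ≤ R) {n : ℕ}
    (hn : 1 ≤ n) :
    ‖pairingSq ζ n u w‖ ≤ pairingConst R z.im⁻¹ * (n + 1) * z.im⁻¹ ^ 2 * ‖ζ‖ ^ (2 * n) := by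
  have h0 := h.im_pos
  have hR : 0 ≤ R := (abs_nonneg _).trans hu
  have b1 := h.norm_siteSq_sub_le hu n
  have b2 := h.norm_siteDiag_sub_le hu n
  have b3 := (h.norm_inv_one_add_siteDiag_le hn u w).trans
    (by gcongr : 1 + |w| * z.im⁻¹ ≤ 1 + R * z.im⁻¹)
  have b4 := (h.norm_inv_one_add_freeDiag_le w).trans
    (by gcongr : 1 + |w| * z.im⁻¹ ≤ 1 + R * z.im⁻¹)
  have b5 := h.norm_freeSq_le
  set x := z.im⁻¹ with hx
  have hx0 : 0 ≤ x := by positivity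
  have hn0 : (0 : ℝ) ≤ n := Nat.cast_nonneg n
  set q := ‖ζ‖ ^ (2 * n) with hq
  have hq0 : 0 ≤ q := by positivity
  set B := 1 + R * x with hB
  have hB0 : 0 ≤ B := by positivity
  have h1 : ‖pairingSq ζ n u w‖ ≤ R * ((q * (2 * (R * B) * x * (n * x ^ 2 + x * x)
      + (R * B) ^ 2 * x ^ 2 * (x * x))) * B + (x * x) * R * (R * B * x ^ 2 * q) * (B * B)) := by
    rw [h.pairingSq_eq hn, norm_mul, Complex.norm_real, Real.norm_eq_abs]
    refine mul_le_mul hw ?_ (norm_nonneg _) hR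
    refine (norm_sub_le _ _).trans ?_
    rw [norm_mul, norm_mul, norm_mul, norm_mul, norm_mul, Complex.norm_real, Real.norm_eq_abs]
    gcongr
  refine h1.trans ?_
  have e1 : R * ((q * (2 * (R * B) * x * (n * x ^ 2 + x * x)
      + (R * B) ^ 2 * x ^ 2 * (x * x))) * B + (x * x) * R * (R * B * x ^ 2 * q) * (B * B))
      = (2 * R ^ 2 * B ^ 2 * x * (n + 1) + 2 * R ^ 3 * B ^ 3 * x ^ 2 * 1) * x ^ 2 * q := by ring
  rw [e1]
  have e2 : pairingConst R x * (n + 1)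
      = R ^ 2 * B ^ 3 * (n + 1) + 2 * R ^ 2 * B ^ 2 * x * (n + 1)
        + 2 * R ^ 3 * B ^ 3 * x ^ 2 * (n + 1) := by
    rw [pairingConst]
    ring
  rw [e2]
  have e3 : 0 ≤ R ^ 2 * B ^ 3 * ((n : ℝ) + 1) := by positivity
  gcongr <;> linarith

/-- The product of the reflection coefficients of the two impurities. -/
def _root_.Anderson.reflection (ζ : ℂ) (u w : ℝ) : ℂ :=
  u / (1 + u * freeDiag ζ) * freeDiag ζ ^ 2 * (w * (1 / (1 + w * freeDiag ζ)))

theorem tendsto_pow_zero (h : Uniformized z ζ) :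
    Tendsto (fun n : ℕ => ζ ^ (2 * n)) atTop (𝓝 0) := by
  have h1 : ‖ζ ^ 2‖ < 1 := by
    rw [norm_pow]
    exact pow_lt_one₀ (norm_nonneg ζ) h.norm_lt two_ne_zero
  simpa only [pow_mul] using tendsto_pow_atTop_nhds_zero_of_norm_lt_one h1

theorem tendsto_siteDiag (h : Uniformized z ζ) (u : ℝ) :
    Tendsto (fun n : ℕ => siteDiag ζ n u) atTop (𝓝 (freeDiag ζ)) := by
  have h1 := (h.tendsto_pow_zero.const_mul (freeDiag ζ ^ 2)).const_mul
    ((u : ℂ) / (1 + u * freeDiag ζ))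
  simpa [siteDiag] using h1.const_sub (freeDiag ζ)

theorem tendsto_inv_one_add_siteDiag (h : Uniformized z ζ) (u t : ℝ) :
    Tendsto (fun n : ℕ => (1 + t * siteDiag ζ n u)⁻¹) atTop (𝓝 (1 + t * freeDiag ζ)⁻¹) :=
  (((h.tendsto_siteDiag u).const_mul (t : ℂ)).const_add 1).inv₀ (h.one_add_freeDiag_ne_zero t)

/-- The factor `ζ ^ (2 n)` is pulled out of the integral; in what remains the distant impurity
disappears as `n → ∞`. -/
theorem tendsto_pairing_div (h : Uniformized z ζ) (u w : ℝ) :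
    Tendsto (fun n : ℕ => pairing ζ n u w / ζ ^ (2 * n)) atTop (𝓝 (-reflection ζ u w)) := by
  have h0 := h.im_pos
  set c := (u : ℂ) / (1 + u * freeDiag ζ) * freeDiag ζ ^ 2 with hc
  have e1 : ∀ n : ℕ, 1 ≤ n → pairing ζ n u w / ζ ^ (2 * n)
      = -c * ∫ t in (0 : ℝ)..w, (1 + t * siteDiag ζ n u)⁻¹ * (1 + t * freeDiag ζ)⁻¹ := by
    intro n hn
    have hp : ζ ^ (2 * n) ≠ 0 := pow_ne_zero _ h.ne_zero
    rw [pairing, div_eq_iff hp]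
    simp only [h.pairing_integrand hn, siteDiag_sub]
    rw [intervalIntegral.integral_const_mul, ← hc]
    ring
  have e2 : reflection ζ u w
      = c * ∫ t in (0 : ℝ)..w, (1 + t * freeDiag ζ)⁻¹ * (1 + t * freeDiag ζ)⁻¹ := by
    rw [reflection, ← integral_div_one_add_sq h.one_add_freeDiag_ne_zero 1 w]
    congr 1
    refine intervalIntegral.integral_congr fun t _ => ?_
    simp only [one_div, sq, mul_inv]
  rw [e2, neg_mul_eq_neg_mul]
  refine Tendsto.congr' (f₁ := fun n : ℕ => -c * ∫ t in (0 : ℝ)..w,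
    (1 + t * siteDiag ζ n u)⁻¹ * (1 + t * freeDiag ζ)⁻¹) ?_ (Tendsto.const_mul _ ?_)
  · filter_upwards [eventually_ge_atTop 1] with n hn
    exact (e1 n hn).symm
  · refine intervalIntegral.tendsto_integral_filter_of_dominated_convergence
      (fun _ => (1 + |w| * z.im⁻¹) * (1 + |w| * z.im⁻¹)) ?_ ?_ (by simp) ?_
    · filter_upwards [eventually_ge_atTop 1] with n hn
      refine Continuous.aestronglyMeasurable ?_
      refine Continuous.mul ?_ ?_
      · exact Continuous.inv₀ (by fun_prop) (h.one_add_siteDiag_ne_zero hn u)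
      · exact Continuous.inv₀ (by fun_prop) h.one_add_freeDiag_ne_zero
    · filter_upwards [eventually_ge_atTop 1] with n hn
      refine Eventually.of_forall fun t ht => ?_
      have ht' : |t| ≤ |w| := by
        rcases Set.mem_uIoc.1 ht with h | h
        · rw [abs_of_pos h.1]
          exact h.2.trans (le_abs_self _)
        · rw [abs_of_nonpos h.2, abs_of_neg (h.1.trans_le h.2)]
          linarith [h.1]
      rw [norm_mul]
      gcongr
      · exact (h.norm_inv_one_add_siteDiag_le hn u t).trans (by gcongr)
      · exact (h.norm_inv_one_add_freeDiag_le t).trans (by gcongr)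
    · exact Eventually.of_forall fun t _ => (h.tendsto_inv_one_add_siteDiag u t).mul_const _

/-- The linear factor of the squared resolvent makes the double pole larger by `n`; all other terms
are `O(1 / n)` relative to it. With the factor `2 g n`, `g` being the free diagonal entry, the limit
is the same as for a simple pole. -/
theorem tendsto_pairingSq_div (h : Uniformized z ζ) (u w : ℝ) :
    Tendsto (fun n : ℕ => pairingSq ζ n u w / (2 * freeDiag ζ * n * ζ ^ (2 * n))) atTop
      (𝓝 (-reflection ζ u w)) := by
  set g := freeDiag ζ with hg
  have hg0 : g ≠ 0 := h.freeDiag_ne_zero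
  set c := (u : ℂ) / (1 + u * g) with hc
  set d := freeSq ζ with hd
  have hinv : Tendsto (fun n : ℕ => ((n : ℂ))⁻¹) atTop (𝓝 0) := tendsto_inv_atTop_nhds_zero_nat
  have hs := h.tendsto_inv_one_add_siteDiag u w
  have e1 : ∀ n : ℕ, 1 ≤ n → pairingSq ζ n u w / (2 * g * n * ζ ^ (2 * n))
      = w * (-(c * g ^ 2 + (c * d - c ^ 2 * g * d / 2) * (n : ℂ)⁻¹) * (1 + w * siteDiag ζ n u)⁻¹
        + d * w * (c * g / 2) * (n : ℂ)⁻¹ * ((1 + w * siteDiag ζ n u)⁻¹ * (1 + w * g)⁻¹)) := by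
    intro n hn
    have hp : ζ ^ (2 * n) ≠ 0 := pow_ne_zero _ h.ne_zero
    have hn0 : (n : ℂ) ≠ 0 := by exact_mod_cast (by omega : n ≠ 0)
    have h1 := h.one_add_siteDiag_ne_zero hn u w
    have h2 := h.one_add_freeDiag_ne_zero w
    rw [h.pairingSq_eq hn, siteDiag_sub, siteSq, ← hg, ← hd, ← hc,
      div_eq_iff (mul_ne_zero (mul_ne_zero (mul_ne_zero two_ne_zero hg0) hn0) hp)]
    field_simp
    ring
  have e2 : -reflection ζ u w
      = w * (-(c * g ^ 2 + (c * d - c ^ 2 * g * d / 2) * 0) * (1 + w * g)⁻¹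
        + d * w * (c * g / 2) * 0 * ((1 + w * g)⁻¹ * (1 + w * g)⁻¹)) := by
    rw [reflection]
    ring
  rw [e2]
  refine Tendsto.congr' ?_ (Tendsto.const_mul _ (Tendsto.add (Tendsto.mul
    (((hinv.const_mul (c * d - c ^ 2 * g * d / 2)).const_add (c * g ^ 2)).neg) hs)
    (Tendsto.mul (hinv.const_mul (d * w * (c * g / 2))) (hs.mul_const (1 + w * g)⁻¹))))
  filter_upwards [eventually_ge_atTop 1] with n hn
  exact (e1 n hn).symm

/-- After division by the dominant scale, of order `ζ ^ (2 n)` or `n ζ ^ (2 n)`, the limit is the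
same reflection product, so one argument serves both kinds of poles. The lower bound on the scale is
what makes higher poles negligible. -/
theorem exists_scale (h : Uniformized z ζ) {a b : ℂ} (hab : a ≠ 0 ∨ b ≠ 0) :
    ∃ (S : ℕ → ℂ) (κ : ℝ), 0 < κ ∧ (∀ n, 1 ≤ n → κ * ‖ζ‖ ^ (2 * n) ≤ ‖S n‖) ∧
      ∀ u w : ℝ, Tendsto (fun n => (a * pairing ζ n u w + b * pairingSq ζ n u w) / S n) atTop
        (𝓝 (reflection ζ u w)) := by
  have hg0 : freeDiag ζ ≠ 0 := h.freeDiag_ne_zero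
  by_cases hb : b = 0
  · have ha : a ≠ 0 := hab.resolve_right (not_not.2 hb)
    refine ⟨fun n => -a * ζ ^ (2 * n), ‖a‖, norm_pos_iff.2 ha, fun n _ => ?_, fun u w => ?_⟩
    · rw [norm_mul, norm_neg, norm_pow]
    · have h1 := (h.tendsto_pairing_div u w).neg
      rw [neg_neg] at h1
      refine h1.congr fun n => ?_
      have hp : ζ ^ (2 * n) ≠ 0 := pow_ne_zero _ h.ne_zero
      rw [hb]
      field_simp
      ring
  · refine ⟨fun n => -(b * (2 * freeDiag ζ * n * ζ ^ (2 * n))), ‖b‖ * (2 * ‖freeDiag ζ‖),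
      by positivity, fun n hn => ?_, fun u w => ?_⟩
    · simp only [norm_neg, norm_mul, norm_pow, Complex.norm_natCast, Complex.norm_two]
      have : (1 : ℝ) ≤ n := by exact_mod_cast hn
      calc ‖b‖ * (2 * ‖freeDiag ζ‖) * ‖ζ‖ ^ (2 * n)
          = ‖b‖ * (2 * ‖freeDiag ζ‖ * 1 * ‖ζ‖ ^ (2 * n)) := by ring
        _ ≤ _ := by gcongr
    · have h1 := (h.tendsto_pairingSq_div u w).neg
      have h2 := (h.tendsto_pairing_div u w)
      have hinv : Tendsto (fun n : ℕ => ((n : ℂ))⁻¹) atTop (𝓝 0) := tendsto_inv_atTop_nhds_zero_nat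
      have h3 := ((h2.mul hinv).const_mul (a / (b * (2 * freeDiag ζ)))).neg.add h1
      rw [neg_neg, mul_zero, mul_zero, neg_zero, zero_add] at h3
      refine h3.congr' ?_
      filter_upwards [eventually_ge_atTop 1] with n hn
      have hn0 : (n : ℂ) ≠ 0 := by exact_mod_cast (by omega : n ≠ 0)
      have hp : ζ ^ (2 * n) ≠ 0 := pow_ne_zero _ h.ne_zero
      field_simp
      ring

end Uniformized

end

end Anderson

namespace Anderson

noncomputable section

/-! ### Functions given by series of poles on a vertical line -/

theorem hasSum_diag_of_bound {ι : Type*} {R : ℝ} {q : ι → ℝ → ℝ} {f : ℝ → ℝ} {M : ι → ℝ}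
    {V : ℤ → ℝ} (hV : ∀ j, |V j| ≤ R) (hq : ∀ i, Continuous (q i)) (hM : Summable M)
    (hqM : ∀ i x, |x| ≤ 2 + R → |q i x| ≤ M i)
    (hf : ∀ x, |x| ≤ 2 + R → HasSum (fun i => q i x) (f x)) (j : ℤ) :
    HasSum (fun i => diag (q i) V j) (diag f V j) := by
  have h1 := tendstoUniformlyOn_tsum hM (s := spectrum ℝ (schrodinger V)) (f := q)
    (fun i x hx => hqM i x (abs_le_of_mem_spectrum hV hx))
  have h2 : TendstoUniformlyOn (fun (t : Finset ι) x => ∑ i ∈ t, q i x) f atTop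
      (spectrum ℝ (schrodinger V)) :=
    h1.congr_right fun x hx => (hf x (abs_le_of_mem_spectrum hV hx)).tsum_eq
  have h3 := tendsto_cfc_fun h2 (Eventually.of_forall fun t =>
    (continuous_finsetSum t fun i _ => hq i).continuousOn)
  have h4 : HasSum (fun i => cfc (q i) (schrodinger V)) (cfc f (schrodinger V)) := by
    refine Tendsto.congr (fun t => ?_) h3
    rw [← cfc_sum q (schrodinger V) t fun i _ => (hq i).continuousOn]
    congr 1
    funext x
    simp
  exact Complex.reCLM.hasSum ((entryCLM j j).hasSum h4)

theorem abs_diag_le_of_bound {R M : ℝ} {q : ℝ → ℝ} {V : ℤ → ℝ} (hV : ∀ j, |V j| ≤ R)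
    (hq : ∀ x, |x| ≤ 2 + R → |q x| ≤ M) (j : ℤ) : |diag q V j| ≤ M := by
  have hR : 0 ≤ R := (abs_nonneg _).trans (hV 0)
  have hM : 0 ≤ M := (abs_nonneg _).trans (hq 0 (by rw [abs_zero]; linarith))
  refine (Complex.abs_re_le_norm _).trans ((norm_entry_le _ _ _).trans ?_)
  exact norm_cfc_le hM fun x hx => hq x (abs_le_of_mem_spectrum hV hx)

theorem continuous_poleFun {z : ℂ} (hz : 0 < z.im) (a b : ℂ) : Continuous (poleFun a b z) := by
  have h : Continuous fun x : ℝ => ((x : ℂ) - z)⁻¹ := by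
    refine Continuous.inv₀ (by fun_prop) fun x hx => ?_
    have := congrArg Complex.im hx
    simp at this
    exact hz.ne' this
  exact Complex.continuous_re.comp
    ((continuous_const.mul h).add (continuous_const.mul (h.mul h)))

/-- `f` is the sum on `[-(2 + R), 2 + R]` of a normally convergent series of functions with poles on
a vertical line, the lowest of which is isolated. -/
structure PoleSeries {ι : Type*} (R : ℝ) (f : ℝ → ℝ) (a b z : ι → ℂ) (i₀ : ι) : Prop where
  im_pos : 0 < (z i₀).im
  re_eq : ∀ i, (z i).re = (z i₀).re
  gap : ∃ η, (z i₀).im < η ∧ ∀ i, i ≠ i₀ → η < (z i).im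
  ne_zero : a i₀ ≠ 0 ∨ b i₀ ≠ 0
  summable : Summable fun i => (‖a i‖ + ‖b i‖) * (z i).im⁻¹ ^ 4
  bound : ∃ M : ι → ℝ, Summable M ∧ ∀ i x, |x| ≤ 2 + R → |poleFun (a i) (b i) (z i) x| ≤ M i
  hasSum : ∀ x, |x| ≤ 2 + R → HasSum (fun i => poleFun (a i) (b i) (z i) x) (f x)

namespace PoleSeries

variable {ι : Type*} {R : ℝ} {f : ℝ → ℝ} {a b z : ι → ℂ} {i₀ : ι}

theorem im_pos' (h : PoleSeries R f a b z i₀) (i : ι) : 0 < (z i).im := by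
  obtain ⟨η, h1, h2⟩ := h.gap
  by_cases hi : i = i₀
  · rw [hi]; exact h.im_pos
  · exact (h.im_pos.trans h1).trans (h2 i hi)

theorem hasSum_twoSite [Countable ι] (h : PoleSeries R f a b z i₀) {u w : ℝ} (hu : |u| ≤ R)
    (hw : |w| ≤ R) {n : ℕ} (hn : 1 ≤ n) :
    HasSum (fun i => twoSite (poleFun (a i) (b i) (z i)) n u w) (twoSite f n u w) := by
  obtain ⟨M, hM, hb⟩ := h.bound
  have hR : 0 ≤ R := (abs_nonneg _).trans hu
  have ht : ∀ t ∈ Set.uIoc 0 w, |t| ≤ R := by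
    intro t ht
    rw [abs_le] at hw ⊢
    rcases Set.mem_uIoc.1 ht with h | h <;> constructor <;> linarith [hw.1, hw.2, h.1, h.2]
  have hz : ∀ j : ℤ, |(0 : ℤ → ℝ) j| ≤ R := fun j => by simpa using hR
  have hq : ∀ i, Continuous (poleFun (a i) (b i) (z i)) := fun i => continuous_poleFun (h.im_pos' i) _ _
  refine intervalIntegral.hasSum_integral_of_dominated_convergence (fun i _ => M i + M i) ?_ ?_
    (Eventually.of_forall fun _ _ => hM.add hM) (by simp) ?_
  · intro i
    obtain ⟨ζ, hζ⟩ := exists_uniformized (h.im_pos' i)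
    exact (hζ.continuous_diag_poleFun_sub hn u _ _).aestronglyMeasurable
  · refine fun i => Eventually.of_forall fun t h't => ?_
    refine (norm_sub_le _ _).trans (add_le_add ?_ ?_)
    · exact abs_diag_le_of_bound (PolyExpansion.abs_update_le (PolyExpansion.abs_update_le hz hu _) (ht t h't) _) (hb i) 0
    · exact abs_diag_le_of_bound (PolyExpansion.abs_update_le hz (ht t h't) _) (hb i) 0
  · refine Eventually.of_forall fun t h't => ?_
    exact (hasSum_diag_of_bound (PolyExpansion.abs_update_le (PolyExpansion.abs_update_le hz hu _) (ht t h't) _) hq hM hb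
      h.hasSum 0).sub (hasSum_diag_of_bound (PolyExpansion.abs_update_le hz (ht t h't) _) hq hM hb h.hasSum 0)

theorem pairingConst_mono {R x y : ℝ} (hR : 0 ≤ R) (hx : 0 ≤ x) (hxy : x ≤ y) :
    pairingConst R x ≤ pairingConst R y := by
  have hy : 0 ≤ y := hx.trans hxy
  unfold pairingConst
  gcongr

theorem pairingConst_nonneg {R x : ℝ} (hR : 0 ≤ R) (hx : 0 ≤ x) : 0 ≤ pairingConst R x := by
  unfold pairingConst
  positivity

/-- The contribution of all poles but the lowest is of smaller exponential order. -/
theorem exists_abs_twoSite_sub_le [Countable ι] (h : PoleSeries R f a b z i₀) {ζ : ℂ}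
    (hζ : Uniformized (z i₀) ζ) : ∃ C ρ : ℝ, 0 ≤ C ∧ 0 ≤ ρ ∧ ρ < ‖ζ‖ ∧ ∀ u w : ℝ, |u| ≤ R →
      |w| ≤ R → ∀ n : ℕ, |twoSite f (n + 1) u w
        - twoSite (poleFun (a i₀) (b i₀) (z i₀)) (n + 1) u w| ≤ C * (n + 2) * ρ ^ (2 * n) := by
  classical
  by_cases hR : 0 ≤ R
  swap
  · exact ⟨0, 0, le_rfl, le_rfl, norm_pos_iff.2 hζ.ne_zero, fun u w hu =>
      absurd ((abs_nonneg _).trans hu) hR⟩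
  obtain ⟨η, h1, h2⟩ := h.gap
  have hη : 0 < η := h.im_pos.trans h1
  -- A reference point at the height of the gap: the parameters of all higher poles are at most
  -- `‖ζ'‖`, which is less than `‖ζ‖`.
  obtain ⟨ζ', hζ'⟩ := exists_uniformized (z := ⟨(z i₀).re, η⟩) hη
  choose w' hw' using fun i => exists_uniformized (h.im_pos' i)
  refine ⟨4 * pairingConst R η⁻¹ * ∑' i, (‖a i‖ + ‖b i‖) * (z i).im⁻¹ ^ 4, ‖ζ'‖, ?_, norm_nonneg _,
    hζ.norm_lt_of_im_lt hζ' rfl h1, fun u w hu hw n => ?_⟩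
  · have h5 := pairingConst_nonneg hR (inv_nonneg.2 hη.le)
    have h6 : 0 ≤ ∑' i, (‖a i‖ + ‖b i‖) * (z i).im⁻¹ ^ 4 := tsum_nonneg fun i => by
      have := (h.im_pos' i).le
      positivity
    positivity
  have hn : 1 ≤ n + 1 := by omega
  have h3 := hasSum_ite_sub_hasSum (h.hasSum_twoSite hu hw hn) i₀
  rw [← h3.tsum_eq]
  have h4 : ∀ i, ‖if i = i₀ then 0 else twoSite (poleFun (a i) (b i) (z i)) (n + 1) u w‖
      ≤ 4 * pairingConst R η⁻¹ * (n + 2) * ‖ζ'‖ ^ (2 * n) * ((‖a i‖ + ‖b i‖) * (z i).im⁻¹ ^ 4) := by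
    intro i
    have hi0 := h.im_pos' i
    have hc := pairingConst_nonneg hR (inv_nonneg.2 hη.le)
    split_ifs with hi
    · rw [norm_zero]
      positivity
    · rw [(hw' i).twoSite_poleFun hn]
      have e1 : pairingConst R (z i).im⁻¹ ≤ pairingConst R η⁻¹ :=
        pairingConst_mono hR (by positivity) (inv_anti₀ hη (h2 i hi).le)
      have e2 : ‖w' i‖ ≤ ‖ζ'‖ := (hζ'.norm_lt_of_im_lt (hw' i) (h.re_eq i).symm (h2 i hi)).le
      have e3 := (hw' i).norm_le_two_div
      -- Two factors are traded for inverse heights. This is why distances are written `n + 1`, and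
      -- it provides the fourth power that makes the sum over the poles converge.
      have e4 : ‖w' i‖ ^ (2 * (n + 1)) ≤ ‖ζ'‖ ^ (2 * n) * (2 * (z i).im⁻¹) ^ 2 := by
        rw [mul_add, pow_add]
        gcongr
      have e5 : pairingConst R (z i).im⁻¹ * ((n + 1 : ℕ) + 1 : ℝ) * (z i).im⁻¹ ^ 2
          * ‖w' i‖ ^ (2 * (n + 1)) ≤ pairingConst R η⁻¹ * ((n + 1 : ℕ) + 1 : ℝ) * (z i).im⁻¹ ^ 2
          * (‖ζ'‖ ^ (2 * n) * (2 * (z i).im⁻¹) ^ 2) := by gcongr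
      refine (Complex.abs_re_le_norm _).trans ((norm_add_le _ _).trans ?_)
      rw [norm_mul, norm_mul]
      calc ‖a i‖ * ‖pairing (w' i) (n + 1) u w‖ + ‖b i‖ * ‖pairingSq (w' i) (n + 1) u w‖
          ≤ ‖a i‖ * (pairingConst R η⁻¹ * ((n + 1 : ℕ) + 1 : ℝ) * (z i).im⁻¹ ^ 2
          * (‖ζ'‖ ^ (2 * n) * (2 * (z i).im⁻¹) ^ 2)) + ‖b i‖ * (pairingConst R η⁻¹ * ((n + 1 : ℕ) + 1 : ℝ) * (z i).im⁻¹ ^ 2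
          * (‖ζ'‖ ^ (2 * n) * (2 * (z i).im⁻¹) ^ 2)) := by
            gcongr
            · exact ((hw' i).norm_pairing_le hu hw hn).trans e5
            · exact ((hw' i).norm_pairingSq_le hu hw hn).trans e5
        _ = _ := by
            push_cast
            ring
  have h5 := tsum_of_norm_bounded (h.summable.hasSum.mul_left
    (4 * pairingConst R η⁻¹ * (n + 2) * ‖ζ'‖ ^ (2 * n))) h4
  refine (Real.norm_eq_abs _ ▸ h5).trans (le_of_eq ?_)
  ring

end PoleSeries

theorem tendsto_add_two_mul_pow {r : ℝ} (h0 : 0 ≤ r) (h1 : r < 1) :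
    Tendsto (fun n : ℕ => ((n : ℝ) + 2) * r ^ n) atTop (𝓝 0) := by
  have h2 := tendsto_self_mul_const_pow_of_lt_one h0 h1
  have h3 := (tendsto_pow_atTop_nhds_zero_of_lt_one h0 h1).const_mul 2
  rw [mul_zero] at h3
  have h4 := h2.add h3
  rw [add_zero] at h4
  refine h4.congr fun n => ?_
  ring

/-! ### The phase argument -/

theorem reflection_mul (ζ : ℂ) (u u' w : ℝ) (h : 1 + u * freeDiag ζ ≠ 0)
    (h' : 1 + u' * freeDiag ζ ≠ 0) :
    reflection ζ u w * (u' * (1 + u * freeDiag ζ)) = reflection ζ u' w * (u * (1 + u' * freeDiag ζ)) := by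
  rw [reflection, reflection]
  generalize 1 / (1 + w * freeDiag ζ) = e
  generalize 1 + u * freeDiag ζ = D at h ⊢
  generalize 1 + u' * freeDiag ζ = D' at h' ⊢
  field_simp

/-- If `x` and `y` are both imaginary, the real part of the relation gives `x = y`, since `g` is not
real. The imaginary part then forces `x = 0`, since `u ≠ u'`. -/
theorem eq_zero_of_re_eq_zero {x y g : ℂ} {u u' : ℝ} (hx : x.re = 0) (hy : y.re = 0) (hg : g.im ≠ 0)
    (hu : 0 < u) (hu' : u' < 0) (h : x * (u' * (1 + u * g)) = y * (u * (1 + u' * g))) : x = 0 := by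
  have h1 := congrArg Complex.re h
  have h2 := congrArg Complex.im h
  simp [hx, hy] at h1 h2
  have e1 : x.im * (u' * u * g.im) = y.im * (u' * u * g.im) := by linarith
  have e2 : x.im = y.im :=
    mul_right_cancel₀ (mul_ne_zero (mul_ne_zero hu'.ne hu.ne') hg) e1
  rw [← e2] at h2
  have e3 : x.im * (u' - u) = 0 := by linarith
  have e4 : x.im = 0 := (mul_eq_zero.1 e3).resolve_right (by linarith)
  exact Complex.ext hx e4

/-- The leading term is the real part of a scale times the reflection product. If it vanished for
both impurities, a common rotation would make both reflection products imaginary, which their ratio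
forbids. -/
theorem PoleSeries.exists_twoSite_ne_zero {ι : Type*} {R : ℝ} {f : ℝ → ℝ} {a b z : ι → ℂ} {i₀ : ι}
    [Countable ι] (h : PoleSeries R f a b z i₀) {u u' : ℝ} (hu : 0 < u) (hu' : u' < 0)
    (huR : |u| ≤ R) (huR' : |u'| ≤ R) :
    ∃ n : ℕ, twoSite f (n + 1) u u ≠ 0 ∨ twoSite f (n + 1) u' u ≠ 0 := by
  by_contra! hcon
  obtain ⟨ζ, hζ⟩ := exists_uniformized h.im_pos
  obtain ⟨C, ρ, hC, hρ0, hρ, hrem⟩ := h.exists_abs_twoSite_sub_le hζ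
  obtain ⟨S, κ, hκ, hS, hlim⟩ := hζ.exists_scale h.ne_zero
  have hζ0 : 0 < ‖ζ‖ := norm_pos_iff.2 hζ.ne_zero
  have hSpos : ∀ n, 0 < ‖S (n + 1)‖ := fun n =>
    lt_of_lt_of_le (by positivity) (hS (n + 1) (by omega))
  -- The phase of the scale, which need not converge as `n` grows.
  set e : ℕ → ℂ := fun n => S (n + 1) / ‖S (n + 1)‖ with he
  have hsmall : Tendsto (fun n : ℕ => C * (n + 2) * ρ ^ (2 * n) / (κ * ‖ζ‖ ^ (2 * (n + 1)))) atTop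
      (𝓝 0) := by
    have h1 : (ρ / ‖ζ‖) ^ 2 < 1 :=
      pow_lt_one₀ (by positivity) ((div_lt_one hζ0).2 hρ) two_ne_zero
    have h2 := (tendsto_add_two_mul_pow (by positivity) h1).const_mul (C / (κ * ‖ζ‖ ^ 2))
    rw [mul_zero] at h2
    refine h2.congr fun n => ?_
    rw [mul_add 2 n 1, pow_add, ← pow_mul, div_pow]
    field_simp
    ring
  have key : ∀ v : ℝ, |v| ≤ R → (∀ n, twoSite f (n + 1) v u = 0) →
      Tendsto (fun n => (e n * reflection ζ v u).re) atTop (𝓝 0) := by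
    intro v hv hv0
    set X : ℕ → ℂ := fun n => a i₀ * pairing ζ (n + 1) v u + b i₀ * pairingSq ζ (n + 1) v u with hX
    have h1 : Tendsto (fun n => X n / S (n + 1)) atTop (𝓝 (reflection ζ v u)) :=
      (hlim v u).comp (tendsto_add_atTop_nat 1)
    have h2 : Tendsto (fun n => e n * (reflection ζ v u - X n / S (n + 1))) atTop (𝓝 0) := by
      have h3 := (h1.const_sub (reflection ζ v u)).norm
      rw [sub_self, norm_zero] at h3
      refine squeeze_zero_norm (fun n => ?_) h3
      rw [norm_mul, he]
      simp only [norm_div, Complex.norm_real, norm_norm]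
      rw [div_self (hSpos n).ne', one_mul]
    have h4 : Tendsto (fun n => (e n * (X n / S (n + 1))).re) atTop (𝓝 0) := by
      refine squeeze_zero_norm (fun n => ?_) hsmall
      have h5 : e n * (X n / S (n + 1)) = X n / (‖S (n + 1)‖ : ℝ) := by
        have : S (n + 1) ≠ 0 := norm_pos_iff.1 (hSpos n)
        rw [he]
        field_simp
      have h6 := hrem v u hv huR n
      rw [hv0 n, zero_sub, abs_neg, hζ.twoSite_poleFun (by omega)] at h6
      rw [h5, Complex.div_ofReal_re, Real.norm_eq_abs, abs_div, abs_norm]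
      exact div_le_div₀ (by positivity) h6 (by positivity) (hS (n + 1) (by omega))
    have h7 := ((Complex.continuous_re.tendsto _).comp h2).add h4
    rw [Complex.zero_re, add_zero] at h7
    refine h7.congr fun n => ?_
    simp only [Function.comp_apply]
    rw [← Complex.add_re, ← mul_add, sub_add_cancel]
  have hmem : ∀ n, e n ∈ Metric.sphere (0 : ℂ) 1 := fun n => by
    rw [mem_sphere_zero_iff_norm, he]
    simp only [norm_div, Complex.norm_real, norm_norm]
    exact div_self (hSpos n).ne'
  -- By compactness of the circle the phase converges along a subsequence, the same one for both
  -- impurities.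
  obtain ⟨e', he', φ, hφ, hlim'⟩ := (isCompact_sphere (0 : ℂ) 1).tendsto_subseq hmem
  have hre : ∀ v : ℝ, |v| ≤ R → (∀ n, twoSite f (n + 1) v u = 0) →
      (e' * reflection ζ v u).re = 0 := by
    intro v hv hv0
    have h1 : Tendsto (fun n => (e (φ n) * reflection ζ v u).re) atTop
        (𝓝 (e' * reflection ζ v u).re) :=
      (Complex.continuous_re.tendsto _).comp (hlim'.mul_const _)
    exact tendsto_nhds_unique h1 ((key v hv hv0).comp hφ.tendsto_atTop)
  have h1 := hζ.one_add_freeDiag_ne_zero u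
  have h2 := hζ.one_add_freeDiag_ne_zero u'
  have h3 := eq_zero_of_re_eq_zero (hre u huR fun n => (hcon n).1) (hre u' huR' fun n => (hcon n).2)
    hζ.im_freeDiag_ne_zero hu hu' (by
      rw [mul_assoc, mul_assoc, reflection_mul ζ u u' u h1 h2])
  have he'0 : e' ≠ 0 := by
    rintro rfl
    simp at he'
  have hu0 : (u : ℂ) ≠ 0 := by exact_mod_cast hu.ne'
  have hr : reflection ζ u u ≠ 0 :=
    mul_ne_zero (mul_ne_zero (div_ne_zero hu0 h1) (pow_ne_zero _ hζ.freeDiag_ne_zero))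
      (mul_ne_zero hu0 (div_ne_zero one_ne_zero h1))
  exact (mul_ne_zero he'0 hr) h3

end

end Anderson

namespace Anderson

noncomputable section

/-! ### Pole expansions of hyperbolic functions -/

/-- The Matsubara frequency `(2 j + 1) π`. -/
def freq (j : ℕ) : ℝ := (2 * j + 1) * Real.pi

theorem freq_pos (j : ℕ) : 0 < freq j := by
  have := Real.pi_pos
  unfold freq
  positivity

theorem three_pi_le_freq {j : ℕ} (hj : j ≠ 0) : 3 * Real.pi ≤ freq j := by
  have h : (1 : ℝ) ≤ j := by exact_mod_cast Nat.one_le_iff_ne_zero.2 hj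
  unfold freq
  have := Real.pi_pos
  gcongr
  linarith

theorem pi_le_freq (j : ℕ) : Real.pi ≤ freq j := by
  unfold freq
  have := Real.pi_pos
  have h : (0 : ℝ) ≤ j := Nat.cast_nonneg j
  nlinarith

theorem summable_inv_freq_sq : Summable fun j => (freq j ^ 2)⁻¹ := by
  have h1 : Summable fun j : ℕ => 1 / ((j : ℝ) + 1) ^ 2 := by
    exact_mod_cast (summable_nat_add_iff 1).2 (Real.summable_one_div_nat_pow.2 one_lt_two)
  refine Summable.of_nonneg_of_le (fun j => by positivity) (fun j => ?_) h1
  rw [← one_div]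
  have hj : (0 : ℝ) ≤ j := Nat.cast_nonneg j
  have h2 : (j : ℝ) + 1 ≤ freq j := by
    unfold freq
    nlinarith [Real.pi_gt_three]
  gcongr

theorem mem_integerComplement_of_im_ne_zero {x : ℂ} (hx : x.im ≠ 0) :
    x ∈ Complex.integerComplement := by
  rintro ⟨n, rfl⟩
  simp at hx

theorem hasSum_cotTerm {x : ℂ} (hx : x ∈ Complex.integerComplement) :
    HasSum (cotTerm x) (Real.pi * Complex.cot (Real.pi * x) - 1 / x) := by
  rw [cot_series_rep' hx]
  exact (summable_cotTerm hx).hasSum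

/-- In the cotangent series the terms of odd index have poles at even integers and form the series
at `x / 2`. Subtracting them leaves the poles at odd integers, which become the Matsubara
frequencies. -/
theorem hasSum_cotTerm_even {x : ℂ} (hx : x.im ≠ 0) :
    HasSum (fun k => cotTerm x (2 * k))
      (Real.pi * Complex.cot (Real.pi * x) - Real.pi / 2 * Complex.cot (Real.pi * (x / 2))) := by
  have hx0 : x ≠ 0 := by
    rintro rfl
    simp at hx
  have h1 := hasSum_cotTerm (mem_integerComplement_of_im_ne_zero hx)
  have h2 := hasSum_cotTerm (x := x / 2) (mem_integerComplement_of_im_ne_zero (by simpa using hx))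
  have h3 : HasSum (fun k => cotTerm x (2 * k + 1))
      (1 / 2 * (Real.pi * Complex.cot (Real.pi * (x / 2)) - 1 / (x / 2))) := by
    refine (h2.mul_left (1 / 2)).congr_fun fun k => ?_
    have e1 : x - ((2 * k + 1 : ℕ) + 1) = 2 * (x / 2 - (k + 1)) := by push_cast; ring
    have e2 : x + ((2 * k + 1 : ℕ) + 1) = 2 * (x / 2 + (k + 1)) := by push_cast; ring
    simp only [cotTerm, e1, e2, one_div, mul_inv]
    ring
  have h4 : Summable fun k => cotTerm x (2 * k) :=
    h1.summable.comp_injective (mul_right_injective₀ two_ne_zero)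
  have h5 := (h4.hasSum.even_add_odd h3).unique h1
  have h6 := h4.hasSum
  rw [eq_sub_of_add_eq h5] at h6
  convert h6 using 1
  field_simp
  ring

/-- The partial fraction expansion of `tanh (y / 2)`. -/
theorem hasSum_tanh (y : ℝ) : HasSum (fun j => 4 * y / (y ^ 2 + freq j ^ 2))
    ((1 - Real.exp (-y)) / (1 + Real.exp (-y))) := by
  by_cases hy : y = 0
  · rw [hy]
    simp [hasSum_zero]
  have hpi := Real.pi_pos
  have hpi' : (Real.pi : ℂ) ≠ 0 := by exact_mod_cast hpi.ne'
  -- On the imaginary axis cotangents become hyperbolic cotangents.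
  set x : ℂ := y / Real.pi * Complex.I with hx
  have him : x.im = y / Real.pi := by
    rw [hx, ← Complex.ofReal_div]
    simp
  have h1 := hasSum_cotTerm_even (x := x) (by rw [him]; positivity)
  have e1 : (Real.pi : ℂ) * x = y * Complex.I := by rw [hx]; field_simp
  have e2 : (Real.pi : ℂ) * (x / 2) = y / 2 * Complex.I := by rw [hx]; field_simp
  have e3 : 2 * Complex.I * (y * Complex.I) = -(2 * y : ℂ) := by
    linear_combination 2 * (y : ℂ) * Complex.I_mul_I
  have e4 : 2 * Complex.I * (y / 2 * Complex.I) = -(y : ℂ) := by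
    linear_combination (y : ℂ) * Complex.I_mul_I
  set q : ℝ := Real.exp (-y) with hq
  have hq0 : 0 < q := Real.exp_pos _
  have hq1 : q ≠ 1 := by
    rw [hq]
    intro h
    rw [Real.exp_eq_one_iff] at h
    exact hy (by linarith)
  have e5 : Complex.exp (-(y : ℂ)) = q := by rw [hq]; push_cast; rfl
  have e6 : Complex.exp (-(2 * y : ℂ)) = q ^ 2 := by
    rw [← e5, ← Complex.exp_nat_mul]; congr 1; push_cast; ring
  rw [e1, e2, Complex.cot_eq_exp_ratio, Complex.cot_eq_exp_ratio, e3, e4, e5, e6] at h1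
  have hqa : (1 : ℂ) - q ≠ 0 := by
    rw [sub_ne_zero]; exact_mod_cast hq1.symm
  have hqb : (1 : ℂ) + q ≠ 0 := by
    have : (1 : ℝ) + q ≠ 0 := by positivity
    exact_mod_cast this
  have hqc : (1 : ℂ) - q ^ 2 = (1 - q) * (1 + q) := by ring
  have h2 := h1.mul_left (2 * Complex.I / Real.pi)
  rw [hqc] at h2
  have e7 : 2 * Complex.I / Real.pi * (Real.pi * (((q : ℂ) ^ 2 + 1) / (Complex.I * ((1 - q) * (1 + q))))
      - Real.pi / 2 * ((q + 1) / (Complex.I * (1 - q)))) = (((1 - q) / (1 + q) : ℝ) : ℂ) := by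
    push_cast
    have := Complex.I_ne_zero
    field_simp
    ring
  rw [e7] at h2
  rw [← Complex.hasSum_ofReal]
  refine h2.congr_fun fun j => ?_
  have hj := freq_pos j
  have hf : freq j = (2 * j + 1) * Real.pi := rfl
  have hd : ((y : ℂ) ^ 2 + (freq j : ℂ) ^ 2) ≠ 0 := by
    have : y ^ 2 + freq j ^ 2 ≠ 0 := by positivity
    exact_mod_cast this
  have hI := Complex.I_sq
  have e8 : x - ((2 * j : ℕ) + 1) = (y * Complex.I - freq j) / Real.pi := by
    rw [hf, hx]; push_cast; field_simp
  have e9 : x + ((2 * j : ℕ) + 1) = (y * Complex.I + freq j) / Real.pi := by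
    rw [hf, hx]; push_cast; field_simp
  have ha : (y : ℂ) * Complex.I - freq j ≠ 0 := fun h => by
    have := congrArg Complex.re h
    simp at this
    exact hj.ne' this
  have hb : (y : ℂ) * Complex.I + freq j ≠ 0 := fun h => by
    have := congrArg Complex.re h
    simp at this
    exact hj.ne' this
  simp only [cotTerm, e8, e9]
  push_cast
  field_simp
  linear_combination -(4 * (y : ℂ) * (freq j : ℂ) ^ 2) * hI

theorem abs_deriv_tanh_term_le {y w : ℝ} (hw : 0 < w) :
    |4 * (w ^ 2 - y ^ 2) / (y ^ 2 + w ^ 2) ^ 2| ≤ 4 * (w ^ 2)⁻¹ := by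
  have h0 : 0 < y ^ 2 + w ^ 2 := by positivity
  rw [abs_div, abs_mul, abs_of_pos (by positivity : (0 : ℝ) < 4),
    abs_of_pos (by positivity : 0 < (y ^ 2 + w ^ 2) ^ 2), ← div_eq_mul_inv]
  have h1 : |w ^ 2 - y ^ 2| ≤ y ^ 2 + w ^ 2 := by
    rw [abs_le]; constructor <;> nlinarith [sq_nonneg y, sq_nonneg w]
  calc 4 * |w ^ 2 - y ^ 2| / (y ^ 2 + w ^ 2) ^ 2 ≤ 4 * (y ^ 2 + w ^ 2) / (y ^ 2 + w ^ 2) ^ 2 := by gcongr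
    _ = 4 / (y ^ 2 + w ^ 2) := by field_simp
    _ ≤ 4 / w ^ 2 := by gcongr; nlinarith [sq_nonneg y]

/-- The partial fraction expansion of `(2 cosh (y / 2) ^ 2)⁻¹`. -/
theorem hasSum_deriv_tanh (y : ℝ) :
    HasSum (fun j => 4 * (freq j ^ 2 - y ^ 2) / (y ^ 2 + freq j ^ 2) ^ 2)
      (2 * Real.exp (-y) / (1 + Real.exp (-y)) ^ 2) := by
  have hs : Summable fun j => 4 * (freq j ^ 2)⁻¹ := summable_inv_freq_sq.mul_left 4
  have hd : ∀ (j : ℕ) (y : ℝ), HasDerivAt (fun y => 4 * y / (y ^ 2 + freq j ^ 2))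
      (4 * (freq j ^ 2 - y ^ 2) / (y ^ 2 + freq j ^ 2) ^ 2) y := by
    intro j y
    have hj := freq_pos j
    have h0 : y ^ 2 + freq j ^ 2 ≠ 0 := by positivity
    have h1 : HasDerivAt (fun y : ℝ => 4 * y) 4 y := by simpa using (hasDerivAt_id y).const_mul 4
    have h2 : HasDerivAt (fun y : ℝ => y ^ 2 + freq j ^ 2) (2 * y) y := by
      simpa using (hasDerivAt_pow 2 y).add_const (freq j ^ 2)
    refine (h1.fun_div h2 h0).congr_deriv ?_
    congr 1
    ring
  have h1 := hasDerivAt_tsum hs hd (fun j y => abs_deriv_tanh_term_le (freq_pos j))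
    (hasSum_tanh 0).summable y
  have h2 : (fun z => ∑' j, 4 * z / (z ^ 2 + freq j ^ 2))
      = fun z => (1 - Real.exp (-z)) / (1 + Real.exp (-z)) := funext fun z => (hasSum_tanh z).tsum_eq
  rw [h2] at h1
  have h3 : HasDerivAt (fun z => (1 - Real.exp (-z)) / (1 + Real.exp (-z)))
      (2 * Real.exp (-y) / (1 + Real.exp (-y)) ^ 2) y := by
    have e1 : HasDerivAt (fun z => Real.exp (-z)) (-Real.exp (-y)) y := by
      simpa using (hasDerivAt_neg y).exp
    refine ((e1.const_sub 1).fun_div (e1.const_add 1) (by positivity)).congr_deriv ?_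
    congr 1
    ring
  rw [h3.unique h1]
  refine Summable.hasSum (Summable.of_norm_bounded hs fun j => ?_)
  exact abs_deriv_tanh_term_le (freq_pos j)

/-! ### Pole series with equidistant poles -/

/-- The point `E + i h`. -/
def pole (E h : ℝ) : ℂ := ⟨E, h⟩

theorem inv_sub_pole (E h x : ℝ) (hh : 0 < h) :
    ((x : ℂ) - pole E h)⁻¹ = (((x - E) / ((x - E) ^ 2 + h ^ 2) : ℝ) : ℂ)
      + ((h / ((x - E) ^ 2 + h ^ 2) : ℝ) : ℂ) * Complex.I := by
  have e : (x : ℂ) - pole E h = (x - E) - h * Complex.I := by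
    apply Complex.ext <;> simp [pole]
  have hd : ((x : ℂ) - E) ^ 2 + (h : ℂ) ^ 2 ≠ 0 := by
    have : (x - E) ^ 2 + h ^ 2 ≠ 0 := by positivity
    exact_mod_cast this
  rw [e]
  refine inv_eq_of_mul_eq_one_right ?_
  push_cast
  field_simp
  linear_combination -(h : ℂ) ^ 2 * Complex.I_sq

theorem poleFun_simple (E h c x : ℝ) (hh : 0 < h) :
    poleFun c 0 (pole E h) x = c * ((x - E) / ((x - E) ^ 2 + h ^ 2)) := by
  rw [poleFun, inv_sub_pole E h x hh]
  generalize (x - E) / ((x - E) ^ 2 + h ^ 2) = p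
  generalize h / ((x - E) ^ 2 + h ^ 2) = r
  simp

/-- The coefficients come from `x - E = (x - z) + i h`: the function is the real part of `c (x - E)
/ (x - z)²`. -/
theorem poleFun_double (E h c x : ℝ) (hh : 0 < h) :
    poleFun c (c * h * Complex.I) (pole E h) x
      = -(c * ((x - E) * (h ^ 2 - (x - E) ^ 2) / ((x - E) ^ 2 + h ^ 2) ^ 2)) := by
  rw [poleFun, inv_sub_pole E h x hh]
  have hd : (x - E) ^ 2 + h ^ 2 ≠ 0 := by positivity
  have e : (x - E) * (h ^ 2 - (x - E) ^ 2) / ((x - E) ^ 2 + h ^ 2) ^ 2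
      = 2 * h * ((x - E) / ((x - E) ^ 2 + h ^ 2)) * (h / ((x - E) ^ 2 + h ^ 2))
        - (x - E) / ((x - E) ^ 2 + h ^ 2) := by
    field_simp
    ring
  rw [e]
  generalize (x - E) / ((x - E) ^ 2 + h ^ 2) = p
  generalize h / ((x - E) ^ 2 + h ^ 2) = r
  simp
  ring

theorem hasSum_tanh_poles {S : ℝ} (hS : 0 < S) (E c x : ℝ) :
    HasSum (fun j => poleFun ((4 * c / S : ℝ) : ℂ) 0 (pole E (freq j / S)) x)
      (c * ((1 - Real.exp (-(S * (x - E)))) / (1 + Real.exp (-(S * (x - E)))))) := by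
  refine ((hasSum_tanh (S * (x - E))).mul_left c).congr_fun fun j => ?_
  have hj := freq_pos j
  rw [poleFun_simple _ _ _ _ (by positivity)]
  have h1 : (x - E) ^ 2 + (freq j / S) ^ 2 ≠ 0 := by positivity
  have h2 : (S * (x - E)) ^ 2 + freq j ^ 2 ≠ 0 := by positivity
  have h3 : (S * (x - E)) ^ 2 + freq j ^ 2 = S ^ 2 * ((x - E) ^ 2 + (freq j / S) ^ 2) := by
    field_simp
  rw [h3]
  field_simp

theorem abs_sub_le_of_abs_le {E x L : ℝ} (hx : |x| ≤ L) : |x - E| ≤ L + |E| :=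
  (abs_sub x E).trans (by linarith)

theorem abs_poleFun_simple_le {E h c x L : ℝ} (hh : 0 < h) (hx : |x| ≤ L) :
    |poleFun c 0 (pole E h) x| ≤ |c| * (L + |E|) * (h ^ 2)⁻¹ := by
  have hL : 0 ≤ L := (abs_nonneg x).trans hx
  have h1 : 0 < (x - E) ^ 2 + h ^ 2 := by positivity
  rw [poleFun_simple E h c x hh, abs_mul, abs_div, abs_of_pos h1, mul_assoc, ← div_eq_mul_inv]
  gcongr
  · exact abs_sub_le_of_abs_le hx
  · nlinarith [sq_nonneg (x - E)]

theorem abs_poleFun_double_le {E h c x L : ℝ} (hh : 0 < h) (hx : |x| ≤ L) :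
    |poleFun c (c * h * Complex.I) (pole E h) x| ≤ |c| * (L + |E|) * (h ^ 2)⁻¹ := by
  have hL : 0 ≤ L := (abs_nonneg x).trans hx
  rw [poleFun_double E h c x hh, abs_neg, abs_mul, mul_assoc, mul_div_assoc, abs_mul]
  gcongr
  · exact abs_sub_le_of_abs_le hx
  · have := abs_deriv_tanh_term_le (y := x - E) hh
    rw [mul_div_assoc, abs_mul, abs_of_pos (by norm_num : (0 : ℝ) < 4)] at this
    linarith

theorem summable_inv_scaled_freq_sq (S : ℝ) :
    Summable fun j => ((freq j / S) ^ 2)⁻¹ := by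
  refine (summable_inv_freq_sq.mul_left (S ^ 2)).congr fun j => ?_
  rw [div_pow, inv_div, div_eq_mul_inv]

theorem summable_inv_scaled_freq_pow {S : ℝ} (hS : 0 < S) :
    Summable fun j => (freq j / S)⁻¹ ^ 4 := by
  refine Summable.of_nonneg_of_le (fun j => ?_) (fun j => ?_)
    ((summable_inv_scaled_freq_sq S).mul_left ((Real.pi / S)⁻¹ ^ 2))
  · have := freq_pos j
    positivity
  · have h1 := freq_pos j
    have h2 := pi_le_freq j
    have h3 := Real.pi_pos
    rw [← inv_pow, show (freq j / S)⁻¹ ^ 4 = (freq j / S)⁻¹ ^ 2 * (freq j / S)⁻¹ ^ 2 by ring]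
    gcongr

/-- The two families of poles have heights `freq j / S` and `freq j / T`. As `T < S`, the lowest is
`π / S`, and the second family cannot cancel it. -/
theorem poleSeries_tanh_sub {S T : ℝ} (hT : 0 < T) (hTS : T < S) {c : ℝ} (hc : c ≠ 0) (E R : ℝ) :
    PoleSeries R (fun x => c * ((1 - Real.exp (-(S * (x - E)))) / (1 + Real.exp (-(S * (x - E)))))
      - c * ((1 - Real.exp (-(T * (x - E)))) / (1 + Real.exp (-(T * (x - E))))))
      (Sum.elim (fun _ : ℕ => ((4 * c / S : ℝ) : ℂ)) (fun _ : ℕ => ((4 * -c / T : ℝ) : ℂ)))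
      (fun _ => 0) (Sum.elim (fun j => pole E (freq j / S)) (fun j => pole E (freq j / T)))
      (Sum.inl 0) where
  im_pos := div_pos (freq_pos 0) (hT.trans hTS)
  re_eq i := by cases i <;> rfl
  gap := by
    have hS := hT.trans hTS
    have hpi := Real.pi_pos
    have h0 : freq 0 = Real.pi := by simp [freq]
    have h1 : Real.pi / S < Real.pi / T := by gcongr
    -- The next pole of the first family has height `3π / S`, and the lowest of the second has
    -- height `π / T`.
    refine ⟨min (2 * Real.pi / S) ((Real.pi / S + Real.pi / T) / 2), ?_, ?_⟩
    · change freq 0 / S < _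
      rw [h0]
      refine lt_min ?_ (by linarith)
      gcongr
      linarith
    · rintro (j | j) hj
      · change _ < freq j / S
        refine (min_le_left _ _).trans_lt ?_
        have := three_pi_le_freq (j := j) (by rintro rfl; exact hj rfl)
        gcongr
        linarith
      · change _ < freq j / T
        refine (min_le_right _ _).trans_lt ?_
        have : Real.pi / T ≤ freq j / T := by
          have := pi_le_freq j
          gcongr
        linarith
  ne_zero := by
    left
    have hS := hT.trans hTS
    have : 4 * c / S ≠ 0 := by positivity
    exact Complex.ofReal_ne_zero.2 this
  summable := by
    refine Summable.sum _ ?_ ?_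
    · exact (summable_inv_scaled_freq_pow (hT.trans hTS)).mul_left
        (‖((4 * c / S : ℝ) : ℂ)‖ + ‖(0 : ℂ)‖)
    · exact (summable_inv_scaled_freq_pow hT).mul_left (‖((4 * -c / T : ℝ) : ℂ)‖ + ‖(0 : ℂ)‖)
  bound := by
    refine ⟨Sum.elim (fun j => |4 * c / S| * (2 + R + |E|) * ((freq j / S) ^ 2)⁻¹)
      (fun j => |4 * -c / T| * (2 + R + |E|) * ((freq j / T) ^ 2)⁻¹), Summable.sum _ ?_ ?_, ?_⟩
    · exact (summable_inv_scaled_freq_sq S).mul_left (|4 * c / S| * (2 + R + |E|))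
    · exact (summable_inv_scaled_freq_sq T).mul_left (|4 * -c / T| * (2 + R + |E|))
    · rintro (j | j) x hx
      · exact abs_poleFun_simple_le (div_pos (freq_pos j) (hT.trans hTS)) hx
      · exact abs_poleFun_simple_le (div_pos (freq_pos j) hT) hx
  hasSum x _ := by
    have h := HasSum.sum (f := fun i : ℕ ⊕ ℕ => poleFun
      (Sum.elim (fun _ : ℕ => ((4 * c / S : ℝ) : ℂ)) (fun _ : ℕ => ((4 * -c / T : ℝ) : ℂ)) i) 0
      (Sum.elim (fun j => pole E (freq j / S)) (fun j => pole E (freq j / T)) i) x)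
      (hasSum_tanh_poles (hT.trans hTS) E c x) (hasSum_tanh_poles hT E (-c) x)
    rwa [neg_mul, ← sub_eq_add_neg] at h

theorem poleSeries_sech {S : ℝ} (hS : 0 < S) {c : ℝ} (hc : c ≠ 0) (E R : ℝ) :
    PoleSeries R (fun x => -(c * (x - E)
        * (Real.exp (-(S * (x - E))) / (1 + Real.exp (-(S * (x - E)))) ^ 2)))
      (fun _ : ℕ => ((2 * c / S ^ 2 : ℝ) : ℂ))
      (fun j => ((2 * c / S ^ 2 : ℝ) : ℂ) * ((freq j / S : ℝ) : ℂ) * Complex.I)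
      (fun j => pole E (freq j / S)) 0 where
  im_pos := div_pos (freq_pos 0) hS
  re_eq _ := rfl
  gap := by
    have hpi := Real.pi_pos
    have h0 : freq 0 = Real.pi := by simp [freq]
    refine ⟨2 * Real.pi / S, ?_, fun j hj => ?_⟩
    · change freq 0 / S < _
      rw [h0]
      gcongr
      linarith
    · change _ < freq j / S
      have := three_pi_le_freq hj
      gcongr
      linarith
  ne_zero := by
    left
    have : 2 * c / S ^ 2 ≠ 0 := by positivity
    exact_mod_cast this
  summable := by
    have hpi := Real.pi_pos
    have h1 := (summable_inv_scaled_freq_pow hS).mul_left |2 * c / S ^ 2|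
    have h2 := (summable_inv_scaled_freq_sq S).mul_left (|2 * c / S ^ 2| * (Real.pi / S)⁻¹)
    refine Summable.of_nonneg_of_le (fun j => ?_) (fun j => ?_) (h1.add h2)
    · have := freq_pos j
      change 0 ≤ _ * (freq j / S)⁻¹ ^ 4
      positivity
    · have hj := freq_pos j
      have h3 := pi_le_freq j
      change _ * (freq j / S)⁻¹ ^ 4 ≤ _
      rw [norm_mul, norm_mul, Complex.norm_I, mul_one, Complex.norm_real, Complex.norm_real,
        Real.norm_eq_abs, Real.norm_of_nonneg (by positivity : 0 ≤ freq j / S), add_mul]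
      refine add_le_add le_rfl ?_
      calc |2 * c / S ^ 2| * (freq j / S) * (freq j / S)⁻¹ ^ 4
          = |2 * c / S ^ 2| * (freq j / S)⁻¹ * ((freq j / S) ^ 2)⁻¹ := by field_simp
        _ ≤ _ := by gcongr
  bound := ⟨_, (summable_inv_scaled_freq_sq S).mul_left (|2 * c / S ^ 2| * (2 + R + |E|)),
    fun j _ hx => abs_poleFun_double_le (div_pos (freq_pos j) hS) hx⟩
  hasSum x _ := by
    have h := (hasSum_deriv_tanh (S * (x - E))).mul_left (-(c * (x - E) / 2))
    have e : -(c * (x - E) * (Real.exp (-(S * (x - E))) / (1 + Real.exp (-(S * (x - E)))) ^ 2))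
        = -(c * (x - E) / 2) * (2 * Real.exp (-(S * (x - E))) / (1 + Real.exp (-(S * (x - E)))) ^ 2) := by
      ring
    rw [e]
    refine h.congr_fun fun j => ?_
    have hj := freq_pos j
    rw [poleFun_double _ _ _ _ (by positivity)]
    have h1 : (x - E) ^ 2 + (freq j / S) ^ 2 ≠ 0 := by positivity
    have h3 : (S * (x - E)) ^ 2 + freq j ^ 2 = S ^ 2 * ((x - E) ^ 2 + (freq j / S) ^ 2) := by
      field_simp
    have h4 : freq j ^ 2 - (S * (x - E)) ^ 2 = S ^ 2 * ((freq j / S) ^ 2 - (x - E) ^ 2) := by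
      field_simp
    rw [h3, h4]
    generalize (x - E) ^ 2 + (freq j / S) ^ 2 = D at h1 ⊢
    generalize (freq j / S) ^ 2 - (x - E) ^ 2 = G
    field_simp
    ring

end

end Anderson

namespace Anderson

noncomputable section

open scoped ContDiff

/-! ### The entropy functions -/

/-- A bound on the second derivative makes `φ'` Lipschitz; the mean value inequality for `φ` minus
its tangent gives the square. -/
theorem exists_hasQuadraticBound {φ : ℝ → ℝ} {m₁ m₂ : ℝ}
    (h : ∀ x ∈ Set.Icc m₁ m₂, ContDiffAt ℝ 2 φ x) :
    ∃ C, 0 ≤ C ∧ HasQuadraticBound φ (deriv φ) (Set.Icc m₁ m₂) C := by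
  have h1 : ∀ x ∈ Set.Icc m₁ m₂, ContDiffAt ℝ 1 (deriv φ) x := fun x hx =>
    (h x hx).derivWithin (by norm_num)
  have h2 : ContinuousOn (deriv (deriv φ)) (Set.Icc m₁ m₂) := fun x hx =>
    ((h1 x hx).derivWithin (m := 0) (by norm_num)).continuousAt.continuousWithinAt
  obtain ⟨B, hB⟩ := isCompact_Icc.exists_bound_of_continuousOn h2
  refine ⟨|B|, abs_nonneg _, fun x hx y hy => ?_⟩
  have hconv : Convex ℝ (Set.Icc m₁ m₂) := convex_Icc m₁ m₂
  have h3 : ∀ t ∈ Set.Icc m₁ m₂, ‖deriv φ t - deriv φ y‖ ≤ |B| * ‖t - y‖ := by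
    intro t ht
    exact hconv.norm_image_sub_le_of_norm_deriv_le
      (fun s hs => (h1 s hs).differentiableAt one_ne_zero)
      (fun s hs => (hB s hs).trans (le_abs_self B)) hy ht
  have hsub : Set.uIcc y x ⊆ Set.Icc m₁ m₂ := Set.uIcc_subset_Icc hy hx
  have h4 : ∀ t ∈ Set.uIcc y x,
      HasDerivWithinAt (fun t => φ t - deriv φ y * t) (deriv φ t - deriv φ y) (Set.uIcc y x) t := by
    intro t ht
    have e1 := ((h t (hsub ht)).differentiableAt two_ne_zero).hasDerivAt
    have e2 : HasDerivAt (fun t => deriv φ y * t) (deriv φ y) t := by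
      simpa using (hasDerivAt_id t).const_mul (deriv φ y)
    exact (e1.sub e2).hasDerivWithinAt
  have h5 := (convex_uIcc y x).norm_image_sub_le_of_norm_hasDerivWithin_le h4
    (fun t ht => (h3 t (hsub ht)).trans (mul_le_mul_of_nonneg_left (show ‖t - y‖ ≤ ‖x - y‖ by
      rw [Real.norm_eq_abs, Real.norm_eq_abs]
      exact Set.abs_sub_left_of_mem_uIcc ht) (abs_nonneg B)))
    Set.left_mem_uIcc Set.right_mem_uIcc
  rw [mul_assoc, Real.norm_eq_abs, Real.norm_eq_abs, abs_mul_abs_self, ← sq] at h5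
  convert h5 using 2
  ring

theorem contDiffAt_renyi (α : ℝ) {x : ℝ} (h0 : 0 < x) (h1 : x < 1) :
    ContDiffAt ℝ ∞ (renyi α) x := by
  have hx : 0 < 1 - x := by linarith
  have hid : ContDiffAt ℝ ∞ (fun x : ℝ => x) x := contDiffAt_id
  have hsub : ContDiffAt ℝ ∞ (fun x : ℝ => 1 - x) x := contDiffAt_const.sub hid
  by_cases hα : α = 1
  · have e : renyi α = fun x => -x * (Real.log x / Real.log 2)
        - (1 - x) * (Real.log (1 - x) / Real.log 2) := by
      funext y
      rw [renyi, if_pos hα, Real.logb, Real.logb]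
    rw [e]
    exact (hid.neg.mul ((hid.log h0.ne').div_const _)).sub
      (hsub.mul ((hsub.log hx.ne').div_const _))
  · have e : renyi α = fun x => (1 - α)⁻¹ * (Real.log (x ^ α + (1 - x) ^ α) / Real.log 2) := by
      funext y
      rw [renyi, if_neg hα, Real.logb]
    rw [e]
    refine contDiffAt_const.mul ((ContDiffAt.log ?_ ?_).div_const _)
    · exact (Real.contDiffAt_rpow_const_of_ne h0.ne').add
        ((Real.contDiffAt_rpow_const_of_ne hx.ne').comp x hsub)
    · have := Real.rpow_pos_of_pos h0 α
      have := Real.rpow_pos_of_pos hx α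
      positivity

theorem fermi_pos (β EF x : ℝ) : 0 < fermi β EF x := by
  unfold fermi
  positivity

theorem fermi_lt_one (β EF x : ℝ) : fermi β EF x < 1 := by
  unfold fermi
  exact inv_lt_one_of_one_lt₀ (by linarith [Real.exp_pos (β * (x - EF))])

theorem contDiff_fermi (β EF : ℝ) : ContDiff ℝ ∞ (fermi β EF) := by
  unfold fermi
  refine ContDiff.inv (by fun_prop) fun x => ?_
  positivity

theorem contDiff_renyi_fermi (α β EF : ℝ) : ContDiff ℝ ∞ (renyi α ∘ fermi β EF) :=
  contDiff_iff_contDiffAt.2 fun x =>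
    (contDiffAt_renyi α (fermi_pos β EF x) (fermi_lt_one β EF x)).comp x
      (contDiff_fermi β EF).contDiffAt

/-- On a bounded set of energies the Fermi function stays away from `0` and `1`, the endpoints where
smoothness of the entropy may fail. -/
theorem exists_fermi_mem_Icc (β EF L : ℝ) : ∃ m₁ m₂ : ℝ, 0 < m₁ ∧ m₂ < 1 ∧
    ∀ x, |x| ≤ L → fermi β EF x ∈ Set.Icc m₁ m₂ := by
  have hc := (contDiff_fermi β EF).continuous
  by_cases hL : 0 ≤ L
  · have hne : (Set.Icc (-L) L).Nonempty := ⟨0, by constructor <;> linarith⟩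
    obtain ⟨x₁, -, h1⟩ := isCompact_Icc.exists_isMinOn hne hc.continuousOn
    obtain ⟨x₂, -, h2⟩ := isCompact_Icc.exists_isMaxOn hne hc.continuousOn
    exact ⟨_, _, fermi_pos β EF x₁, fermi_lt_one β EF x₂, fun x hx =>
      ⟨h1 (abs_le.1 hx), h2 (abs_le.1 hx)⟩⟩
  · exact ⟨1, 0, one_pos, zero_lt_one, fun x hx => absurd ((abs_nonneg x).trans hx) hL⟩

theorem one_sub_fermi (β EF x : ℝ) :
    1 - fermi β EF x = Real.exp (β * (x - EF)) * fermi β EF x := by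
  have := Real.exp_pos (β * (x - EF))
  unfold fermi
  field_simp
  ring

theorem log_fermi (β EF x : ℝ) :
    Real.log (fermi β EF x) = -Real.log (1 + Real.exp (β * (x - EF))) := by
  rw [fermi, Real.log_inv, add_comm]

/-- Since `1 - n_F` is `e^{β (x - E_F)}` times `n_F`, the power sum factors, and the entropy
combines two free energies at inverse temperatures `α β` and `β`. -/
theorem renyi_fermi_of_ne {α : ℝ} (hα : α ≠ 1) (β EF x : ℝ) :
    renyi α (fermi β EF x) = (1 - α)⁻¹ / Real.log 2
      * (Real.log (1 + Real.exp (α * β * (x - EF))) - α * Real.log (1 + Real.exp (β * (x - EF)))) := by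
  have h0 := fermi_pos β EF x
  rw [renyi, if_neg hα, one_sub_fermi, Real.mul_rpow (Real.exp_pos _).le h0.le, ← Real.exp_mul,
    Real.logb]
  have e : fermi β EF x ^ α + Real.exp (β * (x - EF) * α) * fermi β EF x ^ α
      = (1 + Real.exp (α * β * (x - EF))) * fermi β EF x ^ α := by
    rw [show β * (x - EF) * α = α * β * (x - EF) by ring]
    ring
  rw [e, Real.log_mul (by positivity) (Real.rpow_pos_of_pos h0 α).ne', Real.log_rpow h0, log_fermi]
  ring

theorem renyi_one_fermi (β EF x : ℝ) :
    renyi 1 (fermi β EF x) = (Real.log (1 + Real.exp (β * (x - EF)))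
      - β * (x - EF) * (1 - fermi β EF x)) / Real.log 2 := by
  have h0 := fermi_pos β EF x
  rw [renyi, if_pos rfl, Real.logb, Real.logb, one_sub_fermi,
    Real.log_mul (Real.exp_pos _).ne' h0.ne', Real.log_exp, log_fermi, ← one_sub_fermi]
  ring

theorem hasDerivAt_log_one_add_exp (S E x : ℝ) :
    HasDerivAt (fun x => Real.log (1 + Real.exp (S * (x - E))))
      (S / 2 * (1 + (1 - Real.exp (-(S * (x - E)))) / (1 + Real.exp (-(S * (x - E)))))) x := by
  have h1 : HasDerivAt (fun x => S * (x - E)) S x := by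
    simpa using ((hasDerivAt_id x).sub_const E).const_mul S
  refine ((h1.exp.const_add 1).log (by positivity)).congr_deriv ?_
  rw [Real.exp_neg]
  have := Real.exp_pos (S * (x - E))
  generalize Real.exp (S * (x - E)) = q at this ⊢
  field_simp
  ring

/-- Each free energy contributes a constant plus a hyperbolic tangent; the constants cancel, and
equal amplitudes with opposite signs remain. -/
theorem deriv_renyi_fermi_of_ne {α : ℝ} (hα : α ≠ 1) (β EF : ℝ) :
    deriv (renyi α ∘ fermi β EF) = fun x =>
      (1 - α)⁻¹ / Real.log 2 * (α * β / 2)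
          * ((1 - Real.exp (-(α * β * (x - EF)))) / (1 + Real.exp (-(α * β * (x - EF)))))
        - (1 - α)⁻¹ / Real.log 2 * (α * β / 2)
          * ((1 - Real.exp (-(β * (x - EF)))) / (1 + Real.exp (-(β * (x - EF))))) := by
  have e : renyi α ∘ fermi β EF = fun x => (1 - α)⁻¹ / Real.log 2
      * (Real.log (1 + Real.exp (α * β * (x - EF)))
        - α * Real.log (1 + Real.exp (β * (x - EF)))) :=
    funext fun x => renyi_fermi_of_ne hα β EF x
  rw [e]
  funext x
  have h := ((hasDerivAt_log_one_add_exp (α * β) EF x).sub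
    ((hasDerivAt_log_one_add_exp β EF x).const_mul α)).const_mul ((1 - α)⁻¹ / Real.log 2)
  refine h.deriv.trans ?_
  ring

theorem deriv_renyi_one_fermi (β EF : ℝ) :
    deriv (renyi 1 ∘ fermi β EF) = fun x => -(β ^ 2 / Real.log 2 * (x - EF)
      * (Real.exp (-(β * (x - EF))) / (1 + Real.exp (-(β * (x - EF)))) ^ 2)) := by
  have e : renyi 1 ∘ fermi β EF = fun x => (Real.log (1 + Real.exp (β * (x - EF)))
      - β * (x - EF) * (1 - (Real.exp (β * (x - EF)) + 1)⁻¹)) / Real.log 2 :=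
    funext fun x => renyi_one_fermi β EF x
  rw [e]
  funext x
  have h1 : HasDerivAt (fun x => β * (x - EF)) β x := by
    simpa using ((hasDerivAt_id x).sub_const EF).const_mul β
  have h2 := ((h1.exp.add_const 1).fun_inv (by positivity)).const_sub 1
  have h3 := ((hasDerivAt_log_one_add_exp β EF x).sub (h1.mul h2)).div_const (Real.log 2)
  refine h3.deriv.trans ?_
  rw [Real.exp_neg]
  have := Real.exp_pos (β * (x - EF))
  have hl : Real.log 2 ≠ 0 := (Real.log_pos one_lt_two).ne'
  generalize Real.exp (β * (x - EF)) = q at this ⊢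
  field_simp
  ring

theorem exists_twoSite_deriv_ne_zero {α β : ℝ} (hα : 0 < α) (hβ : 0 < β) (EF : ℝ) {R u u' : ℝ}
    (hu : 0 < u) (hu' : u' < 0) (huR : |u| ≤ R) (huR' : |u'| ≤ R) :
    ∃ n : ℕ, twoSite (deriv (renyi α ∘ fermi β EF)) (n + 1) u u ≠ 0 ∨
      twoSite (deriv (renyi α ∘ fermi β EF)) (n + 1) u' u ≠ 0 := by
  have hl : 0 < Real.log 2 := Real.log_pos one_lt_two
  rcases lt_trichotomy α 1 with h | h | h
  -- For `α < 1` the term at inverse temperature `β` has the lower pole, so the two terms exchange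
  -- roles and the amplitude changes sign.
  · have hc : -((1 - α)⁻¹ / Real.log 2 * (α * β / 2)) ≠ 0 := by
      have : 0 < 1 - α := by linarith
      exact (neg_neg_of_pos (by positivity)).ne
    have h1 := poleSeries_tanh_sub (S := β) (T := α * β) (by positivity) (by nlinarith) hc EF R
    have e : deriv (renyi α ∘ fermi β EF) = _ := deriv_renyi_fermi_of_ne h.ne β EF
    rw [e]
    convert h1.exists_twoSite_ne_zero hu hu' huR huR' using 4 <;>
    · congr 1
      funext x
      ring
  · rw [h, deriv_renyi_one_fermi]
    exact (poleSeries_sech hβ (by positivity) EF R).exists_twoSite_ne_zero hu hu' huR huR'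
  · rw [deriv_renyi_fermi_of_ne h.ne']
    refine (poleSeries_tanh_sub (S := α * β) (T := β) hβ (by nlinarith) ?_ EF
      R).exists_twoSite_ne_zero hu hu' huR huR'
    have : 1 - α ≠ 0 := by linarith
    positivity

end

end Anderson

namespace Anderson

noncomputable section

/-! ### The spectral measure and the density of states -/

section SpectralMeasure

variable {A : Ell2 →L[ℂ] Ell2} {L : ℝ}

instance (A : Ell2 →L[ℂ] Ell2) : (spectralMeasure A).Regular :=
  inferInstanceAs (RealRMK.rieszMeasure (spectralFunctional A)).Regular

theorem integral_spectralMeasure_of_hasCompactSupport (A : Ell2 →L[ℂ] Ell2) {f : ℝ → ℝ}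
    (hf : Continuous f) (hc : HasCompactSupport f) :
    ∫ x, f x ∂(spectralMeasure A) = (entry (cfc f A) 0 0).re :=
  RealRMK.integral_rieszMeasure (spectralFunctional A) ⟨⟨f, hf⟩, hc⟩

/-- A smooth function equal to `1` on `[-(N + 1), N + 1]`. -/
def cutoff (N : ℕ) : ContDiffBump (0 : ℝ) := ⟨N + 1, N + 2, by positivity, by linarith⟩

theorem cutoff_eq_one {N : ℕ} {x : ℝ} (hx : |x| ≤ N + 1) : cutoff N x = 1 :=
  (cutoff N).one_of_mem_closedBall (by simpa [cutoff] using hx)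

theorem re_entry_one : (entry 1 0 0).re = 1 := by
  rw [entry_one]
  simp

theorem integral_cutoff (hA : IsSelfAdjoint A) (hL : ∀ x ∈ spectrum ℝ A, |x| ≤ L) {N : ℕ}
    (hN : L ≤ N) : ∫ x, cutoff N x ∂(spectralMeasure A) = 1 := by
  rw [integral_spectralMeasure_of_hasCompactSupport A (cutoff N).continuous
    (cutoff N).hasCompactSupport]
  have h : cfc (cutoff N) A = cfc (fun _ : ℝ => (1 : ℝ)) A := cfc_congr fun x hx =>
    cutoff_eq_one (by linarith [hL x hx])
  rw [h, cfc_const_one ℝ A, re_entry_one]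

/-- The Riesz measure is only tested on functions of compact support. Cutoffs equal to `1` on the
spectrum act as the identity operator, and so they measure the total mass. -/
theorem isProbabilityMeasure_spectralMeasure (hA : IsSelfAdjoint A)
    (hL : ∀ x ∈ spectrum ℝ A, |x| ≤ L) : IsProbabilityMeasure (spectralMeasure A) := by
  obtain ⟨N₀, hN₀⟩ := exists_nat_ge L
  have hint : ∀ N, Integrable (cutoff N) (spectralMeasure A) := fun N =>
    (cutoff N).continuous.integrable_of_hasCompactSupport (cutoff N).hasCompactSupport
  have h1 : ∀ N, N₀ ≤ N → spectralMeasure A (Metric.closedBall 0 N) ≤ 1 := by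
    intro N hN
    have hN' : L ≤ N := hN₀.trans (by exact_mod_cast hN)
    have h2 : ∫⁻ x, ENNReal.ofReal (cutoff N x) ∂(spectralMeasure A) = 1 := by
      rw [← ofReal_integral_eq_lintegral_ofReal (hint N)
        (Eventually.of_forall fun x => (cutoff N).nonneg), integral_cutoff hA hL hN',
        ENNReal.ofReal_one]
    rw [← h2, ← lintegral_indicator_one Metric.isClosed_closedBall.measurableSet]
    refine lintegral_mono fun x => ?_
    by_cases hx : x ∈ Metric.closedBall (0 : ℝ) N
    · rw [Set.indicator_of_mem hx, cutoff_eq_one (by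
        have : |x| ≤ N := by simpa using hx
        linarith)]
      simp
    · rw [Set.indicator_of_notMem hx]
      exact zero_le
  have h3 : spectralMeasure A Set.univ ≤ 1 := by
    have h4 := tendsto_measure_iUnion_atTop (μ := spectralMeasure A)
      (s := fun N : ℕ => Metric.closedBall (0 : ℝ) N)
      (fun a b hab => Metric.closedBall_subset_closedBall (by exact_mod_cast hab))
    rw [Metric.iUnion_closedBall_nat] at h4
    exact le_of_tendsto h4 (eventually_atTop.2 ⟨N₀, h1⟩)
  have hfin : IsFiniteMeasure (spectralMeasure A) := ⟨h3.trans_lt ENNReal.one_lt_top⟩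
  refine ⟨le_antisymm h3 ?_⟩
  have h5 : (1 : ℝ) ≤ (spectralMeasure A).real Set.univ := by
    rw [← integral_cutoff hA hL hN₀]
    have h6 : ∫ _, (1 : ℝ) ∂(spectralMeasure A) = (spectralMeasure A).real Set.univ := by simp
    rw [← h6]
    exact integral_mono (hint N₀) (integrable_const _) fun x => (cutoff N₀).le_one
  rw [measureReal_def, ← ENNReal.toReal_one] at h5
  exact (ENNReal.toReal_le_toReal ENNReal.one_ne_top (measure_ne_top _ _)).1 h5

theorem ae_cutoff_eq_one (hA : IsSelfAdjoint A) (hL : ∀ x ∈ spectrum ℝ A, |x| ≤ L) {N : ℕ}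
    (hN : L ≤ N) : ∀ᵐ x ∂(spectralMeasure A), cutoff N x = 1 := by
  have hp := isProbabilityMeasure_spectralMeasure hA hL
  have hint : Integrable (cutoff N) (spectralMeasure A) :=
    (cutoff N).continuous.integrable_of_hasCompactSupport (cutoff N).hasCompactSupport
  have h1 : ∫ x, (1 - cutoff N x) ∂(spectralMeasure A) = 0 := by
    rw [integral_sub (integrable_const _) hint, integral_cutoff hA hL hN]
    simp
  rw [integral_eq_zero_iff_of_nonneg (fun x => sub_nonneg.2 (cutoff N).le_one)
    ((integrable_const _).sub hint)] at h1
  filter_upwards [h1] with x hx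
  exact (sub_eq_zero.1 hx).symm

theorem integral_spectralMeasure (hA : IsSelfAdjoint A) (hL : ∀ x ∈ spectrum ℝ A, |x| ≤ L)
    {f : ℝ → ℝ} (hf : Continuous f) :
    ∫ x, f x ∂(spectralMeasure A) = (entry (cfc f A) 0 0).re := by
  obtain ⟨N, hN⟩ := exists_nat_ge L
  have h1 : ∫ x, f x ∂(spectralMeasure A) = ∫ x, cutoff N x * f x ∂(spectralMeasure A) := by
    refine integral_congr_ae ?_
    filter_upwards [ae_cutoff_eq_one hA hL hN] with x hx
    rw [hx, one_mul]
  refine h1.trans ((integral_spectralMeasure_of_hasCompactSupport A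
    ((cutoff N).continuous.mul hf) (cutoff N).hasCompactSupport.mul_right).trans ?_)
  congr 2
  refine cfc_congr fun x hx => ?_
  rw [Pi.mul_apply, cutoff_eq_one (by linarith [hL x hx]), one_mul]

/-- A smooth approximation of the indicator function of the closed ball. -/
def ballApprox (c r : ℝ) (hr : 0 ≤ r) (n : ℕ) : ContDiffBump c :=
  ⟨r + 1 / (n + 1), r + 2 / (n + 1), by positivity, by gcongr; norm_num⟩

theorem tendsto_ballApprox (c r : ℝ) (hr : 0 ≤ r) (x : ℝ) :
    Tendsto (fun n => ballApprox c r hr n x) atTop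
      (𝓝 ((Metric.closedBall c r).indicator (fun _ => 1) x)) := by
  by_cases hx : x ∈ Metric.closedBall c r
  · rw [Set.indicator_of_mem hx]
    refine tendsto_const_nhds.congr fun n => ?_
    refine ((ballApprox c r hr n).one_of_mem_closedBall ?_).symm
    exact Metric.closedBall_subset_closedBall (le_add_of_nonneg_right (by positivity)) hx
  · rw [Set.indicator_of_notMem hx]
    have hd : r < dist x c := not_le.1 hx
    have h1 : Tendsto (fun n : ℕ => r + 2 / ((n : ℝ) + 1)) atTop (𝓝 r) := by
      have := (tendsto_one_div_add_atTop_nhds_zero_nat (𝕜 := ℝ)).const_mul 2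
      rw [mul_zero] at this
      simpa [div_eq_mul_inv] using this.const_add r
    refine tendsto_const_nhds.congr' ?_
    filter_upwards [h1.eventually_lt_const hd] with n hn
    exact ((ballApprox c r hr n).zero_of_le_dist hn.le).symm

end SpectralMeasure

/-! ### Clipped potentials and measurability of the spectral measure -/

/-- The potential with all values projected to `[-R, R]`. -/
def clip (R : ℝ) (v : ℤ → ℝ) : ℤ → ℝ := fun j => max (-R) (min R (v j))

theorem abs_clip_le {R : ℝ} (hR : 0 ≤ R) (v : ℤ → ℝ) (j : ℤ) : |clip R v j| ≤ R := by
  rw [abs_le]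
  exact ⟨le_max_left _ _, max_le (by linarith) (min_le_left _ _)⟩

theorem continuous_clip (R : ℝ) (j : ℤ) : Continuous fun v : ℤ → ℝ => clip R v j := by
  unfold clip
  fun_prop

theorem clip_eq_self {R : ℝ} {v : ℤ → ℝ} (hv : ∀ j, |v j| ≤ R) : clip R v = v := by
  funext j
  have := abs_le.1 (hv j)
  rw [clip, min_eq_right this.2, max_eq_right this.1]

theorem clip_update {R : ℝ} (v : ℤ → ℝ) (k : ℤ) {t : ℝ} (ht : |t| ≤ R) :
    clip R (Function.update v k t) = Function.update (clip R v) k t := by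
  funext j
  rcases eq_or_ne j k with rfl | hj
  · have := abs_le.1 ht
    rw [clip, Function.update_self, Function.update_self, min_eq_right this.2, max_eq_right this.1]
  · rw [clip, Function.update_of_ne hj, Function.update_of_ne hj, clip]

section

variable {R : ℝ}

theorem isProbabilityMeasure_clip (hR : 0 ≤ R) (v : ℤ → ℝ) :
    IsProbabilityMeasure (spectralMeasure (schrodinger (clip R v))) :=
  isProbabilityMeasure_spectralMeasure (isSelfAdjoint_schrodinger _)
    fun _ hx => abs_le_of_mem_spectrum (abs_clip_le hR v) hx

theorem integral_spectralMeasure_clip (hR : 0 ≤ R) (v : ℤ → ℝ) {f : ℝ → ℝ} (hf : Continuous f) :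
    ∫ x, f x ∂(spectralMeasure (schrodinger (clip R v))) = diag f (clip R v) 0 :=
  integral_spectralMeasure (isSelfAdjoint_schrodinger _)
    (fun _ hx => abs_le_of_mem_spectrum (abs_clip_le hR v) hx) hf

-- The bound on the potential is only almost sure. Clipping makes it hold everywhere, so that
-- observables become continuous functions on the whole configuration space.
open scoped ContDiff in
theorem continuous_diag_clip (hR : 0 ≤ R) {f : ℝ → ℝ} (hf : ContDiff ℝ ∞ f) (j : ℤ) :
    Continuous fun v => diag f (clip R v) j := by
  obtain ⟨p, b, -, h, -⟩ := exists_polyExpansion hf (L := 2 + R) (by linarith)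
  exact h.continuous_diag (abs_clip_le hR) (continuous_clip R) j

/-- Closed intervals form a generating `π`-system, and their masses are pointwise limits of smooth
observables, which are continuous in the configuration. -/
theorem measurable_spectralMeasure_clip (hR : 0 ≤ R) :
    Measurable fun v : ℤ → ℝ => spectralMeasure (schrodinger (clip R v)) := by
  have := isProbabilityMeasure_clip hR
  refine .measure_of_isPiSystem_of_isProbabilityMeasure
    (BorelSpace.measurable_eq.trans (borel_eq_generateFrom_Icc ℝ)) (isPiSystem_Icc id id) ?_
  rintro _ ⟨l, u, hlu : l ≤ u, rfl⟩
  rw [Real.Icc_eq_closedBall]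
  have hr : 0 ≤ (u - l) / 2 := by linarith
  have h1 : ∀ v : ℤ → ℝ, Tendsto (fun n => diag (ballApprox ((l + u) / 2) ((u - l) / 2) hr n) (clip R v) 0)
      atTop (𝓝 ((spectralMeasure (schrodinger (clip R v))).real
        (Metric.closedBall ((l + u) / 2) ((u - l) / 2)))) := by
    intro v
    rw [← integral_indicator_one Metric.isClosed_closedBall.measurableSet]
    simp only [← integral_spectralMeasure_clip hR v (ContDiffBump.continuous _)]
    refine tendsto_integral_of_dominated_convergence (fun _ => 1)
      (fun n => (ContDiffBump.continuous _).aestronglyMeasurable) (integrable_const _)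
      (fun n => Eventually.of_forall fun x => ?_)
      (Eventually.of_forall fun x => tendsto_ballApprox _ _ hr x)
    rw [Real.norm_of_nonneg (ContDiffBump.nonneg _)]
    exact ContDiffBump.le_one _
  have h2 : Measurable fun v : ℤ → ℝ => (spectralMeasure (schrodinger (clip R v))).real
      (Metric.closedBall ((l + u) / 2) ((u - l) / 2)) :=
    measurable_of_tendsto_metrizable
      (fun n => (continuous_diag_clip hR (ContDiffBump.contDiff _) 0).measurable)
      (tendsto_pi_nhds.2 h1)
  have h3 := h2.ennreal_ofReal
  simpa only [measureReal_def, ENNReal.ofReal_toReal (measure_ne_top _ _)] using h3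

theorem integral_ids {Ω : Type*} [MeasurableSpace Ω] {P : Measure Ω} [IsProbabilityMeasure P]
    {V : ℤ → Ω → ℝ} (hR : 0 ≤ R) (hV : ∀ j, Measurable (V j))
    (hb : ∀ᵐ ω ∂P, ∀ j, |V j ω| ≤ R) {f : ℝ → ℝ} (hf : Continuous f) :
    ∫ x, f x ∂(ids P V) = ∫ ω, diag f (clip R fun j => V j ω) 0 ∂P := by
  have := isProbabilityMeasure_clip hR
  let κ : Kernel Ω ℝ := ⟨fun ω => spectralMeasure (schrodinger (clip R fun j => V j ω)),
    (measurable_spectralMeasure_clip hR).comp (measurable_pi_lambda _ hV)⟩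
  have : IsMarkovKernel κ := ⟨fun ω => isProbabilityMeasure_clip hR fun j => V j ω⟩
  have h1 : ids P V = P.bind κ := by
    refine Measure.bind_congr_right ?_
    filter_upwards [hb] with ω hω
    change _ = spectralMeasure (schrodinger (clip R fun j => V j ω))
    rw [clip_eq_self hω]
  obtain ⟨N, hN⟩ := exists_nat_ge (2 + R)
  -- The averaged measure lives where the cutoff is `1`, so an arbitrary continuous `f` is
  -- integrable.
  have h2 : ∀ᵐ x ∂(P.bind κ), cutoff N x = 1 :=
    Measure.ae_comp_of_ae_ae (measurableSet_eq_fun (cutoff N).continuous.measurable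
      measurable_const) (Eventually.of_forall fun ω =>
        ae_cutoff_eq_one (isSelfAdjoint_schrodinger _)
          (fun _ hx => abs_le_of_mem_spectrum (abs_clip_le hR _) hx) hN)
  have h3 : Integrable f (P.bind κ) := by
    have h4 : Integrable (fun x => cutoff N x * f x) (P.bind κ) :=
      Continuous.integrable_of_hasCompactSupport ((cutoff N).continuous.mul hf)
        (cutoff N).hasCompactSupport.mul_right
    refine h4.congr ?_
    filter_upwards [h2] with x hx
    rw [hx, one_mul]
  rw [h1]
  have h5 : P.bind κ = (κ ∘ₖ Kernel.const Unit P) () := Measure.comp_eq_comp_const_apply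
  rw [h5] at h3 ⊢
  rw [Kernel.integral_comp h3, Kernel.const_apply]
  exact integral_congr_ae (Eventually.of_forall fun ω => integral_spectralMeasure_clip hR _ hf)

end

end

end Anderson

namespace Anderson

noncomputable section

open scoped ContDiff

/-! ### The local observable and its site sum -/

/-- The diagonal entry of `f(H)` at the origin, for the clipped potential. -/
def siteObs (R : ℝ) (f : ℝ → ℝ) (v : ℤ → ℝ) : ℝ := diag f (clip R v) 0

/-- The integral of `f'₀₀` over the value of the clipped potential at the origin. -/
def siteInt (R : ℝ) (f : ℝ → ℝ) (v : ℤ → ℝ) : ℝ :=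
  ∫ t in (0 : ℝ)..clip R v 0, diag (deriv f) (Function.update (clip R v) 0 t) 0

variable {R : ℝ} {f : ℝ → ℝ}

theorem siteObs_translate (hR : 0 ≤ R) (hf : ContDiff ℝ ∞ f) (v : ℤ → ℝ) (j : ℤ) :
    siteObs R f (translate j v) = diag f (clip R v) j := by
  obtain ⟨p, b, -, h, -⟩ := exists_polyExpansion hf (L := 2 + R) (by linarith)
  have := h.diag_translate (abs_clip_le hR v) 0 j
  rwa [zero_add] at this

theorem continuous_siteObs (hR : 0 ≤ R) (hf : ContDiff ℝ ∞ f) : Continuous (siteObs R f) :=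
  continuous_diag_clip hR hf 0

theorem exists_siteLocal_siteObs (hR : 0 ≤ R) (hf : ContDiff ℝ ∞ f) :
    ∃ K, SiteLocal K (siteObs R f) := by
  obtain ⟨p, b, -, h, -⟩ := exists_polyExpansion hf (L := 2 + R) (by linarith)
  have hw : 0 ≤ 16 * PolyExpansion.weight b := (abs_nonneg _).trans
    (h.abs_diag_le (abs_clip_le hR 0) 0)
  refine ⟨16 * PolyExpansion.weight b, (continuous_siteObs hR hf).measurable,
    fun v => h.abs_diag_le (abs_clip_le hR v) 0, fun N v w hvw => ?_⟩
  refine (h.abs_diag_sub_le (abs_clip_le hR v) (abs_clip_le hR w) (N := N) fun i hi => ?_).trans ?_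
  · rw [sub_zero] at hi
    rw [clip, clip, hvw i hi]
  · rw [decay, Int.natAbs_natCast, ← mul_div_assoc, mul_one]
    gcongr
    · linarith
    · norm_num

theorem hasSum_siteInt (hR : 0 ≤ R) (hf : ContDiff ℝ ∞ f) (v : ℤ → ℝ) :
    HasSum (fun j => siteObs R f (translate j v)
      - siteObs R f (translate j (Function.update v 0 0))) (siteInt R f v) := by
  obtain ⟨p, b, b', h, h'⟩ := exists_polyExpansion hf (L := 2 + R) (by linarith)
  have h1 := h.hasSum_diag_update_sub h' (abs_clip_le hR v) (abs_clip_le hR v 0)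
  refine h1.congr_fun fun j => ?_
  rw [siteObs_translate hR hf, siteObs_translate hR hf, clip_update v 0 (by simpa using hR),
    Function.update_eq_self]

theorem continuous_diag_deriv_update (hR : 0 ≤ R) (hf : ContDiff ℝ ∞ f) (v : ℤ → ℝ) :
    ContinuousOn (fun t => diag (deriv f) (Function.update (clip R v) 0 t) 0) (Set.Icc (-R) R) := by
  have hf' : ContDiff ℝ ∞ (deriv f) := ContDiff.deriv' (by simpa using hf)
  have h1 : Continuous fun t : ℝ => diag (deriv f) (clip R (Function.update v 0 t)) 0 :=
    (continuous_diag_clip hR hf' 0).comp (continuous_const.update 0 continuous_id)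
  refine h1.continuousOn.congr fun t ht => ?_
  simp only
  rw [clip_update v 0 (abs_le.2 ht)]

/-- Links the two-impurity asymptotics, computed without clipping, to the site sum of the variance
formula. -/
theorem twoSite_deriv (hR : 0 ≤ R) (hf : ContDiff ℝ ∞ f) {u w : ℝ} (hu : |u| ≤ R) (hw : |w| ≤ R)
    (n : ℕ) : twoSite (deriv f) n u w
      = siteInt R f (Function.update (Function.update 0 (n : ℤ) u) 0 w)
        - siteInt R f (Function.update 0 0 w) := by
  have hz : clip R 0 = 0 := clip_eq_self fun j => by simpa using hR
  have hn : clip R (Function.update (0 : ℤ → ℝ) (n : ℤ) u) = Function.update (0 : ℤ → ℝ) (n : ℤ) u := by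
    rw [clip_update _ _ hu, hz]
  have hsub : Set.uIcc 0 w ⊆ Set.Icc (-R) R :=
    Set.uIcc_subset_Icc ⟨by linarith, hR⟩ (abs_le.1 hw)
  have i1 := ((continuous_diag_deriv_update hR hf (Function.update 0 (n : ℤ) u)).mono
    hsub).intervalIntegrable (μ := volume)
  have i2 := ((continuous_diag_deriv_update hR hf 0).mono hsub).intervalIntegrable (μ := volume)
  rw [hn] at i1
  rw [hz] at i2
  rw [twoSite, intervalIntegral.integral_sub i1 i2, siteInt, siteInt, clip_update _ _ hw,
    clip_update _ _ hw, hn, hz, Function.update_self, Function.update_self]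
  simp only [Function.update_idem]

/-! ### Positivity of the limiting variance -/

theorem exists_mem_support_pos {μ : Measure ℝ} [IsProbabilityMeasure μ]
    (hb : ∀ᵐ x ∂μ, |x| ≤ R) (hmean : ∫ x, x ∂μ = 0) (h0 : ¬ ∀ᵐ x ∂μ, x = 0) :
    ∃ u ∈ μ.support, 0 < u := by
  have hint : Integrable (fun x : ℝ => x) μ :=
    Integrable.of_bound measurable_id.aestronglyMeasurable R (by simpa using hb)
  by_contra! hcon
  have h1 : ∀ᵐ x ∂μ, 0 ≤ -x := by
    filter_upwards [Measure.support_mem_ae (μ := μ)] with x hx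
    linarith [hcon x hx]
  have h2 : ∫ x, -x ∂μ = 0 := by rw [integral_neg, hmean, neg_zero]
  rw [integral_eq_zero_iff_of_nonneg_ae h1 hint.neg] at h2
  apply h0
  filter_upwards [h2] with x hx
  exact neg_eq_zero.1 hx

theorem exists_mem_support_neg {μ : Measure ℝ} [IsProbabilityMeasure μ]
    (hb : ∀ᵐ x ∂μ, |x| ≤ R) (hmean : ∫ x, x ∂μ = 0) (h0 : ¬ ∀ᵐ x ∂μ, x = 0) :
    ∃ u ∈ μ.support, u < 0 := by
  have hint : Integrable (fun x : ℝ => x) μ :=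
    Integrable.of_bound measurable_id.aestronglyMeasurable R (by simpa using hb)
  by_contra! hcon
  have h1 : ∀ᵐ x ∂μ, 0 ≤ x := by
    filter_upwards [Measure.support_mem_ae (μ := μ)] with x hx using hcon x hx
  rw [integral_eq_zero_iff_of_nonneg_ae h1 hint] at hmean
  exact h0 hmean

theorem abs_le_of_mem_support {μ : Measure ℝ} (hb : ∀ᵐ x ∂μ, |x| ≤ R) {u : ℝ}
    (hu : u ∈ μ.support) : |u| ≤ R :=
  Measure.support_subset_of_isClosed (isClosed_le continuous_abs continuous_const) hb hu

/-- A vanishing variance makes the site sum zero on all configurations with one or two impurities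
whose strengths lie in the support. A centred nonzero law has support on both sides of `0`, so the
two-impurity result gives a contradiction. -/
theorem variance_siteInt_pos {μ : Measure ℝ} [IsProbabilityMeasure μ] (hR : 0 ≤ R)
    (hb : ∀ᵐ x ∂μ, |x| ≤ R) (hmean : ∫ x, x ∂μ = 0) (hne : ¬ ∀ᵐ x ∂μ, x = 0)
    (h0 : (0 : ℝ) ∈ μ.support) {α β : ℝ} (hα : 0 < α) (hβ : 0 < β) (EF : ℝ) :
    0 < ∫ v, (tailMean μ 0 (siteInt R (renyi α ∘ fermi β EF)) v
      - tailMean μ 1 (siteInt R (renyi α ∘ fermi β EF)) v) ^ 2 ∂(iidLaw μ) := by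
  have hγ := contDiff_renyi_fermi α β EF
  obtain ⟨K, hK⟩ := exists_siteLocal_siteObs hR hγ
  refine lt_of_le_of_ne (integral_nonneg fun v => sq_nonneg _) fun hvar => ?_
  obtain ⟨u, hu, hupos⟩ := exists_mem_support_pos hb hmean hne
  obtain ⟨u', hu', huneg⟩ := exists_mem_support_neg hb hmean hne
  have hA : ∀ v : ℤ → ℝ, (∀ i, v i ∈ μ.support) → siteInt R (renyi α ∘ fermi β EF) v = 0 :=
    fun v hv => hK.siteSum_eq_zero (continuous_siteObs hR hγ) (hasSum_siteInt hR hγ) h0 hvar.symm hv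
  have hupd : ∀ v : ℤ → ℝ, (∀ i, v i ∈ μ.support) → ∀ (k : ℤ), ∀ s ∈ μ.support,
      ∀ i, Function.update v k s i ∈ μ.support := by
    intro v hv k s hs i
    rcases eq_or_ne i k with rfl | hi
    · rwa [Function.update_self]
    · rw [Function.update_of_ne hi]
      exact hv i
  have hzero : ∀ i : ℤ, (0 : ℤ → ℝ) i ∈ μ.support := fun _ => h0
  have htwo : ∀ s ∈ μ.support, ∀ n : ℕ, twoSite (deriv (renyi α ∘ fermi β EF)) n s u = 0 := by
    intro s hs n
    rw [twoSite_deriv hR hγ (abs_le_of_mem_support hb hs) (abs_le_of_mem_support hb hu),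
      hA _ (hupd _ (hupd _ hzero n s hs) 0 u hu), hA _ (hupd _ hzero 0 u hu), sub_zero]
  obtain ⟨n, hn⟩ := exists_twoSite_deriv_ne_zero hα hβ EF hupos huneg
    (abs_le_of_mem_support hb hu) (abs_le_of_mem_support hb hu')
  exact hn.elim (fun h => h (htwo u hu _)) fun h => h (htwo u' hu' _)

theorem exists_abs_traceBox_sub_le (hR : 0 ≤ R) (α β EF : ℝ) : ∃ C, 0 ≤ C ∧
    (∀ (v : ℤ → ℝ) (M : ℕ), |traceBox (renyi α) (fermi β EF) (clip R v) M
      - ∑ j ∈ Finset.Icc (-M : ℤ) M, diag (renyi α ∘ fermi β EF) (clip R v) j| ≤ C) ∧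
    ∀ M : ℕ, Continuous fun v => traceBox (renyi α) (fermi β EF) (clip R v) M := by
  obtain ⟨p, b, -, h, -⟩ := exists_polyExpansion (contDiff_fermi β EF) (L := 2 + R) (by linarith)
  obtain ⟨m₁, m₂, h0, h1, hm⟩ := exists_fermi_mem_Icc β EF (2 + R)
  have hcd : ∀ x ∈ Set.Icc m₁ m₂, ContDiffAt ℝ ∞ (renyi α) x := fun x hx =>
    contDiffAt_renyi α (h0.trans_le hx.1) (hx.2.trans_lt h1)
  obtain ⟨C, hC0, hC⟩ := exists_hasQuadraticBound fun x hx => (hcd x hx).of_le (by norm_cast)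
  have hcont : ContinuousOn (renyi α) (Set.Icc m₁ m₂) := fun x hx =>
    (hcd x hx).continuousAt.continuousWithinAt
  have hfc := (contDiff_fermi β EF).continuous
  have hb := fun v M => abs_traceBox_sub_sum_diag_le h hfc hm hcont hC0 hC (abs_clip_le hR v) M
  exact ⟨_, (abs_nonneg _).trans (hb 0 0), hb,
    fun M => continuous_traceBox h hfc hm hcont (abs_clip_le hR) (continuous_clip R) M⟩

end

end Anderson

namespace Anderson

noncomputable section

/-! ### Passage to the limit -/

theorem sum_Icc_eq_sum_range (h : ℤ → ℝ) (M : ℕ) :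
    ∑ j ∈ Finset.Icc (-M : ℤ) M, h j = ∑ k ∈ Finset.range (2 * M + 1), h (k + (-M : ℤ)) := by
  refine Finset.sum_nbij' (fun j => (j + M).toNat) (fun k => (k : ℤ) + (-M : ℤ)) ?_ ?_ ?_ ?_ ?_
  · intro j hj
    rw [Finset.mem_Icc] at hj
    rw [Finset.mem_range]
    omega
  · intro k hk
    rw [Finset.mem_range] at hk
    rw [Finset.mem_Icc]
    omega
  · intro j hj
    rw [Finset.mem_Icc] at hj
    omega
  · intro k hk
    omega
  · intro j hj
    rw [Finset.mem_Icc] at hj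
    congr 1
    omega

theorem normSum_translate (μ : Measure ℝ) (g : (ℤ → ℝ) → ℝ) (M : ℕ) (v : ℤ → ℝ) :
    normSum μ g (2 * M + 1) (translate (-M : ℤ) v) = (√(2 * M + 1 : ℝ))⁻¹ *
      (∑ j ∈ Finset.Icc (-M : ℤ) M, g (translate j v) - (2 * M + 1 : ℝ) * ∫ w, g w ∂(iidLaw μ)) := by
  rw [normSum, sum_Icc_eq_sum_range]
  simp only [translate_translate]
  push_cast
  rfl

theorem SiteLocal.integral_sq_normSum {μ : Measure ℝ} [IsProbabilityMeasure μ] {K : ℝ}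
    {g : (ℤ → ℝ) → ℝ} (hg : SiteLocal K g) (n : ℕ) :
    ∫ v, normSum μ g n v ^ 2 ∂(iidLaw μ)
      = Var[fun v => ∑ j ∈ Finset.range n, g (translate j v); iidLaw μ] / n := by
  have hm : ∀ j : ℕ, Measurable fun v => g (translate j v) := fun j =>
    hg.measurable.comp (measurable_translate j)
  have hS : Measurable fun v => ∑ j ∈ Finset.range n, g (translate j v) :=
    Finset.measurable_fun_sum _ fun j _ => hm j
  have hi : ∀ j : ℕ, Integrable (fun v => g (translate j v)) (iidLaw μ) := fun j =>
    Integrable.of_bound (hm j).aestronglyMeasurable K (Eventually.of_forall fun v => hg.abs_le _)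
  have hE : ∫ v, ∑ j ∈ Finset.range n, g (translate j v) ∂(iidLaw μ) = n * ∫ w, g w ∂(iidLaw μ) := by
    rw [integral_finsetSum _ fun j _ => hi j]
    simp [SiteLocal.integral_translate g hg.measurable]
  rw [variance_eq_integral hS.aemeasurable, hE, ← integral_div]
  refine integral_congr_ae (Eventually.of_forall fun v => ?_)
  simp only [normSum, mul_pow, inv_pow, Real.sq_sqrt (Nat.cast_nonneg n)]
  rw [div_eq_inv_mul]

theorem SiteLocal.exists_abs_normSum_le {μ : Measure ℝ} {K : ℝ} {g : (ℤ → ℝ) → ℝ}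
    (hg : SiteLocal K g) (n : ℕ) : ∃ B, ∀ v, |normSum μ g n v| ≤ B := by
  refine ⟨(√n)⁻¹ * (∑ _j ∈ Finset.range n, K + |n * ∫ w, g w ∂(iidLaw μ)|), fun v => ?_⟩
  rw [normSum, abs_mul, abs_of_nonneg (by positivity : 0 ≤ (√(n : ℝ))⁻¹)]
  gcongr
  refine (abs_sub _ _).trans (add_le_add ?_ le_rfl)
  exact (Finset.abs_sum_le_sum_abs _ _).trans (Finset.sum_le_sum fun j _ => hg.abs_le _)

theorem covariance_congr_ae {Ω : Type*} [MeasurableSpace Ω] {P : Measure Ω} {X X' Y Y' : Ω → ℝ}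
    (hX : X =ᵐ[P] X') (hY : Y =ᵐ[P] Y') : cov[X, Y; P] = cov[X', Y'; P] := by
  rw [covariance, covariance, integral_congr_ae hX, integral_congr_ae hY]
  refine integral_congr_ae ?_
  filter_upwards [hX, hY] with ω h1 h2
  rw [h1, h2]

/-- Factor `Y² - X² = (Y - X)(2X + (Y - X))` and use `|2X| ≤ X² + 1`: the error is controlled by the
second moments that already converge. -/
theorem tendsto_integral_sq_of_abs_sub_le {Ω : Type*} [MeasurableSpace Ω] {P : Measure Ω}
    [IsProbabilityMeasure P] {X Y : ℕ → Ω → ℝ} {ε : ℕ → ℝ} {s : ℝ}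
    (hX : ∀ n, MemLp (X n) 2 P) (hY : ∀ n, AEStronglyMeasurable (Y n) P)
    (hε : Tendsto ε atTop (𝓝 0)) (hε0 : ∀ n, 0 ≤ ε n)
    (hXY : ∀ n, ∀ᵐ ω ∂P, |Y n ω - X n ω| ≤ ε n)
    (hs : Tendsto (fun n => ∫ ω, X n ω ^ 2 ∂P) atTop (𝓝 s)) :
    Tendsto (fun n => ∫ ω, Y n ω ^ 2 ∂P) atTop (𝓝 s) := by
  have hXi : ∀ n, Integrable (fun ω => X n ω ^ 2) P := fun n => (hX n).integrable_sq
  have hYi : ∀ n, Integrable (fun ω => Y n ω ^ 2) P := fun n => by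
    have h1 : MemLp (fun ω => Y n ω - X n ω) 2 P :=
      MemLp.of_bound ((hY n).sub (hX n).1) (ε n) (by simpa using hXY n)
    have h2 := (h1.add (hX n)).integrable_sq
    simpa using h2
  have hb : ∀ n, |∫ ω, Y n ω ^ 2 ∂P - ∫ ω, X n ω ^ 2 ∂P|
      ≤ ε n * (∫ ω, X n ω ^ 2 ∂P + 1 + ε n) := by
    intro n
    have h1 : ∫ ω, ε n * (X n ω ^ 2 + (1 + ε n)) ∂P = ε n * (∫ ω, X n ω ^ 2 ∂P + 1 + ε n) := by
      rw [integral_const_mul, integral_add (hXi n) (integrable_const _)]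
      rw [integral_const, probReal_univ, one_smul, add_assoc]
    rw [← integral_sub (hYi n) (hXi n), ← h1]
    rw [← Real.norm_eq_abs]
    refine norm_integral_le_of_norm_le
      (((hXi n).fun_add (integrable_const (1 + ε n))).const_mul (ε n)) ?_
    filter_upwards [hXY n] with ω hω
    have h2 : Y n ω ^ 2 - X n ω ^ 2 = (Y n ω - X n ω) * (2 * X n ω + (Y n ω - X n ω)) := by ring
    rw [h2, norm_mul, Real.norm_eq_abs, Real.norm_eq_abs]
    have h3 : |2 * X n ω + (Y n ω - X n ω)| ≤ X n ω ^ 2 + (1 + ε n) := by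
      refine (abs_add_le _ _).trans ?_
      have : |2 * X n ω| ≤ X n ω ^ 2 + 1 := by
        rw [abs_le]; constructor <;> nlinarith [sq_nonneg (X n ω - 1), sq_nonneg (X n ω + 1)]
      linarith
    exact mul_le_mul hω h3 (abs_nonneg _) (hε0 n)
  have h4 : Tendsto (fun n => ∫ ω, Y n ω ^ 2 ∂P - ∫ ω, X n ω ^ 2 ∂P) atTop (𝓝 0) := by
    refine squeeze_zero_norm hb ?_
    have := hε.mul ((hs.add_const 1).add hε)
    rwa [zero_mul] at this
  simpa using h4.add hs

theorem tendstoInMeasure_zero_of_abs_le {Ω : Type*} [MeasurableSpace Ω] {P : Measure Ω}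
    {Z : ℕ → Ω → ℝ} {ε : ℕ → ℝ} (hε : Tendsto ε atTop (𝓝 0))
    (hZ : ∀ n, ∀ᵐ ω ∂P, |Z n ω| ≤ ε n) : TendstoInMeasure P Z atTop 0 := by
  rw [tendstoInMeasure_iff_norm]
  intro δ hδ
  refine tendsto_const_nhds.congr' ?_
  filter_upwards [hε.eventually_lt_const hδ] with n hn
  symm
  have h1 : ∀ᵐ ω ∂P, ¬ δ ≤ ‖Z n ω - (0 : Ω → ℝ) ω‖ := by
    filter_upwards [hZ n] with ω hω
    rw [Pi.zero_apply, sub_zero, Real.norm_eq_abs]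
    linarith
  rw [ae_iff] at h1
  simpa only [not_not] using h1

theorem SiteLocal.tendstoInDistribution_comp {μ : Measure ℝ} [IsProbabilityMeasure μ] {K : ℝ}
    {g : (ℤ → ℝ) → ℝ} (hg : SiteLocal K g) {Ω : Type*} [MeasurableSpace Ω] {P : Measure Ω}
    [IsProbabilityMeasure P] {ξ : Ω → ℤ → ℝ} (hξ : Measurable ξ) (hlaw : P.map ξ = iidLaw μ) :
    TendstoInDistribution (fun (M : ℕ) ω => normSum μ g (2 * M + 1) (translate (-M : ℤ) (ξ ω))) atTop
      (id : ℝ → ℝ) (fun _ => P)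
      (gaussianReal 0 (∑' l : ℤ, cov[g, fun v => g (translate l v); iidLaw μ]).toNNReal) := by
  have hn : Tendsto (fun M : ℕ => 2 * M + 1) atTop atTop :=
    tendsto_atTop_mono (fun M => show M ≤ _ by omega) tendsto_id
  refine ⟨fun M => ((hg.measurable_normSum _).comp
    ((measurable_translate _).comp hξ)).aemeasurable, by fun_prop, ?_⟩
  refine ((hg.tendstoInDistribution_normSum (μ := μ)).tendsto.comp hn).congr fun M => ?_
  apply Subtype.ext
  change (iidLaw μ).map (normSum μ g (2 * M + 1)) = P.map _
  conv_lhs => rw [← (measurePreserving_translate (μ := μ) (-M : ℤ)).map_eq, ← hlaw]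
  rw [Measure.map_map (hg.measurable_normSum _) (measurable_translate _),
    Measure.map_map ((hg.measurable_normSum _).comp (measurable_translate _)) hξ]
  rfl

theorem gaussianReal_frontier_eq_zero {Δ : Set ℝ} (hΔ : Δ.OrdConnected) (m : ℝ) {v : NNReal}
    (hv : v ≠ 0) : gaussianReal m v (frontier Δ) = 0 :=
  gaussianReal_absolutelyContinuous m hv ((hΔ.convex (𝕜 := ℝ)).addHaar_frontier volume)

/-- The boundary of an interval is Lebesgue null, hence Gaussian null since `σ > 0`; the portmanteau
theorem applies to the rescaled interval. -/
theorem TendstoInDistribution.tendsto_measure_ordConnected {Ω : Type*} [MeasurableSpace Ω]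
    {P : Measure Ω} [IsProbabilityMeasure P] {X : ℕ → Ω → ℝ} {σ : ℝ} (hσ : 0 < σ)
    (hX : TendstoInDistribution X atTop (id : ℝ → ℝ) (fun _ => P)
      (gaussianReal 0 (σ ^ 2).toNNReal)) {Δ : Set ℝ} (hΔ : Δ.OrdConnected) :
    Tendsto (fun n => P {ω | σ⁻¹ * X n ω ∈ Δ}) atTop (𝓝 (gaussianReal 0 1 Δ)) := by
  have hv : (σ ^ 2).toNNReal ≠ 0 := (Real.toNNReal_pos.2 (by positivity)).ne'
  set Δ' : Set ℝ := (fun x => σ⁻¹ * x) ⁻¹' Δ with hΔ'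
  have hord : Δ'.OrdConnected := by
    refine ⟨fun x hx y hy z hz => ?_⟩
    refine hΔ.out hx hy ⟨?_, ?_⟩
    · exact mul_le_mul_of_nonneg_left hz.1 (by positivity)
    · exact mul_le_mul_of_nonneg_left hz.2 (by positivity)
  have h1 := ProbabilityMeasure.tendsto_measure_of_null_frontier_of_tendsto' hX.tendsto
    (E := Δ') (by
      change (gaussianReal 0 (σ ^ 2).toNNReal).map id (frontier Δ') = 0
      rw [Measure.map_id]
      exact gaussianReal_frontier_eq_zero hord 0 hv)
  have h2 : gaussianReal 0 1 Δ = (gaussianReal 0 (σ ^ 2).toNNReal).map id Δ' := by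
    rw [Measure.map_id, hΔ', ← Measure.map_apply (by fun_prop) hΔ.measurableSet,
      gaussianReal_map_const_mul]
    congr 2
    · simp
    · ext
      have : 0 ≤ σ ^ 2 := by positivity
      simp [Real.coe_toNNReal _ this]
      field_simp
  rw [h2]
  refine h1.congr fun n => ?_
  change P.map (X n) Δ' = _
  rw [Measure.map_apply_of_aemeasurable (hX.forall_aemeasurable n) hord.measurableSet]
  rfl

/-- The conditional mean in the conditional variance is the coarser expectation, by the tower
property. -/
theorem integral_condVar_condExp {Ω : Type*} {m₁ m₂ m₀ : MeasurableSpace Ω} (h12 : m₁ ≤ m₂)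
    (h20 : m₂ ≤ m₀) {P : Measure[m₀] Ω} [IsProbabilityMeasure P] (X : Ω → ℝ) :
    ∫ ω, (Var[P[X | m₂]; P | m₁]) ω ∂P = ∫ ω, ((P[X | m₂]) ω - (P[X | m₁]) ω) ^ 2 ∂P := by
  rw [condVar, integral_condExp (h12.trans h20)]
  refine integral_congr_ae ?_
  filter_upwards [condExp_condExp_of_le (μ := P) (f := X) h12 h20] with ω hω
  simp [hω]

end

end Anderson

/-! ### The limit theorem for the entanglement entropy -/

open Anderson
theorem theorem2 {Ω : Type*} [MeasurableSpace Ω] (P : Measure Ω) [IsProbabilityMeasure P]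
    (V : ℤ → Ω → ℝ) (Vbar : ℝ)
    (hmeas : ∀ j, Measurable (V j))
    (hbdd : ∀ j, ∀ᵐ ω ∂P, |V j ω| ≤ Vbar)
    (hindep : iIndepFun V P)
    (hident : ∀ j, IdentDistrib (V j) (V 0) P P)
    (hmean : ∫ ω, V 0 ω ∂P = 0)
    (hsupp : (0 : ℝ) ∈ (P.map (V 0)).support)
    (hnontrivial : ¬ (V 0 =ᵐ[P] fun _ => 0))
    (α β EF : ℝ) (hα : 0 < α) (hβ : 0 < β)
    (hEF : ∀ᵐ ω ∂P, EF ∈ spectrum ℝ (schrodinger fun j => V j ω))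
    (γ : ℝ → ℝ) (hγ : γ = renyi α ∘ fermi β EF) :
    ∃ σ : ℝ, 0 < σ ∧
      Tendsto (fun M : ℕ => ∫ ω, (fluct P V (renyi α) (fermi β EF) M ω) ^ 2 ∂P) atTop
        (𝓝 (σ ^ 2)) ∧
      HasSum (fun l : ℤ => cov[fun ω => diag γ (fun j => V j ω) 0,
        fun ω => diag γ (fun j => V j ω) l; P]) (σ ^ 2) ∧
      σ ^ 2 = ∫ ω, ((P[siteDeriv V γ | tailSigma V 0]) ω
        - (P[siteDeriv V γ | tailSigma V 1]) ω) ^ 2 ∂P ∧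
      σ ^ 2 = ∫ ω, (Var[P[siteDeriv V γ | tailSigma V 0]; P | tailSigma V 1]) ω ∂P ∧
      (∀ Δ : Set ℝ, Δ.OrdConnected →
        Tendsto (fun M : ℕ => P {ω | σ⁻¹ * fluct P V (renyi α) (fermi β EF) M ω ∈ Δ}) atTop
          (𝓝 (gaussianReal 0 1 Δ))) ∧
      TendstoInDistribution (fun (M : ℕ) ω => fluct P V (renyi α) (fermi β EF) M ω) atTop
        (id : ℝ → ℝ) (fun _ => P) (gaussianReal 0 (σ ^ 2).toNNReal) := by
  set R := Vbar with hRdef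
  set ξ : Ω → ℤ → ℝ := fun ω j => V j ω with hξdef
  have hξ : Measurable ξ := measurable_pi_lambda _ hmeas
  have hb : ∀ᵐ ω ∂P, ∀ j, |V j ω| ≤ R := ae_all_iff.2 hbdd
  have hR : 0 ≤ R := by
    obtain ⟨ω, hω⟩ := hb.exists
    exact (abs_nonneg _).trans (hω 0)
  set μ : Measure ℝ := P.map (V 0) with hμdef
  have hμ : IsProbabilityMeasure μ := Measure.isProbabilityMeasure_map (hmeas 0).aemeasurable
  have hlaw : P.map ξ = iidLaw μ := by
    have h1 := hindep.map_fun_eq_infinitePi_map hmeas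
    rw [hξdef, h1, iidLaw]
    congr 1
    exact funext fun j => (hident j).map_eq
  -- Almost surely clipping does nothing, so the continuous clipped observables may replace the
  -- original ones throughout.
  have hclip : ∀ᵐ ω ∂P, clip R (ξ ω) = ξ ω := by
    filter_upwards [hb] with ω hω using clip_eq_self hω
  have hγs : ContDiff ℝ (⊤ : ℕ∞) γ := hγ ▸ contDiff_renyi_fermi α β EF
  set g := siteObs R γ with hgdef
  set A := siteInt R γ with hAdef
  obtain ⟨K, hg⟩ := exists_siteLocal_siteObs hR hγs
  have hgc := continuous_siteObs hR hγs
  have hA := hasSum_siteInt hR hγs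
  have hAb : BddMeas A := hg.bddMeas_siteSum hgc hA
  set s : ℝ := ∫ v, (tailMean μ 0 A v - tailMean μ 1 A v) ^ 2 ∂(iidLaw μ) with hsdef
  have hcov := hg.integral_sq_tailMean_sub (μ := μ) hA
  have hs : 0 < s := by
    have h1 : ∀ᵐ x ∂μ, |x| ≤ R := (ae_map_iff (hmeas 0).aemeasurable
      (measurableSet_le measurable_abs measurable_const)).2 (hbdd 0)
    have h2 : ∫ x, x ∂μ = 0 := by
      rw [hμdef, integral_map (hmeas 0).aemeasurable (f := fun x => x) measurable_id.aestronglyMeasurable]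
      exact hmean
    have h3 : ¬ ∀ᵐ x ∂μ, x = 0 := fun h => hnontrivial
      ((ae_map_iff (hmeas 0).aemeasurable (measurableSet_singleton 0)).1 h)
    have h4 := variance_siteInt_pos hR h1 h2 h3 hsupp hα hβ EF
    rwa [← hγ] at h4
  have hσ2 : √s ^ 2 = s := Real.sq_sqrt hs.le
  have hσ : 0 < √s := Real.sqrt_pos.2 hs
  -- conditional expectations
  have hderiv : siteDeriv V γ =ᵐ[P] fun ω => A (ξ ω) := by
    filter_upwards [hclip] with ω hω
    have h1 := intervalIntegral.mul_integral_comp_mul_right (a := 0) (b := 1)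
      (f := fun t => diag (deriv γ) (Function.update (ξ ω) 0 t) 0) (c := V 0 ω)
    rw [zero_mul, one_mul] at h1
    rw [siteDeriv, hAdef, siteInt, hω]
    exact h1
  have hcond : ∀ m : ℤ, P[siteDeriv V γ | tailSigma V m] =ᵐ[P] fun ω => tailMean μ m A (ξ ω) :=
    fun m => (condExp_congr_ae hderiv).trans (condExp_tailSigma hmeas hlaw hAb m)
  have hvar : s = ∫ ω, ((P[siteDeriv V γ | tailSigma V 0]) ω
      - (P[siteDeriv V γ | tailSigma V 1]) ω) ^ 2 ∂P := by
    have hm : Measurable fun v => (tailMean μ 0 A v - tailMean μ 1 A v) ^ 2 :=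
      ((hAb.tailMean 0).measurable.sub (hAb.tailMean 1).measurable).pow_const 2
    rw [hsdef, ← hlaw, integral_map hξ.aemeasurable hm.aestronglyMeasurable]
    refine integral_congr_ae ?_
    filter_upwards [hcond 0, hcond 1] with ω h0 h1
    rw [h0, h1]
  have hcovP : HasSum (fun l : ℤ => cov[fun ω => diag γ (fun j => V j ω) 0,
      fun ω => diag γ (fun j => V j ω) l; P]) s := by
    refine hcov.congr_fun fun l => ?_
    have hm : Measurable fun v => siteObs R γ (Anderson.translate l v) :=
      hgc.measurable.comp (measurable_translate l)
    rw [← hlaw, covariance_map_fun hgc.measurable.aestronglyMeasurable hm.aestronglyMeasurable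
      hξ.aemeasurable]
    refine covariance_congr_ae ?_ ?_
    · filter_upwards [hclip] with ω hω
      rw [siteObs, hω]
    · filter_upwards [hclip] with ω hω
      rw [siteObs_translate hR hγs, hω]
  -- the fluctuation is a normalized sum up to a vanishing error
  obtain ⟨C, hC0, hC, hTc⟩ := exists_abs_traceBox_sub_le hR α β EF
  -- The density of states supplies exactly the mean of the local observable, so the centring is the
  -- same on both sides.
  have hids : ∫ x, renyi α (fermi β EF x) ∂(ids P V) = ∫ w, siteObs R γ w ∂(iidLaw μ) := by
    have h1 := integral_ids hR hmeas hb hγs.continuous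
    rw [hγ] at h1
    rw [← hlaw, integral_map hξ.aemeasurable hgc.measurable.aestronglyMeasurable]
    subst hγ
    exact h1
  set X : ℕ → Ω → ℝ := fun M ω =>
    normSum μ (siteObs R γ) (2 * M + 1) (Anderson.translate (-M : ℤ) (ξ ω)) with hXdef
  set ε : ℕ → ℝ := fun M => (√(2 * M + 1 : ℝ))⁻¹ * C with hεdef
  have hε0 : ∀ M, 0 ≤ ε M := fun M => by positivity
  have hε : Tendsto ε atTop (𝓝 0) := by
    have h1 : Tendsto (fun M : ℕ => (2 * M + 1 : ℝ)) atTop atTop :=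
      tendsto_atTop_add_const_right _ _
        (tendsto_natCast_atTop_atTop.const_mul_atTop two_pos)
    have h2 := (tendsto_inv_atTop_zero.comp (Real.tendsto_sqrt_atTop.comp h1)).mul_const C
    rwa [zero_mul] at h2
  -- A bounded trace error divided by the square root of the volume.
  have hXY : ∀ M, ∀ᵐ ω ∂P, |fluct P V (renyi α) (fermi β EF) M ω - X M ω| ≤ ε M := by
    intro M
    filter_upwards [hclip] with ω hω
    have h1 : X M ω = (√(2 * M + 1 : ℝ))⁻¹ * (∑ j ∈ Finset.Icc (-M : ℤ) M, diag γ (ξ ω) j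
        - (2 * M + 1 : ℝ) * ∫ w, siteObs R γ w ∂(iidLaw μ)) := by
      rw [hXdef]
      simp only [normSum_translate, siteObs_translate hR hγs, hω]
    have h2 := hC (ξ ω) M
    rw [hω, ← hγ] at h2
    rw [fluct, h1, hids, ← mul_sub, sub_sub_sub_cancel_right, abs_mul,
      abs_of_nonneg (by positivity : 0 ≤ (√(2 * M + 1 : ℝ))⁻¹)]
    exact mul_le_mul_of_nonneg_left h2 (by positivity)
  have hYm : ∀ M, AEMeasurable (fun ω => fluct P V (renyi α) (fermi β EF) M ω) P := by
    intro M
    refine AEMeasurable.const_mul (AEMeasurable.sub_const ?_ _) _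
    refine ((hTc M).measurable.comp hξ).aemeasurable.congr ?_
    filter_upwards [hclip] with ω hω
    simp only [Function.comp_apply, hω]
    rfl
  have hXm : ∀ M, Measurable (X M) := fun M =>
    (hg.measurable_normSum _).comp ((measurable_translate _).comp hξ)
  have hdist : TendstoInDistribution (fun (M : ℕ) ω => fluct P V (renyi α) (fermi β EF) M ω) atTop
      (id : ℝ → ℝ) (fun _ => P) (gaussianReal 0 (√s ^ 2).toNNReal) := by
    have h1 := hg.tendstoInDistribution_comp (μ := μ) hξ hlaw
    rw [hcov.tsum_eq] at h1
    rw [hσ2]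
    exact tendstoInDistribution_of_tendstoInMeasure_sub _ _ h1
      (tendstoInMeasure_zero_of_abs_le hε hXY) hYm
  have hsecond : Tendsto (fun M : ℕ => ∫ ω, (fluct P V (renyi α) (fermi β EF) M ω) ^ 2 ∂P) atTop
      (𝓝 s) := by
    have hn : Tendsto (fun M : ℕ => 2 * M + 1) atTop atTop :=
      tendsto_atTop_mono (fun M => show M ≤ _ by omega) tendsto_id
    have h1 := (hg.blockLocal.tendsto_variance_div (μ := μ)).comp hn
    rw [hcov.tsum_eq] at h1
    refine tendsto_integral_sq_of_abs_sub_le (X := X) (fun M => ?_)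
      (fun M => (hYm M).aestronglyMeasurable) hε hε0 hXY (h1.congr fun M => ?_)
    · obtain ⟨B, hB⟩ := hg.exists_abs_normSum_le (μ := μ) (2 * M + 1)
      exact MemLp.of_bound (hXm M).aestronglyMeasurable B (Eventually.of_forall fun ω => hB _)
    · have hmeasN : Measurable fun v => normSum μ (siteObs R γ) (2 * M + 1) v ^ 2 :=
        (hg.measurable_normSum _).pow_const 2
      rw [Function.comp_apply, ← hg.integral_sq_normSum,
        ← SiteLocal.integral_translate (μ := μ) _ hmeasN (-M : ℤ), ← hlaw]
      exact integral_map hξ.aemeasurable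
        (hmeasN.comp (measurable_translate _)).aestronglyMeasurable
  refine ⟨√s, hσ, ?_, ?_, ?_, ?_, fun Δ hΔ => ?_, hdist⟩
  · rwa [hσ2]
  · rwa [hσ2]
  · rwa [hσ2]
  · rw [hσ2, hvar]
    refine (integral_condVar_condExp ?_ ?_ _).symm
    · exact iSup₂_le fun j hj => le_iSup₂_of_le j
        (Set.Ici_subset_Ici.2 zero_le_one hj) le_rfl
    · exact iSup₂_le fun j _ => (hmeas j).comap_le
  · exact TendstoInDistribution.tendsto_measure_ordConnected hσ hdist hΔ
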